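/- Let $d\ge 3$ be an odd integer, $C$ a constant, $p=\frac{d+2}{d-2}$, $q=\frac{2(d+2)}{d-2}$. Consider real-valued nonlinearities $F(t,x,u)$, measurable in $(t,x)$ and radial in $x$, with $$|F(t,x,u)|\le C|u|^{\frac{d+2}{d-2}},\qquad |F(t,x,u)-F(t,x,v)|\le C\big(|u|^{\frac4{d-2}}+|v|^{\frac4{d-2}}\big)|u-v| .$$ For $(u_0,u_1)\in\dot H^1\times L^2(\mathbb R^d)$ let $\mathbf S_L(u_0,u_1)(t)=\cos(t\sqrt{-\Delta})u_0+\frac{\sin (t\sqrt{-\Delta})}{\sqrt{-\Delta}}u_1$ be the free wave. For $R\ge0$ let $\chi_R$ be the characteristic function of $\{|x|>R+|t|\}$, and for $j\in\mathbb Z$ let $\chi_j$ be the characteristic function of $\{|t|+2^j\le|x|<|t|+2^{j+1}\}$. For an interval $I\ni 0$ put $$\|u\|_{L^aL^b(I)}=\Big(\int_I\Big(\int_{\mathbb R^d}|u(x,t)|^b\,dx\Big)^{a/b}dt\Big)^{1/a},$$ $$\|u\|_{Y(I)}=\Big(\sum_{j\in\mathbb Z}\|\chi_ju\|_{L^pL^q(I)}^2\Big)^{1/2},\qquad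 \|G\|_{Z(I)}=\Big(\sum_{j\in\mathbb Z}\|\chi_jG\|_{L^1L^2(I)}^2\Big)^{1/2},$$ where functions defined only for $|x|>R+|t|$ are extended by zero. An exterior solution with data $(u_0,u_1)$, for $R$ and $I$, is a measurable function $u$ on $\{(x,t):t\in I,\ |x|>R+|t|\}$, radial in $x$, with $\|\chi_RF(\cdot,\cdot,u)\|_{Z(I)}<\infty$ (which is automatic if $\|u\|_{Y(I)}<\infty$) and, almost everywhere in this region, $$u(t)=\mathbf S_L(u_0,u_1)(t)+\sum_{k\in\mathbb Z}\int_0^t\frac{\sin((t-\tau)\sqrt{-\Delta})}{\sqrt{-\Delta}}\big[\chi_k\chi_RF(\tau,x,u)\big]\,d\tau .$$ (At almost every point of the region only finitely many terms are nonzero, by finite speed of propagation; the sum is the usual Duhamel integral of $\chi_R F(\tau,x,u)$ whenever that function is in $L^1L^2$.) Solutions are identified if they agree almost everywhere in the region. Then: 1. There is a constant $\delta>0$, depending only on $d$ and $C$, such that for all $F$ as above, all $R\ge0$, all intervals $I\ni0$ and all radial $(u_0,u_1)\in\dot H^1\times L^2(\mathbb R^d)$ with $\|\chi_R\mathbf S_L(u_0,u_1)\|_{Y(I)}<\delta$,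 there is a unique exterior solution $u$ with $\|u\|_{Y(I)}<\infty$. 2. With the same $\delta$: if $(v_0,v_1)\in\dot H^1\times L^2(\mathbb R^d)$ are also radial with $\|\chi_R\mathbf S_L(v_0,v_1)\|_{Y(I)}<\delta$, and $v$ is the exterior solution with data $(v_0,v_1)$ and $\|v\|_{Y(I)}<\infty$, then $$\|u-v\|_{Y(I)}\le 2\,\|\chi_R\mathbf S_L(u_0-v_0,u_1-v_1)\|_{Y(I)} .$$ 3. For all $F$ as above, all radial $(u_0,u_1)\in\dot H^1\times L^2(\mathbb R^d)$ and all $R\ge0$ there is $T>0$ such that there is a unique exterior solution $u$ for $R$ and $I=[-T,T]$ with $\|u\|_{Y([-T,T])}<\infty$. 4. For all $F$ as above and all radial $(u_0,u_1)\in\dot H^1\times L^2(\mathbb R^d)$ there is $R_0\ge0$ such that for every $R\ge R_0$ there is a unique exterior solution $u$ for $R$ and $I=\mathbb R$ with $\|u\|_{Y(\mathbb R)}<\infty$. -/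

import Mathlib

open MeasureTheory Set
open scoped FourierTransform SchwartzMap ENNReal

namespace ExteriorWave

noncomputable section

/-- The space `ℝ^d`. -/
abbrev Space (d : ℕ) : Type := EuclideanSpace ℝ (Fin d)

/-! ### Cut-offs and space-time norms -/

/-- `χ_R u`: the restriction of `u` to the exterior region `|x| > R + |t|`, extended by zero. -/
def extCut {d : ℕ} {V : Type*} [Zero V] (R : ℝ) (u : ℝ → Space d → V) : ℝ → Space d → V :=
  fun t => Set.indicator {x | R + |t| < ‖x‖} (u t)

/-- `χ_j u`: the restriction of `u` to the channel `|t| + 2^j ≤ |x| < |t| + 2^(j+1)`, extended by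
zero. -/
def channelCut {d : ℕ} {V : Type*} [Zero V] (j : ℤ) (u : ℝ → Space d → V) : ℝ → Space d → V :=
  fun t => Set.indicator {x | |t| + (2 : ℝ) ^ j ≤ ‖x‖ ∧ ‖x‖ < |t| + (2 : ℝ) ^ (j + 1)} (u t)

/-- The norm of `L^p L^q (I × ℝ^d)`, with exponent `p` in time and `q` in space. -/
def mixedNorm {d : ℕ} {V : Type*} [NormedAddCommGroup V] (p q : ℝ) (I : Set ℝ)
    (u : ℝ → Space d → V) : ℝ≥0∞ :=
  (∫⁻ t in I, (∫⁻ x, ‖u t x‖ₑ ^ q) ^ (p / q)) ^ (1 / p)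

/-- The norm of `Y(I)`: the `ℓ²` sum over the channels of the
`L^((d+2)/(d-2)) L^(2(d+2)/(d-2))` norms. -/
def YNorm {d : ℕ} {V : Type*} [NormedAddCommGroup V] (I : Set ℝ) (u : ℝ → Space d → V) : ℝ≥0∞ :=
  (∑' j : ℤ, mixedNorm (((d : ℝ) + 2) / ((d : ℝ) - 2)) (2 * ((d : ℝ) + 2) / ((d : ℝ) - 2)) I
    (channelCut j u) ^ (2 : ℝ)) ^ (1 / 2 : ℝ)

/-- The norm of `Z(I)`: the `ℓ²` sum over the channels of the `L^1 L^2` norms. -/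
def ZNorm {d : ℕ} {V : Type*} [NormedAddCommGroup V] (I : Set ℝ) (u : ℝ → Space d → V) : ℝ≥0∞ :=
  (∑' j : ℤ, mixedNorm 1 2 I (channelCut j u) ^ (2 : ℝ)) ^ (1 / 2 : ℝ)

/-! ### Initial data -/

/-- The tempered function `u` has the function `g` as its Fourier transform in the sense of tempered
distributions. -/
def HasFourierTransform {d : ℕ} (u g : Space d → ℂ) : Prop :=
  ∀ φ : 𝓢(Space d, ℂ), Integrable (fun x => u x * φ x) ∧ Integrable (fun ξ => g ξ * φ ξ) ∧
    ∫ x, u x * (𝓕 φ) x = ∫ ξ, g ξ * φ ξ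

/-- The homogeneous Sobolev space `Ḣ¹(ℝ^d)`: the Fourier transform is a function `g` with
`|ξ| g ∈ L²`. -/
def MemHDotOne {d : ℕ} (f : Space d → ℝ) : Prop :=
  ∃ g : Space d → ℂ, HasFourierTransform (fun x => (f x : ℂ)) g ∧
    MemLp (fun ξ => (‖ξ‖ : ℂ) * g ξ) 2 volume

/-- The Fourier transform of an element of `Ḣ¹(ℝ^d)` (it is unique up to null sets). -/
def hatHDotOne {d : ℕ} (f : Space d → ℝ) : Space d → ℂ :=
  open Classical in if h : MemHDotOne f then h.choose else 0

/-- Radial symmetry, almost everywhere on the set `s`. -/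
def IsRadialOn {d : ℕ} (s : Set (Space d)) (f : Space d → ℝ) : Prop :=
  ∃ h : ℝ → ℝ, ∀ᵐ x, x ∈ s → f x = h ‖x‖

/-- Radial initial data `(u₀, u₁) ∈ Ḣ¹ × L²(ℝ^d)`. -/
structure IsRadialData {d : ℕ} (u₀ u₁ : Space d → ℝ) : Prop where
  memHDotOne : MemHDotOne u₀
  memLp : MemLp u₁ 2 volume
  radial₀ : IsRadialOn univ u₀
  radial₁ : IsRadialOn univ u₁

/-! ### Linear wave propagation

With Mathlib's normalization of the Fourier transform, `√(-Δ)` is the Fourier multiplier `2π|ξ|`. -/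

/-- The class in `L²` of a square integrable function (and `0` for all other functions). -/
def toL2 {d : ℕ} (f : Space d → ℂ) : Lp ℂ 2 (volume : Measure (Space d)) :=
  open Classical in if h : MemLp f 2 volume then h.toLp f else 0

/-- The operator `sin(s√(-Δ)) / √(-Δ)` on `L²(ℝ^d)`. -/
def sinOp {d : ℕ} (s : ℝ) (f : Lp ℂ 2 (volume : Measure (Space d))) :
    Lp ℂ 2 (volume : Measure (Space d)) :=
  𝓕⁻ (toL2 fun ξ : Space d =>
    ((Real.sin (s * (2 * Real.pi * ‖ξ‖)) / (2 * Real.pi * ‖ξ‖) : ℝ) : ℂ) * (𝓕 f) ξ)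

/-- `cos(s√(-Δ)) f - f` for `f ∈ Ḣ¹(ℝ^d)`. The multiplier `cos(2πs|ξ|) - 1` is `O(|s||ξ|)`,
so that this difference is an element of `L²(ℝ^d)`. -/
def cosSubOne {d : ℕ} (s : ℝ) (f : Space d → ℝ) : Lp ℂ 2 (volume : Measure (Space d)) :=
  𝓕⁻ (toL2 fun ξ : Space d =>
    ((Real.cos (s * (2 * Real.pi * ‖ξ‖)) - 1 : ℝ) : ℂ) * hatHDotOne f ξ)

/-- The free wave `S_L(u₀, u₁) = cos(t√(-Δ)) u₀ + sin(t√(-Δ)) / √(-Δ) u₁`. -/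
def freeWave {d : ℕ} (u₀ u₁ : Space d → ℝ) (t : ℝ) (x : Space d) : ℂ :=
  (u₀ x : ℂ) + cosSubOne t u₀ x + sinOp t (toL2 fun y => (u₁ y : ℂ)) x

/-- The integral `∫_0^t sin((t-τ)√(-Δ)) / √(-Δ) G(τ) dτ`, as a Bochner integral in `L²(ℝ^d)`. -/
def duhamel {d : ℕ} (G : ℝ → Space d → ℝ) (t : ℝ) : Lp ℂ 2 (volume : Measure (Space d)) :=
  ∫ τ in (0 : ℝ)..t, sinOp (t - τ) (toL2 fun y => (G τ y : ℂ))

/-! ### The nonlinear equation -/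

/-- The conditions on the nonlinearity `F(t, x, u)`, with constant `C`: it is measurable in `(t, x)`,
radial in `x`, and satisfies the energy-critical growth and Lipschitz bounds. -/
structure IsEnergyCritical {d : ℕ} (C : ℝ) (F : ℝ → Space d → ℝ → ℝ) : Prop where
  measurable : ∀ a : ℝ, Measurable fun z : ℝ × Space d => F z.1 z.2 a
  radial : ∀ (t : ℝ) (x y : Space d) (a : ℝ), ‖x‖ = ‖y‖ → F t x a = F t y a
  growth : ∀ (t : ℝ) (x : Space d) (a : ℝ),
    |F t x a| ≤ C * |a| ^ (((d : ℝ) + 2) / ((d : ℝ) - 2))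
  lipschitz : ∀ (t : ℝ) (x : Space d) (a b : ℝ),
    |F t x a - F t x b| ≤
      C * (|a| ^ (4 / ((d : ℝ) - 2)) + |b| ^ (4 / ((d : ℝ) - 2))) * |a - b|

/-- The source term `χ_R F(t, x, u)`. -/
def source {d : ℕ} (F : ℝ → Space d → ℝ → ℝ) (R : ℝ) (u : ℝ → Space d → ℝ) :
    ℝ → Space d → ℝ :=
  extCut R fun t x => F t x (u t x)

/-- `u` is a radial exterior solution, in the region `|x| > R + |t|`, `t ∈ I`, of
`∂_t² u - Δ u = F(t, x, u)` with initial data `(u₀, u₁)`. Only the values of `u` in this region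
matter, up to null sets. In the formula
`u = S_L(u₀, u₁) + ∫_0^t sin((t-τ)√(-Δ)) / √(-Δ) [χ_R F(τ, x, u)] dτ` for `|x| > R + |t|`, the source
is an element of `Z(I)`. Such a source need not belong to `L^1 L^2` as a whole, but its restriction to
each channel does. The integral is therefore taken channel by channel; by finite speed of propagation,
only finitely many of the terms are nonzero at almost every point of the region. -/
structure IsExteriorSolution {d : ℕ} (F : ℝ → Space d → ℝ → ℝ) (u₀ u₁ : Space d → ℝ) (R : ℝ)
    (I : Set ℝ) (u : ℝ → Space d → ℝ) : Prop where
  measurable : AEStronglyMeasurable (fun z : ℝ × Space d => extCut R u z.1 z.2)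
    (volume.restrict (I ×ˢ univ))
  radial : ∀ᵐ t ∂(volume.restrict I), IsRadialOn {x | R + |t| < ‖x‖} (u t)
  source_mem : ZNorm I (source F R u) < ∞
  formula : ∀ᵐ t ∂(volume.restrict I), ∀ᵐ x : Space d, R + |t| < ‖x‖ →
    HasSum (fun k : ℤ => duhamel (channelCut k (source F R u)) t x)
      ((u t x : ℂ) - freeWave u₀ u₁ t x)

/-- There is an exterior solution with finite `Y(I)` norm, and it is unique (up to null sets). -/
def ExistsUniqueExteriorSolution {d : ℕ} (F : ℝ → Space d → ℝ → ℝ) (u₀ u₁ : Space d → ℝ) (R : ℝ)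
    (I : Set ℝ) : Prop :=
  (∃ u : ℝ → Space d → ℝ, IsExteriorSolution F u₀ u₁ R I u ∧ YNorm I (extCut R u) < ∞) ∧
  ∀ u v : ℝ → Space d → ℝ,
    IsExteriorSolution F u₀ u₁ R I u → YNorm I (extCut R u) < ∞ →
    IsExteriorSolution F u₀ u₁ R I v → YNorm I (extCut R v) < ∞ →
    ∀ᵐ t ∂(volume.restrict I), ∀ᵐ x : Space d, R + |t| < ‖x‖ → u t x = v t x

end

end ExteriorWave

/-!
The theorem is the small data theory of an energy-critical wave equation outside the light cone. Two
linear estimates are needed there, both for radial functions: the free wave has finite norm in `Y`, and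
the Duhamel integral is bounded from `Z` to `Y`. Since the norms of the channels
`|t| + 2^j ≤ |x| < |t| + 2^(j+1)` are summed in `ℓ²`, the point is to sum the interactions of different
channels. The estimates are obtained from an explicit kernel rather than from Strichartz estimates.

*The kernel.* Let `d = 2k + 1`. The Fourier transform of the indicator function of the ball of radius `s`
in `ℝ^d` is a multiple of `∫_{-s}^s e^{2πi|ξ|b} (s² - b²)^k db`, and applying `s⁻¹ d/ds` to it `k` times
leaves a multiple of `∫_{-s}^s e^{2πi|ξ|b} db`, the symbol of `sin(s√(-Δ)) / √(-Δ)`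
(`integral_mul_ball_conv`). On the physical side, the mean of a radial function over a ball that does not
contain the origin is an integral over spherical caps, whose area is a primitive of order `k` of a
Legendre polynomial of degree `k - 1`. Hence, for radial `f` and `|x| > s`, the function
`sin(s√(-Δ)) / √(-Δ) f` at `x` is the integral of `f` over the shell `||x| - |y|| < s` against a kernel of
size at most a constant times `(|x| |y|)^(-k)` (`integral_sin_mul_eq_radialProp`, `sinOp_ae_eq`). The part
`cos(s√(-Δ)) u₀` is a limit of difference quotients in `s` of this expression (`exists_tendsto_cosSubOne`).
There the profile of `u₀` is controlled by its gradient: `|u₀|` at radius `ρ` is at most the integral of a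
square integrable function against `|y|^(-2k)` over `|y| > ρ` (`exists_gradient_bound`).

*Linear estimates.* The backward cone of a point of channel `j` meets only the channels `i ≥ j`. By
Cauchy-Schwarz in each of these, both the free wave and the Duhamel integral are bounded in channel `j` by
`∑_{i ≥ j} a_i Φ_i(|x|)` with `Φ_i(r) = 2^(i/2) max(r, 2^i)^(-k)`. For the Duhamel integral, `a_i` is the
`L¹L²` norm of the source in channel `i`; for the free wave it is the `L²` norm over a dyadic shell of
`u₁` and of the function that replaces the gradient of `u₀` (`kernel_le_bump`,
`exists_radialProp_sub_le_bump`). The `L^pL^q` norm of `Φ_i` in channel `j` decays geometrically in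
`i - j`, so the norm in `Y` is at most a constant times the `ℓ²` norm of `a` (`exists_chanL_le_of_bump`).
This gives `exists_freeWave_rep` and `exists_chanL_radialDuhamel_le`.

*Nonlinear theory.* As `q = 2p`, Hölder's inequality in each channel shows that the nonlinearity is locally
Lipschitz from `Y` to `Z`, with constant `O(‖u‖^(p-1) + ‖v‖^(p-1))` (`sourceNorm_source_sub_le`). If `δ` is
small, the Picard iterates for a free wave of norm less than `δ` stay in the ball of radius `2δ` and
converge (`exists_isMildSolution`). Conversely, every solution of finite norm lies in this ball: its norm
over `I ∩ [-T, T]` is continuous in `T`, vanishes for `T = 0` and never equals `2δ`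
(`IsMildSolution.waveNorm_le_two_mul`). Therefore the contraction estimate applies to any two solutions
and yields both uniqueness and the Lipschitz bound with the constant `2`
(`IsMildSolution.waveNorm_sub_le_two_mul`). The statements for short times and for large `R` follow, since
the free wave, having finite norm, becomes small by dominated convergence.
-/

open scoped Interval

namespace ExteriorWave

/-! ### Polar coordinates and slicing -/

/-- The surface measure of the unit sphere of `ℝ^n`. -/
noncomputable def sphereMeasure (n : ℕ) : Measure (Metric.sphere (0 : Space n) 1) :=
  (volume : Measure (Space n)).toSphere

instance (n : ℕ) : IsFiniteMeasure (sphereMeasure n) := by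
  unfold sphereMeasure; infer_instance

theorem sphereMeasure_univ_ne_zero {n : ℕ} (hn : 1 ≤ n) : sphereMeasure n univ ≠ 0 := by
  have : Nonempty (Fin n) := ⟨⟨0, hn⟩⟩
  unfold sphereMeasure
  have := Measure.toSphere_ne_zero (volume : Measure (Space n))
  exact fun h => this (Measure.measure_univ_eq_zero.mp h)

/-- Polar coordinates. -/
theorem lintegral_polar {n : ℕ} (hn : 1 ≤ n) {f : Space n → ℝ≥0∞} (hf : Measurable f) :
    ∫⁻ y, f y = ∫⁻ ω, (∫⁻ r in Ioi (0 : ℝ), ENNReal.ofReal (r ^ (n - 1)) * f (r • (ω : Space n)))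
      ∂sphereMeasure n := by
  have : Nonempty (Fin n) := ⟨⟨0, hn⟩⟩
  have hmp := (volume : Measure (Space n)).measurePreserving_homeomorphUnitSphereProd
  have h1 : ∫⁻ y, f y = ∫⁻ y in ({0}ᶜ : Set (Space n)), f y := by
    rw [← lintegral_add_compl f (measurableSet_singleton (0 : Space n))]
    simp
  have hg : Measurable fun z : Metric.sphere (0 : Space n) 1 × Ioi (0 : ℝ) =>
      f ((z.2 : ℝ) • (z.1 : Space n)) := by
    apply hf.comp
    fun_prop
  have hs : MeasurableSet ({0}ᶜ : Set (Space n)) := (measurableSet_singleton _).compl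
  have h2 : ∫⁻ y in ({0}ᶜ : Set (Space n)), f y
      = ∫⁻ y : ({0}ᶜ : Set (Space n)), f y ∂(Measure.comap Subtype.val volume) := by
    rw [lintegral_subtype_comap hs]
  rw [h1, h2]
  have h3 : ∀ y : ({0}ᶜ : Set (Space n)), f y =
      (fun z : Metric.sphere (0 : Space n) 1 × Ioi (0 : ℝ) => f ((z.2 : ℝ) • (z.1 : Space n)))
        (homeomorphUnitSphereProd (Space n) y) := by
    intro y
    simp only [homeomorphUnitSphereProd_apply_snd_coe, homeomorphUnitSphereProd_apply_fst_coe]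
    rw [smul_inv_smul₀]
    exact norm_ne_zero_iff.mpr y.2
  simp_rw [h3]
  rw [hmp.lintegral_comp hg, lintegral_prod _ hg.aemeasurable]
  unfold sphereMeasure
  refine lintegral_congr fun ω => ?_
  simp only [finrank_euclideanSpace, Fintype.card_fin]
  unfold Measure.volumeIoiPow
  rw [lintegral_withDensity_eq_lintegral_mul _ (by fun_prop)
    (show Measurable fun r : Ioi (0 : ℝ) => f ((r : ℝ) • (ω : Space n)) from
      hg.comp (measurable_const.prodMk measurable_id))]
  exact lintegral_subtype_comap measurableSet_Ioi
    (fun r : ℝ => ENNReal.ofReal (r ^ (n - 1)) * f (r • (ω : Space n)))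

theorem lintegral_norm_eq {n : ℕ} (hn : 1 ≤ n) {f : ℝ → ℝ≥0∞} (hf : Measurable f) :
    ∫⁻ y : Space n, f ‖y‖
      = sphereMeasure n univ * ∫⁻ r in Ioi (0 : ℝ), ENNReal.ofReal (r ^ (n - 1)) * f r := by
  rw [lintegral_polar (f := fun y => f ‖y‖) hn (hf.comp measurable_norm)]
  have : ∀ ω : Metric.sphere (0 : Space n) 1,
      ∫⁻ r in Ioi (0 : ℝ), ENNReal.ofReal (r ^ (n - 1)) * f ‖r • (ω : Space n)‖
      = ∫⁻ r in Ioi (0 : ℝ), ENNReal.ofReal (r ^ (n - 1)) * f r := by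
    intro ω
    apply setLIntegral_congr_fun measurableSet_Ioi
    intro r hr
    simp only
    rw [norm_smul, norm_eq_of_mem_sphere, mul_one, Real.norm_of_nonneg (le_of_lt hr)]
  simp_rw [this]
  rw [lintegral_const, mul_comm]

/-- A property that holds at almost every point holds at almost every point of almost every ray from
the origin. -/
theorem ae_polar {n : ℕ} (hn : 1 ≤ n) {p : Space n → Prop} (h : ∀ᵐ y, p y) :
    ∀ᵐ ω : Metric.sphere (0 : Space n) 1 ∂sphereMeasure n, ∀ᵐ r ∂(volume.restrict (Ioi (0 : ℝ))), p (r • (ω : Space n)) := by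
  rw [ae_iff] at h
  obtain ⟨s, hs, hsm, hs0⟩ := exists_measurable_superset_of_null h
  have h1 := lintegral_polar hn (f := s.indicator 1) (measurable_one.indicator hsm)
  rw [lintegral_indicator_one hsm, hs0] at h1
  have hm : Measurable fun z : Metric.sphere (0 : Space n) 1 × ℝ =>
      ENNReal.ofReal (z.2 ^ (n - 1)) * s.indicator 1 (z.2 • (z.1 : Space n)) := by
    refine Measurable.mul (by fun_prop) ?_
    exact (measurable_one.indicator hsm).comp (by fun_prop)
  have h2 := (lintegral_eq_zero_iff (hm.lintegral_prod_right'
    (ν := volume.restrict (Ioi (0 : ℝ))))).mp h1.symm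
  filter_upwards [h2] with ω hω
  have h3 := (lintegral_eq_zero_iff (hm.comp (measurable_const.prodMk measurable_id))).mp hω
  filter_upwards [h3, ae_restrict_mem measurableSet_Ioi] with r hr hr0
  by_contra hp
  have : r • (ω : Space n) ∈ s := hs hp
  simp only [Function.comp_apply, id, Pi.zero_apply, mul_eq_zero, ENNReal.ofReal_eq_zero] at hr
  rcases hr with hr | hr
  · exact absurd hr (not_le.mpr (pow_pos hr0 _))
  · simp [this] at hr

/-- A property of radii that holds almost everywhere on `(0, ∞)` holds for the norm of almost every
point. -/
theorem ae_norm_of_ae {n : ℕ} (hn : 1 ≤ n) {p : ℝ → Prop}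
    (h : ∀ᵐ r ∂(volume.restrict (Ioi (0 : ℝ))), p r) : ∀ᵐ y : Space n, p ‖y‖ := by
  obtain ⟨s, hs, hsm, hs0⟩ := exists_measurable_superset_of_null (ae_iff.mp h)
  have h1 := lintegral_norm_eq hn (f := s.indicator 1) (measurable_one.indicator hsm)
  have h2 : ∫⁻ r in Ioi (0 : ℝ), ENNReal.ofReal (r ^ (n - 1)) * s.indicator 1 r = 0 := by
    rw [lintegral_eq_zero_iff (by
      exact Measurable.mul (by fun_prop) (measurable_one.indicator hsm))]
    have : ∀ᵐ r ∂(volume.restrict (Ioi (0 : ℝ))), r ∉ s := by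
      rw [ae_iff]; simpa using hs0
    filter_upwards [this] with r hr
    simp [hr]
  rw [h2, mul_zero] at h1
  have h1 := (lintegral_eq_zero_iff
    ((measurable_one.indicator hsm).comp measurable_norm)).mp h1
  filter_upwards [h1] with y hy
  by_contra hp
  have : ‖y‖ ∈ s := hs hp
  simp [Function.comp_apply, this] at hy

/-- Splitting off the first coordinate. -/
theorem lintegral_slice {n : ℕ} {F : ℝ → ℝ → ℝ≥0∞} (hF : Measurable (Function.uncurry F)) :
    ∫⁻ y : Space (n + 1), F (y 0) ‖y‖
      = ∫⁻ z : ℝ, ∫⁻ y : Space n, F z (√(z ^ 2 + ‖y‖ ^ 2)) := by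
  have h1 := (volume_preserving_piFinSuccAbove (fun _ : Fin (n + 1) => ℝ) 0).comp
    (PiLp.volume_preserving_ofLp (Fin (n + 1)))
  have hm : Measurable fun z : ℝ × (Fin n → ℝ) => F z.1 (√(z.1 ^ 2 + ∑ i, z.2 i ^ 2)) := by
    exact hF.comp (measurable_fst.prodMk (by fun_prop))
  have h2 : ∀ y : Space (n + 1), F (y 0) ‖y‖ =
      (fun z : ℝ × (Fin n → ℝ) => F z.1 (√(z.1 ^ 2 + ∑ i, z.2 i ^ 2)))
        ((MeasurableEquiv.piFinSuccAbove (fun _ : Fin (n + 1) => ℝ) 0 ∘ WithLp.ofLp) y) := by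
    intro y
    simp only [Function.comp_apply, MeasurableEquiv.piFinSuccAbove_apply, Fin.insertNthEquiv,
      Equiv.coe_fn_symm_mk, Fin.removeNth]
    rw [EuclideanSpace.norm_eq, Fin.sum_univ_succ]
    simp
  simp_rw [h2]
  rw [h1.lintegral_comp hm]
  rw [Measure.volume_eq_prod, lintegral_prod _ hm.aemeasurable]
  refine lintegral_congr fun z => ?_
  have h3 := PiLp.volume_preserving_ofLp (Fin n)
  rw [← h3.lintegral_comp (f := fun y : Fin n → ℝ => F z (√(z ^ 2 + ∑ i, y i ^ 2)))
    (hm.comp (measurable_const.prodMk measurable_id))]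
  refine lintegral_congr fun y => ?_
  simp [EuclideanSpace.norm_sq_eq]

/-- Any two vectors of the same length are related by a linear isometry. -/
theorem exists_isometry_map {n : ℕ} {x y : Space n} (h : ‖x‖ = ‖y‖) :
    ∃ A : Space n ≃ₗᵢ[ℝ] Space n, A x = y :=
  ⟨_, Submodule.reflection_sub h⟩

/-- The substitution `w = √(ρ² - z²)`. -/
theorem lintegral_radial_shift (k : ℕ) (hk : 1 ≤ k) (z : ℝ) {f : ℝ → ℝ≥0∞} :
    ∫⁻ w in Ioi (0 : ℝ), ENNReal.ofReal (w ^ (2 * k - 1)) * f (√(z ^ 2 + w ^ 2))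
      = ∫⁻ ρ in Ioi |z|, ENNReal.ofReal (ρ * (ρ ^ 2 - z ^ 2) ^ (k - 1)) * f ρ := by
  have himg : (fun ρ : ℝ => √(ρ ^ 2 - z ^ 2)) '' Ioi |z| = Ioi 0 := by
    ext w
    constructor
    · rintro ⟨ρ, hρ, rfl⟩
      apply Real.sqrt_pos.mpr
      have := sq_lt_sq.mpr ((lt_of_lt_of_le (show |z| < ρ from hρ) (le_abs_self ρ)))
      linarith
    · intro hw
      have hw : 0 < w := hw
      refine ⟨√(z ^ 2 + w ^ 2), ?_, ?_⟩
      · apply Real.lt_sqrt_of_sq_lt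
        rw [sq_abs]; nlinarith
      · simp only
        rw [Real.sq_sqrt (by positivity)]
        simp [Real.sqrt_sq hw.le]
  have hlt : ∀ ρ ∈ Ioi |z|, 0 < ρ ^ 2 - z ^ 2 := by
    intro ρ hρ
    have := sq_lt_sq.mpr ((lt_of_lt_of_le (show |z| < ρ from hρ) (le_abs_self ρ)))
    linarith
  have hρ0 : ∀ ρ ∈ Ioi |z|, 0 < ρ := fun ρ hρ => lt_of_le_of_lt (abs_nonneg z) hρ
  rw [← himg, lintegral_image_eq_lintegral_abs_deriv_mul measurableSet_Ioi
    (f' := fun ρ => ρ / √(ρ ^ 2 - z ^ 2))]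
  · apply setLIntegral_congr_fun measurableSet_Ioi
    intro ρ hρ
    have h1 := hlt ρ hρ
    have h0 := hρ0 ρ hρ
    have hs := Real.sqrt_pos.mpr h1
    simp only
    rw [Real.sq_sqrt h1.le, show z ^ 2 + (ρ ^ 2 - z ^ 2) = ρ ^ 2 by ring, Real.sqrt_sq h0.le,
      ← mul_assoc, ← ENNReal.ofReal_mul (abs_nonneg _), abs_of_pos (div_pos h0 hs)]
    congr 2
    obtain ⟨l, rfl⟩ : ∃ l, k = l + 1 := ⟨k - 1, by omega⟩
    rw [show 2 * (l + 1) - 1 = 2 * l + 1 by omega, show l + 1 - 1 = l by omega,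
      pow_succ _ (2 * l), pow_mul, Real.sq_sqrt h1.le]
    field_simp
  · intro ρ hρ
    have h1 := hlt ρ hρ
    have h := ((hasDerivAt_pow 2 ρ).sub_const (z ^ 2)).sqrt h1.ne'
    have hs := Real.sqrt_pos.mpr h1
    refine (h.congr_deriv ?_).hasDerivWithinAt
    norm_num
    field_simp
  · intro a ha b hb hab
    have := (Real.sqrt_inj (hlt a ha).le (hlt b hb).le).mp hab
    exact (pow_left_inj₀ (hρ0 a ha).le (hρ0 b hb).le two_ne_zero).mp (by linarith)

/-! ### Balls, caps and radial functions -/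

/-- The cosine of the angle at the origin of a triangle whose sides at the origin have lengths `r` and
`ρ`, and whose third side has length `s`. -/
noncomputable def cosAngle (r ρ s : ℝ) : ℝ := (r ^ 2 + ρ ^ 2 - s ^ 2) / (2 * r * ρ)

/-- The polynomials obtained from the cap area `μ ↦ ∫_μ^1 (1 - z²)^(k-1) dz` (the case `m = k`) by
applying `-d/dμ` successively; the case `m = 0` is a multiple of the Legendre polynomial of degree
`k - 1`, by Rodrigues' formula. -/
noncomputable def capFn (k m : ℕ) (μ : ℝ) : ℝ :=
  if m = k then ∫ z in μ..1, (1 - z ^ 2) ^ (k - 1)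
  else (-1) ^ (k - 1 - m) * (Polynomial.derivative^[k - 1 - m]
    ((1 - Polynomial.X ^ 2) ^ (k - 1) : Polynomial ℝ)).eval μ

theorem capFn_self (k : ℕ) (μ : ℝ) : capFn k k μ = ∫ z in μ..1, (1 - z ^ 2) ^ (k - 1) := by
  simp [capFn]

theorem hasDerivAt_capFn {k m : ℕ} (hm : m < k) (μ : ℝ) :
    HasDerivAt (capFn k (m + 1)) (-capFn k m μ) μ := by
  by_cases h : m + 1 = k
  · subst h
    have h1 : capFn (m + 1) (m + 1) = fun μ => ∫ z in μ..1, (1 - z ^ 2) ^ m := by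
      ext μ; rw [capFn_self]; simp
    have h2 : capFn (m + 1) m μ = (1 - μ ^ 2) ^ m := by
      simp [capFn]
    rw [h1, h2]
    have hc : Continuous fun z : ℝ => (1 - z ^ 2) ^ m := by fun_prop
    exact intervalIntegral.integral_hasDerivAt_left (hc.intervalIntegrable _ _)
      (hc.stronglyMeasurableAtFilter _ _) hc.continuousAt
  · have h1 : capFn k (m + 1) = fun μ => (-1) ^ (k - 1 - (m + 1)) * (Polynomial.derivative^[k - 1 - (m + 1)]
        ((1 - Polynomial.X ^ 2) ^ (k - 1) : Polynomial ℝ)).eval μ := by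
      ext μ; simp [capFn, h]
    have h2 : k - 1 - m = (k - 1 - (m + 1)) + 1 := by omega
    rw [h1, capFn, if_neg (by omega), h2, Function.iterate_succ_apply', pow_succ]
    have := (Polynomial.hasDerivAt (Polynomial.derivative^[k - 1 - (m + 1)]
        ((1 - Polynomial.X ^ 2) ^ (k - 1) : Polynomial ℝ)) μ).const_mul ((-1) ^ (k - 1 - (m + 1)))
    exact this.congr_deriv (by ring_nf)

theorem capFn_one {k m : ℕ} (hm : 1 ≤ m) (hmk : m ≤ k) : capFn k m 1 = 0 := by
  by_cases h : m = k
  · subst h; simp [capFn_self]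
  · rw [capFn, if_neg h]
    have h1 : (Polynomial.X - Polynomial.C 1 : Polynomial ℝ) ^ (k - 1)
        ∣ (1 - Polynomial.X ^ 2) ^ (k - 1) := by
      apply pow_dvd_pow_of_dvd
      exact ⟨-(1 + Polynomial.X), by simp only [Polynomial.C_1]; ring⟩
    have h2 := Polynomial.pow_sub_dvd_iterate_derivative_of_pow_dvd (k - 1 - m) h1
    have h3 : (Polynomial.X - Polynomial.C 1 : Polynomial ℝ)
        ∣ Polynomial.derivative^[k - 1 - m] ((1 - Polynomial.X ^ 2) ^ (k - 1)) :=
      (dvd_pow_self _ (by omega)).trans h2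
    have h4 := Polynomial.dvd_iff_isRoot.mp h3
    rw [Polynomial.IsRoot] at h4
    rw [h4, mul_zero]

theorem contDiff_capFn_zero {k : ℕ} (hk : 1 ≤ k) : ContDiff ℝ 1 (capFn k 0) := by
  have h1 : capFn k 0 = fun μ => (-1) ^ (k - 1 - 0) * (Polynomial.derivative^[k - 1 - 0]
        ((1 - Polynomial.X ^ 2) ^ (k - 1) : Polynomial ℝ)).eval μ := by
    ext μ; rw [capFn, if_neg (by omega)]
  rw [h1]
  exact contDiff_const.mul (by
    have := Polynomial.contDiff_aeval (𝕜 := ℝ) (Polynomial.derivative^[k - 1 - 0]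
      ((1 - Polynomial.X ^ 2) ^ (k - 1) : Polynomial ℝ)) 1
    simpa [Polynomial.coe_aeval_eq_eval] using this)

theorem continuous_capFn {k m : ℕ} (hk : 1 ≤ k) (hm : m ≤ k) : Continuous (capFn k m) := by
  rcases m with _ | m
  · exact (contDiff_capFn_zero hk).continuous
  · exact continuous_iff_continuousAt.mpr fun μ => (hasDerivAt_capFn (by omega) μ).continuousAt

theorem cosAngle_pos {r ρ s : ℝ} (hs : 0 < s) (hr : s < r) (hρ : |r - ρ| ≤ s) :
    0 < cosAngle r ρ s := by
  have h := abs_le.mp hρ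
  have h1 : 0 < ρ := by linarith
  have h2 : 0 < r := by linarith
  unfold cosAngle
  have : s ^ 2 < r ^ 2 := by nlinarith
  have := sq_nonneg ρ
  apply div_pos <;> nlinarith [mul_pos h1 h2]

theorem cosAngle_lt_one_iff {r ρ s : ℝ} (hr : 0 < r) (hρ : 0 < ρ) (hs : 0 < s) :
    cosAngle r ρ s < 1 ↔ |r - ρ| < s := by
  unfold cosAngle
  rw [div_lt_one (by positivity), ← abs_of_pos hs, ← sq_lt_sq, abs_of_pos hs]
  constructor <;> intro h <;> nlinarith

theorem cosAngle_le_one {r ρ s : ℝ} (hr : 0 < r) (hρ : 0 < ρ) (h : |r - ρ| ≤ s) :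
    cosAngle r ρ s ≤ 1 := by
  unfold cosAngle
  rw [div_le_one (by positivity)]
  have h1 := sq_le_sq' (abs_le.mp h).1 (abs_le.mp h).2
  nlinarith

theorem measurable_cosAngle : Measurable fun z : ℝ × ℝ × ℝ => cosAngle z.1 z.2.1 z.2.2 := by
  unfold cosAngle; fun_prop

theorem norm_sub_single_sq {n : ℕ} (y : Space (n + 1)) (r : ℝ) :
    ‖y - EuclideanSpace.single 0 r‖ ^ 2 = ‖y‖ ^ 2 - 2 * r * y 0 + r ^ 2 := by
  rw [norm_sub_sq_real, EuclideanSpace.inner_single_right, PiLp.norm_single]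
  simp
  ring_nf

theorem capFn_scaled {k : ℕ} (hk : 1 ≤ k) {ρ a : ℝ} :
    ∫ z in (ρ * a)..ρ, (ρ ^ 2 - z ^ 2) ^ (k - 1) = ρ ^ (2 * k - 1) * capFn k k a := by
  have h := intervalIntegral.smul_integral_comp_mul_left (a := a) (b := 1)
    (fun z : ℝ => (ρ ^ 2 - z ^ 2) ^ (k - 1)) ρ
  rw [mul_one] at h
  rw [← h, capFn_self]
  obtain ⟨l, rfl⟩ : ∃ l, k = l + 1 := ⟨k - 1, by omega⟩
  have : ∀ z : ℝ, (ρ ^ 2 - (ρ * z) ^ 2) ^ (l + 1 - 1) = ρ ^ (2 * l) * (1 - z ^ 2) ^ (l + 1 - 1) := by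
    intro z
    rw [show ρ ^ 2 - (ρ * z) ^ 2 = ρ ^ 2 * (1 - z ^ 2) by ring, mul_pow, ← pow_mul]
    simp
  simp_rw [this]
  rw [intervalIntegral.integral_const_mul, smul_eq_mul, ← mul_assoc,
    show 2 * (l + 1) - 1 = 2 * l + 1 by omega, pow_succ' ρ (2 * l)]

/-- The integral of a radial function over a ball that does not contain the origin, in terms of the
areas of the spherical caps cut out by the ball. -/
theorem lintegral_ball_radial {k : ℕ} (hk : 1 ≤ k) {x : Space (2 * k + 1)} {s : ℝ} (hs : 0 < s)
    (hsx : s < ‖x‖) {H : ℝ → ℝ≥0∞} (hH : Measurable H) :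
    sphereMeasure (2 * k + 1) univ * ∫⁻ y in Metric.ball x s, H ‖y‖
      = sphereMeasure (2 * k) univ * ∫⁻ y in {y : Space (2 * k + 1) | |‖x‖ - ‖y‖| < s},
        ENNReal.ofReal (capFn k k (cosAngle ‖x‖ ‖y‖ s)) * H ‖y‖ := by
  set r := ‖x‖ with hr
  have hr0 : 0 < r := by linarith
  -- rotate `x` to the first coordinate axis, then slice by the first coordinate `z`
  obtain ⟨A, hA⟩ := exists_isometry_map (x := EuclideanSpace.single 0 r) (y := x)
    (by rw [PiLp.norm_single, Real.norm_of_nonneg hr0.le])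
  set F : ℝ → ℝ → ℝ≥0∞ := fun z ρ => if ρ ^ 2 - 2 * r * z + r ^ 2 < s ^ 2 then H ρ else 0 with hFdef
  have hF : Measurable (Function.uncurry F) := by
    apply Measurable.ite
    · exact measurableSet_lt (by fun_prop) (by fun_prop)
    · exact hH.comp measurable_snd
    · exact measurable_const
  have h1 : ∫⁻ y in Metric.ball x s, H ‖y‖ = ∫⁻ y : Space (2 * k + 1), F (y 0) ‖y‖ := by
    rw [← lintegral_indicator Metric.isOpen_ball.measurableSet]
    rw [← A.measurePreserving.lintegral_comp (f := (Metric.ball x s).indicator fun y => H ‖y‖)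
      ((hH.comp measurable_norm).indicator Metric.isOpen_ball.measurableSet)]
    refine lintegral_congr fun y => ?_
    have : A y ∈ Metric.ball x s ↔ ‖y‖ ^ 2 - 2 * r * y 0 + r ^ 2 < s ^ 2 := by
      rw [mem_ball_iff_norm, ← hA, ← map_sub, A.norm_map, ← norm_sub_single_sq]
      rw [sq_lt_sq, abs_of_nonneg (norm_nonneg _), abs_of_pos hs]
    simp only [indicator, this, hFdef, LinearIsometryEquiv.norm_map]
  rw [h1, lintegral_slice hF]
  have h2 : ∀ z : ℝ, ∫⁻ y : Space (2 * k), F z √(z ^ 2 + ‖y‖ ^ 2) = sphereMeasure (2 * k) univ *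
      ∫⁻ ρ in Ioi |z|, ENNReal.ofReal (ρ * (ρ ^ 2 - z ^ 2) ^ (k - 1)) * F z ρ := by
    intro z
    rw [lintegral_norm_eq (f := fun w => F z √(z ^ 2 + w ^ 2)) (by omega)
      (hF.comp (measurable_const.prodMk (by fun_prop)))]
    rw [lintegral_radial_shift k hk z]
  simp_rw [h2]
  have hG : Measurable fun w : ℝ × ℝ => (Ioi |w.1|).indicator
      (fun ρ => ENNReal.ofReal (ρ * (ρ ^ 2 - w.1 ^ 2) ^ (k - 1)) * F w.1 ρ) w.2 := by
    have : (fun w : ℝ × ℝ => (Ioi |w.1|).indicator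
      (fun ρ => ENNReal.ofReal (ρ * (ρ ^ 2 - w.1 ^ 2) ^ (k - 1)) * F w.1 ρ) w.2)
      = ({w : ℝ × ℝ | |w.1| < w.2}).indicator
        (fun w => ENNReal.ofReal (w.2 * (w.2 ^ 2 - w.1 ^ 2) ^ (k - 1)) * F w.1 w.2) := by
      ext w; simp [indicator]
    rw [this]
    refine Measurable.indicator (Measurable.mul (by fun_prop) hF) ?_
    exact measurableSet_lt (by fun_prop) (by fun_prop)
  rw [lintegral_const_mul' _ _ (measure_ne_top _ _)]
  simp_rw [← lintegral_indicator measurableSet_Ioi]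
  -- integrate first in `z` at fixed radius `ρ`: what remains is the area of a spherical cap
  rw [lintegral_lintegral_swap hG.aemeasurable]
  have h3 : ∫⁻ y in {y : Space (2 * k + 1) | |r - ‖y‖| < s},
        ENNReal.ofReal (capFn k k (cosAngle r ‖y‖ s)) * H ‖y‖
      = sphereMeasure (2 * k + 1) univ * ∫⁻ ρ in Ioi (0 : ℝ), ENNReal.ofReal (ρ ^ (2 * k)) *
        ({ρ : ℝ | |r - ρ| < s}.indicator
          (fun ρ => ENNReal.ofReal (capFn k k (cosAngle r ρ s)) * H ρ) ρ) := by
    rw [← lintegral_indicator (measurableSet_lt (by fun_prop) (by fun_prop))]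
    have hm : Measurable ({ρ : ℝ | |r - ρ| < s}.indicator
          (fun ρ => ENNReal.ofReal (capFn k k (cosAngle r ρ s)) * H ρ)) := by
      refine Measurable.indicator (Measurable.mul ?_ hH)
        (measurableSet_lt (by fun_prop) (by fun_prop))
      exact ((continuous_capFn hk le_rfl).measurable.comp
        (measurable_cosAngle.comp (by fun_prop : Measurable fun ρ : ℝ => (r, ρ, s)))).ennreal_ofReal
    have := lintegral_norm_eq (n := 2 * k + 1) (by omega) hm
    rw [show 2 * k + 1 - 1 = 2 * k by omega] at this
    rw [← this]
    rfl
  rw [h3, mul_left_comm]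
  congr 2
  rw [← lintegral_indicator measurableSet_Ioi]
  refine lintegral_congr fun ρ => ?_
  by_cases hρ : 0 < ρ
  swap
  · have : ∀ z : ℝ, ρ ∉ Ioi |z| := fun z hz => hρ (lt_of_le_of_lt (abs_nonneg z) hz)
    simp [this, hρ]
  rw [indicator_of_mem (show ρ ∈ Ioi 0 from hρ)]
  -- the section of the ball at radius `ρ` is the set of `z` between `ρ cos(angle)` and `ρ`
  have hiff : ∀ z : ℝ, (ρ ^ 2 - 2 * r * z + r ^ 2 < s ^ 2 ↔ ρ * cosAngle r ρ s < z) := by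
    intro z
    have : ρ * cosAngle r ρ s = (r ^ 2 + ρ ^ 2 - s ^ 2) / (2 * r) := by
      unfold cosAngle; field_simp
    rw [this, div_lt_iff₀ (by positivity)]
    constructor <;> intro h <;> linarith
  by_cases hc : |r - ρ| < s
  · have hc1 := (cosAngle_lt_one_iff hr0 hρ hs).mpr hc
    have hc0 := cosAngle_pos hs hsx hc.le
    rw [indicator_of_mem (show ρ ∈ {ρ : ℝ | |r - ρ| < s} from hc)]
    have h4 : ∀ z : ℝ, (Ioi |z|).indicator
        (fun ρ => ENNReal.ofReal (ρ * (ρ ^ 2 - z ^ 2) ^ (k - 1)) * F z ρ) ρ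
        = (Ioo (ρ * cosAngle r ρ s) ρ).indicator (fun z => ENNReal.ofReal ρ *
          H ρ * ENNReal.ofReal ((ρ ^ 2 - z ^ 2) ^ (k - 1))) z := by
      intro z
      by_cases hz : z ∈ Ioo (ρ * cosAngle r ρ s) ρ
      · have : 0 < z := lt_trans (by positivity) hz.1
        rw [indicator_of_mem hz, indicator_of_mem (show ρ ∈ Ioi |z| by
          rw [abs_of_pos this]; exact hz.2)]
        simp only [hFdef, (hiff z).mpr hz.1, if_true]
        rw [ENNReal.ofReal_mul hρ.le]
        ring
      · rw [indicator_of_notMem hz]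
        by_cases hz2 : ρ ∈ Ioi |z|
        · have h5 : ¬ ρ * cosAngle r ρ s < z := fun h =>
            hz ⟨h, lt_of_le_of_lt (le_abs_self z) hz2⟩
          rw [indicator_of_mem hz2]
          simp [hFdef, hiff z, h5]
        · rw [indicator_of_notMem hz2]
    simp_rw [h4]
    rw [lintegral_indicator measurableSet_Ioo, lintegral_const_mul _ (by fun_prop)]
    have hle : ρ * cosAngle r ρ s ≤ ρ := by nlinarith
    rw [← ofReal_integral_eq_lintegral_ofReal]
    · rw [← integral_Ioc_eq_integral_Ioo, ← intervalIntegral.integral_of_le hle, capFn_scaled hk,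
        ENNReal.ofReal_mul (by positivity), show 2 * k = (2 * k - 1) + 1 by omega, pow_succ,
        ENNReal.ofReal_mul (by positivity)]
      simp only [Nat.add_sub_cancel]
      ring
    · exact (Continuous.integrableOn_Icc (by fun_prop)).mono_set Ioo_subset_Icc_self
    · filter_upwards [ae_restrict_mem measurableSet_Ioo] with z hz
      have : 0 < z := lt_trans (by positivity) hz.1
      have : z ^ 2 ≤ ρ ^ 2 := by nlinarith [hz.2]
      exact pow_nonneg (by linarith) _
  · rw [indicator_of_notMem (show ρ ∉ {ρ : ℝ | |r - ρ| < s} from hc), mul_zero]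
    rw [← lintegral_zero (μ := (volume : Measure ℝ))]
    refine lintegral_congr fun z => ?_
    by_cases hz2 : ρ ∈ Ioi |z|
    · have h6 : ¬ cosAngle r ρ s < 1 := fun h => hc ((cosAngle_lt_one_iff hr0 hρ hs).mp h)
      have h5 : ¬ ρ * cosAngle r ρ s < z := by
        have := lt_of_le_of_lt (le_abs_self z) hz2
        nlinarith
      rw [indicator_of_mem hz2]
      simp [hFdef, hiff z, h5]
    · rw [indicator_of_notMem hz2]

theorem lintegral_ball_coord {n : ℕ} (hn : 1 ≤ n) {s : ℝ} (hs : 0 < s) {f : ℝ → ℝ≥0∞}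
    (hf : Measurable f) :
    ∫⁻ y in Metric.ball (0 : Space (n + 1)) s, f (y 0)
      = ∫⁻ z in Ioo (-s) s, ENNReal.ofReal (√(s ^ 2 - z ^ 2) ^ n) *
        volume (Metric.ball (0 : Space n) 1) * f z := by
  have : Nonempty (Fin n) := ⟨⟨0, hn⟩⟩
  rw [← lintegral_indicator Metric.isOpen_ball.measurableSet]
  have hF : Measurable (Function.uncurry fun z ρ : ℝ => if ρ < s then f z else 0) := by
    apply Measurable.ite
    · exact measurableSet_lt (by fun_prop) (by fun_prop)
    · exact hf.comp measurable_fst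
    · exact measurable_const
  have h := lintegral_slice (n := n) hF
  have h0 : ∀ y : Space (n + 1), (Metric.ball (0 : Space (n + 1)) s).indicator
      (fun y => f (y 0)) y = if ‖y‖ < s then f (y 0) else 0 := by
    intro y; simp [indicator]
  simp_rw [h0]
  rw [h, ← lintegral_indicator measurableSet_Ioo]
  refine lintegral_congr fun z => ?_
  by_cases hz : z ∈ Ioo (-s) s
  · have hz2 : 0 < s ^ 2 - z ^ 2 := by nlinarith [hz.1, hz.2]
    have h1 : ∀ y : Space n, (if √(z ^ 2 + ‖y‖ ^ 2) < s then f z else 0)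
        = (Metric.ball (0 : Space n) √(s ^ 2 - z ^ 2)).indicator (fun _ => f z) y := by
      intro y
      have : √(z ^ 2 + ‖y‖ ^ 2) < s ↔ y ∈ Metric.ball (0 : Space n) √(s ^ 2 - z ^ 2) := by
        rw [mem_ball_zero_iff, Real.sqrt_lt' hs, Real.lt_sqrt (norm_nonneg _)]
        constructor <;> intro h <;> linarith
      simp [indicator, this]
    simp_rw [h1]
    rw [lintegral_indicator_const Metric.isOpen_ball.measurableSet, indicator_of_mem hz,
      Measure.addHaar_ball _ _ (Real.sqrt_nonneg _), finrank_euclideanSpace, Fintype.card_fin,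
      mul_comm]
  · rw [indicator_of_notMem hz]
    have h1 : ∀ y : Space n, ¬ √(z ^ 2 + ‖y‖ ^ 2) < s := by
      intro y hy
      rw [Real.sqrt_lt' hs] at hy
      apply hz
      have : z ^ 2 < s ^ 2 := by nlinarith [sq_nonneg ‖y‖]
      exact ⟨by nlinarith, by nlinarith⟩
    simp [h1]

/-- The Fourier transform of the indicator function of a ball in odd dimension. -/
theorem integral_ball_exp {k : ℕ} (hk : 1 ≤ k) {s : ℝ} (hs : 0 < s) (ξ : Space (2 * k + 1)) :
    ∫ y in Metric.ball (0 : Space (2 * k + 1)) s,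
        Complex.exp (↑(2 * Real.pi * inner ℝ y ξ) * Complex.I)
      = volume.real (Metric.ball (0 : Space (2 * k)) 1) *
        ∫ b in Ioo (-s) s, Complex.exp (↑(2 * Real.pi * ‖ξ‖ * b) * Complex.I) *
          ((s ^ 2 - b ^ 2) ^ k : ℝ) := by
  obtain ⟨A, hA⟩ := exists_isometry_map (x := EuclideanSpace.single 0 ‖ξ‖) (y := ξ)
    (by rw [PiLp.norm_single, norm_norm])
  set g : ℝ → ℂ := fun b => Complex.exp (↑(2 * Real.pi * ‖ξ‖ * b) * Complex.I) with hg
  have hgc : Continuous g := by fun_prop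
  have h1 : ∫ y in Metric.ball (0 : Space (2 * k + 1)) s,
        Complex.exp (↑(2 * Real.pi * inner ℝ y ξ) * Complex.I)
      = ∫ y in Metric.ball (0 : Space (2 * k + 1)) s, g (y 0) := by
    rw [← A.measurePreserving.setIntegral_preimage_emb A.toHomeomorph.measurableEmbedding]
    have hpre : A ⁻¹' Metric.ball (0 : Space (2 * k + 1)) s = Metric.ball 0 s := by
      ext y; simp
    rw [hpre]
    refine setIntegral_congr_fun Metric.isOpen_ball.measurableSet fun y _ => ?_
    simp only [hg]
    rw [← hA, A.inner_map_map, EuclideanSpace.inner_single_right]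
    simp [mul_assoc]
  rw [h1]
  set ν : Measure ℝ := (volume.restrict (Ioo (-s) s)).withDensity fun z =>
    ENNReal.ofReal (√(s ^ 2 - z ^ 2) ^ (2 * k)) * volume (Metric.ball (0 : Space (2 * k)) 1) with hν
  have hm : Measurable fun y : Space (2 * k + 1) => y 0 := by fun_prop
  have hmap : Measure.map (fun y : Space (2 * k + 1) => y 0)
      (volume.restrict (Metric.ball 0 s)) = ν := by
    ext t ht
    rw [← lintegral_indicator_one ht, lintegral_map (measurable_one.indicator ht) hm,
      lintegral_ball_coord (by omega) hs (measurable_one.indicator ht), hν,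
      withDensity_apply _ ht, ← lintegral_indicator ht]
    refine lintegral_congr fun z => ?_
    by_cases hz : z ∈ t <;> simp [hz]
  rw [← integral_map hm.aemeasurable hgc.aestronglyMeasurable, hmap, hν]
  have hv : volume (Metric.ball (0 : Space (2 * k)) 1) ≠ ⊤ := measure_ball_lt_top.ne
  rw [integral_withDensity_eq_integral_toReal_smul (by fun_prop)
    (Filter.Eventually.of_forall fun z => ENNReal.mul_lt_top ENNReal.ofReal_lt_top hv.lt_top),
    ← integral_const_mul]
  refine setIntegral_congr_fun measurableSet_Ioo fun z hz => ?_
  have hz2 : 0 < s ^ 2 - z ^ 2 := by nlinarith [hz.1, hz.2]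
  simp only [ENNReal.toReal_mul, ENNReal.toReal_ofReal (pow_nonneg (Real.sqrt_nonneg _) _)]
  rw [pow_mul, Real.sq_sqrt hz2.le, Complex.real_smul]
  simp only [Measure.real, hg]
  push_cast
  ring_nf

/-! ### Fourier transforms of functions -/

theorem integrable_Lp_mul_schwartz {d : ℕ} (f : Lp ℂ 2 (volume : Measure (Space d)))
    (φ : 𝓢(Space d, ℂ)) : Integrable (fun x => f x * φ x) :=
  (Lp.memLp f).integrable_mul (φ.memLp 2 volume)

theorem hasFourierTransform_Lp {d : ℕ} (f : Lp ℂ 2 (volume : Measure (Space d))) :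
    HasFourierTransform (f : Space d → ℂ) (𝓕 f : Lp ℂ 2 (volume : Measure (Space d))) := by
  intro φ
  refine ⟨integrable_Lp_mul_schwartz f φ, integrable_Lp_mul_schwartz _ φ, ?_⟩
  have h := DFunLike.congr_fun (Lp.fourier_toTemperedDistribution_eq f) φ
  rw [TemperedDistribution.fourier_apply, Lp.toTemperedDistribution_apply,
    Lp.toTemperedDistribution_apply] at h
  simpa [mul_comm] using h

theorem integral_fourierInv_mul {d : ℕ} (F : Lp ℂ 2 (volume : Measure (Space d)))
    (ψ : 𝓢(Space d, ℂ)) :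
    ∫ x, (𝓕⁻ F : Lp ℂ 2 (volume : Measure (Space d))) x * ψ x = ∫ ξ, F ξ * (𝓕⁻ ψ) ξ := by
  have h := (hasFourierTransform_Lp (𝓕⁻ F) (𝓕⁻ ψ)).2.2
  rwa [FourierTransform.fourier_fourierInv_eq, FourierTransform.fourier_fourierInv_eq] at h

theorem HasFourierTransform.integral_mul {d : ℕ} {u g : Space d → ℂ} (h : HasFourierTransform u g)
    (ψ : 𝓢(Space d, ℂ)) : ∫ x, u x * ψ x = ∫ ξ, g ξ * (𝓕⁻ ψ) ξ := by
  have h := (h (𝓕⁻ ψ)).2.2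
  rwa [FourierTransform.fourier_fourierInv_eq] at h

/-- A smooth compactly supported real function, as a complex valued Schwartz function. -/
noncomputable def testFn {d : ℕ} {g : Space d → ℝ} (hg : ContDiff ℝ (⊤ : ℕ∞) g)
    (hc : HasCompactSupport g) : 𝓢(Space d, ℂ) :=
  HasCompactSupport.toSchwartzMap (f := fun x => (g x : ℂ)) (hc.comp_left Complex.ofReal_zero)
    (Complex.ofRealCLM.contDiff.comp hg)

@[simp]
theorem testFn_apply {d : ℕ} {g : Space d → ℝ} (hg : ContDiff ℝ (⊤ : ℕ∞) g)
    (hc : HasCompactSupport g) (x : Space d) : testFn hg hc x = (g x : ℂ) := rfl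

theorem locallyIntegrable_of_schwartz {d : ℕ} {u : Space d → ℂ}
    (h : ∀ φ : 𝓢(Space d, ℂ), Integrable (fun x => u x * φ x)) : LocallyIntegrable u := by
  rw [locallyIntegrable_iff]
  intro K hK
  obtain ⟨R, hR0, hR⟩ := hK.isBounded.subset_closedBall_lt 0 0
  let b : ContDiffBump (0 : Space d) := ⟨R, R + 1, hR0, by linarith⟩
  have h1 := (h (testFn b.contDiff b.hasCompactSupport)).integrableOn (s := K)
  refine h1.congr_fun_ae ?_
  filter_upwards [ae_restrict_mem hK.measurableSet] with x hx
  simp [b.one_of_mem_closedBall (hR hx)]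

theorem ae_eq_zero_of_schwartz {d : ℕ} {u : Space d → ℂ}
    (h : ∀ φ : 𝓢(Space d, ℂ), Integrable (fun x => u x * φ x))
    (h0 : ∀ φ : 𝓢(Space d, ℂ), ∫ x, u x * φ x = 0) : u =ᵐ[volume] 0 := by
  refine ae_eq_zero_of_integral_contDiff_smul_eq_zero (locallyIntegrable_of_schwartz h) ?_
  intro g hg hc
  have := h0 (testFn hg hc)
  simpa [mul_comm] using this

theorem HasFourierTransform.sub {d : ℕ} {u g u' g' : Space d → ℂ} (h : HasFourierTransform u g)
    (h' : HasFourierTransform u' g') : HasFourierTransform (u - u') (g - g') := by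
  intro φ
  obtain ⟨h1, h2, h3⟩ := h φ
  obtain ⟨h1', h2', h3'⟩ := h' φ
  simp only [Pi.sub_apply, sub_mul]
  refine ⟨h1.sub h1', h2.sub h2', ?_⟩
  rw [integral_sub (h (𝓕 φ)).1 (h' (𝓕 φ)).1, integral_sub h2 h2', h3, h3']

theorem HasFourierTransform.unique {d : ℕ} {u g g' : Space d → ℂ} (h : HasFourierTransform u g)
    (h' : HasFourierTransform u g') : g =ᵐ[volume] g' := by
  have hs := h.sub h'
  have := ae_eq_zero_of_schwartz (fun φ => (hs φ).2.1) (fun φ => by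
    rw [← (hs φ).2.2]; simp)
  filter_upwards [this] with x hx
  simpa [sub_eq_zero] using hx

theorem HasFourierTransform.unique_left {d : ℕ} {u u' g : Space d → ℂ} (h : HasFourierTransform u g)
    (h' : HasFourierTransform u' g) : u =ᵐ[volume] u' := by
  have hs := h.sub h'
  have := ae_eq_zero_of_schwartz (fun φ => (hs φ).1) (fun φ => by
    rw [hs.integral_mul]; simp)
  filter_upwards [this] with x hx
  simpa [sub_eq_zero] using hx

theorem HasFourierTransform.congr {d : ℕ} {u g u' g' : Space d → ℂ} (h : HasFourierTransform u g)
    (hu : u =ᵐ[volume] u') (hg : g =ᵐ[volume] g') : HasFourierTransform u' g' := by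
  intro φ
  obtain ⟨h1, h2, h3⟩ := h φ
  have e1 : ∀ φ : 𝓢(Space d, ℂ), (fun x => u x * φ x) =ᵐ[volume] fun x => u' x * φ x := fun φ => by
    filter_upwards [hu] with x hx; rw [hx]
  have e2 : ∀ φ : 𝓢(Space d, ℂ), (fun x => g x * φ x) =ᵐ[volume] fun x => g' x * φ x := fun φ => by
    filter_upwards [hg] with x hx; rw [hx]
  exact ⟨h1.congr (e1 φ), h2.congr (e2 φ),
    by rw [← integral_congr_ae (e1 (𝓕 φ)), h3, integral_congr_ae (e2 φ)]⟩

theorem toL2_of_memLp {d : ℕ} {f : Space d → ℂ} (h : MemLp f 2 volume) : toL2 f = h.toLp f := by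
  simp [toL2, h]

theorem coeFn_toL2 {d : ℕ} {f : Space d → ℂ} (h : MemLp f 2 volume) : toL2 f =ᵐ[volume] f := by
  rw [toL2_of_memLp h]; exact h.coeFn_toLp

theorem toL2_congr {d : ℕ} {f g : Space d → ℂ} (h : f =ᵐ[volume] g) : toL2 f = toL2 g := by
  by_cases hf : MemLp f 2 volume
  · have hg := hf.ae_eq h
    rw [toL2_of_memLp hf, toL2_of_memLp hg]
    exact (MemLp.toLp_eq_toLp_iff _ _).mpr h
  · have hg : ¬ MemLp g 2 volume := fun hg => hf (hg.ae_eq h.symm)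
    simp [toL2, hf, hg]

theorem norm_toL2 {d : ℕ} {f : Space d → ℂ} (h : MemLp f 2 volume) :
    ‖toL2 f‖ₑ = eLpNorm f 2 volume := by
  rw [toL2_of_memLp h, Lp.enorm_toLp]

/-! ### The multipliers of the wave equation -/

theorem abs_sin_mul_div_le (s κ : ℝ) :
    |Real.sin (s * κ) / κ| ≤ |s| := by
  by_cases h : κ = 0
  · simp [h]
  rw [abs_div, div_le_iff₀ (abs_pos.mpr h), ← abs_mul]
  exact Real.abs_sin_le_abs

theorem abs_sin_div_sub_sin_div_le (s t κ : ℝ) :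
    |Real.sin (s * κ) / κ - Real.sin (t * κ) / κ| ≤ |s - t| := by
  by_cases h : κ = 0
  · simp [h]
  rw [← sub_div, abs_div, div_le_iff₀ (abs_pos.mpr h), ← abs_mul]
  have := Real.abs_sin_sub_sin_le (s * κ) (t * κ)
  rwa [← sub_mul] at this

theorem memLp_sinMul {d : ℕ} (s : ℝ) (F : Lp ℂ 2 (volume : Measure (Space d))) :
    MemLp (fun ξ : Space d =>
      ((Real.sin (s * (2 * Real.pi * ‖ξ‖)) / (2 * Real.pi * ‖ξ‖) : ℝ) : ℂ) * F ξ) 2 volume := by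
  refine MemLp.of_le_mul (c := |s|) (Lp.memLp F) ?_ ?_
  · refine AEStronglyMeasurable.mul ?_ (Lp.aestronglyMeasurable F)
    exact Measurable.aestronglyMeasurable (by fun_prop)
  · refine Filter.Eventually.of_forall fun ξ => ?_
    rw [norm_mul, Complex.norm_real, Real.norm_eq_abs]
    exact mul_le_mul_of_nonneg_right (abs_sin_mul_div_le _ _) (norm_nonneg _)

/-! ### The propagator on radial functions outside the light cone -/

/-- Differentiation of `σ ↦ ∫_{a < σ} w e(σ)` when `e(σ)` vanishes at the threshold `σ = a`. -/
theorem hasDerivAt_integral_threshold {Ω : Type*} [MeasurableSpace Ω] {ν : Measure Ω} {w : Ω → ℂ}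
    (hw : Integrable w ν) {a : Ω → ℝ} (ha : Measurable a) {e e' : ℝ → Ω → ℝ} {s₀ s s₁ B : ℝ}
    (hB0 : 0 ≤ B) (hs0 : s₀ < s) (hs1 : s < s₁)
    (hem : ∀ σ, Measurable (e σ)) (hem' : ∀ σ, Measurable (e' σ))
    (hd : ∀ ω, w ω ≠ 0 → ∀ σ ∈ Ioo s₀ s₁, a ω ≤ σ → HasDerivAt (fun τ => e τ ω) (e' σ ω) σ)
    (h0 : ∀ ω, w ω ≠ 0 → a ω ∈ Ioo s₀ s₁ → e (a ω) ω = 0)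
    (hB : ∀ ω, w ω ≠ 0 → ∀ σ ∈ Ioo s₀ s₁, a ω ≤ σ → |e σ ω| ≤ B)
    (hB' : ∀ ω, w ω ≠ 0 → ∀ σ ∈ Ioo s₀ s₁, a ω ≤ σ → |e' σ ω| ≤ B)
    (hnull : ν {ω | a ω = s} = 0) :
    HasDerivAt (fun σ => ∫ ω, w ω * ((if a ω < σ then e σ ω else 0 : ℝ) : ℂ) ∂ν)
      (∫ ω, w ω * ((if a ω < s then e' s ω else 0 : ℝ) : ℂ) ∂ν) s := by
  have hmeas : ∀ (E : ℝ → Ω → ℝ), (∀ σ, Measurable (E σ)) → ∀ σ, AEStronglyMeasurable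
      (fun ω => w ω * ((if a ω < σ then E σ ω else 0 : ℝ) : ℂ)) ν := by
    intro E hE σ
    refine hw.aestronglyMeasurable.mul ?_
    refine Measurable.aestronglyMeasurable (Complex.measurable_ofReal.comp ?_)
    exact Measurable.ite (measurableSet_lt ha measurable_const) (hE σ) measurable_const
  have hlip : ∀ ω, w ω ≠ 0 → ∀ σ ∈ Ioo s₀ s₁, ∀ τ ∈ Ioo s₀ s₁, σ ≤ τ →
      |(if a ω < τ then e τ ω else 0) - (if a ω < σ then e σ ω else 0)| ≤ B * (τ - σ) := by
    intro ω hω σ hσ τ hτ hle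
    have key : ∀ c ∈ Ioo s₀ s₁, a ω ≤ c → c ≤ τ → |e τ ω - e c ω| ≤ B * (τ - c) := by
      intro c hc hac hcτ
      have h := (convex_Icc c τ).norm_image_sub_le_of_norm_hasDerivWithin_le
        (f := fun σ => e σ ω) (f' := fun σ => e' σ ω) (C := B)
        (fun x hx => (hd ω hω x ⟨lt_of_lt_of_le hc.1 hx.1, lt_of_le_of_lt hx.2 hτ.2⟩
          (hac.trans hx.1)).hasDerivWithinAt)
        (fun x hx => hB' ω hω x ⟨lt_of_lt_of_le hc.1 hx.1, lt_of_le_of_lt hx.2 hτ.2⟩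
          (hac.trans hx.1))
        (left_mem_Icc.mpr hcτ) (right_mem_Icc.mpr hcτ)
      simpa [Real.norm_eq_abs, abs_of_nonneg (sub_nonneg.mpr hcτ)] using h
    -- the integrand is Lipschitz across the threshold because `e` vanishes there
    by_cases h1 : a ω < σ
    · rw [if_pos h1, if_pos (h1.trans_le hle)]
      exact key σ hσ h1.le hle
    · rw [if_neg h1]
      by_cases h2 : a ω < τ
      · rw [if_pos h2, sub_zero]
        have h3 : a ω ∈ Ioo s₀ s₁ := ⟨lt_of_lt_of_le hσ.1 (not_lt.mp h1), h2.trans hτ.2⟩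
        have h4 := key (a ω) h3 le_rfl h2.le
        rw [h0 ω hω h3, sub_zero] at h4
        refine h4.trans (mul_le_mul_of_nonneg_left ?_ hB0)
        linarith [not_lt.mp h1]
      · rw [if_neg h2]
        simpa using mul_nonneg hB0 (sub_nonneg.mpr hle)
  have hnhds : Ioo s₀ s₁ ∈ nhds s := Ioo_mem_nhds hs0 hs1
  refine (hasDerivAt_integral_of_dominated_loc_of_lip (bound := fun ω => ‖w ω‖ * B) hnhds
    (Filter.Eventually.of_forall (hmeas e hem)) ?_ (hmeas e' hem' s) ?_
    (hw.norm.mul_const B) ?_).2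
  · refine Integrable.mono' (hw.norm.mul_const |B|) (hmeas e hem s) (Filter.Eventually.of_forall ?_)
    intro ω
    rw [norm_mul, Complex.norm_real, Real.norm_eq_abs]
    by_cases hω : w ω = 0
    · simp [hω]
    · refine mul_le_mul_of_nonneg_left ?_ (norm_nonneg _)
      split_ifs with h
      · exact (hB ω hω s ⟨hs0, hs1⟩ h.le).trans (le_abs_self _)
      · simp
  · refine Filter.Eventually.of_forall fun ω => ?_
    by_cases hω : w ω = 0
    · refine LipschitzOnWith.of_dist_le_mul fun σ _ τ _ => ?_
      simp only [hω, zero_mul, dist_self]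
      positivity
    · refine LipschitzOnWith.of_dist_le_mul fun σ hσ τ hτ => ?_
      rw [dist_eq_norm, ← mul_sub, norm_mul, ← Complex.ofReal_sub, Complex.norm_real,
        Real.norm_eq_abs, Real.coe_nnabs, abs_of_nonneg (mul_nonneg (norm_nonneg _) hB0), mul_assoc,
        Real.dist_eq]
      refine mul_le_mul_of_nonneg_left ?_ (norm_nonneg _)
      rcases le_total σ τ with h | h
      · rw [abs_sub_comm, abs_sub_comm σ, abs_of_nonneg (sub_nonneg.mpr h)]
        exact hlip ω hω σ hσ τ hτ h
      · rw [abs_of_nonneg (sub_nonneg.mpr h)]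
        exact hlip ω hω τ hτ σ hσ h
  · have : ∀ᵐ ω ∂ν, a ω ≠ s := by rw [ae_iff]; simpa using hnull
    filter_upwards [this] with ω hne
    by_cases hω : w ω = 0
    · simp [hω, hasDerivAt_const]
    · refine HasDerivAt.const_mul _ (HasDerivAt.ofReal_comp ?_)
      rcases lt_or_gt_of_ne hne with h | h
      · rw [if_pos h]
        refine (hd ω hω s ⟨hs0, hs1⟩ h.le).congr_of_eventuallyEq ?_
        filter_upwards [Ioi_mem_nhds h] with σ hσ
        rw [if_pos (show a ω < σ from hσ)]
      · rw [if_neg (not_lt.mpr h.le)]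
        refine (hasDerivAt_const s (0 : ℝ)).congr_of_eventuallyEq ?_
        filter_upwards [Iio_mem_nhds h] with σ hσ
        rw [if_neg (not_lt.mpr (le_of_lt hσ))]

/-- The Fourier side of the ball means: the integral of `G` against
`∫_{-s}^s e^{2πi|ξ|b} (s² - b²)^m db`. The domain `(-S, S)` of `b`, for `S > s`, does not depend on
`s`, so that the derivative in `s` is a derivative under the integral sign. -/
noncomputable def fourierSide {d : ℕ} (G : Space d → ℂ) (S : ℝ) (m : ℕ) (s : ℝ) : ℂ :=
  ∫ p : ℝ × Space d, (G p.2 * Complex.exp (↑(2 * Real.pi * ‖p.2‖ * p.1) * Complex.I)) *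
    ((if |p.1| < s then (s ^ 2 - p.1 ^ 2) ^ m else 0 : ℝ) : ℂ)
    ∂((volume.restrict (Ioo (-S) S)).prod volume)

theorem integrable_fourierSide {d : ℕ} {G : Space d → ℂ} (hG : Integrable G) (S : ℝ) :
    Integrable (fun p : ℝ × Space d =>
      G p.2 * Complex.exp (↑(2 * Real.pi * ‖p.2‖ * p.1) * Complex.I))
      ((volume.restrict (Ioo (-S) S)).prod volume) := by
  refine Integrable.mul_bdd (c := 1) (hG.comp_snd _) (Continuous.aestronglyMeasurable (by fun_prop))
    (Filter.Eventually.of_forall fun p => ?_)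
  rw [Complex.norm_exp_ofReal_mul_I]

theorem hasDerivAt_fourierSide {d : ℕ} {G : Space d → ℂ} (hG : Integrable G) {S s : ℝ} (m : ℕ)
    (hs : 0 < s) (hS : s < S) :
    HasDerivAt (fourierSide G S (m + 1)) (2 * (m + 1) * s * fourierSide G S m s) s := by
  have hS0 : 0 < S := hs.trans hS
  have h := hasDerivAt_integral_threshold (integrable_fourierSide hG S) (a := fun p => |p.1|)
    (by fun_prop) (e := fun σ p => (σ ^ 2 - p.1 ^ 2) ^ (m + 1))
    (e' := fun σ p => 2 * (m + 1) * σ * (σ ^ 2 - p.1 ^ 2) ^ m)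
    (B := (S ^ 2) ^ (m + 1) + 2 * (m + 1) * S * (S ^ 2) ^ m) (by positivity) hs hS
    (fun σ => by fun_prop) (fun σ => by fun_prop) ?_ ?_ ?_ ?_ ?_
  · have e : fourierSide G S (m + 1) = _ := rfl
    refine h.congr_deriv ?_
    rw [fourierSide, ← integral_const_mul]
    congr 1
    ext p
    by_cases hp : |p.1| < s
    · simp only [hp, if_true]; push_cast; ring
    · simp [hp]
  · intro p _ σ _ _
    have := (((hasDerivAt_pow 2 σ).sub_const (p.1 ^ 2)).pow (m + 1))
    refine this.congr_deriv ?_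
    push_cast
    simp
    ring
  · intro p _ _
    simp
  · intro p _ σ hσ hp
    have h1 : p.1 ^ 2 ≤ σ ^ 2 := by
      rw [← sq_abs]; exact pow_le_pow_left₀ (abs_nonneg _) hp 2
    have h2 : σ ^ 2 ≤ S ^ 2 := pow_le_pow_left₀ hσ.1.le hσ.2.le 2
    have h3 := sq_nonneg p.1
    rw [abs_of_nonneg (pow_nonneg (by linarith) _)]
    have : (σ ^ 2 - p.1 ^ 2) ^ (m + 1) ≤ (S ^ 2) ^ (m + 1) :=
      pow_le_pow_left₀ (by linarith) (by linarith) _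
    have : 0 ≤ 2 * (m + 1) * S * (S ^ 2) ^ m := by positivity
    linarith
  · intro p _ σ hσ hp
    have h1 : p.1 ^ 2 ≤ σ ^ 2 := by
      rw [← sq_abs]; exact pow_le_pow_left₀ (abs_nonneg _) hp 2
    have h2 : σ ^ 2 ≤ S ^ 2 := pow_le_pow_left₀ hσ.1.le hσ.2.le 2
    have h3 := sq_nonneg p.1
    have h4 := hσ.1
    rw [abs_of_nonneg (mul_nonneg (by positivity) (pow_nonneg (by linarith) _))]
    have : 2 * (m + 1) * σ * (σ ^ 2 - p.1 ^ 2) ^ m ≤ 2 * (m + 1) * S * (S ^ 2) ^ m := by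
      refine mul_le_mul ?_ (pow_le_pow_left₀ (by linarith) (by linarith) _)
        (pow_nonneg (by linarith) _) (by positivity)
      exact mul_le_mul_of_nonneg_left hσ.2.le (by positivity)
    have : 0 ≤ (S ^ 2) ^ (m + 1) := by positivity
    linarith
  · have hsub : {p : ℝ × Space d | |p.1| = s} ⊆ ({s, -s} : Set ℝ) ×ˢ univ := by
      intro p hp
      simpa using (abs_eq hs.le).mp hp
    refine measure_mono_null hsub ?_
    rw [Measure.prod_prod]
    have : (volume.restrict (Ioo (-S) S)) ({s, -s} : Set ℝ) = 0 :=
      (Set.toFinite _).measure_zero _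
    rw [this, zero_mul]

theorem fourierSide_eq {d : ℕ} {G : Space d → ℂ} (hG : Integrable G) {S s : ℝ} (m : ℕ)
    (hs : 0 < s) (hS : s < S) :
    fourierSide G S m s = ∫ ξ, G ξ * ∫ b in Ioo (-s) s,
      Complex.exp (↑(2 * Real.pi * ‖ξ‖ * b) * Complex.I) * ((s ^ 2 - b ^ 2) ^ m : ℝ) := by
  have hint : Integrable (fun p : ℝ × Space d =>
      (G p.2 * Complex.exp (↑(2 * Real.pi * ‖p.2‖ * p.1) * Complex.I)) *
      ((if |p.1| < s then (s ^ 2 - p.1 ^ 2) ^ m else 0 : ℝ) : ℂ))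
      ((volume.restrict (Ioo (-S) S)).prod volume) := by
    refine Integrable.mul_bdd (c := (s ^ 2) ^ m) (integrable_fourierSide hG S) ?_
      (Filter.Eventually.of_forall fun p => ?_)
    · refine Measurable.aestronglyMeasurable (Complex.measurable_ofReal.comp ?_)
      exact Measurable.ite (measurableSet_lt (by fun_prop) measurable_const) (by fun_prop)
        measurable_const
    · rw [Complex.norm_real, Real.norm_eq_abs]
      split_ifs with h
      · have h1 : p.1 ^ 2 ≤ s ^ 2 := by
          rw [← sq_abs]; exact pow_le_pow_left₀ (abs_nonneg _) h.le 2
        rw [abs_of_nonneg (pow_nonneg (by linarith) _)]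
        have := sq_nonneg p.1
        exact pow_le_pow_left₀ (by linarith) (by linarith) _
      · simp; positivity
  rw [fourierSide, integral_prod_symm _ hint]
  refine integral_congr_ae (Filter.Eventually.of_forall fun ξ => ?_)
  simp only
  rw [← integral_const_mul, ← integral_indicator measurableSet_Ioo,
    ← integral_indicator measurableSet_Ioo]
  congr 1
  ext b
  by_cases hb : |b| < s
  · have h1 := abs_lt.mp hb
    rw [indicator_of_mem (show b ∈ Ioo (-S) S from ⟨by linarith, by linarith⟩),
      indicator_of_mem (show b ∈ Ioo (-s) s from h1), if_pos hb, mul_assoc]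
  · rw [indicator_of_notMem (show b ∉ Ioo (-s) s from fun h => hb (abs_lt.mpr h))]
    simp [indicator, hb]

/-- The kernel of the propagator on radial functions, and (for `m ≥ 1`) its iterated primitives with
respect to `s ds`. -/
noncomputable def waveKernel (k m : ℕ) (s r ρ : ℝ) : ℝ :=
  if |r - ρ| < s then capFn k m (cosAngle r ρ s) * (r * ρ) ^ m / (r * ρ) ^ k else 0

theorem measurable_waveKernel {k m : ℕ} (hk : 1 ≤ k) (hm : m ≤ k) :
    Measurable fun z : ℝ × ℝ × ℝ => waveKernel k m z.1 z.2.1 z.2.2 := by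
  refine Measurable.ite (measurableSet_lt (by fun_prop) (by fun_prop)) ?_ measurable_const
  refine Measurable.div (Measurable.mul ?_ (by fun_prop)) (by fun_prop)
  exact (continuous_capFn hk hm).measurable.comp (measurable_cosAngle.comp
    (by fun_prop : Measurable fun z : ℝ × ℝ × ℝ => (z.2.1, z.2.2, z.1)))

theorem exists_capFn_bound {k m : ℕ} (hk : 1 ≤ k) (hm : m ≤ k) :
    ∃ B, 0 ≤ B ∧ ∀ μ ∈ Icc (0 : ℝ) 1, |capFn k m μ| ≤ B := by
  obtain ⟨B, hB⟩ := isCompact_Icc.exists_bound_of_continuousOn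
    (continuous_capFn hk hm).continuousOn (s := Icc (0 : ℝ) 1)
  exact ⟨B, (norm_nonneg _).trans (hB 0 (by simp)), hB⟩

/-- The physical side of the ball means: the integral of the product `ψ(x) f(y)` against
`waveKernel k m s |x| |y|`. For `m = k` this is, up to a constant, the mean of `f` over balls of
radius `s` tested against `ψ`, and each derivative with respect to `s²/2` lowers `m` by one. -/
noncomputable def physSide {d : ℕ} (k : ℕ) (ψ f : Space d → ℝ) (m : ℕ) (s : ℝ) : ℂ :=
  ∫ p : Space d × Space d, ((ψ p.1 : ℂ) * (f p.2 : ℂ)) * ((waveKernel k m s ‖p.1‖ ‖p.2‖ : ℝ) : ℂ)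

theorem pow_div_pow_le {k m : ℕ} (hm : m ≤ k) {η t : ℝ} (hη : 0 < η) (ht : η ≤ t) :
    t ^ m / t ^ k ≤ (1 + η⁻¹) ^ k := by
  have ht0 : 0 < t := hη.trans_le ht
  obtain ⟨j, rfl⟩ := Nat.exists_eq_add_of_le hm
  have h1 : t ^ m / t ^ (m + j) = (t⁻¹) ^ j := by
    rw [pow_add, inv_pow]; field_simp
  rw [h1]
  have h2 : t⁻¹ ≤ 1 + η⁻¹ := by
    have := inv_anti₀ hη ht
    linarith
  have h3 : 1 ≤ 1 + η⁻¹ := by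
    have := inv_pos.mpr hη
    linarith
  calc (t⁻¹) ^ j ≤ (1 + η⁻¹) ^ j := pow_le_pow_left₀ (by positivity) h2 _
    _ ≤ (1 + η⁻¹) ^ (m + j) := pow_le_pow_right₀ h3 (by omega)

theorem volume_norm_diff_eq {n : ℕ} (hn : 1 ≤ n) (s : ℝ) :
    (volume : Measure (Space n × Space n)) {p | |‖p.1‖ - ‖p.2‖| = s} = 0 := by
  have : Nonempty (Fin n) := ⟨⟨0, hn⟩⟩
  have hm : MeasurableSet {p : Space n × Space n | |‖p.1‖ - ‖p.2‖| = s} :=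
    measurableSet_eq_fun (by fun_prop) (by fun_prop)
  rw [Measure.volume_eq_prod, Measure.measure_prod_null hm]
  refine Filter.Eventually.of_forall fun x => ?_
  have hsub : Prod.mk x ⁻¹' {p : Space n × Space n | |‖p.1‖ - ‖p.2‖| = s}
      ⊆ Metric.sphere 0 (‖x‖ - s) ∪ Metric.sphere 0 (‖x‖ + s) := by
    intro y hy
    simp only [mem_preimage, mem_ofPred_eq] at hy
    simp only [mem_union, mem_sphere_zero_iff_norm]
    rcases abs_choice (‖x‖ - ‖y‖) with h | h
    · left; linarith
    · right; linarith
  refine measure_mono_null hsub (measure_union_null ?_ ?_) <;> exact Measure.addHaar_sphere _ _ _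

theorem hasDerivAt_physSide {k : ℕ} (hk : 1 ≤ k) {ψ f : Space (2 * k + 1) → ℝ}
    (hψ : Integrable ψ) (hf : Integrable f) {s₀ s : ℝ} (hsupp : ∀ x, ψ x ≠ 0 → s₀ < ‖x‖) {m : ℕ}
    (hm : m < k) (hs : 0 < s) (hs0 : s < s₀) :
    HasDerivAt (physSide k ψ f (m + 1)) (s * physSide k ψ f m s) s := by
  obtain ⟨B₁, hB₁0, hB₁⟩ := exists_capFn_bound hk hm.le
  obtain ⟨B₂, hB₂0, hB₂⟩ := exists_capFn_bound hk (Nat.succ_le_of_lt hm)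
  set s₁ := (s + s₀) / 2 with hs1
  have hs1' : s < s₁ := by rw [hs1]; linarith
  have hs10 : s₁ < s₀ := by rw [hs1]; linarith
  set η := s₀ * (s₀ - s₁) with hη
  have hη0 : 0 < η := mul_pos (by linarith) (by linarith)
  set D := (1 + η⁻¹) ^ k with hD
  have hD0 : 0 < D := by positivity
  have hw : Integrable (fun p : Space (2 * k + 1) × Space (2 * k + 1) =>
      (ψ p.1 : ℂ) * (f p.2 : ℂ)) := by
    rw [Measure.volume_eq_prod]
    exact hψ.ofReal.mul_prod hf.ofReal
  have hcm : ∀ m ≤ k, ∀ σ, Measurable fun p : Space (2 * k + 1) × Space (2 * k + 1) =>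
      capFn k m (cosAngle ‖p.1‖ ‖p.2‖ σ) := fun m hm σ =>
    (continuous_capFn hk hm).measurable.comp (measurable_cosAngle.comp
    (by fun_prop : Measurable fun p : Space (2 * k + 1) × Space (2 * k + 1) => (‖p.1‖, ‖p.2‖, σ)))
  -- on the support of the integrand the radii are bounded below
  have hgeo : ∀ p : Space (2 * k + 1) × Space (2 * k + 1), (ψ p.1 : ℂ) * (f p.2 : ℂ) ≠ 0 →
      ∀ σ ∈ Ioo 0 s₁, |‖p.1‖ - ‖p.2‖| ≤ σ → 0 < ‖p.1‖ ∧ 0 < ‖p.2‖ ∧ η ≤ ‖p.1‖ * ‖p.2‖ ∧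
        cosAngle ‖p.1‖ ‖p.2‖ σ ∈ Icc (0 : ℝ) 1 := by
    intro p hp σ hσ hle
    have h1 : ψ p.1 ≠ 0 := by
      intro h; apply hp; simp [h]
    have h2 := hsupp _ h1
    have h3 := abs_le.mp hle
    have h4 := hσ.1
    have h5 := hσ.2
    refine ⟨by linarith, by linarith, ?_, ?_, ?_⟩
    · exact mul_le_mul h2.le (by linarith) (by linarith) (by linarith)
    · exact (cosAngle_pos hσ.1 (by linarith) hle).le
    · exact cosAngle_le_one (by linarith) (by linarith) hle
  have h := hasDerivAt_integral_threshold hw (a := fun p => |‖p.1‖ - ‖p.2‖|)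
    (by fun_prop)
    (e := fun σ p => capFn k (m + 1) (cosAngle ‖p.1‖ ‖p.2‖ σ) * (‖p.1‖ * ‖p.2‖) ^ (m + 1)
      / (‖p.1‖ * ‖p.2‖) ^ k)
    (e' := fun σ p => σ * (capFn k m (cosAngle ‖p.1‖ ‖p.2‖ σ) * (‖p.1‖ * ‖p.2‖) ^ m
      / (‖p.1‖ * ‖p.2‖) ^ k))
    (B := B₂ * D + s₁ * (B₁ * D)) (by
      have : 0 < s₁ := by linarith
      positivity) hs hs1' ?_ ?_ ?_ ?_ ?_ ?_ ?_
  · refine h.congr_deriv ?_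
    rw [physSide, ← integral_const_mul]
    congr 1
    ext p
    rw [waveKernel]
    by_cases hp : |‖p.1‖ - ‖p.2‖| < s
    · simp only [hp, if_true]; push_cast; ring
    · simp [hp]
  · intro σ
    exact Measurable.div (Measurable.mul (hcm _ hm σ) (by fun_prop)) (by fun_prop)
  · intro σ
    exact Measurable.mul measurable_const
      (Measurable.div (Measurable.mul (hcm _ hm.le σ) (by fun_prop)) (by fun_prop))
  · intro p hp σ hσ hle
    obtain ⟨h1, h2, h3, h4⟩ := hgeo p hp σ hσ hle
    have hcos : HasDerivAt (fun τ => cosAngle ‖p.1‖ ‖p.2‖ τ) (-(σ / (‖p.1‖ * ‖p.2‖))) σ := by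
      unfold cosAngle
      refine (((hasDerivAt_pow 2 σ).const_sub _).div_const _).congr_deriv ?_
      norm_num
      field_simp
    have h5 := (hasDerivAt_capFn hm (cosAngle ‖p.1‖ ‖p.2‖ σ)).comp σ hcos
    refine ((h5.mul_const _).div_const _).congr_deriv ?_
    rw [pow_succ]
    field_simp
  -- at the threshold the cap degenerates to a point, so its area vanishes
  · intro p hp ha
    obtain ⟨h1, h2, h3, h4⟩ := hgeo p hp _ ha le_rfl
    have : cosAngle ‖p.1‖ ‖p.2‖ |‖p.1‖ - ‖p.2‖| = 1 := by
      unfold cosAngle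
      rw [sq_abs]
      field_simp
      ring
    simp only [this]
    rw [capFn_one (by omega) (by omega)]
    simp
  · intro p hp σ hσ hle
    obtain ⟨h1, h2, h3, h4⟩ := hgeo p hp σ hσ hle
    have h5 : |capFn k (m + 1) (cosAngle ‖p.1‖ ‖p.2‖ σ) * (‖p.1‖ * ‖p.2‖) ^ (m + 1)
        / (‖p.1‖ * ‖p.2‖) ^ k| ≤ B₂ * D := by
      rw [mul_div_assoc, abs_mul, abs_of_pos (a := (‖p.1‖ * ‖p.2‖) ^ (m + 1) / _) (by positivity)]
      exact mul_le_mul (hB₂ _ h4) (pow_div_pow_le hm hη0 h3) (by positivity) hB₂0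
    have : 0 ≤ s₁ * (B₁ * D) := mul_nonneg (by linarith) (by positivity)
    linarith
  · intro p hp σ hσ hle
    obtain ⟨h1, h2, h3, h4⟩ := hgeo p hp σ hσ hle
    have h5 : |capFn k m (cosAngle ‖p.1‖ ‖p.2‖ σ) * (‖p.1‖ * ‖p.2‖) ^ m
        / (‖p.1‖ * ‖p.2‖) ^ k| ≤ B₁ * D := by
      rw [mul_div_assoc, abs_mul, abs_of_pos (a := (‖p.1‖ * ‖p.2‖) ^ m / _) (by positivity)]
      exact mul_le_mul (hB₁ _ h4) (pow_div_pow_le hm.le hη0 h3) (by positivity) hB₁0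
    have : 0 ≤ B₂ * D := by positivity
    rw [abs_mul, abs_of_pos hσ.1]
    have := mul_le_mul hσ.2.le h5 (abs_nonneg _) (by linarith)
    linarith
  · exact volume_norm_diff_eq (by omega) s

/-- The integral over a ball of a radial function, as an integral of cap areas. -/
theorem setIntegral_ball_radial {k : ℕ} (hk : 1 ≤ k) {x : Space (2 * k + 1)} {s : ℝ} (hs : 0 < s)
    (hsx : s < ‖x‖) {f : Space (2 * k + 1) → ℝ} {h : ℝ → ℝ} (hm : Measurable h)
    (hf : ∀ᵐ y, f y = h ‖y‖) :
    (sphereMeasure (2 * k + 1)).real univ * ∫ y in Metric.ball x s, f y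
      = (sphereMeasure (2 * k)).real univ *
        ∫ y in {y : Space (2 * k + 1) | |‖x‖ - ‖y‖| < s},
          capFn k k (cosAngle ‖x‖ ‖y‖ s) * f y := by
  have hS : MeasurableSet {y : Space (2 * k + 1) | |‖x‖ - ‖y‖| < s} :=
    measurableSet_lt (by fun_prop) (by fun_prop)
  have hcm : Measurable fun y : Space (2 * k + 1) => capFn k k (cosAngle ‖x‖ ‖y‖ s) :=
    (continuous_capFn hk le_rfl).measurable.comp (measurable_cosAngle.comp
      (by fun_prop : Measurable fun y : Space (2 * k + 1) => (‖x‖, ‖y‖, s)))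
  have hpos : ∀ y ∈ {y : Space (2 * k + 1) | |‖x‖ - ‖y‖| < s},
      0 ≤ capFn k k (cosAngle ‖x‖ ‖y‖ s) := by
    intro y hy
    have hy : |‖x‖ - ‖y‖| < s := hy
    have h1 := abs_lt.mp hy
    have h2 := cosAngle_le_one (by linarith) (by linarith) hy.le
    have h3 := cosAngle_pos hs hsx hy.le
    rw [capFn_self]
    refine intervalIntegral.integral_nonneg h2 fun z hz => pow_nonneg ?_ _
    nlinarith [hz.1, hz.2]
  -- both sides are integrals of the profile `h` against measures on the line: the images under the
  -- norm of the two measures on the space; these images coincide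
  set ν₁ : Measure ℝ := sphereMeasure (2 * k + 1) univ •
    Measure.map (fun y : Space (2 * k + 1) => ‖y‖) (volume.restrict (Metric.ball x s)) with hν₁
  set ν₂ : Measure ℝ := sphereMeasure (2 * k) univ •
    Measure.map (fun y : Space (2 * k + 1) => ‖y‖)
      ((volume.restrict {y : Space (2 * k + 1) | |‖x‖ - ‖y‖| < s}).withDensity
        fun y => ENNReal.ofReal (capFn k k (cosAngle ‖x‖ ‖y‖ s))) with hν₂
  have hν : ν₁ = ν₂ := by
    ext t ht
    have := lintegral_ball_radial hk hs hsx (H := t.indicator 1) (measurable_one.indicator ht)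
    rw [hν₁, hν₂, Measure.smul_apply, Measure.smul_apply, ← lintegral_indicator_one ht,
      lintegral_map (measurable_one.indicator ht) measurable_norm,
      ← lintegral_indicator_one ht, lintegral_map (measurable_one.indicator ht) measurable_norm,
      lintegral_withDensity_eq_lintegral_mul _ hcm.ennreal_ofReal
        (g := fun y => t.indicator 1 ‖y‖) ((measurable_one.indicator ht).comp measurable_norm)]
    exact this
  have hae : ∀ {t : Set (Space (2 * k + 1))}, ∀ᵐ y ∂(volume.restrict t), f y = h ‖y‖ :=
    ae_restrict_of_ae hf
  rw [integral_congr_ae hae]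
  have h2 : ∫ y in {y : Space (2 * k + 1) | |‖x‖ - ‖y‖| < s},
      capFn k k (cosAngle ‖x‖ ‖y‖ s) * f y
      = ∫ y in {y : Space (2 * k + 1) | |‖x‖ - ‖y‖| < s},
      (ENNReal.ofReal (capFn k k (cosAngle ‖x‖ ‖y‖ s))).toReal • h ‖y‖ := by
    refine integral_congr_ae ?_
    filter_upwards [hae, ae_restrict_mem hS] with y hy hyS
    rw [hy, ENNReal.toReal_ofReal (hpos y hyS), smul_eq_mul]
  rw [h2, ← integral_withDensity_eq_integral_toReal_smul hcm.ennreal_ofReal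
    (Filter.Eventually.of_forall fun y => ENNReal.ofReal_lt_top)]
  have h3 : ∫ t, h t ∂ν₁ = ∫ t, h t ∂ν₂ := by rw [hν]
  rw [hν₁, hν₂, integral_smul_measure, integral_smul_measure,
    integral_map (by fun_prop) hm.aestronglyMeasurable,
    integral_map (by fun_prop) hm.aestronglyMeasurable] at h3
  exact h3

theorem abs_waveKernel_le {k m : ℕ} (hk : 1 ≤ k) (hm : m ≤ k) :
    ∃ B, 0 ≤ B ∧ ∀ s r ρ, 0 < s → s < r → 0 ≤ ρ →
      |waveKernel k m s r ρ| ≤ B * ((r * ρ) ^ m / (r * ρ) ^ k) := by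
  obtain ⟨B, hB0, hB⟩ := exists_capFn_bound hk hm
  refine ⟨B, hB0, fun s r ρ hs hr hρ => ?_⟩
  unfold waveKernel
  split_ifs with h
  · have h1 := abs_lt.mp h
    have h2 : 0 < ρ := by linarith
    have h3 : 0 < r := by linarith
    rw [mul_div_assoc, abs_mul, abs_of_nonneg (a := (r * ρ) ^ m / _) (by positivity)]
    exact mul_le_mul_of_nonneg_right
      (hB _ ⟨(cosAngle_pos hs hr h.le).le, cosAngle_le_one h3 h2 h.le⟩) (by positivity)
  · have h3 : 0 < r := by linarith
    rw [abs_zero]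
    positivity

/-- The ratio of the surface areas of the unit spheres of `ℝ^(2k)` and `ℝ^(2k+1)`. -/
noncomputable def sphereRatio (k : ℕ) : ℝ :=
  (sphereMeasure (2 * k)).real univ / (sphereMeasure (2 * k + 1)).real univ

/-- The normalization that turns the kernel `waveKernel k 0` into the propagator. -/
noncomputable def waveConst (k : ℕ) : ℝ :=
  sphereRatio k / (2 * (volume.real (Metric.ball (0 : Space (2 * k)) 1) *
    ∏ i ∈ Finset.range k, (2 * ((k : ℝ) - i))))

/-- The propagator `sin(s√(-Δ)) / √(-Δ)` on radial functions, at points with `|x| > s`. -/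
noncomputable def radialProp (k : ℕ) (s : ℝ) (f : Space (2 * k + 1) → ℝ) (x : Space (2 * k + 1)) :
    ℝ :=
  waveConst k * ∫ y, waveKernel k 0 s ‖x‖ ‖y‖ * f y

/-- The Fourier transform of a ball acts on test functions as the convolution with its indicator
function. -/
theorem integral_mul_ball_conv {k : ℕ} (hk : 1 ≤ k) {f : Space (2 * k + 1) → ℂ}
    {g : Space (2 * k + 1) → ℂ} (hf : HasFourierTransform f g) {ψ : Space (2 * k + 1) → ℝ}
    (hψ : ContDiff ℝ (⊤ : ℕ∞) ψ) (hc : HasCompactSupport ψ) {s : ℝ} (hs : 0 < s) :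
    ∫ y, f y * ∫ x, (if ‖y - x‖ < s then 1 else 0) * (ψ x : ℂ)
      = volume.real (Metric.ball (0 : Space (2 * k)) 1) *
        ∫ ξ, (g ξ * (𝓕⁻ (testFn hψ hc)) ξ) * ∫ b in Ioo (-s) s,
          Complex.exp (↑(2 * Real.pi * ‖ξ‖ * b) * Complex.I) * ((s ^ 2 - b ^ 2) ^ k : ℝ) := by
  set E : Space (2 * k + 1) → ℂ := fun y => if ‖y‖ < s then 1 else 0 with hE
  set Ψ : Space (2 * k + 1) → ℂ := fun x => (ψ x : ℂ) with hΨ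
  have hEi : E = (Metric.ball (0 : Space (2 * k + 1)) s).indicator 1 := by
    ext y; simp [hE, indicator]
  have hEint : Integrable E := by
    rw [hEi, integrable_indicator_iff Metric.isOpen_ball.measurableSet]
    exact integrableOn_const measure_ball_lt_top.ne
  have hΨc : HasCompactSupport Ψ := hc.comp_left Complex.ofReal_zero
  have hΨs : ContDiff ℝ (⊤ : ℕ∞) Ψ := Complex.ofRealCLM.contDiff.comp hψ
  have hΨint : Integrable Ψ := hΨs.continuous.integrable_of_hasCompactSupport hΨc
  set χ := convolution E Ψ (ContinuousLinearMap.mul ℂ ℂ) volume with hχ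
  have hχr : χ = convolution E Ψ (ContinuousLinearMap.mul ℝ ℂ) volume := rfl
  have hEc : HasCompactSupport E := by
    apply HasCompactSupport.of_support_subset_isCompact (isCompact_closedBall (0 : Space (2 * k + 1)) s)
    intro y hy
    rw [hEi] at hy
    exact Metric.ball_subset_closedBall (mem_of_indicator_ne_zero hy)
  have hχc : HasCompactSupport χ := HasCompactSupport.convolution (L := ContinuousLinearMap.mul ℂ ℂ) hEc hΨc
  have hχs : ContDiff ℝ (⊤ : ℕ∞) χ := by
    rw [hχr]
    exact HasCompactSupport.contDiff_convolution_right _ hΨc hEint.locallyIntegrable hΨs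
  have h1 := hf.integral_mul (hχc.toSchwartzMap hχs)
  have h2 : ∀ y, (hχc.toSchwartzMap hχs) y = ∫ x, (if ‖y - x‖ < s then 1 else 0) * (ψ x : ℂ) := by
    intro y
    change χ y = _
    rw [hχ, convolution_eq_swap]
    rfl
  simp_rw [h2] at h1
  rw [h1, ← integral_const_mul]
  congr 1
  ext ξ
  have h3 : (𝓕⁻ (hχc.toSchwartzMap hχs)) ξ = 𝓕⁻ χ ξ := by
    rw [SchwartzMap.fourierInv_coe]; rfl
  have h4 : (𝓕⁻ (testFn hψ hc)) ξ = 𝓕⁻ Ψ ξ := by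
    rw [SchwartzMap.fourierInv_coe]; rfl
  rw [h3, h4, Real.fourierInv_eq_fourier_neg, hχ, Real.fourier_mul_convolution_eq hEint hΨint,
    Real.fourierInv_eq_fourier_neg Ψ]
  have h5 : 𝓕 E (-ξ) = ∫ y in Metric.ball (0 : Space (2 * k + 1)) s,
        Complex.exp (↑(2 * Real.pi * inner ℝ y ξ) * Complex.I) := by
    rw [Real.fourier_eq', ← integral_indicator Metric.isOpen_ball.measurableSet]
    congr 1
    ext y
    by_cases hy : y ∈ Metric.ball (0 : Space (2 * k + 1)) s
    · rw [hEi, indicator_of_mem hy, indicator_of_mem hy]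
      simp
    · rw [hEi, indicator_of_notMem hy, indicator_of_notMem hy]
      simp
  rw [h5, integral_ball_exp hk hs]
  ring

theorem locallyIntegrable_of_hasFourierTransform {d : ℕ} {f : Space d → ℝ} {g : Space d → ℂ}
    (hf : HasFourierTransform (fun x => (f x : ℂ)) g) : LocallyIntegrable f := by
  have := locallyIntegrable_of_schwartz (fun φ => (hf φ).1)
  intro x
  obtain ⟨U, hU, hi⟩ := this x
  exact ⟨U, hU, hi.re⟩

theorem integral_exp_Ioo {s κ : ℝ} (hs : 0 < s) (hκ : κ ≠ 0) :
    ∫ b in Ioo (-s) s, Complex.exp (↑(κ * b) * Complex.I) * ((s ^ 2 - b ^ 2) ^ 0 : ℝ)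
      = 2 * ((Real.sin (s * κ) / κ : ℝ) : ℂ) := by
  rw [← integral_Ioc_eq_integral_Ioo, ← intervalIntegral.integral_of_le (by linarith)]
  have hc : (κ * Complex.I : ℂ) ≠ 0 := by simp [hκ]
  have h : ∀ b : ℝ, Complex.exp (↑(κ * b) * Complex.I) * ((s ^ 2 - b ^ 2) ^ 0 : ℝ)
      = Complex.exp (κ * Complex.I * b) := by
    intro b
    simp only [pow_zero, Complex.ofReal_one, mul_one]
    push_cast; ring_nf
  simp_rw [h]
  rw [integral_exp_mul_complex hc]
  push_cast
  have hκ' : (κ : ℂ) ≠ 0 := by exact_mod_cast hκ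
  rw [Complex.sin]
  field_simp
  have hI : Complex.I ^ 2 = -1 := Complex.I_sq
  ring_nf
  simp only [hI]
  ring

/-- Ball means of a radial function outside the origin are integrals against cap areas. -/
theorem integral_mul_ball_conv_eq_physSide {k : ℕ} (hk : 1 ≤ k) {f : Space (2 * k + 1) → ℝ}
    (hfl : LocallyIntegrable f) {h : ℝ → ℝ} (hm : Measurable h)
    (hfh : ∀ᵐ y, f y = h ‖y‖) {ψ : Space (2 * k + 1) → ℝ} (hψ : Continuous ψ)
    (hc : HasCompactSupport ψ) {s₀ s M : ℝ} (hs : 0 < s) (hs0 : s < s₀)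
    (hsupp : ∀ x, ψ x ≠ 0 → s₀ < ‖x‖) (hM : ∀ x, ψ x ≠ 0 → ‖x‖ + s₀ ≤ M) :
    ∫ y, (f y : ℂ) * ∫ x, (if ‖y - x‖ < s then 1 else 0) * (ψ x : ℂ)
      = sphereRatio k * physSide k ψ ((Metric.ball 0 M).indicator f) k s := by
  set fM := (Metric.ball (0 : Space (2 * k + 1)) M).indicator f with hfM
  have hfMi : Integrable fM := by
    rw [hfM, integrable_indicator_iff Metric.isOpen_ball.measurableSet]
    exact (hfl.integrableOn_isCompact (isCompact_closedBall 0 M)).mono_set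
      Metric.ball_subset_closedBall
  have hψi : Integrable ψ := hψ.integrable_of_hasCompactSupport hc
  have hprod : Integrable (fun p : Space (2 * k + 1) × Space (2 * k + 1) =>
      (ψ p.1 : ℂ) * (fM p.2 : ℂ)) := by
    rw [Measure.volume_eq_prod]
    exact hψi.ofReal.mul_prod hfMi.ofReal
  have hI1 : Integrable (fun p : Space (2 * k + 1) × Space (2 * k + 1) =>
      ((ψ p.1 : ℂ) * (fM p.2 : ℂ)) * (if ‖p.2 - p.1‖ < s then 1 else 0)) := by
    refine Integrable.mul_bdd (c := 1) hprod ?_ (Filter.Eventually.of_forall fun p => ?_)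
    · exact (Measurable.ite (measurableSet_lt (by fun_prop) measurable_const) measurable_const
        measurable_const).aestronglyMeasurable
    · split_ifs <;> simp
  obtain ⟨B, hB0, hB⟩ := abs_waveKernel_le (m := k) hk le_rfl
  have hI2 : Integrable (fun p : Space (2 * k + 1) × Space (2 * k + 1) =>
      ((ψ p.1 : ℂ) * (fM p.2 : ℂ)) * ((waveKernel k k s ‖p.1‖ ‖p.2‖ : ℝ) : ℂ)) := by
    refine Integrable.mono' (hprod.norm.mul_const B) (hprod.aestronglyMeasurable.mul ?_)
      (Filter.Eventually.of_forall fun p => ?_)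
    · exact (Complex.measurable_ofReal.comp ((measurable_waveKernel hk le_rfl).comp
        (by fun_prop : Measurable fun p : Space (2 * k + 1) × Space (2 * k + 1) =>
          (s, ‖p.1‖, ‖p.2‖)))).aestronglyMeasurable
    · rw [norm_mul]
      by_cases hp : ψ p.1 = 0
      · simp [hp]
      · refine mul_le_mul_of_nonneg_left ?_ (norm_nonneg _)
        rw [Complex.norm_real, Real.norm_eq_abs]
        refine (hB s _ _ hs (hs0.trans (hsupp _ hp)) (norm_nonneg _)).trans ?_
        exact mul_le_of_le_one_right hB0 (div_self_le_one _)
  -- the support of `ψ` and `s < s₀` keep `y` in the ball of radius `M`, where `f` is its truncation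
  have hL : ∫ y, (f y : ℂ) * ∫ x, (if ‖y - x‖ < s then 1 else 0) * (ψ x : ℂ)
      = ∫ y, ∫ x, ((ψ x : ℂ) * (fM y : ℂ)) * (if ‖y - x‖ < s then 1 else 0) := by
    refine integral_congr_ae (Filter.Eventually.of_forall fun y => ?_)
    simp only
    rw [← integral_const_mul]
    congr 1
    ext x
    by_cases hx : ψ x = 0
    · simp [hx]
    by_cases hxy : ‖y - x‖ < s
    · have h1 : ‖y‖ < M := by
        have := hM x hx
        have := norm_sub_norm_le y x
        linarith
      have h2 : fM y = f y := by
        rw [hfM, indicator_of_mem]; simpa using h1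
      simp [hxy, h2, mul_comm]
    · simp [hxy]
  rw [hL, physSide, Measure.volume_eq_prod, integral_prod _ hI2, ← integral_const_mul]
  rw [Measure.volume_eq_prod] at hI1
  have hswap := integral_prod_symm _ hI1
  rw [← hswap, integral_prod _ hI1]
  congr 1
  ext x
  simp only
  by_cases hx : ψ x = 0
  · simp [hx]
  have hsx : s < ‖x‖ := hs0.trans (hsupp x hx)
  have e1 : ∀ y, ((ψ x : ℂ) * (fM y : ℂ)) * (if ‖y - x‖ < s then 1 else 0)
      = (ψ x : ℂ) * (((Metric.ball x s).indicator f y : ℝ) : ℂ) := by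
    intro y
    by_cases hxy : ‖y - x‖ < s
    · have h1 : ‖y‖ < M := by
        have := hM x hx
        have := norm_sub_norm_le y x
        linarith
      have h2 : fM y = f y := by
        rw [hfM, indicator_of_mem]; simpa using h1
      rw [indicator_of_mem (mem_ball_iff_norm.mpr hxy)]
      simp [hxy, h2]
    · rw [indicator_of_notMem (fun h => hxy (mem_ball_iff_norm.mp h))]
      simp [hxy]
  have e2 : ∀ y, ((ψ x : ℂ) * (fM y : ℂ)) * ((waveKernel k k s ‖x‖ ‖y‖ : ℝ) : ℂ)
      = (ψ x : ℂ) * ((({y : Space (2 * k + 1) | |‖x‖ - ‖y‖| < s}.indicator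
        (fun y => capFn k k (cosAngle ‖x‖ ‖y‖ s) * f y) y : ℝ)) : ℂ) := by
    intro y
    by_cases hxy : |‖x‖ - ‖y‖| < s
    · have h0 := abs_lt.mp hxy
      have h1 : ‖y‖ < M := by
        have := hM x hx
        linarith
      have h2 : fM y = f y := by
        rw [hfM, indicator_of_mem]; simpa using h1
      rw [indicator_of_mem (show y ∈ {y : Space (2 * k + 1) | |‖x‖ - ‖y‖| < s} from hxy),
        waveKernel, if_pos hxy, h2]
      have h3 : ‖x‖ * ‖y‖ ≠ 0 := by
        have : 0 < ‖y‖ := by linarith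
        have : 0 < ‖x‖ := by linarith
        positivity
      rw [mul_div_assoc, div_self (pow_ne_zero _ h3)]
      push_cast; ring
    · rw [indicator_of_notMem (show y ∉ {y : Space (2 * k + 1) | |‖x‖ - ‖y‖| < s} from hxy),
        waveKernel, if_neg hxy]
      simp
  simp_rw [e1, e2]
  rw [integral_const_mul, integral_const_mul, integral_complex_ofReal, integral_complex_ofReal,
    integral_indicator Metric.isOpen_ball.measurableSet,
    integral_indicator (measurableSet_lt (by fun_prop) (by fun_prop))]
  have hcap := setIntegral_ball_radial hk hs hsx hm hfh
  have hne : (sphereMeasure (2 * k + 1)).real univ ≠ 0 := by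
    rw [Measure.real, ENNReal.toReal_ne_zero]
    exact ⟨sphereMeasure_univ_ne_zero (by omega), measure_ne_top _ _⟩
  have hcap2 : ∫ y in Metric.ball x s, f y = sphereRatio k *
        ∫ y in {y : Space (2 * k + 1) | |‖x‖ - ‖y‖| < s},
          capFn k k (cosAngle ‖x‖ ‖y‖ s) * f y := by
    rw [sphereRatio]
    field_simp
    linarith
  rw [hcap2]
  push_cast
  ring

/-- The explicit form of the propagator `sin(s√(-Δ)) / √(-Δ)` on radial functions outside the light
cone, tested against smooth functions. -/
theorem integral_sin_mul_eq_radialProp {k : ℕ} (hk : 1 ≤ k) {f : Space (2 * k + 1) → ℝ}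
    {g : Space (2 * k + 1) → ℂ} (hf : HasFourierTransform (fun x => (f x : ℂ)) g)
    {h : ℝ → ℝ} (hm : Measurable h) (hfh : ∀ᵐ y, f y = h ‖y‖) {ψ : Space (2 * k + 1) → ℝ}
    (hψ : ContDiff ℝ (⊤ : ℕ∞) ψ) (hc : HasCompactSupport ψ) {s₀ s : ℝ} (hs : 0 < s) (hs0 : s < s₀)
    (hsupp : ∀ x, ψ x ≠ 0 → s₀ < ‖x‖) :
    ∫ ξ, (g ξ * (𝓕⁻ (testFn hψ hc)) ξ) *
        ((Real.sin (s * (2 * Real.pi * ‖ξ‖)) / (2 * Real.pi * ‖ξ‖) : ℝ) : ℂ)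
      = ((∫ x, ψ x * radialProp k s f x : ℝ) : ℂ) := by
  obtain ⟨M₀, hM₀⟩ := hc.isCompact.isBounded.exists_norm_le
  set M := M₀ + s₀ with hMdef
  have hM : ∀ x, ψ x ≠ 0 → ‖x‖ + s₀ ≤ M := fun x hx => by
    have := hM₀ x (subset_tsupport _ hx)
    linarith
  have hfl := locallyIntegrable_of_hasFourierTransform hf
  set fM := (Metric.ball (0 : Space (2 * k + 1)) M).indicator f with hfM
  have hfMi : Integrable fM := by
    rw [hfM, integrable_indicator_iff Metric.isOpen_ball.measurableSet]
    exact (hfl.integrableOn_isCompact (isCompact_closedBall 0 M)).mono_set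
      Metric.ball_subset_closedBall
  have hψi : Integrable ψ := hψ.continuous.integrable_of_hasCompactSupport hc
  set G : Space (2 * k + 1) → ℂ := fun ξ => g ξ * (𝓕⁻ (testFn hψ hc)) ξ with hG
  have hGi : Integrable G := (hf (𝓕⁻ (testFn hψ hc))).2.1
  set V := volume.real (Metric.ball (0 : Space (2 * k)) 1) with hV
  have hV0 : V ≠ 0 := by
    rw [hV, Measure.real, ENNReal.toReal_ne_zero]
    exact ⟨(Metric.measure_ball_pos _ _ one_pos).ne', measure_ball_lt_top.ne⟩
  -- the ball means agree, and the identity descends by differentiation with respect to the radius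
  have key : ∀ j ≤ k, ∀ s ∈ Ioo 0 s₀,
      ((V * ∏ i ∈ Finset.range j, (2 * ((k : ℝ) - i)) : ℝ) : ℂ) * fourierSide G s₀ (k - j) s
        = sphereRatio k * physSide k ψ fM (k - j) s := by
    intro j
    induction j with
    | zero =>
      intro _ s hs
      simp only [Finset.range_zero, Finset.prod_empty, mul_one, Nat.sub_zero]
      rw [fourierSide_eq hGi k hs.1 hs.2, ← integral_mul_ball_conv hk hf hψ hc hs.1]
      exact integral_mul_ball_conv_eq_physSide hk hfl hm hfh hψ.continuous hc hs.1 hs.2 hsupp hM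
    | succ j ih =>
      intro hj s hs
      have ih := ih (by omega)
      have hkj : k - j = (k - (j + 1)) + 1 := by omega
      rw [hkj] at ih
      have d1 := (hasDerivAt_fourierSide hGi (k - (j + 1)) hs.1 hs.2).const_mul
        ((V * ∏ i ∈ Finset.range j, (2 * ((k : ℝ) - i)) : ℝ) : ℂ)
      have d2 := (hasDerivAt_physSide hk hψi hfMi hsupp (m := k - (j + 1)) (by omega)
        hs.1 hs.2).const_mul (sphereRatio k : ℂ)
      have heq : (fun s => ((V * ∏ i ∈ Finset.range j, (2 * ((k : ℝ) - i)) : ℝ) : ℂ) *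
          fourierSide G s₀ (k - (j + 1) + 1) s) =ᶠ[nhds s] fun s =>
          sphereRatio k * physSide k ψ fM (k - (j + 1) + 1) s := by
        filter_upwards [Ioo_mem_nhds hs.1 hs.2] with σ hσ using ih σ hσ
      have h2 := d1.unique (d2.congr_of_eventuallyEq heq)
      have hs' : (s : ℂ) ≠ 0 := by exact_mod_cast hs.1.ne'
      have hcast : ((k - (j + 1) : ℕ) : ℂ) + 1 = (k : ℂ) - j := by
        have : ((k - (j + 1) : ℕ) : ℂ) = (k : ℂ) - (j + 1) := by
          push_cast [Nat.cast_sub hj]; ring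
        rw [this]; ring
      rw [hcast] at h2
      rw [Finset.prod_range_succ]
      apply mul_left_cancel₀ hs'
      push_cast at h2 ⊢
      linear_combination h2
  have hfin := key k le_rfl s ⟨hs, hs0⟩
  rw [Nat.sub_self, fourierSide_eq hGi 0 hs hs0] at hfin
  -- after `k` differentiations the exponent of `s² - b²` is zero, and the inner integral is the
  -- multiplier `sin(s κ) / κ` with `κ = 2π|ξ|`, up to the factor `2`
  have hA : ∫ ξ, G ξ * ∫ b in Ioo (-s) s,
      Complex.exp (↑(2 * Real.pi * ‖ξ‖ * b) * Complex.I) * ((s ^ 2 - b ^ 2) ^ 0 : ℝ)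
      = 2 * ∫ ξ, G ξ *
        ((Real.sin (s * (2 * Real.pi * ‖ξ‖)) / (2 * Real.pi * ‖ξ‖) : ℝ) : ℂ) := by
    rw [← integral_const_mul]
    refine integral_congr_ae ?_
    have : ∀ᵐ ξ : Space (2 * k + 1), ξ ≠ 0 := by
      have := Measure.ae_ne (volume : Measure (Space (2 * k + 1))) 0
      exact this
    filter_upwards [this] with ξ hξ
    rw [integral_exp_Ioo hs (by
      have := norm_pos_iff.mpr hξ
      positivity)]
    ring
  rw [hA] at hfin
  obtain ⟨B, hB0, hB⟩ := abs_waveKernel_le (m := 0) hk (Nat.zero_le k)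
  have hP : physSide k ψ fM 0 s
      = ((∫ x, ψ x * ∫ y, waveKernel k 0 s ‖x‖ ‖y‖ * f y : ℝ) : ℂ) := by
    have hprod : Integrable (fun p : Space (2 * k + 1) × Space (2 * k + 1) =>
        ψ p.1 * fM p.2) := by
      rw [Measure.volume_eq_prod]
      exact hψi.mul_prod hfMi
    have hI2 : Integrable (fun p : Space (2 * k + 1) × Space (2 * k + 1) =>
        (ψ p.1 * fM p.2) * waveKernel k 0 s ‖p.1‖ ‖p.2‖) := by
      refine Integrable.mono' (hprod.norm.mul_const (B * (1 + (s₀ * (s₀ - s))⁻¹) ^ k))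
        (hprod.aestronglyMeasurable.mul ?_) (Filter.Eventually.of_forall fun p => ?_)
      · exact ((measurable_waveKernel hk (Nat.zero_le k)).comp
          (by fun_prop : Measurable fun p : Space (2 * k + 1) × Space (2 * k + 1) =>
            (s, ‖p.1‖, ‖p.2‖))).aestronglyMeasurable
      · rw [norm_mul]
        by_cases hp : ψ p.1 = 0
        · simp [hp]
        refine mul_le_mul_of_nonneg_left ?_ (norm_nonneg _)
        rw [Real.norm_eq_abs]
        have hx := hsupp _ hp
        by_cases hxy : |‖p.1‖ - ‖p.2‖| < s
        · have h0 := abs_lt.mp hxy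
          refine (hB s _ _ hs (hs0.trans hx) (norm_nonneg _)).trans ?_
          refine mul_le_mul_of_nonneg_left ?_ hB0
          exact pow_div_pow_le (Nat.zero_le k) (mul_pos (by linarith) (by linarith))
            (mul_le_mul hx.le (by linarith) (by linarith) (by linarith))
        · rw [waveKernel, if_neg hxy, abs_zero]
          have : 0 < s₀ * (s₀ - s) := mul_pos (by linarith) (by linarith)
          positivity
    have e0 : physSide k ψ fM 0 s = ((∫ p : Space (2 * k + 1) × Space (2 * k + 1),
        (ψ p.1 * fM p.2) * waveKernel k 0 s ‖p.1‖ ‖p.2‖ : ℝ) : ℂ) := by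
      rw [physSide, ← integral_complex_ofReal]
      congr 1
      ext p
      push_cast
      rfl
    rw [e0, Measure.volume_eq_prod, integral_prod _ hI2]
    congr 2
    ext x
    rw [← integral_const_mul]
    congr 1
    ext y
    by_cases hx : ψ x = 0
    · simp [hx]
    by_cases hxy : |‖x‖ - ‖y‖| < s
    · have h0 := abs_lt.mp hxy
      have h1 : ‖y‖ < M := by
        have := hM x hx
        linarith
      have h2 : fM y = f y := by
        rw [hfM, indicator_of_mem]; simpa using h1
      rw [h2]; ring
    · simp [waveKernel, hxy]
  rw [hP] at hfin
  have e3 : ∫ x, ψ x * radialProp k s f x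
      = waveConst k * ∫ x, ψ x * ∫ y, waveKernel k 0 s ‖x‖ ‖y‖ * f y := by
    rw [← integral_const_mul]
    congr 1
    ext x
    rw [radialProp]; ring
  rw [e3, waveConst]
  have hprod0 : (∏ i ∈ Finset.range k, (2 * ((k : ℝ) - i))) ≠ 0 := by
    refine Finset.prod_ne_zero_iff.mpr fun i hi => ?_
    have : (i : ℝ) < k := by exact_mod_cast Finset.mem_range.mp hi
    have : (0 : ℝ) < (k : ℝ) - i := by linarith
    positivity
  have hV0' : (V : ℂ) ≠ 0 := by exact_mod_cast hV0
  have hprod0' : ((∏ i ∈ Finset.range k, (2 * ((k : ℝ) - i)) : ℝ) : ℂ) ≠ 0 := by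
    exact_mod_cast hprod0
  rw [Complex.ofReal_mul, Complex.ofReal_div, Complex.ofReal_mul, Complex.ofReal_mul,
    div_mul_eq_mul_div, eq_div_iff (by
      rw [← hV]
      exact mul_ne_zero (by norm_num) (mul_ne_zero hV0' hprod0'))]
  rw [Complex.ofReal_mul] at hfin
  rw [← hfin, ← hV]
  push_cast
  ring

/-! ### The operator `sinOp` on radial functions -/

/-- A map into a separable space is measurable if its distance to each point is. -/
theorem stronglyMeasurable_of_edist {Ω X : Type*} [MeasurableSpace Ω] [PseudoEMetricSpace X]
    [SecondCountableTopology X] [TopologicalSpace.PseudoMetrizableSpace X] {f : Ω → X}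
    (hf : ∀ c, Measurable fun ω => edist (f ω) c) : StronglyMeasurable f := by
  classical
  borelize X
  refine Measurable.stronglyMeasurable (measurable_of_isOpen fun U hU => ?_)
  rcases isEmpty_or_nonempty X with hX | hX
  · have : U = ∅ := Set.eq_empty_of_isEmpty U
    simp [this]
  -- an open set is the countable union of the balls about points of a dense sequence it contains
  set D := TopologicalSpace.denseSeq X
  have h : f ⁻¹' U = ⋃ n : ℕ, ⋃ m : ℕ, if Metric.eball (D n) ((m : ℝ≥0∞) + 1)⁻¹ ⊆ U
      then {ω | edist (f ω) (D n) < ((m : ℝ≥0∞) + 1)⁻¹} else ∅ := by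
    ext ω
    simp only [mem_preimage, mem_iUnion]
    constructor
    · intro hω
      obtain ⟨ε, hε, hball⟩ := EMetric.isOpen_iff.mp hU _ hω
      obtain ⟨m, hm⟩ := ENNReal.exists_inv_nat_lt (ENNReal.half_pos hε.ne').ne'
      have hm' : ((m : ℝ≥0∞) + 1)⁻¹ ≤ ε / 2 :=
        (ENNReal.inv_le_inv.mpr le_self_add).trans hm.le
      have hpos : 0 < ((m : ℝ≥0∞) + 1)⁻¹ := by
        simp
      obtain ⟨n, hn⟩ := (TopologicalSpace.denseRange_denseSeq X).exists_mem_open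
        (Metric.isOpen_eball (x := f ω) (ε := ((m : ℝ≥0∞) + 1)⁻¹)) ⟨f ω, by simp [hpos]⟩
      refine ⟨n, m, ?_⟩
      rw [if_pos]
      · rw [mem_ofPred_eq, edist_comm]; exact hn
      · intro y hy
        apply hball
        rw [Metric.mem_eball] at hy hn ⊢
        calc edist y (f ω) ≤ edist y (D n) + edist (D n) (f ω) := edist_triangle _ _ _
          _ < ε / 2 + ε / 2 := ENNReal.add_lt_add (hy.trans_le hm') (hn.trans_le hm')
          _ = ε := ENNReal.add_halves ε
    · rintro ⟨n, m, h⟩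
      split_ifs at h with hsub
      · exact hsub (by simpa [Metric.mem_eball] using h)
      · exact absurd h (notMem_empty _)
  rw [h]
  refine MeasurableSet.iUnion fun n => MeasurableSet.iUnion fun m => ?_
  split_ifs
  · exact measurableSet_lt (hf _) measurable_const
  · exact MeasurableSet.empty

/-- A jointly measurable family of square integrable functions is a measurable `L²` valued map. -/
theorem stronglyMeasurable_toL2 {d : ℕ} {G : ℝ → Space d → ℂ}
    (hG : Measurable (Function.uncurry G)) : StronglyMeasurable (fun t => toL2 (G t)) := by
  have hset : MeasurableSet {t | eLpNorm (G t) 2 volume < ⊤} := by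
    refine measurableSet_lt ?_ measurable_const
    simp_rw [eLpNorm_eq_lintegral_rpow_enorm_toReal (p := 2) two_ne_zero ENNReal.ofNat_ne_top]
    refine Measurable.pow_const (Measurable.lintegral_prod_right' (ν := volume)
      (f := fun z : ℝ × Space d => ‖G z.1 z.2‖ₑ ^ (2 : ℝ≥0∞).toReal) ?_) _
    exact hG.enorm.pow_const _
  set S := {t | eLpNorm (G t) 2 volume < ⊤} with hS
  have hGt : ∀ t, Measurable (G t) := fun t => hG.comp measurable_prodMk_left
  have hmem : ∀ t ∈ S, MemLp (G t) 2 volume := fun t ht => ⟨(hGt t).aestronglyMeasurable, ht⟩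
  have hnot : ∀ t ∉ S, toL2 (G t) = 0 := fun t ht => by
    rw [toL2, dif_neg]; exact fun h => ht h.2
  have : Fact ((2 : ℝ≥0∞) ≠ ∞) := ⟨ENNReal.ofNat_ne_top⟩
  refine stronglyMeasurable_of_edist fun c => ?_
  have hc := (Lp.stronglyMeasurable c).measurable
  have : (fun t => edist (toL2 (G t)) c) = fun t => S.piecewise
      (fun t => (∫⁻ x, ‖G t x - c x‖ₑ ^ (2 : ℝ)) ^ (1 / 2 : ℝ)) (fun _ => ‖c‖ₑ) t := by
    ext t
    by_cases ht : t ∈ S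
    · rw [piecewise_eq_of_mem _ _ _ ht, Lp.edist_def,
        eLpNorm_eq_lintegral_rpow_enorm_toReal (p := 2) two_ne_zero ENNReal.ofNat_ne_top]
      simp only [ENNReal.toReal_ofNat]
      congr 1
      refine lintegral_congr_ae ?_
      filter_upwards [coeFn_toL2 (hmem t ht)] with x hx
      simp [hx]
    · rw [piecewise_eq_of_notMem _ _ _ ht, hnot t ht, edist_comm, edist_zero_right]
  rw [this]
  refine Measurable.piecewise hset (Measurable.pow_const ?_ _) measurable_const
  refine Measurable.lintegral_prod_right' (ν := volume)
    (f := fun z : ℝ × Space d => ‖G z.1 z.2 - c z.2‖ₑ ^ (2 : ℝ)) ?_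
  exact ((hG.sub (hc.comp measurable_snd)).enorm).pow_const _

/-- A function that is radial almost everywhere has a measurable profile. -/
theorem IsRadialOn.exists_profile {n : ℕ} (hn : 1 ≤ n) {f : Space n → ℝ}
    (hf : AEStronglyMeasurable f volume) (hr : IsRadialOn univ f) :
    ∃ h : ℝ → ℝ, Measurable h ∧ ∀ᵐ y, f y = h ‖y‖ := by
  obtain ⟨h₀, hh₀⟩ := hr
  have h1 : ∀ᵐ y, hf.mk f y = h₀ ‖y‖ := by
    filter_upwards [hh₀, hf.ae_eq_mk] with y hy hy2
    rw [← hy2, hy (mem_univ y)]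
  -- the restriction of a measurable representative to one generic ray is a measurable profile
  have hne : (ae (sphereMeasure n)).NeBot := by
    rw [ae_neBot]
    intro h
    exact sphereMeasure_univ_ne_zero hn (by simp [h])
  obtain ⟨ω, hω⟩ := (ae_polar hn h1).exists
  refine ⟨fun r => hf.mk f (r • (ω : Space n)), ?_, ?_⟩
  · exact hf.stronglyMeasurable_mk.measurable.comp (by fun_prop)
  · have h2 : ∀ᵐ r ∂(volume.restrict (Ioi (0 : ℝ))), hf.mk f (r • (ω : Space n)) = h₀ r := by
      filter_upwards [hω, ae_restrict_mem measurableSet_Ioi] with r hr hr0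
      rw [hr, norm_smul, norm_eq_of_mem_sphere, mul_one, Real.norm_of_nonneg (le_of_lt hr0)]
    filter_upwards [ae_norm_of_ae hn h2, h1, hf.ae_eq_mk] with y hy hy1 hy2
    rw [hy2, hy1, hy]

theorem enorm_radialProp_le {k : ℕ} (s : ℝ) (f : Space (2 * k + 1) → ℝ) (x : Space (2 * k + 1)) :
    ‖radialProp k s f x‖ₑ ≤ ‖waveConst k‖ₑ * ∫⁻ y, ‖waveKernel k 0 s ‖x‖ ‖y‖ * f y‖ₑ := by
  rw [radialProp, enorm_mul]
  gcongr
  exact enorm_integral_le_lintegral_enorm _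

theorem exists_lintegral_waveKernel_le {k : ℕ} (hk : 1 ≤ k) :
    ∃ C : ℝ, 0 ≤ C ∧ ∀ (s : ℝ) (f : Space (2 * k + 1) → ℝ) (x : Space (2 * k + 1)),
      0 < s → s < ‖x‖ → ∫⁻ y, ‖waveKernel k 0 s ‖x‖ ‖y‖ * f y‖ₑ ≤ ENNReal.ofReal (C / ‖x‖ ^ k) *
        ∫⁻ y in {y : Space (2 * k + 1) | |‖x‖ - ‖y‖| < s},
          ENNReal.ofReal (1 / ‖y‖ ^ k) * ‖f y‖ₑ := by
  obtain ⟨B, hB0, hB⟩ := abs_waveKernel_le (m := 0) hk (Nat.zero_le k)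
  refine ⟨B, hB0, fun s f x hs hsx => ?_⟩
  have hx : 0 < ‖x‖ := hs.trans hsx
  rw [← lintegral_const_mul' _ _ ENNReal.ofReal_ne_top,
    ← lintegral_indicator (measurableSet_lt (by fun_prop) (by fun_prop))]
  refine lintegral_mono fun y => ?_
  by_cases hy : |‖x‖ - ‖y‖| < s
  · rw [indicator_of_mem (show y ∈ {y : Space (2 * k + 1) | |‖x‖ - ‖y‖| < s} from hy), enorm_mul,
      ← mul_assoc, ← ENNReal.ofReal_mul (by positivity)]
    gcongr
    rw [Real.enorm_eq_ofReal_abs]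
    refine ENNReal.ofReal_le_ofReal ((hB s _ _ hs hsx (norm_nonneg _)).trans (le_of_eq ?_))
    rw [pow_zero, mul_pow]
    have : 0 < ‖y‖ := by
      have := abs_lt.mp hy
      linarith
    field_simp
  · simp [waveKernel, hy]

theorem exists_radialProp_bound {k : ℕ} (hk : 1 ≤ k) :
    ∃ C : ℝ, 0 ≤ C ∧ ∀ (s : ℝ) (f : Space (2 * k + 1) → ℝ) (x : Space (2 * k + 1)),
      0 < s → s < ‖x‖ → ‖radialProp k s f x‖ₑ ≤ ENNReal.ofReal (C / ‖x‖ ^ k) *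
        ∫⁻ y in {y : Space (2 * k + 1) | |‖x‖ - ‖y‖| < s},
          ENNReal.ofReal (1 / ‖y‖ ^ k) * ‖f y‖ₑ := by
  obtain ⟨B, hB0, hB⟩ := exists_lintegral_waveKernel_le hk
  refine ⟨|waveConst k| * B, by positivity, fun s f x hs hsx => ?_⟩
  refine (enorm_radialProp_le s f x).trans
    ((mul_le_mul_right (hB s f x hs hsx) _).trans (le_of_eq ?_))
  rw [← mul_assoc, Real.enorm_eq_ofReal_abs, ← ENNReal.ofReal_mul (abs_nonneg _), mul_div_assoc]

/-- Two functions agree almost everywhere on an open set if they agree against test functions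
supported in it. -/
theorem ae_eq_on_of_test {d : ℕ} {A B : Space d → ℂ} {U : Set (Space d)} (hU : IsOpen U)
    (hA : LocallyIntegrableOn A U) (hB : LocallyIntegrableOn B U)
    (h : ∀ (ψ : Space d → ℝ), ContDiff ℝ (⊤ : ℕ∞) ψ → HasCompactSupport ψ → tsupport ψ ⊆ U →
      ∫ x, A x * ψ x = ∫ x, B x * ψ x) :
    ∀ᵐ x, x ∈ U → A x = B x := by
  have h1 := hU.ae_eq_zero_of_integral_contDiff_smul_eq_zero (hA.sub hB) ?_
  · filter_upwards [h1] with x hx hxU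
    exact sub_eq_zero.mp (hx hxU)
  · intro ψ hψ hc hsub
    have hi : ∀ {A : Space d → ℂ}, LocallyIntegrableOn A U → Integrable fun x => A x * ψ x := by
      intro A hA
      have h2 := hA.integrableOn_compact_subset hsub hc.isCompact
      have h3 : (fun x => A x * ψ x) = (tsupport ψ).indicator fun x => A x * ψ x := by
        ext x
        by_cases hx : x ∈ tsupport ψ
        · rw [indicator_of_mem hx]
        · rw [indicator_of_notMem hx, image_eq_zero_of_notMem_tsupport hx]; simp
      rw [h3, integrable_indicator_iff (isClosed_tsupport ψ).measurableSet]
      obtain ⟨C, hC⟩ := hψ.continuous.bounded_above_of_compact_support hc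
      exact h2.mul_bdd (c := C) (Complex.continuous_ofReal.comp
        hψ.continuous).aestronglyMeasurable (Filter.Eventually.of_forall fun x => by
          simpa using hC x)
    have h4 := h ψ hψ hc hsub
    have h5 : ∀ x, ψ x • (A - B) x = A x * ψ x - B x * ψ x := by
      intro x; simp [mul_sub, mul_comm]
    simp_rw [h5]
    rw [integral_sub (hi hA) (hi hB), h4, sub_self]

theorem exists_lt_norm_of_tsupport {d : ℕ} {ψ : Space d → ℝ} (hc : HasCompactSupport ψ) {s : ℝ}
    (h : tsupport ψ ⊆ {x | s < ‖x‖}) : ∃ s₀, s < s₀ ∧ ∀ x, ψ x ≠ 0 → s₀ < ‖x‖ := by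
  rcases (tsupport ψ).eq_empty_or_nonempty with h0 | h0
  · refine ⟨s + 1, by linarith, fun x hx => ?_⟩
    have := subset_tsupport ψ hx
    rw [h0] at this
    exact absurd this (notMem_empty x)
  · obtain ⟨x₀, hx₀, hmin⟩ := hc.isCompact.exists_isMinOn h0 continuous_norm.continuousOn
    have h1 : s < ‖x₀‖ := h hx₀
    refine ⟨(s + ‖x₀‖) / 2, by linarith, fun x hx => ?_⟩
    have : ‖x₀‖ ≤ ‖x‖ := hmin (subset_tsupport ψ hx)
    linarith

theorem lintegral_kernel_le {k : ℕ} {s s₀ r M : ℝ} (hs0 : s < s₀) (hr : s₀ ≤ r)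
    (hM : r + s ≤ M) (f : Space (2 * k + 1) → ℝ) :
    ∫⁻ y in {y : Space (2 * k + 1) | |r - ‖y‖| < s}, ENNReal.ofReal (1 / ‖y‖ ^ k) * ‖f y‖ₑ
      ≤ ENNReal.ofReal (1 / (s₀ - s) ^ k) * ∫⁻ y in Metric.ball 0 M, ‖f y‖ₑ := by
  rw [← lintegral_const_mul' _ _ ENNReal.ofReal_ne_top,
    ← lintegral_indicator (measurableSet_lt (by fun_prop) (by fun_prop)),
    ← lintegral_indicator Metric.isOpen_ball.measurableSet]
  refine lintegral_mono fun y => ?_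
  by_cases hy : |r - ‖y‖| < s
  · have h1 := abs_lt.mp hy
    rw [indicator_of_mem (show y ∈ {y : Space (2 * k + 1) | |r - ‖y‖| < s} from hy),
      indicator_of_mem (by rw [mem_ball_zero_iff]; linarith)]
    gcongr
    linarith
  · rw [indicator_of_notMem (show y ∉ {y : Space (2 * k + 1) | |r - ‖y‖| < s} from hy)]
    exact zero_le

theorem measurable_radialProp {k : ℕ} (hk : 1 ≤ k) {Ω : Type*} [MeasurableSpace Ω]
    {σ : Ω → ℝ} (hσ : Measurable σ) {f : Ω → Space (2 * k + 1) → ℝ}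
    (hf : Measurable (Function.uncurry f)) :
    Measurable fun p : Ω × Space (2 * k + 1) => radialProp k (σ p.1) (f p.1) p.2 := by
  unfold radialProp
  refine Measurable.const_mul ?_ _
  have : StronglyMeasurable fun q : (Ω × Space (2 * k + 1)) × Space (2 * k + 1) =>
      waveKernel k 0 (σ q.1.1) ‖q.1.2‖ ‖q.2‖ * f q.1.1 q.2 := by
    refine Measurable.stronglyMeasurable (Measurable.mul ?_ ?_)
    · exact (measurable_waveKernel hk (Nat.zero_le k)).comp
        (by fun_prop : Measurable fun q : (Ω × Space (2 * k + 1)) × Space (2 * k + 1) =>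
            (σ q.1.1, ‖q.1.2‖, ‖q.2‖))
    · exact hf.comp (by fun_prop : Measurable fun q : (Ω × Space (2 * k + 1)) ×
        Space (2 * k + 1) => (q.1.1, q.2))
  exact (this.integral_prod_right' (ν := volume)).measurable

theorem locallyIntegrableOn_of_bound {d : ℕ} {A : Space d → ℂ} {s : ℝ}
    (hA : AEStronglyMeasurable A volume)
    (h : ∀ s₀ M, s < s₀ → ∃ C : ℝ, ∀ x, s₀ ≤ ‖x‖ → ‖x‖ ≤ M → ‖A x‖ ≤ C) :
    LocallyIntegrableOn A {x | s < ‖x‖} := by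
  have hopen : IsOpen {x : Space d | s < ‖x‖} := isOpen_lt continuous_const continuous_norm
  rw [locallyIntegrableOn_iff hopen.isLocallyClosed]
  intro K hK hKc
  rcases K.eq_empty_or_nonempty with rfl | hne
  · simp
  obtain ⟨x₀, hx₀, hmin⟩ := hKc.exists_isMinOn hne continuous_norm.continuousOn
  obtain ⟨M, hM⟩ := hKc.isBounded.exists_norm_le
  obtain ⟨C, hC⟩ := h ‖x₀‖ M (hK hx₀)
  refine Measure.integrableOn_of_bounded (M := C) hKc.measure_lt_top.ne hA ?_
  filter_upwards [ae_restrict_mem hKc.measurableSet] with x hx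
  exact hC x (hmin hx) (hM x hx)

theorem integrable_ball_of_memLp {d : ℕ} {f : Space d → ℝ} (hf : MemLp f 2 volume) (M : ℝ) :
    ∫⁻ y in Metric.ball 0 M, ‖f y‖ₑ < ⊤ := by
  have : IsFiniteMeasure (volume.restrict (Metric.ball (0 : Space d) M)) :=
    ⟨by simpa using measure_ball_lt_top⟩
  exact ((hf.restrict (Metric.ball 0 M)).integrable one_le_two).2

theorem radialProp_bounded {k : ℕ} (hk : 1 ≤ k) {f : Space (2 * k + 1) → ℝ}
    (hf : ∀ M, ∫⁻ y in Metric.ball 0 M, ‖f y‖ₑ < ⊤) {s : ℝ} (hs : 0 < s) :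
    ∀ s₀ M, s < s₀ → ∃ C : ℝ, ∀ x, s₀ ≤ ‖x‖ → ‖x‖ ≤ M → ‖(radialProp k s f x : ℂ)‖ ≤ C := by
  intro s₀ M hs0
  obtain ⟨C, hC0, hC⟩ := exists_radialProp_bound hk
  refine ⟨(ENNReal.ofReal (C / s₀ ^ k) * (ENNReal.ofReal (1 / (s₀ - s) ^ k) *
    ∫⁻ y in Metric.ball 0 (M + s), ‖f y‖ₑ)).toReal, fun x hx hxM => ?_⟩
  rw [Complex.norm_real, ← toReal_enorm]
  refine ENNReal.toReal_mono ?_ ?_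
  · exact ENNReal.mul_ne_top ENNReal.ofReal_ne_top
      (ENNReal.mul_ne_top ENNReal.ofReal_ne_top (hf _).ne)
  · refine (hC s f x hs (hs0.trans_le hx)).trans ?_
    have := hs.trans hs0
    gcongr
    exact lintegral_kernel_le hs0 hx (by linarith) f

theorem memLp_ofReal {d : ℕ} {f : Space d → ℝ} (hf : MemLp f 2 volume) :
    MemLp (fun y => (f y : ℂ)) 2 volume := hf.ofReal

theorem integral_sinOp_mul {d : ℕ} (s : ℝ) (F : Lp ℂ 2 (volume : Measure (Space d)))
    (ψ : 𝓢(Space d, ℂ)) :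
    ∫ x, sinOp s F x * ψ x = ∫ ξ, ((𝓕 F : Lp ℂ 2 (volume : Measure (Space d))) ξ * (𝓕⁻ ψ) ξ) *
      ((Real.sin (s * (2 * Real.pi * ‖ξ‖)) / (2 * Real.pi * ‖ξ‖) : ℝ) : ℂ) := by
  rw [sinOp, integral_fourierInv_mul]
  refine integral_congr_ae ?_
  filter_upwards [coeFn_toL2 (memLp_sinMul s (𝓕 F))] with ξ hξ
  rw [hξ]; ring

/-- Outside the ball of radius `s`, `sin(s√(-Δ)) / √(-Δ)` is given by the explicit kernel on radial
functions. -/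
theorem sinOp_ae_eq {k : ℕ} (hk : 1 ≤ k) {f : Space (2 * k + 1) → ℝ} (hfm : Measurable f)
    (hf : MemLp f 2 volume) (hr : IsRadialOn univ f) {s : ℝ} (hs : 0 < s) :
    ∀ᵐ x, s < ‖x‖ → sinOp s (toL2 fun y => (f y : ℂ)) x = (radialProp k s f x : ℂ) := by
  obtain ⟨h, hm, hfh⟩ := hr.exists_profile (by omega) hf.1
  set F := toL2 fun y => (f y : ℂ) with hF
  have hFT : HasFourierTransform (fun y => (f y : ℂ))
      (𝓕 F : Lp ℂ 2 (volume : Measure (Space (2 * k + 1)))) :=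
    (hasFourierTransform_Lp F).congr (coeFn_toL2 (memLp_ofReal hf)) (ae_eq_refl _)
  refine ae_eq_on_of_test (U := {x | s < ‖x‖}) (isOpen_lt continuous_const continuous_norm) ?_ ?_ ?_
  · exact (((Lp.memLp (sinOp s F)).locallyIntegrable one_le_two).locallyIntegrableOn _)
  · refine locallyIntegrableOn_of_bound ?_
      (radialProp_bounded hk (integrable_ball_of_memLp hf) hs)
    exact (Complex.measurable_ofReal.comp ((measurable_radialProp (Ω := Unit) hk
      (σ := fun _ => s) measurable_const (f := fun _ => f) (hfm.comp measurable_snd)).comp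
      (measurable_const.prodMk measurable_id : Measurable fun x : Space (2 * k + 1) =>
        (((), x) : Unit × Space (2 * k + 1))))).aestronglyMeasurable
  · intro ψ hψ hc hsub
    obtain ⟨s₀, hs0, hsupp⟩ := exists_lt_norm_of_tsupport hc hsub
    have h1 := integral_sinOp_mul s F (testFn hψ hc)
    rw [integral_sin_mul_eq_radialProp hk hFT hm hfh hψ hc hs hs0 hsupp] at h1
    simp only [testFn_apply] at h1
    rw [h1, ← integral_complex_ofReal]
    congr 1
    ext x
    push_cast
    ring

/-! ### The Duhamel integral of radial sources -/

theorem toL2_sub {d : ℕ} {f g : Space d → ℂ} (hf : MemLp f 2 volume) (hg : MemLp g 2 volume) :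
    toL2 (f - g) = toL2 f - toL2 g := by
  rw [toL2_of_memLp hf, toL2_of_memLp hg, toL2_of_memLp (hf.sub hg), MemLp.toLp_sub]

theorem norm_fourierInv_eq {d : ℕ} (F : Lp ℂ 2 (volume : Measure (Space d))) : ‖𝓕⁻ F‖ = ‖F‖ := by
  rw [← Lp.norm_fourier_eq, FourierTransform.fourier_fourierInv_eq]

theorem fourierInv_sub_Lp {d : ℕ} (F F' : Lp ℂ 2 (volume : Measure (Space d))) :
    𝓕⁻ (F - F') = 𝓕⁻ F - 𝓕⁻ F' := by
  rw [sub_eq_add_neg, FourierTransform.fourierInv_add, FourierTransform.fourierInv_neg,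
    ← sub_eq_add_neg]

theorem fourier_sub_Lp {d : ℕ} (F F' : Lp ℂ 2 (volume : Measure (Space d))) :
    𝓕 (F - F') = 𝓕 F - 𝓕 F' := by
  rw [sub_eq_add_neg, FourierTransform.fourier_add, FourierTransform.fourier_neg,
    ← sub_eq_add_neg]

theorem norm_toL2_mul_le {d : ℕ} {m : Space d → ℂ} (hm : AEStronglyMeasurable m volume) {c : ℝ}
    (hc : ∀ ξ, ‖m ξ‖ ≤ c) (F : Lp ℂ 2 (volume : Measure (Space d))) :
    ‖toL2 fun ξ => m ξ * F ξ‖ ≤ c * ‖F‖ := by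
  have hmem : MemLp (fun ξ => m ξ * F ξ) 2 volume := by
    refine MemLp.of_le_mul (c := c) (Lp.memLp F) (hm.mul (Lp.aestronglyMeasurable F)) ?_
    refine Filter.Eventually.of_forall fun ξ => ?_
    rw [norm_mul]
    exact mul_le_mul_of_nonneg_right (hc ξ) (norm_nonneg _)
  refine Lp.norm_le_mul_norm_of_ae_le_mul ?_
  filter_upwards [coeFn_toL2 hmem] with ξ hξ
  rw [hξ, norm_mul]
  exact mul_le_mul_of_nonneg_right (hc ξ) (norm_nonneg _)

theorem norm_sinOp_le {d : ℕ} (s : ℝ) (F : Lp ℂ 2 (volume : Measure (Space d))) :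
    ‖sinOp s F‖ ≤ |s| * ‖F‖ := by
  rw [sinOp, norm_fourierInv_eq]
  refine (norm_toL2_mul_le (Measurable.aestronglyMeasurable (by fun_prop)) (c := |s|) (fun ξ => ?_)
    (𝓕 F)).trans (by rw [Lp.norm_fourier_eq])
  rw [Complex.norm_real, Real.norm_eq_abs]
  exact abs_sin_mul_div_le _ _

theorem sinOp_sub {d : ℕ} (s : ℝ) (F F' : Lp ℂ 2 (volume : Measure (Space d))) :
    sinOp s (F - F') = sinOp s F - sinOp s F' := by
  simp only [sinOp]
  rw [← fourierInv_sub_Lp, ← toL2_sub (memLp_sinMul s _) (memLp_sinMul s _)]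
  congr 1
  refine toL2_congr ?_
  rw [fourier_sub_Lp]
  filter_upwards [Lp.coeFn_sub (𝓕 F) (𝓕 F')] with ξ hξ
  rw [hξ]
  simp [mul_sub]

theorem norm_sinOp_sub_sinOp_le {d : ℕ} (s t : ℝ) (F : Lp ℂ 2 (volume : Measure (Space d))) :
    ‖sinOp s F - sinOp t F‖ ≤ |s - t| * ‖F‖ := by
  simp only [sinOp]
  rw [← fourierInv_sub_Lp, norm_fourierInv_eq,
    ← toL2_sub (memLp_sinMul s _) (memLp_sinMul t _)]
  refine (le_of_eq ?_).trans ((norm_toL2_mul_le (c := |s - t|) (m := fun ξ : Space d =>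
    ((Real.sin (s * (2 * Real.pi * ‖ξ‖)) / (2 * Real.pi * ‖ξ‖)
      - Real.sin (t * (2 * Real.pi * ‖ξ‖)) / (2 * Real.pi * ‖ξ‖) : ℝ) : ℂ))
    (Measurable.aestronglyMeasurable (by fun_prop)) (fun ξ => ?_)
    (𝓕 F)).trans (by rw [Lp.norm_fourier_eq]))
  · congr 2
    ext ξ
    simp only [Pi.sub_apply]
    push_cast
    ring
  · rw [Complex.norm_real, Real.norm_eq_abs]
    exact abs_sin_div_sub_sin_div_le _ _ _

theorem sinOp_neg {d : ℕ} (s : ℝ) (F : Lp ℂ 2 (volume : Measure (Space d))) :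
    sinOp (-s) F = -sinOp s F := by
  have h0 : sinOp 0 F = 0 := by
    have := norm_sinOp_le 0 F
    simpa using this
  have h1 : ∀ ξ : Space d, ((Real.sin (-s * (2 * Real.pi * ‖ξ‖)) / (2 * Real.pi * ‖ξ‖) : ℝ) : ℂ)
      * (𝓕 F) ξ = 0 - ((Real.sin (s * (2 * Real.pi * ‖ξ‖)) / (2 * Real.pi * ‖ξ‖) : ℝ) : ℂ)
      * (𝓕 F) ξ := by
    intro ξ
    rw [neg_mul, Real.sin_neg]
    push_cast; ring
  have h2 : sinOp (-s) F = 𝓕⁻ (toL2 ((0 : Space d → ℂ) - fun ξ =>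
      ((Real.sin (s * (2 * Real.pi * ‖ξ‖)) / (2 * Real.pi * ‖ξ‖) : ℝ) : ℂ) * (𝓕 F) ξ)) := by
    rw [sinOp]
    congr 2
    ext ξ
    exact h1 ξ
  have hz : MemLp (0 : Space d → ℂ) 2 volume := MemLp.zero
  have h3 : toL2 (0 : Space d → ℂ) = 0 := by
    rw [toL2_of_memLp hz]
    rfl
  rw [h2, toL2_sub hz (memLp_sinMul s _), h3, zero_sub, FourierTransform.fourierInv_neg,
    sinOp]

theorem continuous_sinOp {d : ℕ} :
    Continuous fun p : ℝ × Lp ℂ 2 (volume : Measure (Space d)) => sinOp p.1 p.2 := by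
  rw [continuous_iff_continuousAt]
  rintro ⟨s, F⟩
  rw [ContinuousAt, tendsto_iff_norm_sub_tendsto_zero]
  have h : ∀ p : ℝ × Lp ℂ 2 (volume : Measure (Space d)), ‖sinOp p.1 p.2 - sinOp s F‖
      ≤ |p.1| * ‖p.2 - F‖ + |p.1 - s| * ‖F‖ := by
    intro p
    have : sinOp p.1 p.2 - sinOp s F
        = sinOp p.1 (p.2 - F) + (sinOp p.1 F - sinOp s F) := by
      rw [sinOp_sub]; abel
    rw [this]
    exact (norm_add_le _ _).trans
      (add_le_add (norm_sinOp_le _ _) (norm_sinOp_sub_sinOp_le _ _ _))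
  refine squeeze_zero (fun p => norm_nonneg _) h ?_
  have hc : Continuous fun p : ℝ × Lp ℂ 2 (volume : Measure (Space d)) =>
      |p.1| * ‖p.2 - F‖ + |p.1 - s| * ‖F‖ := by fun_prop
  have := hc.tendsto (s, F)
  simpa using this

/-- The Duhamel integral of a radial source, at points with `|x| > |t|`. -/
noncomputable def radialDuhamel (k : ℕ) (G : ℝ → Space (2 * k + 1) → ℝ) (t : ℝ)
    (x : Space (2 * k + 1)) : ℝ :=
  ∫ τ in Ι 0 t, radialProp k |t - τ| (G τ) x

theorem measurable_radialDuhamel {k : ℕ} (hk : 1 ≤ k) {G : ℝ → Space (2 * k + 1) → ℝ}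
    (hG : Measurable (Function.uncurry G)) :
    Measurable fun p : ℝ × Space (2 * k + 1) => radialDuhamel k G p.1 p.2 := by
  have h1 : Measurable fun q : (ℝ × ℝ) × Space (2 * k + 1) =>
      radialProp k |q.1.1 - q.1.2| (G q.1.2) q.2 :=
    measurable_radialProp hk (Ω := ℝ × ℝ) (σ := fun q => |q.1 - q.2|) (by fun_prop)
      (f := fun q => G q.2) (hG.comp (by fun_prop : Measurable fun p : (ℝ × ℝ) ×
        Space (2 * k + 1) => (p.1.2, p.2)))
  have hset : MeasurableSet {q : (ℝ × Space (2 * k + 1)) × ℝ | q.2 ∈ Ι 0 q.1.1} :=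
    (measurableSet_lt (f := fun q : (ℝ × Space (2 * k + 1)) × ℝ => min 0 q.1.1)
      (g := fun q => q.2) (by fun_prop) (by fun_prop)).inter
    (measurableSet_le (f := fun q : (ℝ × Space (2 * k + 1)) × ℝ => q.2)
      (g := fun q => max 0 q.1.1) (by fun_prop) (by fun_prop))
  have h0 : Measurable fun q : (ℝ × Space (2 * k + 1)) × ℝ =>
      radialProp k |q.1.1 - q.2| (G q.2) q.1.2 :=
    h1.comp (g := fun q : (ℝ × ℝ) × Space (2 * k + 1) =>
      radialProp k |q.1.1 - q.1.2| (G q.1.2) q.2)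
      (f := fun q : (ℝ × Space (2 * k + 1)) × ℝ => ((q.1.1, q.2), q.1.2)) (by fun_prop)
  have h2 := h0.indicator hset
  have h3 := (h2.stronglyMeasurable.integral_prod_right' (ν := (volume : Measure ℝ))).measurable
  convert h3 using 2 with p
  rw [radialDuhamel, ← integral_indicator measurableSet_uIoc]
  rfl

theorem lintegral_ball_le_eLpNorm {d : ℕ} (M : ℝ) {f : Space d → ℝ} (hf : Measurable f) :
    ∫⁻ y in Metric.ball 0 M, ‖f y‖ₑ
      ≤ volume (Metric.ball (0 : Space d) M) ^ (1 / 2 : ℝ) * eLpNorm f 2 volume := by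
  have h := eLpNorm_le_eLpNorm_mul_rpow_measure_univ (μ := volume.restrict (Metric.ball (0 : Space d) M))
    (p := 1) (q := 2) one_le_two hf.aestronglyMeasurable
  rw [eLpNorm_one_eq_lintegral_enorm] at h
  refine h.trans ?_
  rw [mul_comm]
  refine mul_le_mul' (le_of_eq ?_) (eLpNorm_mono_measure f Measure.restrict_le_self)
  rw [Measure.restrict_apply_univ]
  norm_num

theorem exists_radialProp_enorm_le {k : ℕ} (hk : 1 ≤ k) {S s₀ : ℝ} (hS : 0 ≤ S) (hs0 : S < s₀)
    (M : ℝ) : ∃ C : ℝ≥0∞, C ≠ ⊤ ∧ ∀ (s : ℝ) (f : Space (2 * k + 1) → ℝ) (x : Space (2 * k + 1)),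
      Measurable f → 0 < s → s ≤ S → s₀ ≤ ‖x‖ → ‖x‖ ≤ M →
      ‖radialProp k s f x‖ₑ ≤ C * eLpNorm f 2 volume := by
  obtain ⟨C, hC0, hC⟩ := exists_radialProp_bound hk
  refine ⟨ENNReal.ofReal (C / s₀ ^ k) * (ENNReal.ofReal (1 / (s₀ - S) ^ k) *
    volume (Metric.ball (0 : Space (2 * k + 1)) (M + S)) ^ (1 / 2 : ℝ)), ?_, ?_⟩
  · refine ENNReal.mul_ne_top ENNReal.ofReal_ne_top (ENNReal.mul_ne_top ENNReal.ofReal_ne_top ?_)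
    exact ENNReal.rpow_ne_top_of_nonneg (by norm_num) measure_ball_lt_top.ne
  · intro s f x hf hs hsS hx hxM
    have h0 : 0 < s₀ := hS.trans_lt hs0
    refine (hC s f x hs (by linarith)).trans ?_
    rw [mul_assoc, mul_assoc]
    refine mul_le_mul' ?_ ?_
    · refine ENNReal.ofReal_le_ofReal ?_
      gcongr
    · refine (lintegral_kernel_le (s₀ := s₀) (M := M + S) (by linarith) hx (by linarith) f).trans ?_
      refine mul_le_mul' (ENNReal.ofReal_le_ofReal ?_) (lintegral_ball_le_eLpNorm _ hf)
      have : 0 < s₀ - S := by linarith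
      gcongr

theorem intervalIntegral_sinOp_eq {d : ℕ} (f : ℝ → Lp ℂ 2 (volume : Measure (Space d))) (t : ℝ) :
    ∫ τ in (0 : ℝ)..t, sinOp (t - τ) (f τ) = ∫ τ in Ι 0 t, sinOp |t - τ| (f τ) := by
  rcases le_total 0 t with h | h
  · rw [intervalIntegral.integral_of_le h, uIoc_of_le h]
    refine setIntegral_congr_fun measurableSet_Ioc fun τ hτ => ?_
    beta_reduce
    rw [abs_of_nonneg (by linarith [hτ.2])]
  · rw [intervalIntegral.integral_of_ge h, uIoc_of_ge h, ← integral_neg]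
    refine setIntegral_congr_fun measurableSet_Ioc fun τ hτ => ?_
    beta_reduce
    rw [abs_of_nonpos (by linarith [hτ.1]), sinOp_neg]

theorem measurable_eLpNorm_two {d : ℕ} {G : ℝ → Space d → ℝ}
    (hG : Measurable (Function.uncurry G)) : Measurable fun τ => eLpNorm (G τ) 2 volume := by
  have h : ∀ τ, eLpNorm (G τ) 2 volume = (∫⁻ y, ‖G τ y‖ₑ ^ (2 : ℝ)) ^ (1 / 2 : ℝ) := fun τ => by
    rw [eLpNorm_eq_lintegral_rpow_enorm_toReal (p := 2) two_ne_zero ENNReal.ofNat_ne_top,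
      ENNReal.toReal_ofNat]
  simp_rw [h]
  have h1 : Measurable fun z : ℝ × Space d => ‖Function.uncurry G z‖ₑ ^ (2 : ℝ) :=
    hG.enorm.pow_const _
  exact (h1.lintegral_prod_right' (ν := volume)).pow_const _

theorem stronglyMeasurable_comp_prodMk {E : Type*} [TopologicalSpace E] {Φ : ℝ × E → E}
    (hΦ : Continuous Φ) {a : ℝ → ℝ} (ha : StronglyMeasurable a) {b : ℝ → E}
    (hb : StronglyMeasurable b) : StronglyMeasurable fun τ => Φ (a τ, b τ) :=
  hΦ.comp_stronglyMeasurable (ha.prodMk hb)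

theorem stronglyMeasurable_sinOp {d : ℕ} (t : ℝ) {G : ℝ → Space d → ℂ}
    (hG : Measurable (Function.uncurry G)) :
    StronglyMeasurable fun τ => sinOp |t - τ| (toL2 (G τ)) :=
  stronglyMeasurable_comp_prodMk (E := Lp ℂ 2 (volume : Measure (Space d)))
    (Φ := fun p => sinOp p.1 p.2) continuous_sinOp (a := fun τ : ℝ => |t - τ|)
    (Continuous.stronglyMeasurable (by fun_prop)) (b := fun τ => toL2 (G τ))
    (stronglyMeasurable_toL2 hG)

/-- Outside the light cone, the Duhamel integral of a radial source is given by the explicit kernel. -/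
theorem duhamel_ae_eq {k : ℕ} (hk : 1 ≤ k) {G : ℝ → Space (2 * k + 1) → ℝ}
    (hG : Measurable (Function.uncurry G)) {t : ℝ}
    (hr : ∀ᵐ τ ∂(volume.restrict (Ι 0 t)), IsRadialOn univ (G τ))
    (hint : ∫⁻ τ in Ι 0 t, eLpNorm (G τ) 2 volume < ⊤) :
    ∀ᵐ x, |t| < ‖x‖ → duhamel G t x = (radialDuhamel k G t x : ℂ) := by
  have hGt : ∀ τ, Measurable (G τ) := fun τ => hG.comp measurable_prodMk_left
  have hGc : Measurable (Function.uncurry fun τ y => (G τ y : ℂ)) :=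
    Complex.measurable_ofReal.comp hG
  have hL2m := measurable_eLpNorm_two hG
  have hmem : ∀ᵐ τ ∂(volume.restrict (Ι 0 t)), MemLp (G τ) 2 volume := by
    filter_upwards [ae_lt_top hL2m hint.ne] with τ hτ
    exact ⟨(hGt τ).aestronglyMeasurable, hτ⟩
  have hτt : ∀ᵐ τ ∂(volume.restrict (Ι 0 t)), 0 < |t - τ| ∧ |t - τ| ≤ |t| := by
    filter_upwards [ae_restrict_mem measurableSet_uIoc,
      ae_restrict_of_ae (Measure.ae_ne volume t)] with τ hτ hne
    refine ⟨abs_pos.mpr (sub_ne_zero.mpr (Ne.symm hne)), ?_⟩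
    rcases le_total 0 t with h | h
    · rw [uIoc_of_le h] at hτ
      rw [abs_of_nonneg (by linarith [hτ.2]), abs_of_nonneg h]
      linarith [hτ.1]
    · rw [uIoc_of_ge h] at hτ
      rw [abs_of_nonpos (by linarith [hτ.1]), abs_of_nonpos h]
      linarith [hτ.2]
  -- the `L²` valued integrand
  have hinteg : Integrable (fun τ => sinOp |t - τ| (toL2 fun y => (G τ y : ℂ)))
      (volume.restrict (Ι 0 t)) := by
    refine ⟨?_, ?_⟩
    · exact (stronglyMeasurable_sinOp t hGc).aestronglyMeasurable
    · refine lt_of_le_of_lt (lintegral_mono_ae (g := fun τ => ‖t‖ₑ * eLpNorm (G τ) 2 volume) ?_) ?_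
      · filter_upwards [hτt, hmem] with τ hτ hm
        have h1 := norm_sinOp_le |t - τ| (toL2 fun y => (G τ y : ℂ))
        have h2 : ‖toL2 fun y => (G τ y : ℂ)‖ₑ = eLpNorm (G τ) 2 volume := by
          rw [norm_toL2 (memLp_ofReal hm)]
          exact eLpNorm_congr_norm_ae (Filter.Eventually.of_forall fun y => by simp)
        rw [← h2]
        rw [← ofReal_norm, ← ofReal_norm, ← ofReal_norm, ← ENNReal.ofReal_mul (norm_nonneg _)]
        refine ENNReal.ofReal_le_ofReal (h1.trans ?_)
        rw [abs_abs]
        exact mul_le_mul_of_nonneg_right hτ.2 (norm_nonneg _)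
      · rw [lintegral_const_mul _ hL2m]
        exact ENNReal.mul_lt_top (by simp) hint
  have hradm : Measurable fun p : ℝ × Space (2 * k + 1) => radialProp k |t - p.1| (G p.1) p.2 :=
    measurable_radialProp hk (σ := fun τ => |t - τ|) (by fun_prop) hG
  -- pair both sides with a test function and exchange the integrals in `τ` and in `x`
  refine ae_eq_on_of_test (U := {x | |t| < ‖x‖}) (isOpen_lt continuous_const continuous_norm)
    ?_ ?_ ?_
  · exact (((Lp.memLp (duhamel G t)).locallyIntegrable one_le_two).locallyIntegrableOn _)
  · refine locallyIntegrableOn_of_bound ?_ ?_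
    · exact (Complex.measurable_ofReal.comp ((measurable_radialDuhamel hk hG).comp
        measurable_prodMk_left)).aestronglyMeasurable
    · intro s₀ M hs0
      obtain ⟨C, hCtop, hC⟩ := exists_radialProp_enorm_le hk (abs_nonneg t) hs0 M
      refine ⟨(C * ∫⁻ τ in Ι 0 t, eLpNorm (G τ) 2 volume).toReal, fun x hx hxM => ?_⟩
      rw [Complex.norm_real, ← toReal_enorm]
      refine ENNReal.toReal_mono (ENNReal.mul_ne_top hCtop hint.ne) ?_
      rw [radialDuhamel, ← lintegral_const_mul _ hL2m]
      refine (enorm_integral_le_lintegral_enorm _).trans (lintegral_mono_ae ?_)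
      filter_upwards [hτt] with τ hτ
      exact hC _ _ _ (hGt τ) hτ.1 hτ.2 hx hxM
  · intro ψ hψ hc hsub
    obtain ⟨s₀, hs0, hsupp⟩ := exists_lt_norm_of_tsupport hc hsub
    obtain ⟨M, hM⟩ := hc.isCompact.isBounded.exists_norm_le
    obtain ⟨C, hCtop, hC⟩ := exists_radialProp_enorm_le hk (abs_nonneg t) hs0 M
    have hψi : Integrable ψ := hψ.continuous.integrable_of_hasCompactSupport hc
    set ψL : Lp ℂ 2 (volume : Measure (Space (2 * k + 1))) := (testFn hψ hc).toLp 2 volume with hψL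
    have hpair : ∀ F : Lp ℂ 2 (volume : Measure (Space (2 * k + 1))),
        innerSL ℂ ψL F = ∫ x, F x * ψ x := by
      intro F
      rw [innerSL_apply_apply, L2.inner_def]
      refine integral_congr_ae ?_
      filter_upwards [(testFn hψ hc).coeFn_toLp 2 volume] with x hx
      rw [hψL, hx]
      simp
    have hprod : Integrable (fun p : ℝ × Space (2 * k + 1) =>
        ((radialProp k |t - p.1| (G p.1) p.2 * ψ p.2 : ℝ) : ℂ))
        ((volume.restrict (Ι 0 t)).prod volume) := by
      have hmeas : Measurable fun p : ℝ × Space (2 * k + 1) =>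
          ((radialProp k |t - p.1| (G p.1) p.2 * ψ p.2 : ℝ) : ℂ) :=
        Complex.measurable_ofReal.comp (hradm.mul (hψ.continuous.measurable.comp measurable_snd))
      refine ⟨hmeas.aestronglyMeasurable, ?_⟩
      rw [HasFiniteIntegral, lintegral_prod _ hmeas.enorm.aemeasurable]
      refine lt_of_le_of_lt (lintegral_mono_ae (g := fun τ => (C * ∫⁻ x, ‖ψ x‖ₑ) *
        eLpNorm (G τ) 2 volume) ?_) ?_
      · filter_upwards [hτt] with τ hτ
        rw [mul_right_comm, ← lintegral_const_mul _ hψ.continuous.measurable.enorm]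
        refine lintegral_mono fun x => ?_
        by_cases hx : ψ x = 0
        · simp [hx]
        · simp only [Complex.ofReal_mul, enorm_mul]
          have e : ∀ a : ℝ, ‖(a : ℂ)‖ₑ = ‖a‖ₑ := fun a => by
            rw [← ofReal_norm, Complex.norm_real, ofReal_norm]
          rw [e, e]
          gcongr
          exact hC _ _ _ (hGt τ) hτ.1 hτ.2 (hsupp x hx).le (hM x (subset_tsupport _ hx))
      · rw [lintegral_const_mul _ hL2m]
        exact ENNReal.mul_lt_top (ENNReal.mul_lt_top hCtop.lt_top hψi.2) hint
    rw [duhamel, intervalIntegral_sinOp_eq (fun τ => toL2 fun y => (G τ y : ℂ)), ← hpair,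
      ← ContinuousLinearMap.integral_comp_comm _ hinteg]
    have h1 : ∫ τ in Ι 0 t, innerSL ℂ ψL (sinOp |t - τ| (toL2 fun y => (G τ y : ℂ)))
        = ∫ τ in Ι 0 t, ∫ x, ((radialProp k |t - τ| (G τ) x * ψ x : ℝ) : ℂ) := by
      refine integral_congr_ae ?_
      filter_upwards [hτt, hmem, hr] with τ hτ hm hrτ
      rw [hpair]
      refine integral_congr_ae ?_
      filter_upwards [sinOp_ae_eq hk (hGt τ) hm hrτ hτ.1] with x hx
      by_cases hx0 : ψ x = 0
      · simp [hx0]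
      · rw [hx (by linarith [hsupp x hx0, hτ.2])]
        push_cast; rfl
    rw [h1, integral_integral_swap hprod]
    congr 1
    ext x
    rw [integral_complex_ofReal, integral_mul_const, radialDuhamel]
    push_cast; rfl

/-! ### The free evolution of `u₀` -/

theorem MemHDotOne.hat_spec {d : ℕ} {f : Space d → ℝ} (hf : MemHDotOne f) :
    HasFourierTransform (fun x => (f x : ℂ)) (hatHDotOne f) ∧
      MemLp (fun ξ => (‖ξ‖ : ℂ) * hatHDotOne f ξ) 2 volume := by
  rw [hatHDotOne, dif_pos hf]
  exact hf.choose_spec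

theorem abs_cos_sub_cos_le (s t κ : ℝ) : |Real.cos (s * κ) - Real.cos (t * κ)| ≤ |s - t| * |κ| := by
  have h := Real.abs_cos_sub_cos_le (s * κ) (t * κ)
  rwa [← sub_mul, abs_mul] at h

theorem HasFourierTransform.aestronglyMeasurable_right {d : ℕ} {u g : Space d → ℂ}
    (h : HasFourierTransform u g) : AEStronglyMeasurable g volume :=
  (locallyIntegrable_of_schwartz fun φ => (h φ).2.1).aestronglyMeasurable

/-- Multiplication by a bounded multiple of `|ξ|` maps the Fourier transform of an element of `Ḣ¹`
into `L²`. -/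
theorem memLp_mul_hat {d : ℕ} {f : Space d → ℝ} (hf : MemHDotOne f) {m : Space d → ℂ}
    (hm : AEStronglyMeasurable m volume) {c : ℝ} (hc : ∀ ξ, ‖m ξ‖ ≤ c * ‖ξ‖) :
    MemLp (fun ξ => m ξ * hatHDotOne f ξ) 2 volume ∧
      ‖toL2 fun ξ => m ξ * hatHDotOne f ξ‖ ≤ c * ‖toL2 fun ξ => (‖ξ‖ : ℂ) * hatHDotOne f ξ‖ := by
  obtain ⟨h1, h2⟩ := hf.hat_spec
  have hle : ∀ ξ, ‖m ξ * hatHDotOne f ξ‖ ≤ c * ‖(‖ξ‖ : ℂ) * hatHDotOne f ξ‖ := by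
    intro ξ
    rw [norm_mul, norm_mul, Complex.norm_real, norm_norm, ← mul_assoc]
    exact mul_le_mul_of_nonneg_right (hc ξ) (norm_nonneg _)
  have hmem : MemLp (fun ξ => m ξ * hatHDotOne f ξ) 2 volume :=
    MemLp.of_le_mul h2 (hm.mul h1.aestronglyMeasurable_right)
      (Filter.Eventually.of_forall hle)
  refine ⟨hmem, Lp.norm_le_mul_norm_of_ae_le_mul ?_⟩
  filter_upwards [coeFn_toL2 hmem, coeFn_toL2 h2] with ξ e1 e2
  rw [e1, e2]
  exact hle ξ

theorem memLp_cosMul {d : ℕ} {f : Space d → ℝ} (hf : MemHDotOne f) (s : ℝ) :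
    MemLp (fun ξ : Space d => ((Real.cos (s * (2 * Real.pi * ‖ξ‖)) - 1 : ℝ) : ℂ) * hatHDotOne f ξ)
      2 volume := by
  refine (memLp_mul_hat hf (c := |s| * (2 * Real.pi))
    (Measurable.aestronglyMeasurable (by fun_prop)) fun ξ => ?_).1
  have h := abs_cos_sub_cos_le s 0 (2 * Real.pi * ‖ξ‖)
  rw [zero_mul, Real.cos_zero, sub_zero, abs_of_nonneg (by positivity : 0 ≤ 2 * Real.pi * ‖ξ‖)] at h
  rw [Complex.norm_real, Real.norm_eq_abs]
  linarith

theorem norm_cosSubOne_sub_le {d : ℕ} {f : Space d → ℝ} (hf : MemHDotOne f) (s t : ℝ) :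
    ‖cosSubOne s f - cosSubOne t f‖
      ≤ |s - t| * (2 * Real.pi * ‖toL2 fun ξ => (‖ξ‖ : ℂ) * hatHDotOne f ξ‖) := by
  rw [cosSubOne, cosSubOne, ← fourierInv_sub_Lp, norm_fourierInv_eq,
    ← toL2_sub (memLp_cosMul hf s) (memLp_cosMul hf t)]
  have h := (memLp_mul_hat hf (c := |s - t| * (2 * Real.pi)) (m := fun ξ : Space d =>
    ((Real.cos (s * (2 * Real.pi * ‖ξ‖)) - Real.cos (t * (2 * Real.pi * ‖ξ‖)) : ℝ) : ℂ))
    (Measurable.aestronglyMeasurable (by fun_prop)) fun ξ => ?_).2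
  · refine (le_of_eq ?_).trans (h.trans (le_of_eq (by ring)))
    congr 2
    ext ξ
    simp only [Pi.sub_apply]
    push_cast
    ring
  · have h := abs_cos_sub_cos_le s t (2 * Real.pi * ‖ξ‖)
    rw [abs_of_nonneg (by positivity : 0 ≤ 2 * Real.pi * ‖ξ‖)] at h
    rw [Complex.norm_real, Real.norm_eq_abs]
    linarith

theorem continuous_cosSubOne {d : ℕ} {f : Space d → ℝ} (hf : MemHDotOne f) :
    Continuous fun s => cosSubOne s f := by
  refine (LipschitzWith.of_dist_le' (K := 2 * Real.pi *
    ‖toL2 fun ξ => (‖ξ‖ : ℂ) * hatHDotOne f ξ‖) fun s t => ?_).continuous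
  rw [dist_eq_norm, Real.dist_eq, mul_comm]
  exact norm_cosSubOne_sub_le hf s t

/-- The cosine is even, so that the sign of the time does not matter. -/
theorem cosSubOne_abs {d : ℕ} (s : ℝ) (f : Space d → ℝ) : cosSubOne |s| f = cosSubOne s f := by
  rcases abs_choice s with h | h <;> rw [h]
  simp only [cosSubOne, neg_mul, Real.cos_neg]

theorem integral_cosSubOne_mul {d : ℕ} {f : Space d → ℝ} (hf : MemHDotOne f) (s : ℝ)
    (ψ : 𝓢(Space d, ℂ)) :
    ∫ x, cosSubOne s f x * ψ x = ∫ ξ, (hatHDotOne f ξ * (𝓕⁻ ψ) ξ) *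
      ((Real.cos (s * (2 * Real.pi * ‖ξ‖)) - 1 : ℝ) : ℂ) := by
  rw [cosSubOne, integral_fourierInv_mul]
  refine integral_congr_ae ?_
  filter_upwards [coeFn_toL2 (memLp_cosMul hf s)] with ξ hξ
  rw [hξ]; ring

theorem innerSL_testFn {d : ℕ} {ψ : Space d → ℝ} (hψ : ContDiff ℝ (⊤ : ℕ∞) ψ)
    (hc : HasCompactSupport ψ) (F : Lp ℂ 2 (volume : Measure (Space d))) :
    innerSL ℂ ((testFn hψ hc).toLp 2 volume) F = ∫ x, F x * (testFn hψ hc) x := by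
  rw [innerSL_apply_apply, L2.inner_def]
  refine integral_congr_ae ?_
  filter_upwards [(testFn hψ hc).coeFn_toLp 2 volume] with x hx
  rw [hx]
  simp [testFn_apply]

theorem integral_cos_sub_one {s s' κ : ℝ} (hκ : κ ≠ 0) :
    ∫ σ in s..s', (Real.cos (σ * κ) - 1) = Real.sin (s' * κ) / κ - Real.sin (s * κ) / κ - (s' - s) := by
  rw [intervalIntegral.integral_sub (Continuous.intervalIntegrable (by fun_prop) _ _)
    (Continuous.intervalIntegrable (by fun_prop) _ _)]
  rw [intervalIntegral.integral_comp_mul_right (fun x => Real.cos x) hκ]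
  simp
  field_simp

/-- The time integral of `cos(σ√(-Δ)) u₀ - u₀`, tested against a function. -/
theorem inner_integral_cosSubOne {d : ℕ} (hd : 1 ≤ d) {f : Space d → ℝ} (hf : MemHDotOne f)
    {s s' : ℝ} (hs : s ≤ s') {ψ : Space d → ℝ} (hψ : ContDiff ℝ (⊤ : ℕ∞) ψ)
    (hc : HasCompactSupport ψ) :
    ∫ x, (∫ σ in s..s', cosSubOne σ f : Lp ℂ 2 (volume : Measure (Space d))) x * testFn hψ hc x
      = ∫ ξ, (hatHDotOne f ξ * (𝓕⁻ (testFn hψ hc)) ξ) *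
        ((Real.sin (s' * (2 * Real.pi * ‖ξ‖)) / (2 * Real.pi * ‖ξ‖)
          - Real.sin (s * (2 * Real.pi * ‖ξ‖)) / (2 * Real.pi * ‖ξ‖) - (s' - s) : ℝ) : ℂ) := by
  have : Nonempty (Fin d) := ⟨⟨0, hd⟩⟩
  rw [← innerSL_testFn hψ hc, ← ContinuousLinearMap.intervalIntegral_comp_comm _
    ((continuous_cosSubOne hf).intervalIntegrable _ _)]
  simp_rw [innerSL_testFn, integral_cosSubOne_mul hf]
  have hG : Integrable fun ξ => hatHDotOne f ξ * (𝓕⁻ (testFn hψ hc)) ξ := (hf.hat_spec.1 _).2.1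
  rw [intervalIntegral.integral_of_le hs, integral_integral_swap]
  · refine integral_congr_ae ?_
    have h0 : ∀ᵐ ξ : Space d, ξ ≠ 0 := Measure.ae_ne volume 0
    filter_upwards [h0] with ξ hξ
    have hκ : 2 * Real.pi * ‖ξ‖ ≠ 0 := by
      have := norm_pos_iff.mpr hξ
      positivity
    rw [integral_const_mul, integral_complex_ofReal, ← intervalIntegral.integral_of_le hs,
      integral_cos_sub_one hκ]
  · have hG2 : Integrable (fun p : ℝ × Space d => hatHDotOne f p.2 * (𝓕⁻ (testFn hψ hc)) p.2)
        ((volume.restrict (Ioc s s')).prod volume) := hG.comp_snd _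
    refine hG2.mul_bdd (c := 2) (Measurable.aestronglyMeasurable (by fun_prop))
      (Filter.Eventually.of_forall fun p => ?_)
    rw [Complex.norm_real, Real.norm_eq_abs, abs_le]
    constructor <;>
      linarith [Real.cos_le_one (p.1 * (2 * Real.pi * ‖p.2‖)),
        Real.neg_one_le_cos (p.1 * (2 * Real.pi * ‖p.2‖))]

theorem radialProp_congr {k : ℕ} {f g : Space (2 * k + 1) → ℝ} (h : f =ᵐ[volume] g) (s : ℝ)
    (x : Space (2 * k + 1)) : radialProp k s f x = radialProp k s g x := by
  rw [radialProp, radialProp]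
  congr 1
  refine integral_congr_ae ?_
  filter_upwards [h] with y hy
  rw [hy]

theorem measurable_comp_unit_prodMk {α β : Type*} [MeasurableSpace α] [MeasurableSpace β]
    {F : α → β} (h : Measurable fun p : Unit × α => F p.2) : Measurable F :=
  h.comp (measurable_prodMk_left (x := ()))

theorem measurable_radialProp_right {k : ℕ} (hk : 1 ≤ k) (s : ℝ) {f : Space (2 * k + 1) → ℝ}
    (hf : Measurable f) : Measurable fun x => radialProp k s f x := by
  have h : Measurable fun p : Unit × Space (2 * k + 1) => radialProp k s f p.2 :=
    measurable_radialProp (Ω := Unit) hk (σ := fun _ => s) measurable_const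
      (f := fun _ => f) (hf.comp measurable_snd)
  exact measurable_comp_unit_prodMk h

theorem lintegral_ball_lt_top {d : ℕ} {f : Space d → ℝ} (hf : LocallyIntegrable f) (M : ℝ) :
    ∫⁻ y in Metric.ball 0 M, ‖f y‖ₑ < ⊤ :=
  ((hf.integrableOn_isCompact (isCompact_closedBall 0 M)).mono_set
    Metric.ball_subset_closedBall).2

/-- The integral of `cos(σ√(-Δ)) u₀` over `[s, s']` is the increment of the explicit kernel for
`sin(σ√(-Δ)) / √(-Δ)`, outside the ball of radius `s'`. -/
theorem integral_cosSubOne_ae_eq {k : ℕ} (hk : 1 ≤ k) {f : Space (2 * k + 1) → ℝ}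
    (hf : MemHDotOne f) {h : ℝ → ℝ} (hm : Measurable h) (hfh : ∀ᵐ y, f y = h ‖y‖) {s s' : ℝ}
    (hs : 0 < s) (hs' : s ≤ s') :
    ∀ᵐ x, s' < ‖x‖ → (∫ σ in s..s', cosSubOne σ f : Lp ℂ 2 (volume : Measure _)) x
      = ((radialProp k s' f x - radialProp k s f x - (s' - s) * f x : ℝ) : ℂ) := by
  have hl := locallyIntegrable_of_hasFourierTransform hf.hat_spec.1
  have hrm : ∀ σ, AEStronglyMeasurable (fun x => (radialProp k σ f x : ℂ)) volume := by
    intro σ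
    have hn : Measurable fun y : Space (2 * k + 1) => h ‖y‖ := hm.comp measurable_norm
    have := (measurable_radialProp_right hk σ hn)
    simp_rw [radialProp_congr hfh σ]
    exact (Complex.measurable_ofReal.comp this).aestronglyMeasurable
  have hrl : ∀ σ, 0 < σ → σ ≤ s' → LocallyIntegrableOn (fun x => (radialProp k σ f x : ℂ))
      {x | s' < ‖x‖} := fun σ h0 hσ =>
    (locallyIntegrableOn_of_bound (hrm σ)
      (radialProp_bounded hk (lintegral_ball_lt_top hl) h0)).mono_set
      fun x (hx : s' < ‖x‖) => hσ.trans_lt hx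
  have hfl : LocallyIntegrable fun x => (f x : ℂ) := by
    intro x
    obtain ⟨u, hu, hi⟩ := hl x
    exact ⟨u, hu, hi.ofReal⟩
  refine ae_eq_on_of_test (U := {x | s' < ‖x‖}) (isOpen_lt continuous_const continuous_norm)
    ?_ ?_ ?_
  · exact (((Lp.memLp _).locallyIntegrable one_le_two).locallyIntegrableOn _)
  · have := ((hrl s' (hs.trans_le hs') le_rfl).sub (hrl s hs hs')).sub
      ((hfl.locallyIntegrableOn {x | s' < ‖x‖}).smul ((s' - s : ℝ) : ℂ))
    refine this.congr (Filter.Eventually.of_forall fun x => ?_)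
    simp
  · intro ψ hψ hc hsub
    obtain ⟨s₀, hs0, hsupp⟩ := exists_lt_norm_of_tsupport hc hsub
    have h1 := inner_integral_cosSubOne (by omega) hf hs' hψ hc
    simp only [testFn_apply] at h1
    rw [h1]
    have hG : Integrable fun ξ => hatHDotOne f ξ * (𝓕⁻ (testFn hψ hc)) ξ := (hf.hat_spec.1 _).2.1
    have hSi : ∀ σ, Integrable fun ξ => (hatHDotOne f ξ * (𝓕⁻ (testFn hψ hc)) ξ) *
        ((Real.sin (σ * (2 * Real.pi * ‖ξ‖)) / (2 * Real.pi * ‖ξ‖) : ℝ) : ℂ) := by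
      intro σ
      refine hG.mul_bdd (c := |σ|) (Measurable.aestronglyMeasurable (by fun_prop))
        (Filter.Eventually.of_forall fun ξ => ?_)
      rw [Complex.norm_real, Real.norm_eq_abs]
      exact abs_sin_mul_div_le _ _
    have h2 : ∀ σ, 0 < σ → σ ≤ s' → ∫ ξ, (hatHDotOne f ξ * (𝓕⁻ (testFn hψ hc)) ξ) *
        ((Real.sin (σ * (2 * Real.pi * ‖ξ‖)) / (2 * Real.pi * ‖ξ‖) : ℝ) : ℂ)
        = ∫ x, (radialProp k σ f x : ℂ) * ψ x := by
      intro σ h0 hσ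
      rw [integral_sin_mul_eq_radialProp hk hf.hat_spec.1 hm hfh hψ hc h0 (hσ.trans_lt hs0) hsupp,
        ← integral_complex_ofReal]
      congr 1
      ext x
      push_cast
      ring
    have h3 : ∫ ξ, hatHDotOne f ξ * (𝓕⁻ (testFn hψ hc)) ξ = ∫ x, (f x : ℂ) * ψ x := by
      rw [← hf.hat_spec.1.integral_mul]
      simp only [testFn_apply]
    have hmulψ : ∀ {A : Space (2 * k + 1) → ℂ}, LocallyIntegrableOn A {x | s' < ‖x‖} →
        Integrable fun x => A x * ψ x := by
      intro A hA
      have h2 := hA.integrableOn_compact_subset hsub hc.isCompact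
      have h3 : (fun x => A x * ψ x) = (tsupport ψ).indicator fun x => A x * ψ x := by
        ext x
        by_cases hx : x ∈ tsupport ψ
        · rw [indicator_of_mem hx]
        · rw [indicator_of_notMem hx, image_eq_zero_of_notMem_tsupport hx]; simp
      rw [h3, integrable_indicator_iff (isClosed_tsupport ψ).measurableSet]
      obtain ⟨C, hC⟩ := hψ.continuous.bounded_above_of_compact_support hc
      exact h2.mul_bdd (c := C) (Complex.continuous_ofReal.comp
        hψ.continuous).aestronglyMeasurable (Filter.Eventually.of_forall fun x => by
          simpa using hC x)
    -- split into the two sine multipliers and the constant term, and apply the explicit form of the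
    -- sine propagator to each of the former
    calc _ = ∫ ξ, ((hatHDotOne f ξ * (𝓕⁻ (testFn hψ hc)) ξ) *
          ((Real.sin (s' * (2 * Real.pi * ‖ξ‖)) / (2 * Real.pi * ‖ξ‖) : ℝ) : ℂ)
          - (hatHDotOne f ξ * (𝓕⁻ (testFn hψ hc)) ξ) *
          ((Real.sin (s * (2 * Real.pi * ‖ξ‖)) / (2 * Real.pi * ‖ξ‖) : ℝ) : ℂ)
          - ((s' - s : ℝ) : ℂ) * (hatHDotOne f ξ * (𝓕⁻ (testFn hψ hc)) ξ)) := by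
            congr 1; ext ξ; push_cast; ring
      _ = _ := by
        have hi : Integrable fun ξ => (hatHDotOne f ξ * (𝓕⁻ (testFn hψ hc)) ξ) *
          ((Real.sin (s' * (2 * Real.pi * ‖ξ‖)) / (2 * Real.pi * ‖ξ‖) : ℝ) : ℂ)
          - (hatHDotOne f ξ * (𝓕⁻ (testFn hψ hc)) ξ) *
          ((Real.sin (s * (2 * Real.pi * ‖ξ‖)) / (2 * Real.pi * ‖ξ‖) : ℝ) : ℂ) :=
            (hSi s').sub (hSi s)
        have hj : Integrable fun x => (radialProp k s' f x : ℂ) * ψ x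
            - (radialProp k s f x : ℂ) * ψ x :=
          (hmulψ (hrl s' (hs.trans_le hs') le_rfl)).sub (hmulψ (hrl s hs hs'))
        rw [integral_sub hi (hG.const_mul _), integral_sub (hSi s') (hSi s),
          h2 s' (hs.trans_le hs') le_rfl, h2 s hs hs', integral_const_mul, h3,
          ← integral_const_mul, ← integral_sub (hmulψ (hrl s' (hs.trans_le hs') le_rfl))
          (hmulψ (hrl s hs hs')), ← integral_sub hj
          ((hmulψ (hfl.locallyIntegrableOn _)).const_mul _)]
        congr 1; ext x; push_cast; ring

theorem norm_average_cosSubOne_le {d : ℕ} {f : Space d → ℝ} (hf : MemHDotOne f) (s : ℝ) {η : ℝ}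
    (hη : 0 < η) :
    ‖((η⁻¹ : ℝ) : ℂ) • (∫ σ in s..(s + η), cosSubOne σ f) - cosSubOne s f‖
      ≤ η * (2 * Real.pi * ‖toL2 fun ξ => (‖ξ‖ : ℂ) * hatHDotOne f ξ‖) := by
  set K := 2 * Real.pi * ‖toL2 fun ξ => (‖ξ‖ : ℂ) * hatHDotOne f ξ‖ with hK
  have hK0 : 0 ≤ K := by positivity
  have h1 : ((η⁻¹ : ℝ) : ℂ) • (∫ σ in s..(s + η), cosSubOne σ f) - cosSubOne s f
      = ((η⁻¹ : ℝ) : ℂ) • (∫ σ in s..(s + η), (cosSubOne σ f - cosSubOne s f)) := by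
    have h0 : ∫ _ in s..(s + η), cosSubOne s f = (η : ℂ) • cosSubOne s f := by
      rw [intervalIntegral.integral_const, add_sub_cancel_left]
      rfl
    rw [intervalIntegral.integral_sub ((continuous_cosSubOne hf).intervalIntegrable _ _)
      (by simp), h0, smul_sub, smul_smul, ← Complex.ofReal_mul, inv_mul_cancel₀ hη.ne',
      Complex.ofReal_one, one_smul]
  rw [h1, norm_smul, Complex.norm_real, Real.norm_eq_abs, abs_of_pos (inv_pos.mpr hη)]
  have h2 := intervalIntegral.norm_integral_le_of_norm_le_const (a := s) (b := s + η) (C := η * K)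
    (f := fun σ => cosSubOne σ f - cosSubOne s f) fun σ hσ => by
      rw [uIoc_of_le (by linarith)] at hσ
      refine (norm_cosSubOne_sub_le hf σ s).trans ?_
      refine mul_le_mul_of_nonneg_right ?_ hK0
      rw [abs_of_pos (by linarith [hσ.1])]
      linarith [hσ.2]
  rw [add_sub_cancel_left, abs_of_pos hη] at h2
  calc _ ≤ η⁻¹ * (η * K * η) := by gcongr
    _ = η * K := by field_simp

/-- Outside the light cone, `cos(s√(-Δ)) u₀` is the limit of difference quotients of the explicit
kernel for `sin(s√(-Δ)) / √(-Δ)`. -/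
theorem exists_tendsto_cosSubOne {k : ℕ} (hk : 1 ≤ k) {f : Space (2 * k + 1) → ℝ}
    (hf : MemHDotOne f) (hr : IsRadialOn univ f) {s : ℝ} (hs : 0 < s) :
    ∃ η : ℕ → ℝ, (∀ n, 0 < η n) ∧ Filter.Tendsto η Filter.atTop (nhds 0) ∧
      ∀ᵐ x, s < ‖x‖ → Filter.Tendsto (fun n =>
        (((radialProp k (s + η n) f x - radialProp k s f x) / η n : ℝ) : ℂ)) Filter.atTop
        (nhds ((f x : ℂ) + cosSubOne s f x)) := by
  have hl := locallyIntegrable_of_hasFourierTransform hf.hat_spec.1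
  obtain ⟨h, hm, hfh⟩ := hr.exists_profile (by omega) hl.aestronglyMeasurable
  -- the averages of `σ ↦ (cos(σ√(-Δ)) - 1) u₀` over `[s, s + η]` converge in `L²` as `η → 0`, hence
  -- almost everywhere along a subsequence, and they are difference quotients of the kernel
  set A : ℕ → Lp ℂ 2 (volume : Measure (Space (2 * k + 1))) := fun n =>
    ((((1 / ((n : ℝ) + 1))⁻¹ : ℝ)) : ℂ) • (∫ σ in s..(s + 1 / ((n : ℝ) + 1)), cosSubOne σ f) with hA
  have hη : ∀ n : ℕ, (0 : ℝ) < 1 / ((n : ℝ) + 1) := fun n => by positivity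
  have hlim : Filter.Tendsto A Filter.atTop (nhds (cosSubOne s f)) := by
    rw [tendsto_iff_norm_sub_tendsto_zero]
    refine squeeze_zero (fun _ => norm_nonneg _) (fun n => norm_average_cosSubOne_le hf s (hη n)) ?_
    have := (tendsto_one_div_add_atTop_nhds_zero_nat (𝕜 := ℝ)).mul_const
      (2 * Real.pi * ‖toL2 fun ξ => (‖ξ‖ : ℂ) * hatHDotOne f ξ‖)
    simpa using this
  obtain ⟨ns, hns, hae⟩ := (tendstoInMeasure_of_tendsto_Lp hlim).exists_seq_tendsto_ae
  refine ⟨fun n => 1 / ((ns n : ℝ) + 1), fun n => hη _,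
    tendsto_one_div_add_atTop_nhds_zero_nat.comp hns.tendsto_atTop, ?_⟩
  have h1 : ∀ᵐ x : Space (2 * k + 1), ∀ n : ℕ, s + 1 / ((n : ℝ) + 1) < ‖x‖ →
      A n x = (((radialProp k (s + 1 / ((n : ℝ) + 1)) f x - radialProp k s f x)
        / (1 / ((n : ℝ) + 1)) - f x : ℝ) : ℂ) := by
    rw [ae_all_iff]
    intro n
    filter_upwards [integral_cosSubOne_ae_eq hk hf hm hfh hs
      (le_add_of_nonneg_right (hη n).le), Lp.coeFn_smul ((((1 / ((n : ℝ) + 1))⁻¹ : ℝ)) : ℂ)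
      (∫ σ in s..(s + 1 / ((n : ℝ) + 1)), cosSubOne σ f)] with x h1 h2 h3
    have hn : (n : ℝ) + 1 ≠ 0 := by positivity
    rw [hA]
    simp only
    rw [h2, Pi.smul_apply, h1 h3, smul_eq_mul, ← Complex.ofReal_mul]
    congr 1
    field_simp
    ring
  filter_upwards [h1, hae] with x h1 h2 hx
  have h3 : ∀ᶠ n in Filter.atTop, s + 1 / ((ns n : ℝ) + 1) < ‖x‖ := by
    have : Filter.Tendsto (fun n => s + 1 / ((ns n : ℝ) + 1)) Filter.atTop (nhds (s + 0)) :=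
      (tendsto_one_div_add_atTop_nhds_zero_nat.comp hns.tendsto_atTop).const_add s
    rw [add_zero] at this
    exact this.eventually_lt_const hx
  refine (h2.const_add (f x : ℂ)).congr' ?_
  filter_upwards [h3] with n hn
  rw [h1 _ hn]
  push_cast
  ring

/-! ### Pointwise bounds for radial functions in `Ḣ¹` -/

theorem continuous_fourierInv {d : ℕ} {G : Space d → ℂ} (hG : Integrable G) :
    Continuous (𝓕⁻ G : Space d → ℂ) := by
  have h : (𝓕⁻ G : Space d → ℂ) = fun x => (𝓕 G : Space d → ℂ) (-x) := by
    ext x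
    exact Real.fourierInv_eq_fourier_neg G x
  rw [h]
  have h2 : Continuous (𝓕 G : Space d → ℂ) :=
    VectorFourier.fourierIntegral_continuous Real.continuous_fourierChar
      (by exact continuous_inner) hG
  exact h2.comp continuous_neg

theorem norm_fourierInv_le {d : ℕ} (G : Space d → ℂ) (x : Space d) :
    ‖(𝓕⁻ G : Space d → ℂ) x‖ ≤ ∫ ξ, ‖G ξ‖ := by
  rw [Real.fourierInv_eq']
  refine (norm_integral_le_integral_norm _).trans (le_of_eq ?_)
  congr 1
  ext ξ
  rw [norm_smul, Complex.norm_exp_ofReal_mul_I, one_mul]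

/-- An inverse Fourier integral of an integrable function has that function as Fourier transform in the
sense of tempered distributions. -/
theorem hasFourierTransform_fourierInv {d : ℕ} {G : Space d → ℂ} (hG : Integrable G) :
    HasFourierTransform (𝓕⁻ G : Space d → ℂ) G := by
  have hb : ∀ φ : 𝓢(Space d, ℂ), Integrable fun x => (𝓕⁻ G : Space d → ℂ) x * φ x := fun φ =>
    φ.integrable.bdd_mul (continuous_fourierInv hG).aestronglyMeasurable
      (Filter.Eventually.of_forall (norm_fourierInv_le G))
  intro φ
  refine ⟨hb φ, ?_, ?_⟩
  · obtain ⟨C, hC⟩ : ∃ C, ∀ x, ‖φ x‖ ≤ C := ⟨_, fun x => φ.norm_le_seminorm ℝ x⟩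
    exact hG.mul_bdd (c := C) φ.continuous.aestronglyMeasurable (Filter.Eventually.of_forall hC)
  · have h := VectorFourier.integral_fourierIntegral_smul_eq_flip (μ := (volume : Measure (Space d)))
      (ν := (volume : Measure (Space d))) (e := Real.fourierChar) (L := -innerₗ (Space d))
      (f := G) (g := (𝓕 φ : 𝓢(Space d, ℂ))) Real.continuous_fourierChar
      (continuous_inner (𝕜 := ℝ) (E := Space d)).neg hG
      (SchwartzMap.integrable _)
    have hflip : (-innerₗ (Space d)).flip = -innerₗ (Space d) := by
      ext x y
      simp [real_inner_comm]
    rw [hflip] at h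
    have e1 : ∀ K : Space d → ℂ, VectorFourier.fourierIntegral Real.fourierChar volume
      (-innerₗ (Space d)) K = 𝓕⁻ K := fun K => rfl
    rw [e1, e1] at h
    have e2 : (𝓕⁻ (⇑(𝓕 φ : 𝓢(Space d, ℂ))) : Space d → ℂ) = φ := by
      rw [← SchwartzMap.fourierInv_coe, FourierTransform.fourierInv_fourier_eq]
    rw [e2] at h
    exact h

/-- Differentiation along a ray under the Fourier integral. -/
theorem hasDerivAt_fourierInv_ray {d : ℕ} {G : Space d → ℂ} (hG : Integrable G)
    (hG1 : Integrable fun ξ => (‖ξ‖ : ℂ) * G ξ) (ω : Space d) (r : ℝ) :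
    HasDerivAt (fun r : ℝ => (𝓕⁻ G : Space d → ℂ) (r • ω))
      ((𝓕⁻ (fun ξ => (2 * Real.pi * inner ℝ ξ ω : ℝ) * Complex.I * G ξ) : Space d → ℂ) (r • ω))
      r := by
  simp only [Real.fourierInv_eq', smul_eq_mul]
  refine (hasDerivAt_integral_of_dominated_loc_of_deriv_le (s := univ)
    (F := fun (t : ℝ) ξ => Complex.exp (↑(2 * Real.pi * inner ℝ ξ (t • ω)) * Complex.I) * G ξ)
    (F' := fun (t : ℝ) ξ => Complex.exp (↑(2 * Real.pi * inner ℝ ξ (t • ω)) * Complex.I) *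
      ((2 * Real.pi * inner ℝ ξ ω : ℝ) * Complex.I * G ξ))
    (bound := fun ξ => 2 * Real.pi * ‖ω‖ * ‖(‖ξ‖ : ℂ) * G ξ‖) Filter.univ_mem ?_ ?_ ?_ ?_ ?_ ?_).2
  · refine Filter.Eventually.of_forall fun t => ?_
    exact (Continuous.aestronglyMeasurable (by fun_prop)).mul hG.aestronglyMeasurable
  · refine hG.bdd_mul (c := 1) (Continuous.aestronglyMeasurable (by fun_prop))
      (Filter.Eventually.of_forall fun ξ => ?_)
    rw [Complex.norm_exp_ofReal_mul_I]
  · exact (Continuous.aestronglyMeasurable (by fun_prop)).mul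
      ((Continuous.aestronglyMeasurable (by fun_prop)).mul hG.aestronglyMeasurable)
  · refine Filter.Eventually.of_forall fun ξ t _ => ?_
    rw [norm_mul, Complex.norm_exp_ofReal_mul_I, one_mul, norm_mul, norm_mul, norm_mul,
      Complex.norm_I, mul_one, Complex.norm_real, Complex.norm_real, norm_norm, norm_mul,
      Real.norm_of_nonneg (by positivity : (0 : ℝ) ≤ 2 * Real.pi), ← mul_assoc]
    refine mul_le_mul_of_nonneg_right ?_ (norm_nonneg _)
    have := norm_inner_le_norm (𝕜 := ℝ) ξ ω
    have hp := Real.pi_pos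
    calc 2 * Real.pi * ‖inner ℝ ξ ω‖ ≤ 2 * Real.pi * (‖ξ‖ * ‖ω‖) := by gcongr
      _ = _ := by ring
  · exact hG1.norm.const_mul _
  · refine Filter.Eventually.of_forall fun ξ t _ => ?_
    have h1 : HasDerivAt (fun t : ℝ => ((2 * Real.pi * inner ℝ ξ (t • ω) : ℝ) : ℂ) * Complex.I)
        ((2 * Real.pi * inner ℝ ξ ω : ℝ) * Complex.I) t := by
      have : HasDerivAt (fun t : ℝ => 2 * Real.pi * inner ℝ ξ (t • ω))
          (2 * Real.pi * inner ℝ ξ ω) t := by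
        simp only [inner_smul_right]
        have := ((hasDerivAt_id t).mul_const (inner ℝ ξ ω)).const_mul (2 * Real.pi)
        simpa using this
      exact this.ofReal_comp.mul_const _
    have h2 := (h1.cexp).mul_const (G ξ)
    refine h2.congr_deriv ?_
    ring

/-- The fundamental theorem of calculus along a ray from infinity. -/
theorem enorm_fourierInv_le {d : ℕ} {G : Space d → ℂ} (hG : Integrable G)
    (hG1 : Integrable fun ξ => (‖ξ‖ : ℂ) * G ξ) {ω : Space d} (hω : ‖ω‖ = 1) (ρ : ℝ) :
    ‖(𝓕⁻ G : Space d → ℂ) (ρ • ω)‖ₑ ≤ ∫⁻ r in Ioi ρ, ∑ i, ‖(𝓕⁻ (fun ξ : Space d =>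
      (2 * Real.pi * ξ i : ℝ) * Complex.I * G ξ) : Space d → ℂ) (r • ω)‖ₑ := by
  set D : ℝ → ℂ := fun r => (𝓕⁻ (fun ξ => (2 * Real.pi * inner ℝ ξ ω : ℝ) * Complex.I * G ξ) :
    Space d → ℂ) (r • ω) with hD
  have hint : ∀ m : Space d → ℝ, Continuous m → (∀ ξ, |m ξ| ≤ ‖ξ‖) →
      Integrable fun ξ => (2 * Real.pi * m ξ : ℝ) * Complex.I * G ξ := by
    intro m hm hle
    refine (hG1.norm.const_mul (2 * Real.pi)).mono'
      ((Continuous.aestronglyMeasurable (by fun_prop)).mul hG.aestronglyMeasurable)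
      (Filter.Eventually.of_forall fun ξ => ?_)
    rw [norm_mul, norm_mul, norm_mul, Complex.norm_I, mul_one, Complex.norm_real,
      Complex.norm_real, norm_norm, norm_mul,
      Real.norm_of_nonneg (by positivity : (0 : ℝ) ≤ 2 * Real.pi), ← mul_assoc]
    have := hle ξ
    gcongr
    rwa [Real.norm_eq_abs]
  have hinti : ∀ i, Integrable fun ξ : Space d => (2 * Real.pi * ξ i : ℝ) * Complex.I * G ξ :=
    fun i => hint (fun ξ => ξ i) (by fun_prop) fun ξ => PiLp.norm_apply_le ξ i
  have hDc : Continuous D := by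
    refine (continuous_fourierInv (hint (fun ξ => inner ℝ ξ ω) (by fun_prop) fun ξ => ?_)).comp
      (by fun_prop)
    have := norm_inner_le_norm (𝕜 := ℝ) ξ ω
    rwa [hω, mul_one] at this
  have hDle : ∀ r, ‖D r‖ₑ ≤ ∑ i, ‖(𝓕⁻ (fun ξ : Space d =>
      (2 * Real.pi * ξ i : ℝ) * Complex.I * G ξ) : Space d → ℂ) (r • ω)‖ₑ := by
    intro r
    have h1 : D r = ∑ i : Fin d, (ω i : ℂ) * (𝓕⁻ (fun ξ : Space d =>
        (2 * Real.pi * ξ i : ℝ) * Complex.I * G ξ) : Space d → ℂ) (r • ω) := by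
      simp only [hD, Real.fourierInv_eq', smul_eq_mul]
      simp_rw [← integral_const_mul]
      rw [← integral_finsetSum (Finset.univ : Finset (Fin d)) (f := fun (i : Fin d) (ξ : Space d) =>
        (ω i : ℂ) * (Complex.exp (↑(2 * Real.pi * inner ℝ ξ (r • ω)) * Complex.I) *
          ((2 * Real.pi * ξ i : ℝ) * Complex.I * G ξ)))]
      · congr 1
        ext ξ
        have hin : inner ℝ ξ ω = ∑ i : Fin d, ω i * ξ i := by
          rw [PiLp.inner_apply]
          simp only [RCLike.inner_apply, conj_trivial]
        rw [hin, Finset.mul_sum, Complex.ofReal_sum, Finset.sum_mul, Finset.sum_mul,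
          Finset.mul_sum]
        refine Finset.sum_congr rfl fun i _ => ?_
        push_cast
        ring
      · intro i _
        refine Integrable.const_mul ?_ _
        refine (hinti i).bdd_mul (c := 1) (Continuous.aestronglyMeasurable (by fun_prop))
          (Filter.Eventually.of_forall fun ξ => ?_)
        rw [Complex.norm_exp_ofReal_mul_I]
    rw [h1]
    refine (enorm_sum_le _ _).trans (Finset.sum_le_sum fun i _ => ?_)
    rw [enorm_mul]
    refine mul_le_of_le_one_left (zero_le) ?_
    rw [← ofReal_norm, Complex.norm_real]
    refine ENNReal.ofReal_le_one.mpr ?_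
    have := PiLp.norm_apply_le ω i
    rwa [hω] at this
  refine le_trans ?_ (lintegral_mono hDle)
  have hM : ∀ M, ρ ≤ M → ‖(𝓕⁻ G : Space d → ℂ) (ρ • ω)‖ₑ
      ≤ ‖(𝓕⁻ G : Space d → ℂ) (M • ω)‖ₑ + ∫⁻ r in Ioi ρ, ‖D r‖ₑ := by
    intro M hM
    have h1 := intervalIntegral.integral_eq_sub_of_hasDerivAt
      (fun r _ => hasDerivAt_fourierInv_ray hG hG1 ω r) (hDc.intervalIntegrable ρ M)
    have h2 : (𝓕⁻ G : Space d → ℂ) (ρ • ω) = (𝓕⁻ G : Space d → ℂ) (M • ω) - ∫ r in ρ..M, D r := by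
      rw [h1]; ring
    rw [h2]
    refine (enorm_sub_le).trans (add_le_add le_rfl ?_)
    rw [intervalIntegral.integral_of_le hM]
    exact (enorm_integral_le_lintegral_enorm _).trans (lintegral_mono_set Ioc_subset_Ioi_self)
  have hlim : Filter.Tendsto (fun M : ℝ => ‖(𝓕⁻ G : Space d → ℂ) (M • ω)‖ₑ
      + ∫⁻ r in Ioi ρ, ‖D r‖ₑ) Filter.atTop (nhds (0 + ∫⁻ r in Ioi ρ, ‖D r‖ₑ)) := by
    refine Filter.Tendsto.add ?_ tendsto_const_nhds
    -- the boundary term at infinity vanishes by the Riemann-Lebesgue lemma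
    have h1 : Filter.Tendsto (𝓕⁻ G : Space d → ℂ) (Filter.cocompact (Space d)) (nhds 0) := by
      have h2 : Filter.Tendsto (𝓕 G : Space d → ℂ) (Filter.cocompact (Space d)) (nhds 0) :=
        tendsto_integral_exp_inner_smul_cocompact G
      have h3 : (𝓕⁻ G : Space d → ℂ) = (𝓕 G : Space d → ℂ) ∘ fun x => -x := by
        ext x
        exact Real.fourierInv_eq_fourier_neg G x
      rw [h3]
      exact h2.comp (Homeomorph.neg (Space d)).isClosedEmbedding.tendsto_cocompact
    have h4 : Filter.Tendsto (fun M : ℝ => M • ω) Filter.atTop (Filter.cocompact (Space d)) := by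
      rw [← Metric.cobounded_eq_cocompact, ← tendsto_norm_atTop_iff_cobounded]
      simp only [norm_smul, hω, mul_one]
      exact tendsto_norm_atTop_atTop
    have h5 := (h1.comp h4).enorm
    simpa using h5
  rw [zero_add] at hlim
  exact ge_of_tendsto hlim (Filter.eventually_atTop.mpr ⟨ρ, hM⟩)

theorem integrable_mul_indicator_hat {d : ℕ} {f : Space d → ℝ} (hf : MemHDotOne f)
    {m : Space d → ℂ} (hm : Continuous m) (N : ℝ) :
    Integrable fun ξ => m ξ * (Metric.ball 0 N).indicator (hatHDotOne f) ξ := by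
  have hl : LocallyIntegrable (hatHDotOne f) :=
    locallyIntegrable_of_schwartz fun φ => (hf.hat_spec.1 φ).2.1
  have h1 : IntegrableOn (fun ξ => m ξ * hatHDotOne f ξ) (Metric.closedBall 0 N) :=
    (hl.integrableOn_isCompact (isCompact_closedBall 0 N)).continuousOn_mul hm.continuousOn
      (isCompact_closedBall 0 N)
  have h2 : (fun ξ => m ξ * (Metric.ball 0 N).indicator (hatHDotOne f) ξ)
      = (Metric.ball 0 N).indicator fun ξ => m ξ * hatHDotOne f ξ := by
    ext ξ
    by_cases hξ : ξ ∈ Metric.ball 0 N <;> simp [hξ]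
  rw [h2, integrable_indicator_iff Metric.isOpen_ball.measurableSet]
  exact h1.mono_set Metric.ball_subset_closedBall

theorem integrable_indicator_hat {d : ℕ} {f : Space d → ℝ} (hf : MemHDotOne f) (N : ℝ) :
    Integrable ((Metric.ball 0 N).indicator (hatHDotOne f)) := by
  simpa using integrable_mul_indicator_hat hf (m := fun _ => 1) continuous_const N

theorem fourierInv_ae_eq_Lp {d : ℕ} {G : Space d → ℂ} (hG : Integrable G)
    {W : Lp ℂ 2 (volume : Measure (Space d))} (hW : (𝓕 W : Lp ℂ 2 (volume : Measure _)) =ᵐ[volume] G) :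
    (𝓕⁻ G : Space d → ℂ) =ᵐ[volume] W :=
  (hasFourierTransform_fourierInv hG).unique_left
    ((hasFourierTransform_Lp W).congr (ae_eq_refl _) hW)

/-- The high frequencies of `∇u₀` tend to zero in `L²`. -/
theorem tendsto_tail_norm {d : ℕ} {f : Space d → ℝ} (hf : MemHDotOne f) :
    Filter.Tendsto (fun n : ℕ => ‖toL2 fun ξ => (Metric.ball 0 (n : ℝ))ᶜ.indicator
      (fun ξ => (‖ξ‖ : ℂ) * hatHDotOne f ξ) ξ‖) Filter.atTop (nhds 0) := by
  have hmem := hf.hat_spec.2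
  have hmemn : ∀ n : ℕ, MemLp ((Metric.ball 0 (n : ℝ))ᶜ.indicator
      (fun ξ => (‖ξ‖ : ℂ) * hatHDotOne f ξ)) 2 volume := fun n =>
    hmem.indicator Metric.isOpen_ball.measurableSet.compl
  suffices h : Filter.Tendsto (fun n : ℕ => ‖‖toL2 fun ξ => (Metric.ball 0 (n : ℝ))ᶜ.indicator
      (fun ξ => (‖ξ‖ : ℂ) * hatHDotOne f ξ) ξ‖‖ₑ) Filter.atTop (nhds 0) from
    tendsto_zero_iff_enorm_tendsto_zero.2 h
  have h1 : ∀ n : ℕ, ‖‖toL2 fun ξ => (Metric.ball 0 (n : ℝ))ᶜ.indicator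
      (fun ξ => (‖ξ‖ : ℂ) * hatHDotOne f ξ) ξ‖‖ₑ = (∫⁻ ξ, (Metric.ball 0 (n : ℝ))ᶜ.indicator
        (fun ξ => ‖(‖ξ‖ : ℂ) * hatHDotOne f ξ‖ₑ ^ (2 : ℝ)) ξ) ^ (1 / 2 : ℝ) := by
    intro n
    rw [enorm_norm, norm_toL2 (hmemn n), eLpNorm_eq_lintegral_rpow_enorm_toReal (p := 2) two_ne_zero
      ENNReal.ofNat_ne_top]
    simp only [ENNReal.toReal_ofNat]
    congr 1
    refine lintegral_congr fun ξ => ?_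
    by_cases hξ : ξ ∈ (Metric.ball 0 (n : ℝ))ᶜ
    · rw [indicator_of_mem hξ, indicator_of_mem hξ]
    · rw [indicator_of_notMem hξ, indicator_of_notMem hξ]
      simp
  simp_rw [h1]
  have h2 : Filter.Tendsto (fun n : ℕ => ∫⁻ ξ, (Metric.ball 0 (n : ℝ))ᶜ.indicator
        (fun ξ => ‖(‖ξ‖ : ℂ) * hatHDotOne f ξ‖ₑ ^ (2 : ℝ)) ξ) Filter.atTop
        (nhds (∫⁻ _ : Space d, 0)) := by
    refine tendsto_lintegral_of_dominated_convergence'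
      (fun ξ => ‖(‖ξ‖ : ℂ) * hatHDotOne f ξ‖ₑ ^ (2 : ℝ)) (fun n => ?_) (fun n => ?_) ?_ ?_
    · exact (hmem.1.enorm.pow_const _).indicator Metric.isOpen_ball.measurableSet.compl
    · exact Filter.Eventually.of_forall fun ξ => indicator_le_self' (fun _ _ => zero_le) ξ
    · have := hmem.2
      rw [eLpNorm_lt_top_iff_lintegral_rpow_enorm_lt_top two_ne_zero ENNReal.ofNat_ne_top] at this
      simpa using this.ne
    · refine Filter.Eventually.of_forall fun ξ => ?_
      obtain ⟨N, hN⟩ := exists_nat_gt ‖ξ‖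
      refine tendsto_const_nhds.congr' ?_
      filter_upwards [Filter.eventually_ge_atTop N] with n hn
      rw [indicator_of_notMem]
      rw [mem_compl_iff, not_not, mem_ball_zero_iff]
      exact hN.trans_le (by exact_mod_cast hn)
  rw [lintegral_zero] at h2
  have := h2.ennrpow_const (1 / 2 : ℝ)
  rwa [ENNReal.zero_rpow_of_pos (by norm_num)] at this

/-- The frequency truncations of `m(√(-Δ)) u₀` are regular functions that converge in `L²`, if the
multiplier `m` is bounded by a multiple of `|ξ|`. -/
theorem exists_truncation_error {d : ℕ} {f : Space d → ℝ} (hf : MemHDotOne f) {m : Space d → ℂ}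
    (hm : Continuous m) {c : ℝ} (hc : ∀ ξ, ‖m ξ‖ ≤ c * ‖ξ‖) :
    ∃ (W : Lp ℂ 2 (volume : Measure (Space d))) (E : ℕ → Lp ℂ 2 (volume : Measure (Space d))),
      Filter.Tendsto (fun n => ‖E n‖) Filter.atTop (nhds 0) ∧
      ∀ n : ℕ, (𝓕⁻ (fun ξ => m ξ * (Metric.ball 0 (n : ℝ)).indicator (hatHDotOne f) ξ) : Space d → ℂ)
        =ᵐ[volume] fun x => W x - E n x := by
  set m' : ℕ → Space d → ℂ := fun n ξ => (Metric.ball 0 (n : ℝ))ᶜ.indicator m ξ with hm'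
  have hm'm : ∀ n, AEStronglyMeasurable (m' n) volume := fun n =>
    (hm.measurable.indicator Metric.isOpen_ball.measurableSet.compl).aestronglyMeasurable
  have hm'c : ∀ n ξ, ‖m' n ξ‖ ≤ c * ‖ξ‖ := fun n ξ =>
    (norm_indicator_le_norm_self _ _).trans (hc ξ)
  obtain ⟨hW, -⟩ := memLp_mul_hat hf hm.aestronglyMeasurable hc
  have hE : ∀ n, MemLp (fun ξ => m' n ξ * hatHDotOne f ξ) 2 volume := fun n =>
    (memLp_mul_hat hf (hm'm n) (hm'c n)).1
  refine ⟨𝓕⁻ (toL2 fun ξ => m ξ * hatHDotOne f ξ),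
    fun n => 𝓕⁻ (toL2 fun ξ => m' n ξ * hatHDotOne f ξ), ?_, ?_⟩
  · have h0 := (tendsto_tail_norm hf).const_mul c
    rw [mul_zero] at h0
    refine squeeze_zero (fun _ => norm_nonneg _) (fun n => ?_) h0
    rw [norm_fourierInv_eq]
    refine Lp.norm_le_mul_norm_of_ae_le_mul ?_
    have h1 : MemLp (fun ξ => (Metric.ball 0 (n : ℝ))ᶜ.indicator
      (fun ξ => (‖ξ‖ : ℂ) * hatHDotOne f ξ) ξ) 2 volume :=
      hf.hat_spec.2.indicator Metric.isOpen_ball.measurableSet.compl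
    filter_upwards [coeFn_toL2 (hE n), coeFn_toL2 h1] with ξ e1 e2
    rw [e1, e2]
    by_cases hξ : ξ ∈ (Metric.ball 0 (n : ℝ))ᶜ
    · rw [indicator_of_mem hξ, hm']
      simp only
      rw [indicator_of_mem hξ, norm_mul, norm_mul, Complex.norm_real, norm_norm, ← mul_assoc]
      exact mul_le_mul_of_nonneg_right (hc ξ) (norm_nonneg _)
    · rw [indicator_of_notMem hξ, hm']
      simp only
      rw [indicator_of_notMem hξ]
      simp
  · intro n
    have h1 := fourierInv_ae_eq_Lp (integrable_mul_indicator_hat hf hm n)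
      (W := 𝓕⁻ (toL2 fun ξ => m ξ * hatHDotOne f ξ) - 𝓕⁻ (toL2 fun ξ => m' n ξ * hatHDotOne f ξ)) ?_
    · filter_upwards [h1, Lp.coeFn_sub (𝓕⁻ (toL2 fun ξ => m ξ * hatHDotOne f ξ))
        (𝓕⁻ (toL2 fun ξ => m' n ξ * hatHDotOne f ξ))] with x e1 e2
      rw [e1, e2, Pi.sub_apply]
    · rw [fourier_sub_Lp, FourierTransform.fourier_fourierInv_eq,
        FourierTransform.fourier_fourierInv_eq]
      filter_upwards [Lp.coeFn_sub (toL2 fun ξ => m ξ * hatHDotOne f ξ)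
        (toL2 fun ξ => m' n ξ * hatHDotOne f ξ), coeFn_toL2 hW, coeFn_toL2 (hE n)] with ξ e1 e2 e3
      rw [e1, Pi.sub_apply, e2, e3, hm']
      by_cases hξ : ξ ∈ Metric.ball 0 (n : ℝ) <;> simp [hξ]

/-- The low frequency parts of `u₀` converge to `u₀`, with an error that is small in `L²`. -/
theorem exists_lowFrequency_error {d : ℕ} {f : Space d → ℝ} (hf : MemHDotOne f) :
    ∃ E : ℕ → Lp ℂ 2 (volume : Measure (Space d)),
      Filter.Tendsto (fun n => ‖E n‖) Filter.atTop (nhds 0) ∧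
      ∀ n : ℕ, 1 ≤ n → ∀ᵐ x, (f x : ℂ)
        = (𝓕⁻ ((Metric.ball 0 (n : ℝ)).indicator (hatHDotOne f)) : Space d → ℂ) x + E n x := by
  set m' : ℕ → Space d → ℂ := fun n ξ => (Metric.ball 0 (n : ℝ))ᶜ.indicator (fun _ => 1) ξ with hm'
  have hm'm : ∀ n, AEStronglyMeasurable (m' n) volume := fun n =>
    (measurable_const.indicator Metric.isOpen_ball.measurableSet.compl).aestronglyMeasurable
  -- on frequencies `|ξ| ≥ n` the constant multiplier is at most `|ξ| / n`
  have hm'c : ∀ n : ℕ, 1 ≤ n → ∀ ξ, ‖m' n ξ‖ ≤ (1 / (n : ℝ)) * ‖ξ‖ := by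
    intro n hn ξ
    have hn0 : (0 : ℝ) < n := by exact_mod_cast hn
    by_cases hξ : ξ ∈ Metric.ball 0 (n : ℝ)
    · simp only [hm']
      rw [indicator_of_notMem (by simpa using hξ)]
      simp only [norm_zero]
      positivity
    · simp only [hm']
      rw [indicator_of_mem hξ, norm_one]
      rw [mem_ball_zero_iff, not_lt] at hξ
      rw [one_div, inv_mul_eq_div, one_le_div hn0]
      exact hξ
  refine ⟨fun n => 𝓕⁻ (toL2 fun ξ => m' n ξ * hatHDotOne f ξ), ?_, fun n hn => ?_⟩
  · have h0 := (tendsto_one_div_atTop_nhds_zero_nat (𝕜 := ℝ)).mul_const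
      ‖toL2 fun ξ => (‖ξ‖ : ℂ) * hatHDotOne f ξ‖
    rw [zero_mul] at h0
    refine squeeze_zero' (Filter.Eventually.of_forall fun _ => norm_nonneg _) ?_ h0
    filter_upwards [Filter.eventually_ge_atTop 1] with n hn
    rw [norm_fourierInv_eq]
    exact (memLp_mul_hat hf (hm'm n) (hm'c n hn)).2
  · have hE := (memLp_mul_hat hf (hm'm n) (hm'c n hn)).1
    have h1 := (hf.hat_spec.1).sub (hasFourierTransform_fourierInv (integrable_indicator_hat hf n))
    have h2 : HasFourierTransform (𝓕⁻ (toL2 fun ξ => m' n ξ * hatHDotOne f ξ) :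
        Lp ℂ 2 (volume : Measure (Space d)))
        (hatHDotOne f - (Metric.ball 0 (n : ℝ)).indicator (hatHDotOne f)) := by
      refine (hasFourierTransform_Lp _).congr (ae_eq_refl _) ?_
      rw [FourierTransform.fourier_fourierInv_eq]
      filter_upwards [coeFn_toL2 hE] with ξ e1
      rw [e1, hm']
      by_cases hξ : ξ ∈ Metric.ball 0 (n : ℝ) <;> simp [hξ]
    filter_upwards [h1.unique_left h2] with x hx
    rw [← hx]
    simp

/-- The kernel `1_{|y| > ρ} |y|^(-2k)` is square integrable on `ℝ^(2k+1)`. -/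
theorem lintegral_norm_rpow_lt_top {k : ℕ} (hk : 1 ≤ k) {ρ : ℝ} (hρ : 0 < ρ) :
    ∫⁻ y : Space (2 * k + 1), ({y | ρ < ‖y‖}.indicator
      (fun y => ENNReal.ofReal (1 / ‖y‖ ^ (2 * k))) y) ^ (2 : ℝ) < ⊤ := by
  have h1 : ∀ y : Space (2 * k + 1), ({y : Space (2 * k + 1) | ρ < ‖y‖}.indicator
      (fun y => ENNReal.ofReal (1 / ‖y‖ ^ (2 * k))) y) ^ (2 : ℝ)
      = (fun r => (Ioi ρ).indicator (fun r => ENNReal.ofReal (1 / r ^ (2 * k)) ^ (2 : ℝ)) r) ‖y‖ := by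
    intro y
    by_cases hy : ρ < ‖y‖
    · rw [indicator_of_mem (show y ∈ {y : Space (2 * k + 1) | ρ < ‖y‖} from hy)]
      simp only
      rw [indicator_of_mem (show ‖y‖ ∈ Ioi ρ from hy)]
    · rw [indicator_of_notMem (show y ∉ {y : Space (2 * k + 1) | ρ < ‖y‖} from hy)]
      simp only
      rw [indicator_of_notMem (show ‖y‖ ∉ Ioi ρ from hy)]
      simp
  simp_rw [h1]
  rw [lintegral_norm_eq (f := fun r => (Ioi ρ).indicator
    (fun r => ENNReal.ofReal (1 / r ^ (2 * k)) ^ (2 : ℝ)) r) (by omega)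
    (Measurable.indicator (by fun_prop) measurableSet_Ioi)]
  refine ENNReal.mul_lt_top ?_ ?_
  · exact measure_lt_top _ _
  · have h2 : IntegrableOn (fun t : ℝ => t ^ (-(2 * k : ℝ))) (Ioi ρ) :=
      integrableOn_Ioi_rpow_of_lt (by
        have : (1 : ℝ) ≤ k := by exact_mod_cast hk
        linarith) hρ
    refine lt_of_le_of_lt ?_ h2.2
    rw [← lintegral_indicator measurableSet_Ioi, ← lintegral_indicator measurableSet_Ioi]
    refine lintegral_mono fun r => ?_
    by_cases hr : r ∈ Ioi ρ
    · have hr0 : 0 < r := hρ.trans hr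
      rw [indicator_of_mem (show r ∈ Ioi (0 : ℝ) from hr0), indicator_of_mem hr,
        indicator_of_mem hr, ENNReal.ofReal_rpow_of_nonneg (by positivity) (by norm_num),
        ← ENNReal.ofReal_mul (by positivity), Real.enorm_eq_ofReal (by positivity)]
      refine ENNReal.ofReal_le_ofReal (le_of_eq ?_)
      beta_reduce
      rw [Real.rpow_neg hr0.le, Real.rpow_two,
        show (2 * k : ℝ) = ((2 * k : ℕ) : ℝ) by push_cast; ring, Real.rpow_natCast]
      have : r ^ (2 * k) ≠ 0 := by positivity
      rw [Nat.add_sub_cancel]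
      field_simp
    · rw [indicator_of_notMem hr]
      refine le_of_eq (indicator_apply_eq_zero.mpr fun _ => ?_)
      rw [indicator_of_notMem hr, mul_zero]

/-- The kernel `1_{|y| > ρ} |y|^(-2k)`. -/
noncomputable def outerKernel (k : ℕ) (ρ : ℝ) (y : Space (2 * k + 1)) : ℝ≥0∞ :=
  {y | ρ < ‖y‖}.indicator (fun y => ENNReal.ofReal (1 / ‖y‖ ^ (2 * k))) y

theorem measurable_outerKernel {k : ℕ} {ρ : ℝ} : Measurable (outerKernel k ρ) :=
  Measurable.indicator (by fun_prop) (measurableSet_lt (by fun_prop) (by fun_prop))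

theorem lintegral_mul_le_of_two {α : Type*} [MeasurableSpace α] {μ : Measure α} {f g : α → ℝ≥0∞}
    (hf : AEMeasurable f μ) (hg : AEMeasurable g μ) :
    ∫⁻ a, f a * g a ∂μ ≤ (∫⁻ a, f a ^ (2 : ℝ) ∂μ) ^ (1 / 2 : ℝ) *
      (∫⁻ a, g a ^ (2 : ℝ) ∂μ) ^ (1 / 2 : ℝ) :=
  ENNReal.lintegral_mul_le_Lp_mul_Lq μ (Real.HolderConjugate.two_two) hf hg

theorem lintegral_sq_Lp {d : ℕ} (E : Lp ℂ 2 (volume : Measure (Space d))) :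
    (∫⁻ y, ‖E y‖ₑ ^ (2 : ℝ)) ^ (1 / 2 : ℝ) = ‖E‖ₑ := by
  rw [Lp.enorm_def, eLpNorm_eq_lintegral_rpow_enorm_toReal (p := 2) two_ne_zero
    ENNReal.ofNat_ne_top]
  simp

/-- The spherical average of a smooth decaying function is bounded by its gradient in the exterior
of the sphere. -/
theorem lintegral_sphere_fourierInv_le {k : ℕ} {G : Space (2 * k + 1) → ℂ} (hG : Integrable G)
    (hG1 : Integrable fun ξ => (‖ξ‖ : ℂ) * G ξ)
    (hGi : ∀ i : Fin (2 * k + 1), Integrable fun ξ : Space (2 * k + 1) =>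
      (2 * Real.pi * ξ i : ℝ) * Complex.I * G ξ) {ρ : ℝ} (hρ : 0 < ρ) :
    ∫⁻ ω, ‖(𝓕⁻ G : Space (2 * k + 1) → ℂ) (ρ • (ω : Space (2 * k + 1)))‖ₑ ∂sphereMeasure (2 * k + 1)
      ≤ ∫⁻ y, outerKernel k ρ y * ∑ i, ‖(𝓕⁻ (fun ξ : Space (2 * k + 1) =>
      (2 * Real.pi * ξ i : ℝ) * Complex.I * G ξ) : Space (2 * k + 1) → ℂ) y‖ₑ := by
  have hS : Measurable fun y : Space (2 * k + 1) => ∑ i, ‖(𝓕⁻ (fun ξ : Space (2 * k + 1) =>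
      (2 * Real.pi * ξ i : ℝ) * Complex.I * G ξ) : Space (2 * k + 1) → ℂ) y‖ₑ :=
    Finset.measurable_sum _ fun i _ => (continuous_fourierInv (hGi i)).measurable.enorm
  have hF : Measurable fun y => outerKernel k ρ y * ∑ i, ‖(𝓕⁻ (fun ξ : Space (2 * k + 1) =>
      (2 * Real.pi * ξ i : ℝ) * Complex.I * G ξ) : Space (2 * k + 1) → ℂ) y‖ₑ :=
    measurable_outerKernel.mul hS
  rw [lintegral_polar (by omega) hF]
  refine lintegral_mono fun ω => ?_
  have hω : ‖(ω : Space (2 * k + 1))‖ = 1 := norm_eq_of_mem_sphere ω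
  refine (enorm_fourierInv_le hG hG1 hω ρ).trans ?_
  rw [← lintegral_indicator measurableSet_Ioi, ← lintegral_indicator measurableSet_Ioi]
  refine lintegral_mono fun r => ?_
  by_cases hr : r ∈ Ioi ρ
  · have hr0 : 0 < r := hρ.trans hr
    have hn : ‖r • (ω : Space (2 * k + 1))‖ = r := by
      rw [norm_smul, hω, mul_one, Real.norm_of_nonneg hr0.le]
    rw [indicator_of_mem hr, indicator_of_mem (show r ∈ Ioi (0 : ℝ) from hr0), outerKernel,
      indicator_of_mem (by rw [mem_ofPred_eq, hn]; exact hr), hn, ← mul_assoc,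
      ← ENNReal.ofReal_mul (by positivity)]
    have : r ^ (2 * k + 1 - 1) * (1 / r ^ (2 * k)) = 1 := by
      have : r ^ (2 * k) ≠ 0 := by positivity
      rw [Nat.add_sub_cancel]
      field_simp
    rw [this, ENNReal.ofReal_one, one_mul]
  · rw [indicator_of_notMem hr]
    exact zero_le

/-- A radial function in `Ḣ¹` is bounded by its gradient outside the sphere: in terms of the profile,
`|h(ρ)|` is at most a multiple of `∫_{|y| > ρ} |∇u₀(y)| |y|^(-2k) dy`. -/
theorem exists_gradient_bound {k : ℕ} (hk : 1 ≤ k) {f : Space (2 * k + 1) → ℝ}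
    (hf : MemHDotOne f) {h : ℝ → ℝ} (hm : Measurable h) (hfh : ∀ᵐ y, f y = h ‖y‖) :
    ∃ w : Space (2 * k + 1) → ℝ≥0∞, Measurable w ∧ ∫⁻ y, w y ^ (2 : ℝ) < ⊤ ∧
      ∀ᵐ ρ ∂(volume.restrict (Ioi (0 : ℝ))),
        sphereMeasure (2 * k + 1) univ * ‖h ρ‖ₑ ≤ ∫⁻ y, outerKernel k ρ y * w y := by
  obtain ⟨E₀, hE₀, hfE⟩ := exists_lowFrequency_error hf
  have hmi : ∀ i : Fin (2 * k + 1), ∀ ξ : Space (2 * k + 1),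
      ‖((2 * Real.pi * ξ i : ℝ) : ℂ) * Complex.I‖ ≤ 2 * Real.pi * ‖ξ‖ := by
    intro i ξ
    rw [norm_mul, Complex.norm_I, mul_one, Complex.norm_real, norm_mul,
      Real.norm_of_nonneg (by positivity : (0 : ℝ) ≤ 2 * Real.pi)]
    have := PiLp.norm_apply_le ξ i
    gcongr
  choose W E hE hWE using fun i : Fin (2 * k + 1) =>
    exists_truncation_error hf (m := fun ξ => ((2 * Real.pi * ξ i : ℝ) : ℂ) * Complex.I)
      (by fun_prop) (hmi i)
  have hmem : MemLp (fun y => ∑ i, ‖W i y‖) 2 volume :=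
    memLp_finsetSum _ fun i _ => (Lp.memLp (W i)).norm
  have hwsum : ∀ y, ‖∑ i, ‖W i y‖‖ₑ = ∑ i, ‖W i y‖ₑ := by
    intro y
    rw [Real.enorm_eq_ofReal (Finset.sum_nonneg fun _ _ => norm_nonneg _),
      ENNReal.ofReal_sum_of_nonneg fun _ _ => norm_nonneg _]
    simp_rw [ofReal_norm]
  have hWm : ∀ i, Measurable fun y => ‖W i y‖ₑ := fun i =>
    (Lp.stronglyMeasurable (W i)).measurable.enorm
  refine ⟨fun y => ∑ i, ‖W i y‖ₑ, Finset.measurable_sum _ fun i _ => hWm i, ?_, ?_⟩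
  · have := hmem.2
    rw [eLpNorm_lt_top_iff_lintegral_rpow_enorm_lt_top two_ne_zero ENNReal.ofNat_ne_top] at this
    simp_rw [hwsum] at this
    simpa using this
  set u : ℕ → Space (2 * k + 1) → ℂ := fun n =>
    𝓕⁻ ((Metric.ball 0 (n : ℝ)).indicator (hatHDotOne f)) with hu
  have hum : ∀ n, Measurable (u n) := fun n =>
    (continuous_fourierInv (integrable_indicator_hat hf n)).measurable
  -- the bound for the low frequency parts
  have hbound : ∀ ρ, 0 < ρ → ∀ n : ℕ,
      ∫⁻ ω, ‖u n (ρ • (ω : Space (2 * k + 1)))‖ₑ ∂sphereMeasure (2 * k + 1)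
        ≤ (∫⁻ y, outerKernel k ρ y * ∑ i, ‖W i y‖ₑ)
          + (∫⁻ y, outerKernel k ρ y ^ (2 : ℝ)) ^ (1 / 2 : ℝ) * ∑ i, ‖E i n‖ₑ := by
    intro ρ hρ n
    refine (lintegral_sphere_fourierInv_le (integrable_indicator_hat hf n)
      (integrable_mul_indicator_hat hf (m := fun ξ => (‖ξ‖ : ℂ)) (by fun_prop) n)
      (fun i => integrable_mul_indicator_hat hf
        (m := fun ξ => ((2 * Real.pi * ξ i : ℝ) : ℂ) * Complex.I) (by fun_prop) n) hρ).trans ?_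
    have h1 : ∫⁻ y, outerKernel k ρ y * ∑ i, ‖(𝓕⁻ (fun ξ : Space (2 * k + 1) =>
        (2 * Real.pi * ξ i : ℝ) * Complex.I * (Metric.ball 0 (n : ℝ)).indicator (hatHDotOne f) ξ) :
        Space (2 * k + 1) → ℂ) y‖ₑ ≤ ∫⁻ y, (outerKernel k ρ y * ∑ i, ‖W i y‖ₑ
          + ∑ i, outerKernel k ρ y * ‖E i n y‖ₑ) := by
      refine lintegral_mono_ae ?_
      filter_upwards [ae_all_iff.mpr fun i => hWE i n] with y hy
      rw [← Finset.mul_sum, ← mul_add, ← Finset.sum_add_distrib]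
      gcongr with i
      rw [hy i]
      exact enorm_sub_le
    refine h1.trans ?_
    have hF : Measurable fun y => outerKernel k ρ y * ∑ i, ‖W i y‖ₑ :=
      measurable_outerKernel.mul (Finset.measurable_sum _ fun i _ => hWm i)
    rw [lintegral_add_left hF,
      Finset.mul_sum, lintegral_finsetSum]
    · gcongr with i
      refine (lintegral_mul_le_of_two measurable_outerKernel.aemeasurable
        (Lp.aestronglyMeasurable (E i n)).enorm).trans ?_
      rw [lintegral_sq_Lp]
    · exact fun i _ => measurable_outerKernel.mul (Lp.stronglyMeasurable (E i n)).measurable.enorm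
  -- convergence along a subsequence
  have hE₀' : Filter.Tendsto E₀ Filter.atTop (nhds 0) := tendsto_zero_iff_norm_tendsto_zero.mpr hE₀
  obtain ⟨ns, hns, hae⟩ := (tendstoInMeasure_of_tendsto_Lp hE₀').exists_seq_tendsto_ae
  have hlim : ∀ᵐ y, ‖h ‖y‖‖ₑ ≤ Filter.liminf (fun n => ‖u (ns n) y‖ₑ) Filter.atTop := by
    have h1 : ∀ᵐ y, ∀ n : ℕ, 1 ≤ n → (f y : ℂ) = u n y + E₀ n y := by
      rw [ae_all_iff]
      intro n
      by_cases hn : 1 ≤ n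
      · filter_upwards [hfE n hn] with y hy _ using hy
      · exact Filter.Eventually.of_forall fun y hn' => absurd hn' hn
    filter_upwards [h1, hae, hfh, Lp.coeFn_zero ℂ 2 volume] with y h1 h2 h3 h4
    have h5 : Filter.Tendsto (fun n => u (ns n) y) Filter.atTop (nhds (f y : ℂ)) := by
      rw [h4] at h2
      have h6 := h2.const_sub (f y : ℂ)
      simp only [Pi.zero_apply, sub_zero] at h6
      refine h6.congr' ?_
      filter_upwards [hns.tendsto_atTop.eventually_ge_atTop 1] with n hn
      rw [h1 _ hn]; ring
    rw [h5.enorm.liminf_eq, ← h3]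
    rw [← ofReal_norm, ← ofReal_norm, Complex.norm_real]
  have hpol := ae_polar (n := 2 * k + 1) (by omega) hlim
  -- Fubini: for almost every radius the limit holds in almost every direction, so that Fatou applies
  -- on the sphere of that radius
  have hswap : ∀ᵐ ρ ∂(volume.restrict (Ioi (0 : ℝ))),
      ∀ᵐ ω : Metric.sphere (0 : Space (2 * k + 1)) 1 ∂sphereMeasure (2 * k + 1),
      ‖h ‖ρ • (ω : Space (2 * k + 1))‖‖ₑ
        ≤ Filter.liminf (fun n => ‖u (ns n) (ρ • (ω : Space (2 * k + 1)))‖ₑ) Filter.atTop := by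
    refine (Measure.ae_ae_comm ?_).mp hpol
    refine measurableSet_le (by fun_prop) (Measurable.liminf fun n => ?_)
    exact ((hum (ns n)).comp (by fun_prop)).enorm
  filter_upwards [hswap, ae_restrict_mem measurableSet_Ioi] with ρ hρ hρ0
  have hρ0' : (0 : ℝ) < ρ := hρ0
  have hn : ∀ ω : Metric.sphere (0 : Space (2 * k + 1)) 1, ‖ρ • (ω : Space (2 * k + 1))‖ = ρ := by
    intro ω
    rw [norm_smul, norm_eq_of_mem_sphere, mul_one, Real.norm_of_nonneg hρ0'.le]
  calc sphereMeasure (2 * k + 1) univ * ‖h ρ‖ₑ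
      = ∫⁻ ω, ‖h ‖ρ • (ω : Space (2 * k + 1))‖‖ₑ ∂sphereMeasure (2 * k + 1) := by
        simp_rw [hn]
        rw [lintegral_const, mul_comm]
    _ ≤ ∫⁻ ω, Filter.liminf (fun n => ‖u (ns n) (ρ • (ω : Space (2 * k + 1)))‖ₑ) Filter.atTop
        ∂sphereMeasure (2 * k + 1) := lintegral_mono_ae hρ
    _ ≤ Filter.liminf (fun n => ∫⁻ ω, ‖u (ns n) (ρ • (ω : Space (2 * k + 1)))‖ₑ
        ∂sphereMeasure (2 * k + 1)) Filter.atTop :=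
        lintegral_liminf_le fun n => ((hum (ns n)).comp (by fun_prop)).enorm
    _ ≤ Filter.liminf (fun n => (∫⁻ y, outerKernel k ρ y * ∑ i, ‖W i y‖ₑ)
          + (∫⁻ y, outerKernel k ρ y ^ (2 : ℝ)) ^ (1 / 2 : ℝ) * ∑ i, ‖E i (ns n)‖ₑ)
          Filter.atTop :=
        Filter.liminf_le_liminf (Filter.Eventually.of_forall fun n => hbound ρ hρ0' (ns n))
    _ = ∫⁻ y, outerKernel k ρ y * ∑ i, ‖W i y‖ₑ := by
        have hC : (∫⁻ y, outerKernel k ρ y ^ (2 : ℝ)) ^ (1 / 2 : ℝ) ≠ ⊤ :=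
          ENNReal.rpow_ne_top_of_nonneg (by norm_num) (lintegral_norm_rpow_lt_top hk hρ0').ne
        have h1 : Filter.Tendsto (fun n => ∑ i, ‖E i (ns n)‖ₑ) Filter.atTop
            (nhds (∑ _i : Fin (2 * k + 1), 0)) := by
          refine tendsto_finsetSum _ fun i _ => ?_
          have := tendsto_zero_iff_norm_tendsto_zero.mpr (hE i)
          have h2 := (this.comp hns.tendsto_atTop).enorm
          simpa using h2
        rw [Finset.sum_const_zero] at h1
        have h2 := (ENNReal.Tendsto.const_mul h1 (Or.inr hC)).const_add
          (∫⁻ y, outerKernel k ρ y * ∑ i, ‖W i y‖ₑ)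
        rw [mul_zero, add_zero] at h2
        exact h2.liminf_eq

/-! ### Mixed norms of nonnegative functions -/

/-- The `L^p` norm of a function with values in `[0, ∞]`. -/
noncomputable def lpn {α : Type*} [MeasurableSpace α] (p : ℝ) (μ : Measure α) (f : α → ℝ≥0∞) :
    ℝ≥0∞ :=
  (∫⁻ a, f a ^ p ∂μ) ^ (1 / p)

section lpn

variable {α : Type*} [MeasurableSpace α] {μ : Measure α} {p : ℝ}

theorem lpn_mono (hp : 0 < p) {f g : α → ℝ≥0∞} (h : ∀ᵐ a ∂μ, f a ≤ g a) :
    lpn p μ f ≤ lpn p μ g := by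
  refine ENNReal.rpow_le_rpow (lintegral_mono_ae ?_) (by positivity)
  filter_upwards [h] with a ha using ENNReal.rpow_le_rpow ha hp.le

theorem lpn_rpow (hp : 0 < p) (f : α → ℝ≥0∞) : lpn p μ f ^ p = ∫⁻ a, f a ^ p ∂μ := by
  rw [lpn, ← ENNReal.rpow_mul, one_div_mul_cancel hp.ne', ENNReal.rpow_one]

theorem lpn_add_le (hp : 1 ≤ p) {f g : α → ℝ≥0∞} (hf : AEMeasurable f μ) (hg : AEMeasurable g μ) :
    lpn p μ (fun a => f a + g a) ≤ lpn p μ f + lpn p μ g :=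
  ENNReal.lintegral_Lp_add_le hf hg hp

theorem lpn_zero (hp : 0 < p) : lpn p μ (fun _ => 0) = 0 := by
  simp [lpn, ENNReal.zero_rpow_of_pos hp, hp]

theorem lpn_const_mul (hp : 0 < p) {c : ℝ≥0∞} (hc : c ≠ ⊤) (f : α → ℝ≥0∞) :
    lpn p μ (fun a => c * f a) = c * lpn p μ f := by
  simp only [lpn]
  simp_rw [ENNReal.mul_rpow_of_nonneg _ _ hp.le]
  rw [lintegral_const_mul' _ _ (ENNReal.rpow_ne_top_of_nonneg hp.le hc),
    ENNReal.mul_rpow_of_nonneg _ _ (by positivity), ← ENNReal.rpow_mul, mul_one_div_cancel hp.ne',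
    ENNReal.rpow_one]

theorem lpn_sum_le (hp : 1 ≤ p) {f : ℕ → α → ℝ≥0∞} (hf : ∀ n, Measurable (f n)) (N : ℕ) :
    lpn p μ (fun a => ∑ n ∈ Finset.range N, f n a) ≤ ∑ n ∈ Finset.range N, lpn p μ (f n) := by
  induction N with
  | zero => simp [lpn_zero (zero_lt_one.trans_le hp)]
  | succ N ih =>
    simp_rw [Finset.sum_range_succ]
    refine (lpn_add_le hp (Finset.measurable_sum _ fun n _ => hf n).aemeasurable
      (hf N).aemeasurable).trans ?_
    gcongr

/-- Minkowski's inequality for series. -/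
theorem lpn_tsum_le (hp : 1 ≤ p) {f : ℕ → α → ℝ≥0∞} (hf : ∀ n, Measurable (f n)) :
    lpn p μ (fun a => ∑' n, f n a) ≤ ∑' n, lpn p μ (f n) := by
  have hp0 : 0 < p := zero_lt_one.trans_le hp
  have h1 : ∫⁻ a, (∑' n, f n a) ^ p ∂μ ≤ (∑' n, lpn p μ (f n)) ^ p := by
    have h2 : ∀ a, (∑' n, f n a) ^ p
        = Filter.liminf (fun N => (∑ n ∈ Finset.range N, f n a) ^ p) Filter.atTop := by
      intro a
      refine (Filter.Tendsto.liminf_eq ?_).symm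
      exact ((ENNReal.summable (f := fun n => f n a)).hasSum.tendsto_sum_nat).ennrpow_const p
    simp_rw [h2]
    refine (lintegral_liminf_le fun N =>
      (Finset.measurable_sum _ fun n _ => hf n).pow_const p).trans ?_
    refine Filter.liminf_le_of_le (by isBoundedDefault) fun b hb => ?_
    obtain ⟨N, hN⟩ := hb.exists
    refine hN.trans ?_
    rw [← lpn_rpow hp0]
    refine ENNReal.rpow_le_rpow ((lpn_sum_le hp hf N).trans ?_) hp0.le
    exact ENNReal.sum_le_tsum _
  rw [lpn]
  refine (ENNReal.rpow_le_rpow h1 (by positivity)).trans (le_of_eq ?_)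
  rw [← ENNReal.rpow_mul, mul_one_div_cancel hp0.ne', ENNReal.rpow_one]

theorem ae_lt_top_of_lpn (hp : 0 < p) {f : α → ℝ≥0∞} (hf : Measurable f) (h : lpn p μ f ≠ ⊤) :
    ∀ᵐ a ∂μ, f a < ⊤ := by
  have h1 : ∫⁻ a, f a ^ p ∂μ ≠ ⊤ := by
    rw [← lpn_rpow hp]
    exact ENNReal.rpow_ne_top_of_nonneg hp.le h
  filter_upwards [ae_lt_top (hf.pow_const p) h1] with a ha
  exact (ENNReal.rpow_lt_top_iff_of_pos hp).mp ha

theorem ae_eq_zero_of_lpn (hp : 0 < p) {f : α → ℝ≥0∞} (hf : Measurable f) (h : lpn p μ f = 0) :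
    ∀ᵐ a ∂μ, f a = 0 := by
  have h1 : ∫⁻ a, f a ^ p ∂μ = 0 := by
    rw [← lpn_rpow hp, h, ENNReal.zero_rpow_of_pos hp]
  rw [lintegral_eq_zero_iff (hf.pow_const p)] at h1
  filter_upwards [h1] with a ha
  exact (ENNReal.rpow_eq_zero_iff_of_pos hp).mp ha

/-- Dominated convergence to zero. -/
theorem tendsto_lpn_zero (hp : 0 < p) {f : ℕ → α → ℝ≥0∞} {g : α → ℝ≥0∞}
    (hf : ∀ n, Measurable (f n)) (hle : ∀ n, ∀ᵐ a ∂μ, f n a ≤ g a)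
    (hg : lpn p μ g ≠ ⊤) (h : ∀ᵐ a ∂μ, Filter.Tendsto (fun n => f n a) Filter.atTop (nhds 0)) :
    Filter.Tendsto (fun n => lpn p μ (f n)) Filter.atTop (nhds 0) := by
  have h1 : Filter.Tendsto (fun n => ∫⁻ a, f n a ^ p ∂μ) Filter.atTop (nhds (∫⁻ _, 0 ∂μ)) := by
    refine tendsto_lintegral_of_dominated_convergence (fun a => g a ^ p)
      (fun n => (hf n).pow_const p) (fun n => ?_) ?_ ?_
    · filter_upwards [hle n] with a ha using ENNReal.rpow_le_rpow ha hp.le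
    · rw [← lpn_rpow hp]
      exact ENNReal.rpow_ne_top_of_nonneg hp.le hg
    · filter_upwards [h] with a ha
      have := ha.ennrpow_const p
      rwa [ENNReal.zero_rpow_of_pos hp] at this
  rw [lintegral_zero] at h1
  have := h1.ennrpow_const (1 / p)
  rwa [ENNReal.zero_rpow_of_pos (by positivity)] at this

end lpn

/-- The mixed norm `L^p L^q` over the times in `I` of a nonnegative function. -/
noncomputable def mixedL {d : ℕ} (p q : ℝ) (I : Set ℝ) (f : ℝ → Space d → ℝ≥0∞) : ℝ≥0∞ :=
  lpn p (volume.restrict I) fun t => lpn q volume (f t)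

/-- The `ℓ²` sum over the channels of the mixed norms of a nonnegative function. -/
noncomputable def chanL {d : ℕ} (p q : ℝ) (I : Set ℝ) (f : ℝ → Space d → ℝ≥0∞) : ℝ≥0∞ :=
  lpn 2 Measure.count fun j : ℤ => mixedL p q I (channelCut j f)

theorem mixedNorm_eq {d : ℕ} {V : Type*} [NormedAddCommGroup V] {p q : ℝ} (I : Set ℝ)
    (u : ℝ → Space d → V) : mixedNorm p q I u = mixedL p q I fun t x => ‖u t x‖ₑ := by
  simp only [mixedNorm, mixedL, lpn]
  congr 2
  ext t
  rw [← ENNReal.rpow_mul]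
  congr 1
  ring

theorem enorm_channelCut {d : ℕ} {V : Type*} [NormedAddCommGroup V] (j : ℤ) (u : ℝ → Space d → V)
    (t : ℝ) (x : Space d) : ‖channelCut j u t x‖ₑ = channelCut j (fun t x => ‖u t x‖ₑ) t x := by
  simp only [channelCut, enorm_indicator_eq_indicator_enorm]

/-- The norms `Y` and `Z` depend on the absolute value of the function only. -/
theorem chan_eq {d : ℕ} {V : Type*} [NormedAddCommGroup V] {p q : ℝ} (I : Set ℝ)
    (u : ℝ → Space d → V) :
    (∑' j : ℤ, mixedNorm p q I (channelCut j u) ^ (2 : ℝ)) ^ (1 / 2 : ℝ)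
      = chanL p q I fun t x => ‖u t x‖ₑ := by
  simp only [mixedNorm_eq, enorm_channelCut, chanL, lpn]
  rw [lintegral_count]

theorem channelCut_of_mem {d : ℕ} {V : Type*} [Zero V] {j : ℤ} {f : ℝ → Space d → V} {t : ℝ}
    {x : Space d} (h : |t| + (2 : ℝ) ^ j ≤ ‖x‖ ∧ ‖x‖ < |t| + (2 : ℝ) ^ (j + 1)) :
    channelCut j f t x = f t x :=
  indicator_of_mem (s := {x | |t| + (2 : ℝ) ^ j ≤ ‖x‖ ∧ ‖x‖ < |t| + (2 : ℝ) ^ (j + 1)}) h _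

theorem channelCut_of_notMem {d : ℕ} {V : Type*} [Zero V] {j : ℤ} {f : ℝ → Space d → V} {t : ℝ}
    {x : Space d} (h : ¬ (|t| + (2 : ℝ) ^ j ≤ ‖x‖ ∧ ‖x‖ < |t| + (2 : ℝ) ^ (j + 1))) :
    channelCut j f t x = 0 :=
  indicator_of_notMem (s := {x | |t| + (2 : ℝ) ^ j ≤ ‖x‖ ∧ ‖x‖ < |t| + (2 : ℝ) ^ (j + 1)}) h _

section mixed

variable {d : ℕ} {p q : ℝ} {I : Set ℝ}

theorem measurable_channelCut {V : Type*} [Zero V] [MeasurableSpace V] {f : ℝ → Space d → V}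
    (hf : Measurable (Function.uncurry f)) (j : ℤ) :
    Measurable (Function.uncurry (channelCut j f)) := by
  have hs : MeasurableSet {z : ℝ × Space d |
      |z.1| + (2 : ℝ) ^ j ≤ ‖z.2‖ ∧ ‖z.2‖ < |z.1| + (2 : ℝ) ^ (j + 1)} :=
    (measurableSet_le (f := fun z : ℝ × Space d => |z.1| + (2 : ℝ) ^ j) (g := fun z => ‖z.2‖)
      (by fun_prop) (by fun_prop)).inter
    (measurableSet_lt (f := fun z : ℝ × Space d => ‖z.2‖)
      (g := fun z => |z.1| + (2 : ℝ) ^ (j + 1)) (by fun_prop) (by fun_prop))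
  exact hf.indicator hs

theorem measurable_extCut {V : Type*} [Zero V] [MeasurableSpace V] {f : ℝ → Space d → V}
    (hf : Measurable (Function.uncurry f)) (R : ℝ) :
    Measurable (Function.uncurry (extCut R f)) := by
  have hs : MeasurableSet {z : ℝ × Space d | R + |z.1| < ‖z.2‖} :=
    measurableSet_lt (f := fun z : ℝ × Space d => R + |z.1|) (g := fun z => ‖z.2‖)
      (by fun_prop) (by fun_prop)
  exact hf.indicator hs

theorem measurable_lpn_section {f : ℝ → Space d → ℝ≥0∞} (hf : Measurable (Function.uncurry f)) :
    Measurable fun t => lpn q volume (f t) := by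
  have h : Measurable fun z : ℝ × Space d => Function.uncurry f z ^ q := hf.pow_const q
  exact (h.lintegral_prod_right' (ν := volume)).pow_const _

theorem mixedL_mono (hp : 0 < p) (hq : 0 < q) {f g : ℝ → Space d → ℝ≥0∞}
    (h : ∀ᵐ t ∂(volume.restrict I), ∀ᵐ x, f t x ≤ g t x) : mixedL p q I f ≤ mixedL p q I g := by
  refine lpn_mono hp ?_
  filter_upwards [h] with t ht using lpn_mono hq ht

theorem mixedL_const_mul (hp : 0 < p) (hq : 0 < q) {c : ℝ≥0∞} (hc : c ≠ ⊤)
    (f : ℝ → Space d → ℝ≥0∞) : mixedL p q I (fun t x => c * f t x) = c * mixedL p q I f := by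
  simp only [mixedL, lpn_const_mul hq hc, lpn_const_mul hp hc]

theorem mixedL_add_le (hp : 1 ≤ p) (hq : 1 ≤ q) {f g : ℝ → Space d → ℝ≥0∞}
    (hf : Measurable (Function.uncurry f)) (hg : Measurable (Function.uncurry g)) :
    mixedL p q I (fun t x => f t x + g t x) ≤ mixedL p q I f + mixedL p q I g := by
  refine le_trans (lpn_mono (zero_lt_one.trans_le hp) (Filter.Eventually.of_forall fun t => ?_))
    (lpn_add_le hp (measurable_lpn_section hf).aemeasurable (measurable_lpn_section hg).aemeasurable)
  exact lpn_add_le hq (hf.comp measurable_prodMk_left).aemeasurable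
    (hg.comp measurable_prodMk_left).aemeasurable

theorem mixedL_tsum_le (hp : 1 ≤ p) (hq : 1 ≤ q) {f : ℕ → ℝ → Space d → ℝ≥0∞}
    (hf : ∀ n, Measurable (Function.uncurry (f n))) :
    mixedL p q I (fun t x => ∑' n, f n t x) ≤ ∑' n, mixedL p q I (f n) := by
  refine le_trans (lpn_mono (zero_lt_one.trans_le hp) (Filter.Eventually.of_forall fun t => ?_))
    (lpn_tsum_le hp fun n => measurable_lpn_section (hf n))
  exact lpn_tsum_le hq fun n => (hf n).comp measurable_prodMk_left

theorem channelCut_mono {f g : ℝ → Space d → ℝ≥0∞} {j : ℤ} {t : ℝ} {x : Space d}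
    (h : |t| < ‖x‖ → f t x ≤ g t x) : channelCut j f t x ≤ channelCut j g t x := by
  simp only [channelCut, indicator_apply]
  split_ifs with hx
  · exact h (lt_of_lt_of_le (lt_add_of_pos_right _ (by positivity)) hx.1)
  · exact le_rfl

theorem chanL_mono (hp : 0 < p) (hq : 0 < q) {f g : ℝ → Space d → ℝ≥0∞}
    (h : ∀ᵐ t ∂(volume.restrict I), ∀ᵐ x, |t| < ‖x‖ → f t x ≤ g t x) :
    chanL p q I f ≤ chanL p q I g := by
  refine lpn_mono two_pos (Filter.Eventually.of_forall fun j => mixedL_mono hp hq ?_)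
  filter_upwards [h] with t ht
  filter_upwards [ht] with x hx using channelCut_mono hx

theorem chanL_congr (hp : 0 < p) (hq : 0 < q) {f g : ℝ → Space d → ℝ≥0∞}
    (h : ∀ᵐ t ∂(volume.restrict I), ∀ᵐ x, |t| < ‖x‖ → f t x = g t x) :
    chanL p q I f = chanL p q I g := by
  refine le_antisymm (chanL_mono hp hq ?_) (chanL_mono hp hq ?_)
  · filter_upwards [h] with t ht
    filter_upwards [ht] with x hx hx' using (hx hx').le
  · filter_upwards [h] with t ht
    filter_upwards [ht] with x hx hx' using (hx hx').ge

theorem chanL_const_mul (hp : 0 < p) (hq : 0 < q) {c : ℝ≥0∞} (hc : c ≠ ⊤)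
    (f : ℝ → Space d → ℝ≥0∞) : chanL p q I (fun t x => c * f t x) = c * chanL p q I f := by
  have h : ∀ j : ℤ, channelCut j (fun t x => c * f t x) = fun t x => c * channelCut j f t x := by
    intro j; ext t x
    simp only [channelCut, indicator_apply]
    split_ifs <;> simp
  simp only [chanL, h, mixedL_const_mul hp hq hc, lpn_const_mul two_pos hc]

theorem chanL_add_le (hp : 1 ≤ p) (hq : 1 ≤ q) {f g : ℝ → Space d → ℝ≥0∞}
    (hf : Measurable (Function.uncurry f)) (hg : Measurable (Function.uncurry g)) :
    chanL p q I (fun t x => f t x + g t x) ≤ chanL p q I f + chanL p q I g := by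
  refine le_trans (lpn_mono two_pos (Filter.Eventually.of_forall fun j => ?_))
    (lpn_add_le one_le_two Measurable.of_discrete.aemeasurable Measurable.of_discrete.aemeasurable)
  have h : channelCut j (fun t x => f t x + g t x)
      = fun t x => channelCut j f t x + channelCut j g t x := by
    ext t x
    simp only [channelCut, indicator_apply]
    split_ifs <;> simp
  rw [h]
  exact mixedL_add_le hp hq (measurable_channelCut hf j) (measurable_channelCut hg j)

theorem chanL_tsum_le (hp : 1 ≤ p) (hq : 1 ≤ q) {f : ℕ → ℝ → Space d → ℝ≥0∞}
    (hf : ∀ n, Measurable (Function.uncurry (f n))) :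
    chanL p q I (fun t x => ∑' n, f n t x) ≤ ∑' n, chanL p q I (f n) := by
  refine le_trans (lpn_mono two_pos (Filter.Eventually.of_forall fun j => ?_))
    (lpn_tsum_le one_le_two fun n => Measurable.of_discrete)
  have h : channelCut j (fun t x => ∑' n, f n t x) = fun t x => ∑' n, channelCut j (f n) t x := by
    ext t x
    simp only [channelCut, indicator_apply]
    split_ifs <;> simp
  rw [h]
  exact mixedL_tsum_le hp hq fun n => measurable_channelCut (hf n) j

theorem mixedL_le_chanL (f : ℝ → Space d → ℝ≥0∞) (j : ℤ) :
    mixedL p q I (channelCut j f) ≤ chanL p q I f := by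
  have h : mixedL p q I (channelCut j f) ^ (2 : ℝ)
      ≤ ∑' j : ℤ, mixedL p q I (channelCut j f) ^ (2 : ℝ) :=
    ENNReal.le_tsum j
  have h2 := ENNReal.rpow_le_rpow h (by norm_num : (0 : ℝ) ≤ 1 / 2)
  rw [← ENNReal.rpow_mul] at h2
  norm_num at h2
  rw [chanL, lpn, lintegral_count]
  simpa using h2

/-- Every point outside the light cone belongs to a channel. -/
theorem exists_mem_channel {t r : ℝ} (h : |t| < r) :
    ∃ j : ℤ, |t| + (2 : ℝ) ^ j ≤ r ∧ r < |t| + (2 : ℝ) ^ (j + 1) := by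
  obtain ⟨j, h1, h2⟩ := exists_mem_Ico_zpow (sub_pos.mpr h) one_lt_two
  exact ⟨j, by linarith, by linarith⟩

/-- The channels cover the exterior of the light cone, so that a function of norm zero vanishes there. -/
theorem ae_eq_zero_of_chanL (hp : 0 < p) (hq : 0 < q) {f : ℝ → Space d → ℝ≥0∞}
    (hf : Measurable (Function.uncurry f)) (h : chanL p q I f = 0) :
    ∀ᵐ t ∂(volume.restrict I), ∀ᵐ x, |t| < ‖x‖ → f t x = 0 := by
  have h1 : ∀ j : ℤ, ∀ᵐ t ∂(volume.restrict I), ∀ᵐ x, channelCut j f t x = 0 := by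
    intro j
    have h2 : mixedL p q I (channelCut j f) = 0 := le_antisymm (h ▸ mixedL_le_chanL f j) zero_le
    have hm := measurable_channelCut hf j
    filter_upwards [ae_eq_zero_of_lpn hp (measurable_lpn_section hm) h2] with t ht
    exact ae_eq_zero_of_lpn hq (hm.comp measurable_prodMk_left) ht
  filter_upwards [ae_all_iff.mpr h1] with t ht
  filter_upwards [ae_all_iff.mpr ht] with x hx htx
  obtain ⟨j, hj⟩ := exists_mem_channel htx
  rw [← channelCut_of_mem (f := f) hj, hx j]

theorem tendsto_chanL_zero (hp : 0 < p) (hq : 0 < q) {f : ℕ → ℝ → Space d → ℝ≥0∞}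
    {g : ℝ → Space d → ℝ≥0∞} (hf : ∀ n, Measurable (Function.uncurry (f n)))
    (hg : Measurable (Function.uncurry g)) (hle : ∀ n t x, f n t x ≤ g t x)
    (hfin : chanL p q I g ≠ ⊤)
    (h : ∀ t x, g t x < ⊤ → Filter.Tendsto (fun n => f n t x) Filter.atTop (nhds 0)) :
    Filter.Tendsto (fun n => chanL p q I (f n)) Filter.atTop (nhds 0) := by
  have hcle : ∀ n j t x, channelCut j (f n) t x ≤ channelCut j g t x := fun n j t x =>
    channelCut_mono fun _ => hle n t x
  refine tendsto_lpn_zero two_pos (g := fun j : ℤ => mixedL p q I (channelCut j g))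
    (fun n => Measurable.of_discrete) (fun n => Filter.Eventually.of_forall fun j => ?_) hfin
    (Filter.Eventually.of_forall fun j => ?_)
  · exact mixedL_mono hp hq (Filter.Eventually.of_forall fun t =>
      Filter.Eventually.of_forall fun x => hcle n j t x)
  · have hgm := measurable_channelCut hg j
    have hfj : mixedL p q I (channelCut j g) ≠ ⊤ :=
      ne_top_of_le_ne_top hfin (mixedL_le_chanL g j)
    refine tendsto_lpn_zero hp (g := fun t => lpn q volume (channelCut j g t))
      (fun n => measurable_lpn_section (measurable_channelCut (hf n) j))
      (fun n => Filter.Eventually.of_forall fun t => lpn_mono hq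
        (Filter.Eventually.of_forall fun x => hcle n j t x)) hfj ?_
    filter_upwards [ae_lt_top_of_lpn hp (measurable_lpn_section hgm) hfj] with t ht
    have hgt : Measurable (channelCut j g t) := hgm.comp measurable_prodMk_left
    refine tendsto_lpn_zero hq (g := channelCut j g t)
      (fun n => (measurable_channelCut (hf n) j).comp measurable_prodMk_left)
      (fun n => Filter.Eventually.of_forall fun x => hcle n j t x) ht.ne ?_
    filter_upwards [ae_lt_top_of_lpn hq hgt ht.ne] with x hx
    simp only [channelCut, indicator_apply] at hx ⊢
    split_ifs at hx ⊢ with hc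
    · exact h t x hx
    · exact tendsto_const_nhds

/-- Restricting the time interval amounts to multiplying by a characteristic function. -/
theorem chanL_indicator (hp : 0 < p) (hq : 0 < q) {J : Set ℝ} (hJ : MeasurableSet J)
    (f : ℝ → Space d → ℝ≥0∞) :
    chanL p q I (fun t x => J.indicator (fun t => f t x) t) = chanL p q (I ∩ J) f := by
  simp only [chanL, mixedL]
  congr 1
  ext j
  simp only [lpn]
  rw [inter_comm, ← Measure.restrict_restrict hJ, ← lintegral_indicator hJ]
  congr 2
  ext t
  by_cases ht : t ∈ J
  · simp only [channelCut, indicator_of_mem ht]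
  · have h0 : (channelCut j (fun t (x : Space d) => J.indicator (fun t => f t x) t) t) = fun _ => 0 := by
      ext x
      simp [channelCut, ht]
    rw [h0, indicator_of_notMem ht]
    simp [ENNReal.zero_rpow_of_pos hq, ENNReal.zero_rpow_of_pos hp, hq]

theorem chanL_mono_set {J : Set ℝ} (hp : 0 < p) (hJ : J ⊆ I) (f : ℝ → Space d → ℝ≥0∞) :
    chanL p q J f ≤ chanL p q I f := by
  refine lpn_mono two_pos (Filter.Eventually.of_forall fun j => ?_)
  simp only [mixedL, lpn]
  exact ENNReal.rpow_le_rpow (lintegral_mono_set hJ) (by positivity)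

end mixed

/-! ### Dyadic majorants -/

/-- The exponent `p = (d + 2) / (d - 2)` for `d = 2k + 1`. -/
noncomputable def waveExp (k : ℕ) : ℝ := (2 * k + 3) / (2 * k - 1)

theorem one_lt_waveExp {k : ℕ} (hk : 1 ≤ k) : 1 < waveExp k := by
  have : (1 : ℝ) ≤ k := by exact_mod_cast hk
  rw [waveExp, lt_div_iff₀ (by linarith)]
  linarith

/-- With `p = waveExp k`, the norm `L^p L^(2p)` is scale invariant at the level of `Ḣ¹`; the second
identity is this invariance, and leaves the gain `2^(-1/2)` per octave between scale and channel. -/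
theorem mul_waveExp_sub_one {k : ℕ} (hk : 1 ≤ k) :
    2 < k * (waveExp k - 1) ∧ waveExp k / 2 + 1 - k * (waveExp k - 1) = -(1 / 2) := by
  have h : (1 : ℝ) ≤ k := by exact_mod_cast hk
  have h2 : (2 * k - 1 : ℝ) ≠ 0 := by linarith
  have h1 : (k : ℝ) * (waveExp k - 1) = 4 * k / (2 * k - 1) := by
    rw [waveExp, eq_div_iff h2, mul_assoc, sub_mul, div_mul_cancel₀ _ h2]; ring
  rw [h1]
  constructor
  · rw [lt_div_iff₀ (by linarith)]
    linarith
  · rw [waveExp]; field_simp; ring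

/-- The majorant `2^(i/2) max(r, 2^i)^(-k)` for the contribution of the dyadic scale `2^i`. -/
noncomputable def bump (k : ℕ) (i : ℤ) (r : ℝ) : ℝ≥0∞ :=
  ENNReal.ofReal ((2 : ℝ) ^ ((i : ℝ) / 2) / max r ((2 : ℝ) ^ i) ^ k)

theorem measurable_bump {k : ℕ} {i : ℤ} : Measurable (bump k i) := by
  unfold bump
  fun_prop

theorem measurable_bump_norm {d k : ℕ} {i : ℤ} :
    Measurable (Function.uncurry fun (_ : ℝ) (x : Space d) => bump k i ‖x‖) :=
  measurable_bump.comp (measurable_norm.comp measurable_snd)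

/-- The polar density `r^(2k)` is absorbed by the decay of the majorant, and the remaining negative
power of `max(r, 2^i)` is largest at the tip `r = |t|` of the exterior region. -/
theorem bump_rpow_le {k : ℕ} (hk : 1 ≤ k) {i : ℤ} {t r : ℝ} (ht : |t| ≤ r) :
    ENNReal.ofReal (r ^ (2 * k)) * bump k i r ^ (2 * waveExp k)
      ≤ ENNReal.ofReal ((2 : ℝ) ^ ((i : ℝ) * waveExp k) *
        (max |t| ((2 : ℝ) ^ i)) ^ (-(2 * (k * (waveExp k - 1))))) := by
  have hp := one_lt_waveExp hk
  have he := (mul_waveExp_sub_one hk).1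
  have hr : 0 ≤ r := (abs_nonneg t).trans ht
  have h2i : (0 : ℝ) < 2 ^ i := by positivity
  set M := max r ((2 : ℝ) ^ i) with hM
  have hM0 : 0 < M := lt_max_of_lt_right h2i
  have hN0 : 0 < max |t| ((2 : ℝ) ^ i) := lt_max_of_lt_right h2i
  rw [bump, ENNReal.ofReal_rpow_of_nonneg (by positivity) (by positivity),
    ← ENNReal.ofReal_mul (by positivity)]
  refine ENNReal.ofReal_le_ofReal ?_
  rw [Real.div_rpow (by positivity) (by positivity), ← Real.rpow_mul (by norm_num),
    ← Real.rpow_natCast, ← Real.rpow_natCast, ← Real.rpow_mul hM0.le]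
  calc r ^ ((2 * k : ℕ) : ℝ) * ((2 : ℝ) ^ ((i : ℝ) / 2 * (2 * waveExp k))
        / M ^ ((k : ℝ) * (2 * waveExp k)))
      ≤ M ^ ((2 * k : ℕ) : ℝ) * ((2 : ℝ) ^ ((i : ℝ) / 2 * (2 * waveExp k))
        / M ^ ((k : ℝ) * (2 * waveExp k))) := by
        gcongr
        exact le_max_left _ _
    _ = (2 : ℝ) ^ ((i : ℝ) * waveExp k) * M ^ (-(2 * (k * (waveExp k - 1)))) := by
        rw [show (-(2 * (k * (waveExp k - 1)))) = ((2 * k : ℕ) : ℝ) - (k : ℝ) * (2 * waveExp k) by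
          push_cast; ring, Real.rpow_sub hM0,
          show (i : ℝ) / 2 * (2 * waveExp k) = (i : ℝ) * waveExp k by ring]
        ring
    _ ≤ _ := by
        refine mul_le_mul_of_nonneg_left ?_ (by positivity)
        exact Real.rpow_le_rpow_of_nonpos hN0 (max_le_max_right _ ht) (by linarith)

/-- At fixed time the channel `j` is a shell of thickness `2^j`, on which the majorant at scale `2^i` is
bounded by its value at the light cone. -/
theorem lpn_channelCut_bump_le {k : ℕ} (hk : 1 ≤ k) (i j : ℤ) (t : ℝ) :
    lpn (2 * waveExp k) volume (channelCut j (fun _ (x : Space (2 * k + 1)) => bump k i ‖x‖) t)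
      ^ waveExp k ≤ sphereMeasure (2 * k + 1) univ ^ (1 / 2 : ℝ) *
        ENNReal.ofReal ((2 : ℝ) ^ ((j : ℝ) / 2 + (i : ℝ) * waveExp k / 2) *
          (max |t| ((2 : ℝ) ^ i)) ^ (-(k * (waveExp k - 1)))) := by
  have hp := one_lt_waveExp hk
  have h2i : (0 : ℝ) < 2 ^ i := by positivity
  have hN0 : 0 < max |t| ((2 : ℝ) ^ i) := lt_max_of_lt_right h2i
  set A : ℝ := (2 : ℝ) ^ ((i : ℝ) * waveExp k) *
        (max |t| ((2 : ℝ) ^ i)) ^ (-(2 * (k * (waveExp k - 1)))) with hA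
  set S := Ico (|t| + (2 : ℝ) ^ j) (|t| + (2 : ℝ) ^ (j + 1)) with hS
  have h1 : ∫⁻ x, channelCut j (fun _ (x : Space (2 * k + 1)) => bump k i ‖x‖) t x
      ^ (2 * waveExp k) ≤ sphereMeasure (2 * k + 1) univ * ENNReal.ofReal ((2 : ℝ) ^ j * A) := by
    have h2 : ∀ x, channelCut j (fun _ (x : Space (2 * k + 1)) => bump k i ‖x‖) t x
        ^ (2 * waveExp k) = (fun r => S.indicator (fun r => bump k i r ^ (2 * waveExp k)) r) ‖x‖ := by
      intro x
      simp only [channelCut, indicator_apply, hS, mem_Ico, mem_ofPred_eq]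
      split_ifs
      · rfl
      · rw [ENNReal.zero_rpow_of_pos (by linarith)]
    simp_rw [h2]
    rw [lintegral_norm_eq (f := fun r => S.indicator (fun r => bump k i r ^ (2 * waveExp k)) r)
      (by omega) ((measurable_bump.pow_const _).indicator measurableSet_Ico)]
    gcongr
    calc _ ≤ ∫⁻ r, S.indicator (fun _ => ENNReal.ofReal A) r := by
          refine (setLIntegral_mono' measurableSet_Ioi fun r _ => ?_).trans
            (setLIntegral_le_lintegral _ _)
          simp only [indicator_apply]
          split_ifs with hr
          · exact bump_rpow_le hk (le_trans (by linarith [zpow_pos (two_pos (α := ℝ)) j]) hr.1)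
          · simp
      _ = ENNReal.ofReal A * ENNReal.ofReal ((2 : ℝ) ^ j) := by
          rw [lintegral_indicator measurableSet_Ico, setLIntegral_const, Real.volume_Ico]
          congr 2
          rw [zpow_add₀ two_ne_zero]
          ring
      _ ≤ _ := by
          rw [← ENNReal.ofReal_mul (by positivity), mul_comm]
  rw [lpn, ← ENNReal.rpow_mul,
    show 1 / (2 * waveExp k) * waveExp k = 1 / 2 by field_simp]
  refine (ENNReal.rpow_le_rpow h1 (by norm_num)).trans (le_of_eq ?_)
  rw [ENNReal.mul_rpow_of_nonneg _ _ (by norm_num),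
    ENNReal.ofReal_rpow_of_nonneg (by positivity) (by norm_num)]
  congr 2
  rw [hA, Real.mul_rpow (by positivity) (by positivity),
    Real.mul_rpow (by positivity) (by positivity), ← Real.rpow_mul hN0.le,
    ← Real.rpow_mul (by norm_num), ← Real.rpow_intCast, ← Real.rpow_mul (by norm_num),
    ← mul_assoc, ← Real.rpow_add two_pos]
  congr 2 <;> ring

/-- The integral of `max(|t|, M)^(-e)` scales like `M^(1 - e)`. -/
theorem lintegral_max_rpow_le {e : ℝ} (he : 1 < e) : ∃ c : ℝ≥0∞, c ≠ ⊤ ∧ ∀ M : ℝ, 0 < M →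
    ∫⁻ t : ℝ, ENNReal.ofReal ((max |t| M) ^ (-e)) ≤ c * ENNReal.ofReal (M ^ (1 - e)) := by
  refine ⟨∫⁻ t : ℝ, ENNReal.ofReal ((max |t| 1) ^ (-e)), ?_, fun M hM => ?_⟩
  · have h1 := finite_integral_one_add_norm (E := ℝ) (μ := volume) (r := e)
      (by simpa using he)
    refine ne_top_of_le_ne_top (ENNReal.mul_ne_top (ENNReal.ofReal_ne_top (r := 2 ^ e)) h1.ne) ?_
    rw [← lintegral_const_mul' _ _ ENNReal.ofReal_ne_top]
    refine lintegral_mono fun t => ?_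
    rw [← ENNReal.ofReal_mul (by positivity)]
    refine ENNReal.ofReal_le_ofReal ?_
    have h0 : 0 < max |t| 1 := lt_max_of_lt_right one_pos
    have hle : (1 + ‖t‖) / 2 ≤ max |t| 1 := by
      rw [Real.norm_eq_abs]
      have := le_max_left |t| 1
      have := le_max_right |t| 1
      linarith
    refine (Real.rpow_le_rpow_of_nonpos (by positivity) hle (by linarith)).trans (le_of_eq ?_)
    rw [Real.div_rpow (by positivity) (by norm_num), Real.rpow_neg two_pos.le]
    field_simp
  · have h1 : ∫⁻ s : ℝ, ENNReal.ofReal ((max |M * s| M) ^ (-e))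
        = ENNReal.ofReal (M⁻¹) * ∫⁻ t : ℝ, ENNReal.ofReal ((max |t| M) ^ (-e)) := by
      have hmeas : Measurable fun t : ℝ => ENNReal.ofReal ((max |t| M) ^ (-e)) := by fun_prop
      rw [← lintegral_map (f := fun t : ℝ => ENNReal.ofReal ((max |t| M) ^ (-e)))
        (g := fun s => M * s) hmeas (by fun_prop), Real.map_volume_mul_left hM.ne',
        lintegral_smul_measure, abs_of_pos (inv_pos.mpr hM)]
      rfl
    have h2 : ∀ s : ℝ, ENNReal.ofReal ((max |M * s| M) ^ (-e))
        = ENNReal.ofReal (M ^ (-e)) * ENNReal.ofReal ((max |s| 1) ^ (-e)) := by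
      intro s
      have h0 : 0 < max |s| 1 := lt_max_of_lt_right one_pos
      rw [← ENNReal.ofReal_mul (by positivity), ← Real.mul_rpow hM.le h0.le,
        mul_max_of_nonneg _ _ hM.le, mul_one, abs_mul, abs_of_pos hM]
    simp_rw [h2] at h1
    rw [lintegral_const_mul' _ _ ENNReal.ofReal_ne_top] at h1
    have h3 : ∫⁻ t : ℝ, ENNReal.ofReal ((max |t| M) ^ (-e))
        = ENNReal.ofReal M * (ENNReal.ofReal (M⁻¹) *
          ∫⁻ t : ℝ, ENNReal.ofReal ((max |t| M) ^ (-e))) := by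
      rw [← mul_assoc, ← ENNReal.ofReal_mul hM.le, mul_inv_cancel₀ hM.ne', ENNReal.ofReal_one,
        one_mul]
    rw [h3, ← h1, ← mul_assoc, ← ENNReal.ofReal_mul hM.le, mul_comm]
    gcongr
    rw [sub_eq_add_neg, Real.rpow_add hM, Real.rpow_one]

/-- The ratio of the geometric series that controls the interaction of different channels. -/
noncomputable def chanRatio (k : ℕ) : ℝ≥0∞ := ENNReal.ofReal ((2 : ℝ) ^ (-(1 / (2 * waveExp k))))

theorem chanRatio_lt_one {k : ℕ} (hk : 1 ≤ k) : chanRatio k < 1 := by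
  have hp := one_lt_waveExp hk
  rw [chanRatio, ENNReal.ofReal_lt_one]
  exact Real.rpow_lt_one_of_one_lt_of_neg one_lt_two (by
    have : 0 < 1 / (2 * waveExp k) := by positivity
    linarith)

/-- The contribution of the scale `2^(j + m)` decays geometrically in the channel `j`. -/
theorem exists_mixedL_bump_le {k : ℕ} (hk : 1 ≤ k) : ∃ K : ℝ≥0∞, K ≠ ⊤ ∧
    ∀ (I : Set ℝ) (j : ℤ) (m : ℕ), mixedL (waveExp k) (2 * waveExp k) I
      (channelCut j (fun _ (x : Space (2 * k + 1)) => bump k (j + m) ‖x‖)) ≤ K * chanRatio k ^ m := by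
  have hp := one_lt_waveExp hk
  have hp0 : 0 < waveExp k := by linarith
  obtain ⟨he, hexp⟩ := mul_waveExp_sub_one hk
  obtain ⟨c, hc, hcM⟩ := lintegral_max_rpow_le (e := k * (waveExp k - 1)) (by linarith)
  set σ := sphereMeasure (2 * k + 1) univ with hσ
  have hσt : σ ^ (1 / 2 : ℝ) ≠ ⊤ :=
    ENNReal.rpow_ne_top_of_nonneg (by norm_num) (measure_ne_top _ _)
  refine ⟨(σ ^ (1 / 2 : ℝ) * c) ^ (1 / waveExp k), ENNReal.rpow_ne_top_of_nonneg (by positivity)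
    (ENNReal.mul_ne_top hσt hc), fun I j m => ?_⟩
  have h1 : ∫⁻ t in I, lpn (2 * waveExp k) volume
      (channelCut j (fun _ (x : Space (2 * k + 1)) => bump k (j + m) ‖x‖) t) ^ waveExp k
      ≤ σ ^ (1 / 2 : ℝ) * c * ENNReal.ofReal ((2 : ℝ) ^ (-(1 / 2 : ℝ) * m)) := by
    calc _ ≤ ∫⁻ t, σ ^ (1 / 2 : ℝ) *
        (ENNReal.ofReal ((2 : ℝ) ^ ((j : ℝ) / 2 + ((j + m : ℤ) : ℝ) * waveExp k / 2)) *
          ENNReal.ofReal ((max |t| ((2 : ℝ) ^ (j + m : ℤ))) ^ (-(k * (waveExp k - 1))))) := by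
          refine (lintegral_mono fun t => ?_).trans (setLIntegral_le_lintegral _ _)
          refine (lpn_channelCut_bump_le hk (j + m) j t).trans ?_
          rw [ENNReal.ofReal_mul (by positivity)]
      _ ≤ σ ^ (1 / 2 : ℝ) * (ENNReal.ofReal ((2 : ℝ) ^ ((j : ℝ) / 2 +
          ((j + m : ℤ) : ℝ) * waveExp k / 2)) * (c * ENNReal.ofReal
          (((2 : ℝ) ^ (j + m : ℤ)) ^ (1 - k * (waveExp k - 1))))) := by
          rw [lintegral_const_mul' _ _ hσt, lintegral_const_mul' _ _ ENNReal.ofReal_ne_top]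
          gcongr
          exact hcM _ (by positivity)
      _ = σ ^ (1 / 2 : ℝ) * c * (ENNReal.ofReal ((2 : ℝ) ^ ((j : ℝ) / 2 +
          ((j + m : ℤ) : ℝ) * waveExp k / 2)) * ENNReal.ofReal
          (((2 : ℝ) ^ (j + m : ℤ)) ^ (1 - k * (waveExp k - 1)))) := by ring
      _ = _ := by
          rw [← ENNReal.ofReal_mul (by positivity), ← Real.rpow_intCast, ← Real.rpow_mul two_pos.le,
            ← Real.rpow_add two_pos]
          congr 3
          have h3 : (1 : ℝ) - k * (waveExp k - 1) = -(1 / 2) - waveExp k / 2 := by linarith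
          rw [h3]
          push_cast
          ring
  rw [mixedL, lpn]
  refine (ENNReal.rpow_le_rpow h1 (by positivity)).trans (le_of_eq ?_)
  rw [ENNReal.mul_rpow_of_nonneg _ _ (by positivity),
    ENNReal.ofReal_rpow_of_nonneg (by positivity) (by positivity), chanRatio,
    ← ENNReal.ofReal_pow (by positivity), ← Real.rpow_natCast, ← Real.rpow_mul two_pos.le,
    ← Real.rpow_mul two_pos.le]
  congr 3
  field_simp

theorem lpn_count_shift (a : ℤ → ℝ≥0∞) (m : ℤ) :
    lpn 2 Measure.count (fun j => a (j + m)) = lpn 2 Measure.count a := by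
  rw [lpn, lpn, lintegral_count, lintegral_count]
  congr 1
  exact (Equiv.addRight m).tsum_eq fun j => a j ^ (2 : ℝ)

/-- A function that is dominated in each channel by the contributions of the larger scales is
controlled by the `ℓ²` norm of the coefficients. -/
theorem exists_chanL_le_of_bump {k : ℕ} (hk : 1 ≤ k) : ∃ K : ℝ≥0∞, K ≠ ⊤ ∧
    ∀ (I : Set ℝ) (f : ℝ → Space (2 * k + 1) → ℝ≥0∞) (a : ℤ → ℝ≥0∞), (∀ i, a i ≠ ⊤) →
      (∀ᵐ t ∂(volume.restrict I), ∀ᵐ x : Space (2 * k + 1), ∀ j : ℤ,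
        |t| + (2 : ℝ) ^ j ≤ ‖x‖ → ‖x‖ < |t| + (2 : ℝ) ^ (j + 1) →
        f t x ≤ ∑' m : ℕ, a (j + m) * bump k (j + m) ‖x‖) →
      chanL (waveExp k) (2 * waveExp k) I f ≤ K * lpn 2 Measure.count a := by
  have hp := one_lt_waveExp hk
  have hp0 : 0 < waveExp k := by linarith
  obtain ⟨K, hK, hKb⟩ := exists_mixedL_bump_le hk
  refine ⟨K * (1 - chanRatio k)⁻¹, ENNReal.mul_ne_top hK (ENNReal.inv_ne_top.mpr
    (tsub_pos_of_lt (chanRatio_lt_one hk)).ne'), fun I f a ha hf => ?_⟩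
  have h1 : ∀ j : ℤ, mixedL (waveExp k) (2 * waveExp k) I (channelCut j f)
      ≤ ∑' m : ℕ, K * chanRatio k ^ m * a (j + m) := by
    intro j
    calc _ ≤ mixedL (waveExp k) (2 * waveExp k) I (fun t (x : Space (2 * k + 1)) =>
          ∑' m : ℕ, a (j + m) * channelCut j (fun _ (x : Space (2 * k + 1)) =>
            bump k (j + m) ‖x‖) t x) := by
          refine mixedL_mono hp0 (by linarith) ?_
          filter_upwards [hf] with t ht
          filter_upwards [ht] with x hx
          by_cases hc : |t| + (2 : ℝ) ^ j ≤ ‖x‖ ∧ ‖x‖ < |t| + (2 : ℝ) ^ (j + 1)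
          · simp_rw [channelCut_of_mem hc]
            exact hx j hc.1 hc.2
          · rw [channelCut_of_notMem hc]
            exact zero_le
      _ ≤ ∑' m : ℕ, mixedL (waveExp k) (2 * waveExp k) I (fun t (x : Space (2 * k + 1)) =>
          a (j + m) * channelCut j (fun _ (x : Space (2 * k + 1)) =>
            bump k (j + m) ‖x‖) t x) :=
          mixedL_tsum_le hp.le (by linarith) fun m =>
            (measurable_channelCut measurable_bump_norm j).const_mul _
      _ ≤ _ := by
          refine ENNReal.tsum_le_tsum fun m => ?_
          rw [mixedL_const_mul hp0 (by linarith) (ha _), mul_comm]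
          gcongr
          exact hKb I j m
  -- Minkowski in the offset `m` of the scales, and the shift invariance of the `ℓ²` norm, leave a
  -- geometric series
  calc _ ≤ lpn 2 Measure.count fun j : ℤ => ∑' m : ℕ, K * chanRatio k ^ m * a (j + m) :=
        lpn_mono two_pos (Filter.Eventually.of_forall h1)
    _ ≤ ∑' m : ℕ, lpn 2 Measure.count fun j : ℤ => K * chanRatio k ^ m * a (j + m) :=
        lpn_tsum_le one_le_two fun m => Measurable.of_discrete
    _ = ∑' m : ℕ, K * chanRatio k ^ m * lpn 2 Measure.count a := by
        congr 1
        ext m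
        rw [lpn_const_mul two_pos (ENNReal.mul_ne_top hK
          (ENNReal.pow_ne_top (chanRatio_lt_one hk).ne_top)) fun j : ℤ => a (j + m),
          lpn_count_shift]
    _ = _ := by
        rw [ENNReal.tsum_mul_right, ENNReal.tsum_mul_left, ENNReal.tsum_geometric]

/-! ### Dyadic bounds for the explicit kernel -/

/-- A point at distance at least `2^j` from the light cone lies in a channel with index at least `j`. -/
theorem exists_channel_ge {j : ℤ} {t r : ℝ} (h : |t| + (2 : ℝ) ^ j ≤ r) :
    ∃ m : ℕ, |t| + (2 : ℝ) ^ (j + m) ≤ r ∧ r < |t| + (2 : ℝ) ^ (j + m + 1) := by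
  obtain ⟨i, h1, h2⟩ := exists_mem_channel
    ((lt_add_of_pos_right |t| (zpow_pos (two_pos (α := ℝ)) j)).trans_le h)
  have hlt : (2 : ℝ) ^ j < 2 ^ (i + 1) := by linarith
  have hji : j ≤ i := by
    have := (zpow_lt_zpow_iff_right₀ (one_lt_two (α := ℝ))).mp hlt
    omega
  obtain ⟨m, rfl⟩ := Int.exists_add_of_le hji
  exact ⟨m, h1, h2⟩

/-- The weight `|y|^(-2k)` has integral `2^i` over each channel, up to a constant. -/
theorem lintegral_channelCut_weight_le {k : ℕ} (i : ℤ) (τ : ℝ) :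
    ∫⁻ y, channelCut i (fun _ (y : Space (2 * k + 1)) => ENNReal.ofReal (1 / ‖y‖ ^ k)) τ y ^ (2 : ℝ)
      ≤ sphereMeasure (2 * k + 1) univ * ENNReal.ofReal ((2 : ℝ) ^ i) := by
  set S := Ico (|τ| + (2 : ℝ) ^ i) (|τ| + (2 : ℝ) ^ (i + 1)) with hS
  have h2 : ∀ y, channelCut i (fun _ (y : Space (2 * k + 1)) => ENNReal.ofReal (1 / ‖y‖ ^ k)) τ y
      ^ (2 : ℝ) = (fun r => S.indicator (fun r => ENNReal.ofReal (1 / r ^ k) ^ (2 : ℝ)) r) ‖y‖ := by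
    intro y
    simp only [channelCut, indicator_apply, hS, mem_Ico, mem_ofPred_eq]
    split_ifs
    · rfl
    · rw [ENNReal.zero_rpow_of_pos two_pos]
  simp_rw [h2]
  rw [lintegral_norm_eq (f := fun r => S.indicator (fun r => ENNReal.ofReal (1 / r ^ k) ^ (2 : ℝ)) r)
    (by omega) (Measurable.indicator (by fun_prop) measurableSet_Ico)]
  gcongr
  calc _ ≤ ∫⁻ r, S.indicator (fun _ => 1) r := by
        refine (setLIntegral_mono' measurableSet_Ioi fun r hr => ?_).trans
          (setLIntegral_le_lintegral _ _)
        have hr0 : (0 : ℝ) < r := hr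
        simp only [indicator_apply]
        split_ifs
        · rw [ENNReal.ofReal_rpow_of_nonneg (by positivity) (by norm_num),
            ← ENNReal.ofReal_mul (by positivity), ENNReal.ofReal_le_one, Real.rpow_two,
            Nat.add_sub_cancel]
          refine le_of_eq ?_
          field_simp
          ring
        · simp
    _ = ENNReal.ofReal ((2 : ℝ) ^ i) := by
        rw [lintegral_indicator measurableSet_Ico, setLIntegral_one, Real.volume_Ico]
        congr 1
        rw [zpow_add₀ two_ne_zero]
        ring

/-- For scales `2^i` below `2r` the maximum in the majorant is comparable to `r`. -/
theorem one_div_pow_mul_le_bump {k : ℕ} {i : ℤ} {r : ℝ} (hr : (2 : ℝ) ^ i < 2 * r) :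
    ENNReal.ofReal (1 / r ^ k) * ENNReal.ofReal ((2 : ℝ) ^ ((i : ℝ) / 2)) ≤ 2 ^ k * bump k i r := by
  have h2i : (0 : ℝ) < 2 ^ i := by positivity
  have hr0 : 0 < r := by linarith
  have hM0 : 0 < max r ((2 : ℝ) ^ i) := lt_max_of_lt_right h2i
  rw [bump, ← ENNReal.ofReal_mul (by positivity),
    show (2 : ℝ≥0∞) ^ k = ENNReal.ofReal ((2 : ℝ) ^ k) by
      rw [ENNReal.ofReal_pow two_pos.le, ENNReal.ofReal_ofNat],
    ← ENNReal.ofReal_mul (by positivity)]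
  refine ENNReal.ofReal_le_ofReal ?_
  have hM : max r ((2 : ℝ) ^ i) ≤ 2 * r := max_le (by linarith) hr.le
  have h1 : max r ((2 : ℝ) ^ i) ^ k ≤ 2 ^ k * r ^ k := by
    rw [← mul_pow]; gcongr
  rw [one_div_mul_eq_div, ← mul_div_assoc, div_le_div_iff₀ (by positivity) (by positivity)]
  have h3 : (0 : ℝ) ≤ (2 : ℝ) ^ ((i : ℝ) / 2) := by positivity
  nlinarith

/-- Splitting the domain of the kernel into the channels at time `τ`, and Cauchy-Schwarz in each. Finite
speed of propagation enters through `hj`: only channels of index at least `j` are met. -/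
theorem kernel_le_bump {k : ℕ} {g : ℝ → Space (2 * k + 1) → ℝ≥0∞}
    (hg : Measurable (Function.uncurry g)) {x : Space (2 * k + 1)} {s τ : ℝ} {j : ℤ}
    (hj : |τ| + (2 : ℝ) ^ j + s ≤ ‖x‖) :
    ENNReal.ofReal (1 / ‖x‖ ^ k) * ∫⁻ y in {y : Space (2 * k + 1) | |‖x‖ - ‖y‖| < s},
        ENNReal.ofReal (1 / ‖y‖ ^ k) * g τ y
      ≤ 2 ^ k * sphereMeasure (2 * k + 1) univ ^ (1 / 2 : ℝ) *
        ∑' m : ℕ, lpn 2 volume (channelCut (j + m) g τ) * bump k (j + m) ‖x‖ := by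
  set W : ℤ → Space (2 * k + 1) → ℝ≥0∞ := fun i =>
    channelCut i (fun _ (y : Space (2 * k + 1)) => ENNReal.ofReal (1 / ‖y‖ ^ k)) τ with hW
  have hWm : ∀ i, Measurable (W i) := fun i =>
    (measurable_channelCut (f := fun (_ : ℝ) (y : Space (2 * k + 1)) => ENNReal.ofReal (1 / ‖y‖ ^ k))
      (by unfold Function.uncurry; fun_prop) i).comp measurable_prodMk_left
  have hgm : ∀ i, Measurable (channelCut i g τ) := fun i =>
    (measurable_channelCut hg i).comp measurable_prodMk_left
  have h1 : ∫⁻ y in {y : Space (2 * k + 1) | |‖x‖ - ‖y‖| < s}, ENNReal.ofReal (1 / ‖y‖ ^ k) * g τ y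
      ≤ ∑' m : ℕ, if (2 : ℝ) ^ (j + m) < 2 * ‖x‖ then
        ∫⁻ y, W (j + m) y * channelCut (j + m) g τ y else 0 := by
    calc _ ≤ ∫⁻ y, ∑' m : ℕ, if (2 : ℝ) ^ (j + m) < 2 * ‖x‖ then
          W (j + m) y * channelCut (j + m) g τ y else 0 := by
          rw [← lintegral_indicator (measurableSet_lt (by fun_prop) (by fun_prop))]
          refine lintegral_mono fun y => ?_
          by_cases hy : |‖x‖ - ‖y‖| < s
          · rw [indicator_of_mem (show y ∈ {y : Space (2 * k + 1) | |‖x‖ - ‖y‖| < s} from hy)]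
            have hy' := abs_lt.mp hy
            obtain ⟨m, hm1, hm2⟩ := exists_channel_ge (j := j) (t := τ) (r := ‖y‖) (by linarith)
            refine le_trans ?_ (ENNReal.le_tsum m)
            have hlt : (2 : ℝ) ^ (j + m) < 2 * ‖x‖ := by
              have := abs_nonneg τ
              have := zpow_pos (two_pos (α := ℝ)) j
              linarith
            rw [if_pos hlt, hW]
            simp only
            rw [channelCut_of_mem ⟨hm1, hm2⟩, channelCut_of_mem ⟨hm1, hm2⟩]
          · rw [indicator_of_notMem (show y ∉ {y : Space (2 * k + 1) | |‖x‖ - ‖y‖| < s} from hy)]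
            exact zero_le
      _ = _ := by
          rw [lintegral_tsum]
          · congr 1
            ext m
            split_ifs <;> simp
          · intro m
            split_ifs
            · exact ((hWm _).mul (hgm _)).aemeasurable
            · exact aemeasurable_const
  calc _ ≤ ENNReal.ofReal (1 / ‖x‖ ^ k) * ∑' m : ℕ, (if (2 : ℝ) ^ (j + m) < 2 * ‖x‖ then
        ∫⁻ y, W (j + m) y * channelCut (j + m) g τ y else 0) := by gcongr
    _ ≤ _ := by
        rw [← ENNReal.tsum_mul_left, ← ENNReal.tsum_mul_left]
        refine ENNReal.tsum_le_tsum fun m => ?_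
        split_ifs with hlt
        · have h2 := lintegral_mul_le_of_two (μ := volume) (hWm (j + m)).aemeasurable
            (hgm (j + m)).aemeasurable
          have h3 := ENNReal.rpow_le_rpow (lintegral_channelCut_weight_le (k := k) (j + m) τ)
            (by norm_num : (0 : ℝ) ≤ 1 / 2)
          rw [ENNReal.mul_rpow_of_nonneg _ _ (by norm_num),
            ENNReal.ofReal_rpow_of_nonneg (by positivity) (by norm_num), ← Real.rpow_intCast,
            ← Real.rpow_mul two_pos.le, mul_one_div] at h3
          calc ENNReal.ofReal (1 / ‖x‖ ^ k) * ∫⁻ y, W (j + m) y * channelCut (j + m) g τ y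
              ≤ ENNReal.ofReal (1 / ‖x‖ ^ k) * ((sphereMeasure (2 * k + 1) univ ^ (1 / 2 : ℝ) *
                ENNReal.ofReal ((2 : ℝ) ^ (((j + m : ℤ) : ℝ) / 2))) *
                lpn 2 volume (channelCut (j + m) g τ)) := by
                gcongr
                exact h2.trans (mul_le_mul_left h3 _)
            _ = (ENNReal.ofReal (1 / ‖x‖ ^ k) * ENNReal.ofReal ((2 : ℝ) ^ (((j + m : ℤ) : ℝ) / 2)))
                * (sphereMeasure (2 * k + 1) univ ^ (1 / 2 : ℝ) *
                lpn 2 volume (channelCut (j + m) g τ)) := by ring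
            _ ≤ (2 ^ k * bump k (j + m) ‖x‖) * (sphereMeasure (2 * k + 1) univ ^ (1 / 2 : ℝ) *
                lpn 2 volume (channelCut (j + m) g τ)) :=
                mul_le_mul_left (one_div_pow_mul_le_bump hlt) _
            _ = _ := by ring
        · simp

/-- The bound for the explicit kernel in terms of the channels of the source. -/
theorem exists_lintegral_waveKernel_le_bump {k : ℕ} (hk : 1 ≤ k) : ∃ C : ℝ≥0∞, C ≠ ⊤ ∧
    ∀ (G : ℝ → Space (2 * k + 1) → ℝ), Measurable (Function.uncurry G) →
      ∀ (x : Space (2 * k + 1)) (s τ : ℝ) (j : ℤ), 0 < s → |τ| + (2 : ℝ) ^ j + s ≤ ‖x‖ →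
      ∫⁻ y, ‖waveKernel k 0 s ‖x‖ ‖y‖ * G τ y‖ₑ ≤ C * ∑' m : ℕ,
        lpn 2 volume (channelCut (j + m) (fun τ y => ‖G τ y‖ₑ) τ) * bump k (j + m) ‖x‖ := by
  obtain ⟨C, hC0, hC⟩ := exists_lintegral_waveKernel_le hk
  refine ⟨ENNReal.ofReal C * (2 ^ k * sphereMeasure (2 * k + 1) univ ^ (1 / 2 : ℝ)),
    ENNReal.mul_ne_top ENNReal.ofReal_ne_top (ENNReal.mul_ne_top (by simp)
      (ENNReal.rpow_ne_top_of_nonneg (by norm_num) (measure_ne_top _ _))), ?_⟩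
  intro G hG x s τ j hs hj
  have hsx : s < ‖x‖ := by
    have := abs_nonneg τ
    have := zpow_pos (two_pos (α := ℝ)) j
    linarith
  refine (hC s (G τ) x hs hsx).trans ?_
  rw [div_eq_mul_one_div, ENNReal.ofReal_mul hC0, mul_assoc, mul_assoc (ENNReal.ofReal C)]
  refine mul_le_mul_right ?_ _
  exact kernel_le_bump (g := fun τ y => ‖G τ y‖ₑ) hG.enorm hj

/-- The kernel of the Duhamel integral is controlled by the `L¹L²` norms of the source in the larger
channels. -/
theorem exists_lintegral_duhamel_le_bump {k : ℕ} (hk : 1 ≤ k) : ∃ C : ℝ≥0∞, C ≠ ⊤ ∧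
    ∀ (G : ℝ → Space (2 * k + 1) → ℝ), Measurable (Function.uncurry G) →
      ∀ (I : Set ℝ) (t : ℝ) (x : Space (2 * k + 1)) (j : ℤ), Ι 0 t ⊆ I →
        |t| + (2 : ℝ) ^ j ≤ ‖x‖ →
        (∫⁻ τ in Ι 0 t, ∫⁻ y, ‖waveKernel k 0 |t - τ| ‖x‖ ‖y‖ * G τ y‖ₑ) ≤ C * ∑' m : ℕ,
          mixedL 1 2 I (channelCut (j + m) fun τ y => ‖G τ y‖ₑ) * bump k (j + m) ‖x‖ := by
  obtain ⟨C, hC, hCb⟩ := exists_lintegral_waveKernel_le_bump hk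
  refine ⟨C, hC, fun G hG I t x j hI hj => ?_⟩
  have hm : ∀ i, Measurable fun τ => lpn 2 volume (channelCut i (fun τ y => ‖G τ y‖ₑ) τ) := fun i =>
    measurable_lpn_section (measurable_channelCut (f := fun τ y => ‖G τ y‖ₑ) hG.enorm i)
  have hmix : ∀ i, ∫⁻ τ in Ι 0 t, lpn 2 volume (channelCut i (fun τ y => ‖G τ y‖ₑ) τ)
      ≤ mixedL 1 2 I (channelCut i fun τ y => ‖G τ y‖ₑ) := by
    intro i
    rw [mixedL, lpn]
    simp only [ENNReal.rpow_one, div_one]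
    exact lintegral_mono_set hI
  calc _ ≤ ∫⁻ τ in Ι 0 t, C * ∑' m : ℕ,
        lpn 2 volume (channelCut (j + m) (fun τ y => ‖G τ y‖ₑ) τ) * bump k (j + m) ‖x‖ := by
        refine lintegral_mono_ae ?_
        filter_upwards [ae_restrict_mem measurableSet_uIoc,
          ae_restrict_of_ae (Measure.ae_ne volume t)] with τ hτ hne
        refine hCb G hG x _ τ j (abs_pos.mpr (sub_ne_zero.mpr (Ne.symm hne))) ?_
        -- backward characteristics from `(t, x)` stay at the same distance from the light cone
        have : |τ| + |t - τ| = |t| := by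
          rcases le_total 0 t with h | h
          · rw [uIoc_of_le h] at hτ
            rw [abs_of_pos hτ.1, abs_of_nonneg (by linarith [hτ.2]), abs_of_nonneg h]
            ring
          · rw [uIoc_of_ge h] at hτ
            rw [abs_of_nonpos hτ.2, abs_of_nonpos (by linarith [hτ.1]), abs_of_nonpos h]
            ring
        linarith
    _ ≤ _ := by
        rw [lintegral_const_mul' _ _ hC]
        gcongr
        rw [lintegral_tsum fun m => ((hm _).mul_const _).aemeasurable]
        refine ENNReal.tsum_le_tsum fun m => ?_
        rw [lintegral_mul_const _ (hm _)]
        gcongr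
        exact hmix _

/-! ### Difference quotients of the explicit kernel -/

theorem exists_capFn_lipschitz {k : ℕ} (hk : 1 ≤ k) :
    ∃ L, 0 ≤ L ∧ ∀ μ ∈ Icc (0 : ℝ) 1, ∀ ν ∈ Icc (0 : ℝ) 1,
      |capFn k 0 μ - capFn k 0 ν| ≤ L * |μ - ν| := by
  have hc := contDiff_capFn_zero hk
  obtain ⟨L, hL⟩ := isCompact_Icc.exists_bound_of_continuousOn
    (hc.continuous_deriv le_rfl).continuousOn (s := Icc (0 : ℝ) 1)
  refine ⟨L, (norm_nonneg _).trans (hL 0 (by simp)), fun μ hμ ν hν => ?_⟩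
  exact (convex_Icc (0 : ℝ) 1).norm_image_sub_le_of_norm_deriv_le
    (fun x _ => hc.differentiable one_ne_zero x) hL hν hμ

/-- The increment of the kernel in `s` is concentrated on two shells of thickness `s' - s`, up to a
Lipschitz term. -/
theorem exists_waveKernel_sub_le {k : ℕ} (hk : 1 ≤ k) : ∃ A, 0 ≤ A ∧
    ∀ s s' r ρ : ℝ, 0 < s → s < s' → s' < r → 0 < ρ →
      |waveKernel k 0 s' r ρ - waveKernel k 0 s r ρ| ≤ (1 / (r * ρ) ^ k) *
        (({ρ | s ≤ |r - ρ| ∧ |r - ρ| < s'}.indicator (fun _ => A) ρ)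
          + A * (s' - s) / ρ) := by
  obtain ⟨B, hB0, hB⟩ := exists_capFn_bound (m := 0) hk (Nat.zero_le k)
  obtain ⟨L, hL0, hL⟩ := exists_capFn_lipschitz hk
  refine ⟨max B L, hB0.trans (le_max_left _ _), fun s s' r ρ hs hs' hr hρ => ?_⟩
  have hA0 : 0 ≤ max B L := hB0.trans (le_max_left _ _)
  have hr0 : 0 < r := by linarith
  have hd : 0 ≤ s' - s := by linarith
  have hin : ∀ σ, 0 < σ → σ < r → |r - ρ| < σ → cosAngle r ρ σ ∈ Icc (0 : ℝ) 1 := fun σ h0 h1 h2 =>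
    ⟨(cosAngle_pos h0 h1 h2.le).le, cosAngle_le_one hr0 hρ h2.le⟩
  by_cases h1 : |r - ρ| < s
  · have h2 : |r - ρ| < s' := h1.trans hs'
    rw [indicator_of_notMem (fun h => absurd h1 (not_lt.mpr h.1)), zero_add]
    simp only [waveKernel, h1, h2, if_true, pow_zero, mul_one]
    rw [← sub_div, abs_div, abs_of_pos (by positivity : 0 < (r * ρ) ^ k), one_div_mul_eq_div]
    refine div_le_div_of_nonneg_right ?_ (by positivity)
    refine (hL _ (hin s' (hs.trans hs') hr h2) _ (hin s hs (hs'.trans hr) h1)).trans ?_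
    have h3 : |cosAngle r ρ s' - cosAngle r ρ s| ≤ (s' - s) / ρ := by
      have : cosAngle r ρ s' - cosAngle r ρ s = -((s' - s) * (s' + s) / (2 * r * ρ)) := by
        unfold cosAngle; field_simp; ring
      rw [this, abs_neg, abs_of_nonneg (div_nonneg (mul_nonneg hd (by linarith)) (by positivity)),
        div_le_div_iff₀ (by positivity) hρ]
      nlinarith [mul_nonneg (mul_nonneg hd hρ.le) (by linarith : 0 ≤ 2 * r - (s' + s))]
    rw [mul_div_assoc]
    exact mul_le_mul (le_max_right _ _) h3 (abs_nonneg _) hA0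
  · by_cases h2 : |r - ρ| < s'
    · rw [indicator_of_mem (show ρ ∈ {ρ | s ≤ |r - ρ| ∧ |r - ρ| < s'} from ⟨not_lt.mp h1, h2⟩)]
      simp only [waveKernel, h1, h2, if_true, if_false, pow_zero, mul_one, sub_zero]
      rw [abs_div, abs_of_pos (by positivity : 0 < (r * ρ) ^ k), one_div_mul_eq_div]
      refine div_le_div_of_nonneg_right ?_ (by positivity)
      have h3 := hB _ (hin s' (hs.trans hs') hr h2)
      have h4 : 0 ≤ max B L * (s' - s) / ρ := by positivity
      linarith [le_max_left B L]
    · simp only [waveKernel, h1, h2, if_false, sub_zero, abs_zero]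
      refine mul_nonneg (by positivity) (add_nonneg (indicator_nonneg (fun _ _ => hA0) _) ?_)
      positivity

theorem volume_shell_le {s s' r : ℝ} (hs : s ≤ s') :
    volume {ρ : ℝ | s ≤ |r - ρ| ∧ |r - ρ| < s'} ≤ ENNReal.ofReal (2 * (s' - s)) := by
  have h : {ρ : ℝ | s ≤ |r - ρ| ∧ |r - ρ| < s'} ⊆ Icc (r - s') (r - s) ∪ Icc (r + s) (r + s') := by
    rintro ρ ⟨h1, h2⟩
    rw [abs_lt] at h2
    rcases le_abs.mp h1 with h | h
    · exact Or.inl ⟨by linarith, by linarith⟩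
    · exact Or.inr ⟨by linarith, by linarith⟩
  refine (measure_mono h).trans ((measure_union_le _ _).trans (le_of_eq ?_))
  rw [Real.volume_Icc, Real.volume_Icc, ← ENNReal.ofReal_add (by linarith) (by linarith)]
  congr 1
  ring

/-- The increment of the kernel, integrated over the radii below `2^(i+1)` against the pointwise size of
an `Ḣ¹` function at scale `2^i`, is bounded by the majorant of that scale. -/
theorem exists_lintegral_waveKernel_sub_le {k : ℕ} (hk : 1 ≤ k) : ∃ A, 0 ≤ A ∧
    ∀ (s s' r : ℝ) (i : ℤ), 0 < s → s < s' → s' < r →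
      ENNReal.ofReal ((2 : ℝ) ^ ((i : ℝ) / 2) / ((2 : ℝ) ^ i) ^ k) *
        (∫⁻ ρ in Ioi (0 : ℝ), (Iio ((2 : ℝ) ^ (i + 1))).indicator (fun ρ =>
          ENNReal.ofReal (ρ ^ (2 * k)) * ‖waveKernel k 0 s' r ρ - waveKernel k 0 s r ρ‖ₑ) ρ)
      ≤ ENNReal.ofReal (A * (s' - s)) * bump k i r := by
  obtain ⟨A, hA0, hA⟩ := exists_waveKernel_sub_le hk
  refine ⟨3 * A * 2 ^ k, by positivity, fun s s' r i hs hs' hr => ?_⟩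
  have hr0 : 0 < r := by linarith
  have hd : 0 < s' - s := by linarith
  have h2i : (0 : ℝ) < 2 ^ i := by positivity
  set N := min (2 * r) ((2 : ℝ) ^ (i + 1)) with hN
  have hN0 : 0 < N := lt_min (by linarith) (by positivity)
  set S := {ρ : ℝ | s ≤ |r - ρ| ∧ |r - ρ| < s'} with hS
  have hSm : MeasurableSet S :=
    (measurableSet_le (f := fun _ : ℝ => s) (g := fun ρ => |r - ρ|) (by fun_prop)
      (by fun_prop)).inter
    (measurableSet_lt (f := fun ρ : ℝ => |r - ρ|) (g := fun _ => s') (by fun_prop) (by fun_prop))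
  have h1 : ∫⁻ ρ in Ioi (0 : ℝ), (Iio ((2 : ℝ) ^ (i + 1))).indicator (fun ρ =>
      ENNReal.ofReal (ρ ^ (2 * k)) * ‖waveKernel k 0 s' r ρ - waveKernel k 0 s r ρ‖ₑ) ρ
      ≤ ENNReal.ofReal (3 * A * (s' - s) * (N / r) ^ k) := by
    calc _ ≤ ∫⁻ ρ, (S.indicator (fun _ => ENNReal.ofReal (A * (N / r) ^ k)) ρ
          + (Ioo 0 N).indicator (fun _ => ENNReal.ofReal (A * (s' - s) * (N / r) ^ k / N)) ρ) := by
          rw [← lintegral_indicator measurableSet_Ioi]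
          refine lintegral_mono fun ρ => ?_
          by_cases hρ : 0 < ρ
          · rw [indicator_of_mem (show ρ ∈ Ioi (0 : ℝ) from hρ)]
            by_cases hρi : ρ < (2 : ℝ) ^ (i + 1)
            · rw [indicator_of_mem (show ρ ∈ Iio ((2 : ℝ) ^ (i + 1)) from hρi)]
              by_cases hρr : ρ < 2 * r
              · have hρN : ρ < N := lt_min hρr hρi
                rw [indicator_of_mem (show ρ ∈ Ioo 0 N from ⟨hρ, hρN⟩), Real.enorm_eq_ofReal_abs,
                  ← ENNReal.ofReal_mul (by positivity)]
                have h2 : S.indicator (fun _ => ENNReal.ofReal (A * (N / r) ^ k)) ρ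
                    = ENNReal.ofReal (S.indicator (fun _ => A * (N / r) ^ k) ρ) := by
                  simp only [indicator_apply]
                  split_ifs <;> simp
                rw [h2, ← ENNReal.ofReal_add (indicator_nonneg (fun _ _ => by positivity) _)
                  (by positivity)]
                refine ENNReal.ofReal_le_ofReal ?_
                have h3 := hA s s' r ρ hs hs' hr hρ
                have hle : ρ ^ k / r ^ k ≤ (N / r) ^ k := by
                  rw [← div_pow]; gcongr
                have hle2 : ρ ^ k / r ^ k / ρ ≤ (N / r) ^ k / N := by
                  obtain ⟨l, rfl⟩ : ∃ l, k = l + 1 := ⟨k - 1, by omega⟩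
                  have e : ∀ x : ℝ, 0 < x → (x / r) ^ (l + 1) / x = x ^ l / r ^ (l + 1) := by
                    intro x hx
                    rw [div_pow, pow_succ x]
                    field_simp
                  rw [← div_pow, e ρ hρ, e N hN0]
                  gcongr
                calc ρ ^ (2 * k) * |waveKernel k 0 s' r ρ - waveKernel k 0 s r ρ|
                    ≤ ρ ^ (2 * k) * ((1 / (r * ρ) ^ k) * (S.indicator (fun _ => A) ρ
                      + A * (s' - s) / ρ)) := by gcongr
                  _ = (ρ ^ k / r ^ k) * S.indicator (fun _ => A) ρ
                      + A * (s' - s) * (ρ ^ k / r ^ k / ρ) := by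
                      rw [mul_pow, two_mul, pow_add]
                      field_simp
                  _ ≤ (N / r) ^ k * S.indicator (fun _ => A) ρ
                      + A * (s' - s) * ((N / r) ^ k / N) := by
                      have : 0 ≤ S.indicator (fun _ => A) ρ := indicator_nonneg (fun _ _ => hA0) _
                      gcongr
                  _ = _ := by
                      congr 1
                      · simp only [indicator_apply]
                        split_ifs <;> ring
                      · ring
              · have h2 : s' ≤ |r - ρ| := by
                  rw [abs_of_nonpos (by linarith)]; linarith
                have h3 : ¬ |r - ρ| < s := by linarith
                simp [waveKernel, not_lt.mpr h2, h3]
            · rw [indicator_of_notMem (show ρ ∉ Iio ((2 : ℝ) ^ (i + 1)) from hρi)]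
              exact zero_le
          · rw [indicator_of_notMem (show ρ ∉ Ioi (0 : ℝ) from hρ)]
            exact zero_le
      _ ≤ ENNReal.ofReal (A * (N / r) ^ k) * ENNReal.ofReal (2 * (s' - s))
          + ENNReal.ofReal (A * (s' - s) * (N / r) ^ k / N) * ENNReal.ofReal N := by
          rw [lintegral_add_left (measurable_const.indicator hSm), lintegral_indicator hSm,
            lintegral_indicator measurableSet_Ioo, setLIntegral_const, setLIntegral_const,
            Real.volume_Ioo, sub_zero]
          gcongr
          exact volume_shell_le hs'.le
      _ = _ := by
          rw [← ENNReal.ofReal_mul (by positivity), ← ENNReal.ofReal_mul (by positivity),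
            ← ENNReal.ofReal_add (by positivity) (by positivity)]
          congr 1
          field_simp
          ring
  refine (mul_le_mul_right h1 _).trans ?_
  rw [bump, ← ENNReal.ofReal_mul (by positivity), ← ENNReal.ofReal_mul (by positivity)]
  refine ENNReal.ofReal_le_ofReal ?_
  -- for `r` below `2^i` use the cut-off of the radii at `2r`, otherwise the one at `2^(i+1)`
  have hNr : N / r ≤ 2 * (2 ^ i / max r (2 ^ i)) := by
    rcases le_total r ((2 : ℝ) ^ i) with h | h
    · rw [max_eq_right h, div_self h2i.ne', div_le_iff₀ hr0, mul_one]
      exact min_le_left _ _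
    · rw [max_eq_left h, ← mul_div_assoc]
      refine div_le_div_of_nonneg_right ((min_le_right _ _).trans (le_of_eq ?_)) hr0.le
      rw [zpow_add₀ two_ne_zero]; ring
  calc _ ≤ (2 : ℝ) ^ ((i : ℝ) / 2) / ((2 : ℝ) ^ i) ^ k *
        (3 * A * (s' - s) * (2 * (2 ^ i / max r (2 ^ i))) ^ k) := by gcongr
    _ = _ := by
      have hM0 : 0 < max r ((2 : ℝ) ^ i) := lt_max_of_lt_right h2i
      rw [mul_pow, div_pow]
      field_simp

/-- The dyadic form of the pointwise bound for radial functions in `Ḣ¹`. -/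
theorem exists_profile_le_dyadic {k : ℕ} (hk : 1 ≤ k) : ∃ C : ℝ≥0∞, C ≠ ⊤ ∧
    ∀ (w : Space (2 * k + 1) → ℝ≥0∞), Measurable w → ∀ (ρ : ℝ) (b : ℝ≥0∞),
      sphereMeasure (2 * k + 1) univ * b ≤ ∫⁻ y, outerKernel k ρ y * w y →
      ∀ j : ℤ, (2 : ℝ) ^ j ≤ ρ → b ≤ C * ∑' m : ℕ, (Iio ((2 : ℝ) ^ (j + m + 1))).indicator (fun _ =>
        ENNReal.ofReal ((2 : ℝ) ^ (((j + m : ℤ) : ℝ) / 2) / ((2 : ℝ) ^ (j + m)) ^ k) *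
          lpn 2 volume (channelCut (j + m) (fun _ => w) 0)) ρ := by
  set σ := sphereMeasure (2 * k + 1) univ with hσ
  have hσ0 : σ ≠ 0 := sphereMeasure_univ_ne_zero (by omega)
  have hσt : σ ≠ ⊤ := measure_ne_top _ _
  refine ⟨σ⁻¹ * σ ^ (1 / 2 : ℝ), ENNReal.mul_ne_top (ENNReal.inv_ne_top.mpr hσ0)
    (ENNReal.rpow_ne_top_of_nonneg (by norm_num) hσt), fun w hw ρ b hb j hj => ?_⟩
  set W : ℤ → Space (2 * k + 1) → ℝ≥0∞ := fun i =>
    channelCut i (fun _ (y : Space (2 * k + 1)) => ENNReal.ofReal (1 / ‖y‖ ^ k)) 0 with hW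
  have hWm : ∀ i, Measurable (W i) := fun i =>
    (measurable_channelCut (f := fun (_ : ℝ) (y : Space (2 * k + 1)) => ENNReal.ofReal (1 / ‖y‖ ^ k))
      (by unfold Function.uncurry; fun_prop) i).comp measurable_prodMk_left
  have hgm : ∀ i, Measurable (channelCut i (fun _ => w) 0) := fun i =>
    (measurable_channelCut (f := fun (_ : ℝ) => w) (hw.comp measurable_snd) i).comp
      measurable_prodMk_left
  have hb' : b ≤ σ⁻¹ * ∫⁻ y, outerKernel k ρ y * w y := by
    rw [← ENNReal.div_eq_inv_mul, ENNReal.le_div_iff_mul_le (Or.inl hσ0) (Or.inl hσt), mul_comm]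
    exact hb
  refine hb'.trans ?_
  rw [mul_assoc]
  refine mul_le_mul_right ?_ _
  calc _ ≤ ∫⁻ y, ∑' m : ℕ, (Iio ((2 : ℝ) ^ (j + m + 1))).indicator (fun _ =>
          ENNReal.ofReal (1 / ((2 : ℝ) ^ (j + m)) ^ k) *
          (W (j + m) y * channelCut (j + m) (fun _ => w) 0 y)) ρ := by
        refine lintegral_mono fun y => ?_
        by_cases hy : ρ < ‖y‖
        · have h0 : |(0 : ℝ)| = 0 := abs_zero
          obtain ⟨m, hm1, hm2⟩ := exists_channel_ge (j := j) (t := 0) (r := ‖y‖)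
            (by rw [h0]; linarith)
          refine le_trans ?_ (ENNReal.le_tsum m)
          rw [indicator_of_mem (show ρ ∈ Iio ((2 : ℝ) ^ (j + m + 1)) by
            rw [h0, zero_add] at hm2; exact hy.trans hm2), hW]
          simp only
          rw [channelCut_of_mem ⟨hm1, hm2⟩, channelCut_of_mem ⟨hm1, hm2⟩, outerKernel,
            indicator_of_mem (show y ∈ {y : Space (2 * k + 1) | ρ < ‖y‖} from hy), ← mul_assoc,
            ← ENNReal.ofReal_mul (by positivity)]
          refine mul_le_mul_left (ENNReal.ofReal_le_ofReal ?_) _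
          rw [h0, zero_add] at hm1
          have h2 : (0 : ℝ) < 2 ^ (j + (m : ℤ)) := by positivity
          have h3 : 0 < ‖y‖ := h2.trans_le hm1
          have h4 : 1 / ‖y‖ ^ (2 * k) = 1 / ‖y‖ ^ k * (1 / ‖y‖ ^ k) := by
            rw [one_div_mul_one_div, ← pow_add, ← two_mul]
          rw [h4]
          gcongr
        · rw [outerKernel, indicator_of_notMem (show y ∉ {y : Space (2 * k + 1) | ρ < ‖y‖} from hy),
            zero_mul]
          exact zero_le
    _ = ∑' m : ℕ, (Iio ((2 : ℝ) ^ (j + m + 1))).indicator (fun _ =>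
          ENNReal.ofReal (1 / ((2 : ℝ) ^ (j + m)) ^ k) *
          ∫⁻ y, W (j + m) y * channelCut (j + m) (fun _ => w) 0 y) ρ := by
        rw [lintegral_tsum]
        · congr 1
          ext m
          simp only [indicator_apply]
          split_ifs
          · rw [lintegral_const_mul' _ _ ENNReal.ofReal_ne_top]
          · simp
        · intro m
          simp only [indicator_apply]
          split_ifs
          · exact (((hWm _).mul (hgm _)).const_mul _).aemeasurable
          · exact aemeasurable_const
    _ ≤ _ := by
        rw [← ENNReal.tsum_mul_left]
        refine ENNReal.tsum_le_tsum fun m => ?_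
        simp only [indicator_apply]
        split_ifs
        · have h2 := lintegral_mul_le_of_two (μ := volume) (hWm (j + m)).aemeasurable
            (hgm (j + m)).aemeasurable
          have h3 := ENNReal.rpow_le_rpow (lintegral_channelCut_weight_le (k := k) (j + m) 0)
            (by norm_num : (0 : ℝ) ≤ 1 / 2)
          rw [ENNReal.mul_rpow_of_nonneg _ _ (by norm_num),
            ENNReal.ofReal_rpow_of_nonneg (by positivity) (by norm_num), ← Real.rpow_intCast,
            ← Real.rpow_mul two_pos.le, mul_one_div] at h3
          calc _ ≤ ENNReal.ofReal (1 / ((2 : ℝ) ^ (j + m)) ^ k) *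
                ((σ ^ (1 / 2 : ℝ) * ENNReal.ofReal ((2 : ℝ) ^ (((j + m : ℤ) : ℝ) / 2))) *
                lpn 2 volume (channelCut (j + m) (fun _ => w) 0)) :=
                mul_le_mul_right (h2.trans (mul_le_mul_left h3 _)) _
            _ = σ ^ (1 / 2 : ℝ) * ((ENNReal.ofReal ((2 : ℝ) ^ (((j + m : ℤ) : ℝ) / 2)) *
                ENNReal.ofReal (1 / ((2 : ℝ) ^ (j + m)) ^ k)) *
                lpn 2 volume (channelCut (j + m) (fun _ => w) 0)) := by ring
            _ = _ := by
                rw [← ENNReal.ofReal_mul (by positivity), mul_one_div]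
        · simp

theorem integrable_waveKernel_mul {k : ℕ} (hk : 1 ≤ k) {f : Space (2 * k + 1) → ℝ}
    (hf : LocallyIntegrable f) {s r : ℝ} (hs : 0 < s) (hr : s < r) :
    Integrable fun y => waveKernel k 0 s r ‖y‖ * f y := by
  obtain ⟨B, hB0, hB⟩ := abs_waveKernel_le (m := 0) hk (Nat.zero_le k)
  have hr0 : 0 < r := hs.trans hr
  have h1 : IntegrableOn f (Metric.closedBall 0 (r + s)) :=
    hf.integrableOn_isCompact (isCompact_closedBall 0 (r + s))
  have h2 : (fun y : Space (2 * k + 1) => waveKernel k 0 s r ‖y‖ * f y)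
      = (Metric.closedBall 0 (r + s)).indicator fun y => waveKernel k 0 s r ‖y‖ * f y := by
    ext y
    by_cases hy : y ∈ Metric.closedBall 0 (r + s)
    · rw [indicator_of_mem hy]
    · rw [indicator_of_notMem hy]
      rw [mem_closedBall_zero_iff, not_le] at hy
      have : ¬ |r - ‖y‖| < s := by
        rw [abs_lt, not_and_or]
        left; linarith
      simp [waveKernel, this]
  rw [h2, integrable_indicator_iff Metric.isClosed_closedBall.measurableSet]
  refine h1.bdd_mul (c := B * (1 / (r * (r - s)) ^ k)) ?_ (Filter.Eventually.of_forall fun y => ?_)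
  · exact ((measurable_waveKernel hk (Nat.zero_le k)).comp
      (by fun_prop : Measurable fun y : Space (2 * k + 1) => (s, r, ‖y‖))).aestronglyMeasurable
  · by_cases hy : |r - ‖y‖| < s
    · refine (hB s r ‖y‖ hs hr (norm_nonneg _)).trans ?_
      rw [pow_zero]
      have h3 := abs_lt.mp hy
      have h4 : 0 < r - s := by linarith
      gcongr
      linarith
    · have h4 : 0 < r - s := by linarith
      simp only [waveKernel, hy, if_false, norm_zero]
      positivity

/-- Difference quotients of the explicit kernel, applied to a radial function in `Ḣ¹`. -/
theorem exists_radialProp_sub_le_bump {k : ℕ} (hk : 1 ≤ k) : ∃ C : ℝ≥0∞, C ≠ ⊤ ∧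
    ∀ (f : Space (2 * k + 1) → ℝ) (h : ℝ → ℝ) (w : Space (2 * k + 1) → ℝ≥0∞),
      LocallyIntegrable f → Measurable h → (∀ᵐ y, f y = h ‖y‖) → Measurable w →
      (∀ᵐ ρ ∂(volume.restrict (Ioi (0 : ℝ))),
        sphereMeasure (2 * k + 1) univ * ‖h ρ‖ₑ ≤ ∫⁻ y, outerKernel k ρ y * w y) →
      ∀ (s s' : ℝ) (x : Space (2 * k + 1)) (j : ℤ), 0 < s → s < s' → (2 : ℝ) ^ j + s' ≤ ‖x‖ →
      ‖radialProp k s' f x - radialProp k s f x‖ₑ ≤ C * ENNReal.ofReal (s' - s) *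
        ∑' m : ℕ, lpn 2 volume (channelCut (j + m) (fun _ => w) 0) * bump k (j + m) ‖x‖ := by
  obtain ⟨A, hA0, hA⟩ := exists_lintegral_waveKernel_sub_le hk
  obtain ⟨C, hC, hCb⟩ := exists_profile_le_dyadic hk
  set σ := sphereMeasure (2 * k + 1) univ with hσ
  have hσt : σ ≠ ⊤ := measure_ne_top _ _
  refine ⟨‖waveConst k‖ₑ * σ * C * ENNReal.ofReal A, ENNReal.mul_ne_top (ENNReal.mul_ne_top
    (ENNReal.mul_ne_top enorm_ne_top hσt) hC) ENNReal.ofReal_ne_top, ?_⟩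
  intro f h w hf hh hfh hw hhw s s' x j hs hs' hj
  have h2j : (0 : ℝ) < 2 ^ j := by positivity
  have hs'x : s' < ‖x‖ := by linarith
  set Δ : ℝ → ℝ := fun ρ => waveKernel k 0 s' ‖x‖ ρ - waveKernel k 0 s ‖x‖ ρ with hΔ
  have hwk : ∀ σ : ℝ, Measurable fun ρ => waveKernel k 0 σ ‖x‖ ρ := fun σ =>
    (measurable_waveKernel hk (Nat.zero_le k)).comp
      (by fun_prop : Measurable fun ρ : ℝ => (σ, ‖x‖, ρ))
  have hΔm : Measurable Δ := (hwk s').sub (hwk s)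
  set a : ℤ → ℝ≥0∞ := fun i => lpn 2 volume (channelCut i (fun _ => w) 0) with ha
  have h1 : radialProp k s' f x - radialProp k s f x
      = waveConst k * ∫ y : Space (2 * k + 1), Δ ‖y‖ * h ‖y‖ := by
    rw [radialProp, radialProp, ← mul_sub, ← integral_sub
      (integrable_waveKernel_mul hk hf (hs.trans hs') hs'x)
      (integrable_waveKernel_mul hk hf hs (hs'.trans hs'x))]
    congr 1
    refine integral_congr_ae ?_
    filter_upwards [hfh] with y hy
    rw [hy, hΔ]
    ring
  have h2 : ∫⁻ y : Space (2 * k + 1), ‖Δ ‖y‖ * h ‖y‖‖ₑ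
      ≤ σ * ∫⁻ ρ in Ioi (0 : ℝ), C * ∑' m : ℕ, (Iio ((2 : ℝ) ^ (j + m + 1))).indicator (fun ρ =>
        ENNReal.ofReal ((2 : ℝ) ^ (((j + m : ℤ) : ℝ) / 2) / ((2 : ℝ) ^ (j + m)) ^ k) * a (j + m) *
        (ENNReal.ofReal (ρ ^ (2 * k)) * ‖Δ ρ‖ₑ)) ρ := by
    rw [lintegral_norm_eq (f := fun ρ => ‖Δ ρ * h ρ‖ₑ) (by omega) (hΔm.mul hh).enorm]
    refine mul_le_mul_right (lintegral_mono_ae ?_) _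
    filter_upwards [hhw, ae_restrict_mem measurableSet_Ioi] with ρ hρ hρ0
    -- radii met by the kernel are at least `2^j`, which is finite speed of propagation
    by_cases hρs : |‖x‖ - ρ| < s'
    · have hρj : (2 : ℝ) ^ j ≤ ρ := by
        have := abs_lt.mp hρs
        linarith
      rw [enorm_mul, Nat.add_sub_cancel]
      calc _ = (ENNReal.ofReal (ρ ^ (2 * k)) * ‖Δ ρ‖ₑ) * ‖h ρ‖ₑ := by ring
        _ ≤ (ENNReal.ofReal (ρ ^ (2 * k)) * ‖Δ ρ‖ₑ) * (C * ∑' m : ℕ,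
            (Iio ((2 : ℝ) ^ (j + m + 1))).indicator (fun _ =>
            ENNReal.ofReal ((2 : ℝ) ^ (((j + m : ℤ) : ℝ) / 2) / ((2 : ℝ) ^ (j + m)) ^ k) *
            a (j + m)) ρ) := mul_le_mul_right (hCb w hw ρ _ hρ j hρj) _
        _ = _ := by
          rw [mul_left_comm, ← ENNReal.tsum_mul_left]
          congr 2
          ext m
          simp only [indicator_apply]
          split_ifs <;> ring
    · have : Δ ρ = 0 := by
        have h3 : ¬ |‖x‖ - ρ| < s := fun h => hρs (h.trans hs')
        simp [hΔ, waveKernel, hρs, h3]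
      simp [this]
  have hmeas : ∀ m : ℕ, Measurable fun ρ : ℝ => (Iio ((2 : ℝ) ^ (j + m + 1))).indicator (fun ρ =>
        ENNReal.ofReal ((2 : ℝ) ^ (((j + m : ℤ) : ℝ) / 2) / ((2 : ℝ) ^ (j + m)) ^ k) * a (j + m) *
        (ENNReal.ofReal (ρ ^ (2 * k)) * ‖Δ ρ‖ₑ)) ρ := fun m =>
    Measurable.indicator (Measurable.const_mul (Measurable.mul (by fun_prop) hΔm.enorm) _)
      measurableSet_Iio
  rw [h1, enorm_mul]
  calc _ ≤ ‖waveConst k‖ₑ * (σ * ∫⁻ ρ in Ioi (0 : ℝ), C * ∑' m : ℕ,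
        (Iio ((2 : ℝ) ^ (j + m + 1))).indicator (fun ρ =>
        ENNReal.ofReal ((2 : ℝ) ^ (((j + m : ℤ) : ℝ) / 2) / ((2 : ℝ) ^ (j + m)) ^ k) * a (j + m) *
        (ENNReal.ofReal (ρ ^ (2 * k)) * ‖Δ ρ‖ₑ)) ρ) :=
        mul_le_mul_right ((enorm_integral_le_lintegral_enorm _).trans h2) _
    _ = ‖waveConst k‖ₑ * σ * C * ∑' m : ℕ, ∫⁻ ρ in Ioi (0 : ℝ),
        (Iio ((2 : ℝ) ^ (j + m + 1))).indicator (fun ρ =>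
        ENNReal.ofReal ((2 : ℝ) ^ (((j + m : ℤ) : ℝ) / 2) / ((2 : ℝ) ^ (j + m)) ^ k) * a (j + m) *
        (ENNReal.ofReal (ρ ^ (2 * k)) * ‖Δ ρ‖ₑ)) ρ := by
        rw [lintegral_const_mul' _ _ hC, lintegral_tsum fun m => (hmeas m).aemeasurable]
        ring
    _ ≤ ‖waveConst k‖ₑ * σ * C * ∑' m : ℕ, ENNReal.ofReal (A * (s' - s)) *
        (a (j + m) * bump k (j + m) ‖x‖) := by
        refine mul_le_mul_right (ENNReal.tsum_le_tsum fun m => ?_) _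
        have h3 := hA s s' ‖x‖ (j + m) hs hs' hs'x
        have h4 : ∫⁻ ρ in Ioi (0 : ℝ), (Iio ((2 : ℝ) ^ (j + m + 1))).indicator (fun ρ =>
            ENNReal.ofReal ((2 : ℝ) ^ (((j + m : ℤ) : ℝ) / 2) / ((2 : ℝ) ^ (j + m)) ^ k) *
            a (j + m) * (ENNReal.ofReal (ρ ^ (2 * k)) * ‖Δ ρ‖ₑ)) ρ
            = a (j + m) * (ENNReal.ofReal ((2 : ℝ) ^ (((j + m : ℤ) : ℝ) / 2) /
              ((2 : ℝ) ^ (j + m)) ^ k) * ∫⁻ ρ in Ioi (0 : ℝ),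
              (Iio ((2 : ℝ) ^ (j + m + 1))).indicator (fun ρ =>
                ENNReal.ofReal (ρ ^ (2 * k)) * ‖Δ ρ‖ₑ) ρ) := by
          rw [← lintegral_const_mul' _ _ ENNReal.ofReal_ne_top, ← lintegral_const_mul]
          · congr 1
            ext ρ
            simp only [indicator_apply]
            split_ifs <;> ring
          · exact Measurable.const_mul (Measurable.indicator
              (Measurable.mul (by fun_prop) hΔm.enorm) measurableSet_Iio) _
        rw [h4]
        refine (mul_le_mul_right h3 _).trans (le_of_eq ?_)
        ring
    _ = _ := by
        rw [ENNReal.tsum_mul_left, ENNReal.ofReal_mul hA0]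
        ring

/-! ### The free wave outside the light cone -/

/-- A Lipschitz curve in `L²` has a jointly measurable representative. -/
theorem exists_measurable_of_lipschitz {d : ℕ} {V : ℝ → Lp ℂ 2 (volume : Measure (Space d))} {K : ℝ}
    (hV : ∀ s t, ‖V s - V t‖ ≤ |s - t| * K) :
    ∃ W : ℝ → Space d → ℂ, Measurable (Function.uncurry W) ∧ ∀ t, V t =ᵐ[volume] W t := by
  -- the values at dyadic times converge almost everywhere, since the squares of the errors are summable
  set q : ℕ → ℝ → ℝ := fun n t => (⌊t * 2 ^ n⌋ : ℝ) / 2 ^ n with hq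
  have hqt : ∀ n t, |q n t - t| ≤ (1 / 2) ^ n := by
    intro n t
    have h2 : (0 : ℝ) < 2 ^ n := by positivity
    have h1 : q n t - t = -(Int.fract (t * 2 ^ n)) / 2 ^ n := by
      rw [hq, Int.fract]; field_simp; ring
    rw [h1, abs_div, abs_neg, abs_of_nonneg (Int.fract_nonneg _), abs_of_pos h2, one_div_pow]
    gcongr
    exact (Int.fract_lt_one _).le
  set A : ℕ → ℝ → Space d → ℂ := fun n t x => V (q n t) x with hA
  have hAm : ∀ n, Measurable (Function.uncurry (A n)) := by
    intro n
    have h1 : Measurable fun z : ℤ × Space d => V ((z.1 : ℝ) / 2 ^ n) z.2 :=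
      measurable_from_prod_countable_right fun m =>
        (Lp.stronglyMeasurable (V ((m : ℝ) / 2 ^ n))).measurable
    have h2 : Measurable fun z : ℝ × Space d => ((⌊z.1 * 2 ^ n⌋ : ℤ), z.2) := by fun_prop
    exact h1.comp h2
  refine ⟨fun t x => Filter.limUnder Filter.atTop fun n => A n t x, ?_, fun t => ?_⟩
  · exact (StronglyMeasurable.limUnder (l := Filter.atTop) (f := fun n => Function.uncurry (A n))
      fun n => (hAm n).stronglyMeasurable).measurable
  · have hK : ∀ n, ∫⁻ x, ‖A n t x - V t x‖ₑ ^ (2 : ℝ) ≤ ENNReal.ofReal (K ^ 2 * (1 / 4) ^ n) := by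
      intro n
      have h1 : ∫⁻ x, ‖A n t x - V t x‖ₑ ^ (2 : ℝ) = ‖V (q n t) - V t‖ₑ ^ (2 : ℝ) := by
        rw [← lintegral_sq_Lp, ← ENNReal.rpow_mul]
        norm_num
        refine lintegral_congr_ae ?_
        filter_upwards [Lp.coeFn_sub (V (q n t)) (V t)] with x hx
        exact congrArg (fun z => ‖z‖ₑ ^ 2) hx.symm
      rw [h1, ← ofReal_norm, ENNReal.ofReal_rpow_of_nonneg (norm_nonneg _) two_pos.le]
      refine ENNReal.ofReal_le_ofReal ?_
      have h3 : ‖V (q n t) - V t‖ ≤ (1 / 2) ^ n * |K| :=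
        (hV _ _).trans (mul_le_mul (hqt n t) (le_abs_self K) (by
          -- a Lipschitz constant is nonnegative, as two distinct times show
          by_contra hneg
          push Not at hneg
          have := (norm_nonneg _).trans (hV 1 0)
          norm_num at this
          linarith) (by positivity))
      have h4 : ((1 : ℝ) / 4) ^ n = ((1 / 2) ^ n) ^ 2 := by
        rw [← pow_mul, mul_comm, pow_mul]; norm_num
      rw [Real.rpow_two, h4, ← sq_abs K]
      calc _ ≤ ((1 / 2) ^ n * |K|) ^ 2 := by gcongr
        _ = _ := by ring
    have hm : ∀ n, Measurable fun x => ‖A n t x - V t x‖ₑ ^ (2 : ℝ) := fun n =>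
      (((hAm n).comp measurable_prodMk_left).sub
        (Lp.stronglyMeasurable (V t)).measurable).enorm.pow_const _
    have hfin : ∫⁻ x, ∑' n, ‖A n t x - V t x‖ₑ ^ (2 : ℝ) ≠ ⊤ := by
      rw [lintegral_tsum fun n => (hm n).aemeasurable]
      refine ne_top_of_le_ne_top ?_ (ENNReal.tsum_le_tsum hK)
      exact Summable.tsum_ofReal_ne_top
        ((summable_geometric_of_lt_one (by norm_num) (by norm_num)).mul_left _)
    filter_upwards [ae_lt_top (Measurable.tsum hm) hfin] with x hx
    have h1 := ENNReal.tendsto_atTop_zero_of_tsum_ne_top hx.ne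
    have h2 : Filter.Tendsto (fun n => ‖A n t x - V t x‖ₑ) Filter.atTop (nhds 0) := by
      have := h1.ennrpow_const (1 / 2)
      simp only [← ENNReal.rpow_mul] at this
      norm_num at this
      exact this
    have h3 : Filter.Tendsto (fun n => A n t x) Filter.atTop (nhds (V t x)) := by
      rw [← tendsto_sub_nhds_zero_iff]
      exact tendsto_zero_iff_enorm_tendsto_zero.mpr h2
    exact h3.limUnder_eq.symm

theorem isRadialOn_of_norm {n : ℕ} (hn : 1 ≤ n) (S : Set (Space n)) {Φ : Space n → ℝ}
    (h : ∀ x y, ‖x‖ = ‖y‖ → Φ x = Φ y) : IsRadialOn S Φ := by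
  refine ⟨fun r => Φ (EuclideanSpace.single (⟨0, hn⟩ : Fin n) r),
    Filter.Eventually.of_forall fun x _ => h _ _ ?_⟩
  rw [PiLp.norm_single, norm_norm]

theorem radialProp_of_norm {k : ℕ} (s : ℝ) (f : Space (2 * k + 1) → ℝ) {x y : Space (2 * k + 1)}
    (h : ‖x‖ = ‖y‖) : radialProp k s f x = radialProp k s f y := by
  simp only [radialProp, h]

/-- The dyadic shells are disjoint, so that their `L²` norms are square summable. -/
theorem lpn_count_shell_le {d : ℕ} {w : Space d → ℝ≥0∞} (hw : Measurable w) :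
    lpn 2 Measure.count (fun i : ℤ => lpn 2 volume (channelCut i (fun _ => w) 0))
      ≤ lpn 2 volume w := by
  have hm : ∀ i : ℤ, Measurable (channelCut i (fun _ : ℝ => w) 0) := fun i =>
    (measurable_channelCut (f := fun _ : ℝ => w) (hw.comp measurable_snd) i).comp
      measurable_prodMk_left
  refine ENNReal.rpow_le_rpow ?_ (by norm_num)
  rw [lintegral_count]
  simp_rw [lpn_rpow two_pos]
  rw [← lintegral_tsum fun i => ((hm i).pow_const _).aemeasurable]
  refine lintegral_mono fun x => ?_
  by_cases hx : (0 : ℝ) < ‖x‖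
  · obtain ⟨j, hj⟩ := exists_mem_channel (t := 0) (r := ‖x‖) (by rwa [abs_zero])
    rw [tsum_eq_single j]
    · rw [channelCut_of_mem hj]
    · intro i hi
      rw [channelCut_of_notMem, ENNReal.zero_rpow_of_pos two_pos]
      rintro ⟨h1, h2⟩
      simp only [abs_zero, zero_add] at h1 h2 hj
      have h3 := (zpow_lt_zpow_iff_right₀ (one_lt_two (α := ℝ))).mp (h1.trans_lt hj.2)
      have h4 := (zpow_lt_zpow_iff_right₀ (one_lt_two (α := ℝ))).mp (hj.1.trans_lt h2)
      omega
  · have h0 : ∀ i : ℤ, channelCut i (fun _ : ℝ => w) 0 x ^ (2 : ℝ) = 0 := by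
      intro i
      rw [channelCut_of_notMem, ENNReal.zero_rpow_of_pos two_pos]
      rintro ⟨h1, -⟩
      have : (0 : ℝ) < 2 ^ i := by positivity
      simp only [abs_zero, zero_add] at h1
      exact hx (this.trans_le h1)
    simp [h0]

theorem ne_top_of_lpn_count {a : ℤ → ℝ≥0∞} (ha : lpn 2 Measure.count a ≠ ⊤) (i : ℤ) : a i ≠ ⊤ := by
  have h1 : ∑' i, a i ^ (2 : ℝ) ≠ ⊤ := by
    rw [← lintegral_count, ← lpn_rpow two_pos]
    exact ENNReal.rpow_ne_top_of_nonneg two_pos.le ha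
  have h2 := ENNReal.ne_top_of_tsum_ne_top h1 i
  intro h
  rw [h, ENNReal.top_rpow_of_pos two_pos] at h2
  exact h2 rfl

/-- The operator `cos(s√(-Δ))` on radial functions in `Ḣ¹`: it is real and radial outside the light
cone, where it is controlled by the gradient in the larger shells. -/
theorem exists_cosSubOne_le_bump {k : ℕ} (hk : 1 ≤ k) {f : Space (2 * k + 1) → ℝ} (hf : MemHDotOne f)
    (hr : IsRadialOn univ f) : ∃ a : ℤ → ℝ≥0∞, (∀ i, a i ≠ ⊤) ∧ lpn 2 Measure.count a ≠ ⊤ ∧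
      ∀ s : ℝ, 0 < s → ∃ Φ : Space (2 * k + 1) → ℝ, (∀ x y, ‖x‖ = ‖y‖ → Φ x = Φ y) ∧
        ∀ᵐ x, s < ‖x‖ → (f x : ℂ) + cosSubOne s f x = (Φ x : ℂ) ∧
          ∀ j : ℤ, s + (2 : ℝ) ^ j ≤ ‖x‖ →
            ‖Φ x‖ₑ ≤ ∑' m : ℕ, a (j + m) * bump k (j + m) ‖x‖ := by
  have hl := locallyIntegrable_of_hasFourierTransform hf.hat_spec.1
  obtain ⟨h, hm, hfh⟩ := hr.exists_profile (by omega) hl.aestronglyMeasurable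
  obtain ⟨w, hwm, hw, hhw⟩ := exists_gradient_bound hk hf hm hfh
  obtain ⟨C, hC, hCb⟩ := exists_radialProp_sub_le_bump hk
  set a : ℤ → ℝ≥0∞ := fun i => lpn 2 volume (channelCut i (fun _ => w) 0) with ha
  have hal : lpn 2 Measure.count a ≠ ⊤ := by
    refine ne_top_of_le_ne_top ?_ (lpn_count_shell_le hwm)
    exact ENNReal.rpow_ne_top_of_nonneg (by norm_num) hw.ne
  have hat : ∀ i, a i ≠ ⊤ := ne_top_of_lpn_count hal
  refine ⟨fun i => C * a i, fun i => ENNReal.mul_ne_top hC (hat i), ?_, fun s hs => ?_⟩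
  · rw [lpn_const_mul two_pos hC]
    exact ENNReal.mul_ne_top hC hal
  obtain ⟨η, hη0, hη, hlim⟩ := exists_tendsto_cosSubOne hk hf hr hs
  set Q : ℕ → Space (2 * k + 1) → ℝ := fun n x =>
    (radialProp k (s + η n) f x - radialProp k s f x) / η n with hQ
  refine ⟨fun x => Filter.limUnder Filter.atTop fun n => Q n x, fun x y hxy => ?_, ?_⟩
  · have : ∀ n, Q n x = Q n y := fun n => by
      simp only [hQ, radialProp_of_norm _ f hxy]
    simp only [this]
  -- the points on the boundary of a channel form a null set
  have hsphere : ∀ᵐ x : Space (2 * k + 1), ∀ j : ℤ, ‖x‖ ≠ s + 2 ^ j := by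
    rw [ae_all_iff]
    intro j
    have h0 := Measure.addHaar_sphere (volume : Measure (Space (2 * k + 1))) 0 (s + 2 ^ j)
    filter_upwards [measure_eq_zero_iff_ae_notMem.mp h0] with x hx
    simpa using hx
  filter_upwards [hlim, hsphere] with x hx hxs hsx
  have h1 := hx hsx
  have hre : Filter.Tendsto (fun n => Q n x) Filter.atTop
      (nhds ((f x : ℂ) + cosSubOne s f x).re) := by
    have := (Complex.continuous_re.tendsto _).comp h1
    exact this
  -- a limit of real difference quotients is real
  have him : ((f x : ℂ) + cosSubOne s f x).im = 0 := by
    have := (Complex.continuous_im.tendsto _).comp h1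
    simp only [Function.comp_def, Complex.ofReal_im] at this
    exact tendsto_nhds_unique this tendsto_const_nhds
  rw [hre.limUnder_eq]
  refine ⟨Complex.ext (by simp) (by simpa using him), fun j hj => ?_⟩
  have hlt : s + (2 : ℝ) ^ j < ‖x‖ := lt_of_le_of_ne hj (hxs j).symm
  refine le_of_tendsto (hre.enorm) ?_
  filter_upwards [hη.eventually (gt_mem_nhds (sub_pos.mpr hlt))] with n hn
  have hb := hCb f h w hl hm hfh hwm hhw s (s + η n) x j hs (by linarith [hη0 n]) (by linarith)
  have he : ENNReal.ofReal (η n) ≠ 0 := (ENNReal.ofReal_pos.mpr (hη0 n)).ne'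
  simp only [hQ]
  rw [div_eq_mul_inv, enorm_mul, enorm_inv (hη0 n).ne', Real.enorm_of_nonneg (hη0 n).le,
    ← div_eq_mul_inv]
  refine ENNReal.div_le_of_le_mul (hb.trans (le_of_eq ?_))
  rw [add_sub_cancel_left]
  simp_rw [mul_assoc C, ENNReal.tsum_mul_left]
  ring

theorem lpn_count_add_ne_top {a b : ℤ → ℝ≥0∞} (ha : lpn 2 Measure.count a ≠ ⊤)
    (hb : lpn 2 Measure.count b ≠ ⊤) : lpn 2 Measure.count (fun i => a i + b i) ≠ ⊤ :=
  ne_top_of_le_ne_top (ENNReal.add_ne_top.mpr ⟨ha, hb⟩) (lpn_add_le one_le_two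
    Measurable.of_discrete.aemeasurable Measurable.of_discrete.aemeasurable)

/-- Outside the light cone the free wave is given by a real measurable function, radial in space,
whose norm over the channels is finite. -/
theorem exists_freeWave_rep {k : ℕ} (hk : 1 ≤ k) {u₀ u₁ : Space (2 * k + 1) → ℝ}
    (hu : IsRadialData u₀ u₁) : ∃ L : ℝ → Space (2 * k + 1) → ℝ, Measurable (Function.uncurry L) ∧
      (∀ᵐ t, ∀ᵐ x, |t| < ‖x‖ → freeWave u₀ u₁ t x = (L t x : ℂ)) ∧
      (∀ᵐ t, IsRadialOn {x | |t| < ‖x‖} (L t)) ∧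
      chanL (waveExp k) (2 * waveExp k) univ (fun t x => ‖L t x‖ₑ) ≠ ⊤ := by
  obtain ⟨a, hat, hal, ha⟩ := exists_cosSubOne_le_bump hk hu.memHDotOne hu.radial₀
  obtain ⟨W, hWm, hW⟩ := exists_measurable_of_lipschitz (norm_cosSubOne_sub_le hu.memHDotOne)
  obtain ⟨C₀, hC₀, hCb⟩ := exists_lintegral_waveKernel_le_bump hk
  set C := ‖waveConst k‖ₑ * C₀ with hCdef
  have hC : C ≠ ⊤ := ENNReal.mul_ne_top enorm_ne_top hC₀
  have hl := (locallyIntegrable_of_hasFourierTransform hu.memHDotOne.hat_spec.1).aestronglyMeasurable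
  set f := hl.mk u₀ with hf
  have hfm : Measurable f := hl.stronglyMeasurable_mk.measurable
  have hff : u₀ =ᵐ[volume] f := hl.ae_eq_mk
  set g := hu.memLp.1.mk u₁ with hg
  have hgm : Measurable g := hu.memLp.1.stronglyMeasurable_mk.measurable
  have hgg : u₁ =ᵐ[volume] g := hu.memLp.1.ae_eq_mk
  have hgL : MemLp g 2 volume := hu.memLp.ae_eq hgg
  have hgr : IsRadialOn univ g := by
    obtain ⟨h, hh⟩ := hu.radial₁
    refine ⟨h, ?_⟩
    filter_upwards [hh, hgg] with x h1 h2 h3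
    rw [← h2, h1 h3]
  have hLu : (toL2 fun y => (u₁ y : ℂ)) = toL2 fun y => (g y : ℂ) := by
    refine toL2_congr ?_
    filter_upwards [hgg] with y hy
    rw [hy]
  set b : ℤ → ℝ≥0∞ := fun i => C * lpn 2 volume (channelCut i (fun _ y => ‖g y‖ₑ) 0) with hb
  have hbl : lpn 2 Measure.count b ≠ ⊤ := by
    rw [hb, lpn_const_mul two_pos hC]
    refine ENNReal.mul_ne_top hC (ne_top_of_le_ne_top ?_ (lpn_count_shell_le hgm.enorm))
    have := hgL.2.ne
    rw [eLpNorm_eq_lintegral_rpow_enorm_toReal (p := 2) two_ne_zero ENNReal.ofNat_ne_top] at this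
    simpa [lpn] using this
  have hbt : ∀ i, b i ≠ ⊤ := ne_top_of_lpn_count hbl
  -- the kernel is for positive times; the sine is odd in the time and the cosine even
  set ε : ℝ → ℝ := fun t => if 0 ≤ t then 1 else -1 with hε
  have hεm : Measurable ε := Measurable.ite measurableSet_Ici measurable_const measurable_const
  have hε1 : ∀ t, ‖ε t‖ₑ = 1 := fun t => by
    simp only [hε]; split_ifs <;> simp
  set S : ℝ → Space (2 * k + 1) → ℝ := fun t x => ε t * radialProp k |t| g x with hS
  have hSm : Measurable (Function.uncurry S) := by
    have h1 : Measurable fun p : ℝ × Space (2 * k + 1) => radialProp k |p.1| g p.2 :=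
      measurable_radialProp hk (σ := fun t : ℝ => |t|) (by fun_prop) (f := fun _ => g)
        (hgm.comp measurable_snd)
    exact (hεm.comp measurable_fst).mul h1
  have hsin : ∀ t : ℝ, t ≠ 0 → ∀ᵐ x, |t| < ‖x‖ →
      sinOp t (toL2 fun y => (u₁ y : ℂ)) x = (S t x : ℂ) := by
    intro t ht
    rw [hLu]
    have h1 := sinOp_ae_eq hk hgm hgL hgr (abs_pos.mpr ht)
    by_cases h0 : 0 ≤ t
    · filter_upwards [h1] with x hx htx
      rw [abs_of_nonneg h0] at hx htx
      rw [hx htx]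
      simp only [hS, hε, if_pos h0, abs_of_nonneg h0, one_mul]
    · push Not at h0
      have h2 : sinOp t (toL2 fun y => (g y : ℂ)) = -sinOp |t| (toL2 fun y => (g y : ℂ)) := by
        rw [← sinOp_neg, abs_of_neg h0, neg_neg]
      rw [h2]
      filter_upwards [h1, Lp.coeFn_neg (sinOp |t| (toL2 fun y => (g y : ℂ)))] with x hx hneg htx
      rw [hneg, Pi.neg_apply, hx htx]
      simp [hS, hε, h0.not_ge]
  have hcos : ∀ t : ℝ, t ≠ 0 → ∃ Φ : Space (2 * k + 1) → ℝ, (∀ x y, ‖x‖ = ‖y‖ → Φ x = Φ y) ∧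
      ∀ᵐ x, |t| < ‖x‖ → f x + (W t x).re = Φ x ∧
        freeWave u₀ u₁ t x = ((f x + (W t x).re + S t x : ℝ) : ℂ) ∧
        ∀ j : ℤ, |t| + (2 : ℝ) ^ j ≤ ‖x‖ →
          ‖Φ x‖ₑ ≤ ∑' m : ℕ, a (j + m) * bump k (j + m) ‖x‖ := by
    intro t ht
    obtain ⟨Φ, hΦ, h1⟩ := ha |t| (abs_pos.mpr ht)
    refine ⟨Φ, hΦ, ?_⟩
    rw [cosSubOne_abs] at h1
    filter_upwards [h1, hW t, hff, hsin t ht] with x hx hWx hfx hSx htx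
    obtain ⟨h2, h3⟩ := hx htx
    have h4 : f x + (W t x).re = Φ x := by
      have := congrArg Complex.re h2
      rw [hWx, hfx] at this
      simpa using this
    refine ⟨h4, ?_, h3⟩
    rw [freeWave, h2, hSx htx, h4]
    push_cast; rfl
  refine ⟨fun t x => f x + (W t x).re + S t x, ?_, ?_, ?_, ?_⟩
  · exact ((hfm.comp measurable_snd).add (Complex.measurable_re.comp hWm)).add hSm
  · filter_upwards [Measure.ae_ne volume (0 : ℝ)] with t ht
    obtain ⟨Φ, hΦ, h1⟩ := hcos t ht
    filter_upwards [h1] with x hx htx using (hx htx).2.1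
  · filter_upwards [Measure.ae_ne volume (0 : ℝ)] with t ht
    obtain ⟨Φ, hΦ, h1⟩ := hcos t ht
    obtain ⟨h, hh⟩ := isRadialOn_of_norm (by omega) {x | |t| < ‖x‖} (Φ := fun x => Φ x + S t x)
      (fun x y hxy => by simp only [hS, hΦ x y hxy, radialProp_of_norm _ g hxy])
    refine ⟨h, ?_⟩
    filter_upwards [hh, h1] with x h2 h3 htx
    rw [← h2 htx, (h3 htx).1]
  · obtain ⟨K, hK, hKb⟩ := exists_chanL_le_of_bump hk
    refine ne_top_of_le_ne_top (ENNReal.mul_ne_top hK (lpn_count_add_ne_top hal hbl))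
      (hKb univ _ (fun i => a i + b i) (fun i => ENNReal.add_ne_top.mpr ⟨hat i, hbt i⟩) ?_)
    -- both parts are controlled at each scale: the cosine by the gradient of `u₀`, the sine by `u₁`
    filter_upwards [ae_restrict_of_ae (Measure.ae_ne volume (0 : ℝ))] with t ht
    obtain ⟨Φ, hΦ, h1⟩ := hcos t ht
    filter_upwards [h1] with x hx j hj _
    have htx : |t| < ‖x‖ := lt_of_lt_of_le (lt_add_of_pos_right _ (by positivity)) hj
    obtain ⟨h2, -, h3⟩ := hx htx
    rw [h2]
    refine (enorm_add_le _ _).trans ?_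
    simp_rw [add_mul]
    rw [ENNReal.tsum_add]
    refine add_le_add (h3 j hj) ?_
    rw [hS, enorm_mul, hε1, one_mul]
    refine (enorm_radialProp_le _ _ _).trans ((mul_le_mul_right (hCb (fun _ => g)
      (hgm.comp measurable_snd) x |t| 0 j (abs_pos.mpr ht)
      (by rw [abs_zero, zero_add, add_comm]; exact hj)) _).trans (le_of_eq ?_))
    rw [← mul_assoc, ← ENNReal.tsum_mul_left]
    simp only [hb, hCdef, mul_assoc]

/-! ### Linearity of the free wave and of the Duhamel integral -/

theorem hasFourierTransform_sub_hat {d : ℕ} {f g : Space d → ℝ} (hf : MemHDotOne f)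
    (hg : MemHDotOne g) :
    HasFourierTransform (fun x => ((f - g) x : ℂ)) (hatHDotOne f - hatHDotOne g) := by
  have h := hf.hat_spec.1.sub hg.hat_spec.1
  convert h using 1
  ext x
  simp

theorem MemHDotOne.sub {d : ℕ} {f g : Space d → ℝ} (hf : MemHDotOne f) (hg : MemHDotOne g) :
    MemHDotOne (f - g) := by
  refine ⟨_, hasFourierTransform_sub_hat hf hg, ?_⟩
  convert hf.hat_spec.2.sub hg.hat_spec.2 using 1
  ext ξ
  simp [mul_sub]

theorem cosSubOne_sub {d : ℕ} {f g : Space d → ℝ} (hf : MemHDotOne f) (hg : MemHDotOne g) (s : ℝ) :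
    cosSubOne s (f - g) = cosSubOne s f - cosSubOne s g := by
  simp only [cosSubOne]
  rw [← fourierInv_sub_Lp, ← toL2_sub (memLp_cosMul hf s) (memLp_cosMul hg s)]
  congr 1
  refine toL2_congr ?_
  filter_upwards [(hf.sub hg).hat_spec.1.unique (hasFourierTransform_sub_hat hf hg)] with ξ hξ
  rw [hξ]
  simp [mul_sub]

theorem freeWave_sub {d : ℕ} {u₀ u₁ v₀ v₁ : Space d → ℝ} (hu : IsRadialData u₀ u₁)
    (hv : IsRadialData v₀ v₁) (t : ℝ) : ∀ᵐ x, freeWave (u₀ - v₀) (u₁ - v₁) t x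
      = freeWave u₀ u₁ t x - freeWave v₀ v₁ t x := by
  have h1 : (toL2 fun y => ((u₁ - v₁) y : ℂ)) = (toL2 fun y => (u₁ y : ℂ)) - toL2 fun y => (v₁ y : ℂ) := by
    rw [← toL2_sub (memLp_ofReal hu.memLp) (memLp_ofReal hv.memLp)]
    congr 1
    ext y
    simp
  simp only [freeWave]
  rw [h1, cosSubOne_sub hu.memHDotOne hv.memHDotOne, sinOp_sub]
  filter_upwards [Lp.coeFn_sub (cosSubOne t u₀) (cosSubOne t v₀),
    Lp.coeFn_sub (sinOp t (toL2 fun y => (u₁ y : ℂ))) (sinOp t (toL2 fun y => (v₁ y : ℂ)))]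
    with x hx1 hx2
  rw [hx1, hx2]
  simp only [Pi.sub_apply, Complex.ofReal_sub]
  ring

theorem tsum_bump_ne_top {k : ℕ} (hk : 1 ≤ k) (j : ℤ) (r : ℝ) :
    ∑' m : ℕ, bump k (j + m) r ≠ ⊤ := by
  have hk' : (1 : ℝ) ≤ k := by exact_mod_cast hk
  set c : ℝ := 2 ^ ((1 : ℝ) / 2 - k) with hc
  have hc1 : c < 1 := Real.rpow_lt_one_of_one_lt_of_neg one_lt_two (by linarith)
  have hc0 : 0 ≤ c := by positivity
  refine ne_top_of_le_ne_top (Summable.tsum_ofReal_ne_top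
    ((summable_geometric_of_lt_one hc0 hc1).mul_left ((2 : ℝ) ^ ((j : ℝ) * (1 / 2 - k)))))
    (ENNReal.tsum_le_tsum fun m => ENNReal.ofReal_le_ofReal ?_)
  have h1 : (0 : ℝ) < 2 ^ (j + (m : ℤ)) := by positivity
  calc (2 : ℝ) ^ (((j + (m : ℤ) : ℤ) : ℝ) / 2) / max r ((2 : ℝ) ^ (j + (m : ℤ))) ^ k
      ≤ (2 : ℝ) ^ (((j + (m : ℤ) : ℤ) : ℝ) / 2) / ((2 : ℝ) ^ (j + (m : ℤ))) ^ k := by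
        gcongr
        exact le_max_right _ _
    _ = _ := by
      rw [hc, ← Real.rpow_natCast, ← Real.rpow_natCast, ← Real.rpow_intCast, ← Real.rpow_mul two_pos.le,
        ← Real.rpow_mul two_pos.le, ← Real.rpow_sub two_pos, ← Real.rpow_add two_pos]
      congr 1
      push_cast
      ring

theorem le_lpn_count (a : ℤ → ℝ≥0∞) (i : ℤ) : a i ≤ lpn 2 Measure.count a := by
  have h := ENNReal.rpow_le_rpow (ENNReal.le_tsum (f := fun i => a i ^ (2 : ℝ)) i)
    (by norm_num : (0 : ℝ) ≤ 1 / 2)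
  rw [← ENNReal.rpow_mul] at h
  norm_num at h
  rw [lpn, lintegral_count]
  simpa using h

section Duhamel

variable {k : ℕ} {G H : ℝ → Space (2 * k + 1) → ℝ} {J : Set ℝ} {t : ℝ} {x : Space (2 * k + 1)}

/-- The Duhamel integral of a source in `Z` converges absolutely at every point off the light cone, though
the source need not be in `L¹L²`. -/
theorem lintegral_duhamel_lt_top (hk : 1 ≤ k) (hG : Measurable (Function.uncurry G))
    (hJ : Ι 0 t ⊆ J) (hfin : chanL 1 2 J (fun τ y => ‖G τ y‖ₑ) ≠ ⊤) (hx : |t| < ‖x‖) :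
    (∫⁻ τ in Ι 0 t, ∫⁻ y, ‖waveKernel k 0 |t - τ| ‖x‖ ‖y‖ * G τ y‖ₑ) < ⊤ := by
  obtain ⟨C, hC, hCb⟩ := exists_lintegral_duhamel_le_bump hk
  obtain ⟨j, hj, -⟩ := exists_mem_channel hx
  refine (hCb G hG J t x j hJ hj).trans_lt (ENNReal.mul_lt_top hC.lt_top ?_)
  refine (ENNReal.tsum_le_tsum fun m : ℕ => mul_le_mul_left (le_lpn_count (fun i : ℤ =>
    mixedL 1 2 J (channelCut i fun τ y => ‖G τ y‖ₑ)) (j + m)) _).trans_lt ?_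
  rw [ENNReal.tsum_mul_left]
  exact ENNReal.mul_lt_top hfin.lt_top (tsum_bump_ne_top hk j _).lt_top

theorem measurable_duhamel_kernel (hk : 1 ≤ k) (hG : Measurable (Function.uncurry G)) :
    Measurable fun z : ℝ × Space (2 * k + 1) => waveKernel k 0 |t - z.1| ‖x‖ ‖z.2‖ * G z.1 z.2 := by
  have h1 : Measurable fun z : ℝ × Space (2 * k + 1) => waveKernel k 0 |t - z.1| ‖x‖ ‖z.2‖ :=
    (measurable_waveKernel hk (Nat.zero_le k)).comp
      (by fun_prop : Measurable fun z : ℝ × Space (2 * k + 1) => (|t - z.1|, ‖x‖, ‖z.2‖))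
  exact h1.mul hG

theorem integrable_duhamel_kernel (hk : 1 ≤ k) (hG : Measurable (Function.uncurry G))
    (hJ : Ι 0 t ⊆ J) (hfin : chanL 1 2 J (fun τ y => ‖G τ y‖ₑ) ≠ ⊤) (hx : |t| < ‖x‖) :
    Integrable (fun z : ℝ × Space (2 * k + 1) => waveKernel k 0 |t - z.1| ‖x‖ ‖z.2‖ * G z.1 z.2)
      ((volume.restrict (Ι 0 t)).prod volume) := by
  have hm := measurable_duhamel_kernel (t := t) (x := x) hk hG
  refine ⟨hm.aestronglyMeasurable, ?_⟩
  rw [hasFiniteIntegral_iff_enorm, lintegral_prod _ hm.enorm.aemeasurable]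
  exact lintegral_duhamel_lt_top hk hG hJ hfin hx

theorem radialDuhamel_eq_integral (hk : 1 ≤ k) (hG : Measurable (Function.uncurry G))
    (hJ : Ι 0 t ⊆ J) (hfin : chanL 1 2 J (fun τ y => ‖G τ y‖ₑ) ≠ ⊤) (hx : |t| < ‖x‖) :
    radialDuhamel k G t x = waveConst k * ∫ z : ℝ × Space (2 * k + 1),
      waveKernel k 0 |t - z.1| ‖x‖ ‖z.2‖ * G z.1 z.2 ∂((volume.restrict (Ι 0 t)).prod volume) := by
  rw [integral_prod _ (integrable_duhamel_kernel hk hG hJ hfin hx), ← integral_const_mul]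
  rfl

theorem chanL_enorm_sub_ne_top (hG : Measurable (Function.uncurry G))
    (hH : Measurable (Function.uncurry H)) (hGf : chanL 1 2 J (fun τ y => ‖G τ y‖ₑ) ≠ ⊤)
    (hHf : chanL 1 2 J (fun τ y => ‖H τ y‖ₑ) ≠ ⊤) :
    chanL 1 2 J (fun τ y => ‖G τ y - H τ y‖ₑ) ≠ ⊤ := by
  refine ne_top_of_le_ne_top (ENNReal.add_ne_top.mpr ⟨hGf, hHf⟩) (le_trans ?_
    (chanL_add_le le_rfl one_le_two hG.enorm hH.enorm))
  exact chanL_mono one_pos two_pos (Filter.Eventually.of_forall fun t =>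
    Filter.Eventually.of_forall fun x _ => enorm_sub_le)

theorem radialDuhamel_sub (hk : 1 ≤ k) (hG : Measurable (Function.uncurry G))
    (hH : Measurable (Function.uncurry H)) (hJ : Ι 0 t ⊆ J)
    (hGf : chanL 1 2 J (fun τ y => ‖G τ y‖ₑ) ≠ ⊤) (hHf : chanL 1 2 J (fun τ y => ‖H τ y‖ₑ) ≠ ⊤)
    (hx : |t| < ‖x‖) :
    radialDuhamel k (fun τ y => G τ y - H τ y) t x = radialDuhamel k G t x - radialDuhamel k H t x := by
  have hm : Measurable (Function.uncurry fun τ y => G τ y - H τ y) := hG.sub hH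
  rw [radialDuhamel_eq_integral hk hG hJ hGf hx, radialDuhamel_eq_integral hk hH hJ hHf hx,
    radialDuhamel_eq_integral hk hm hJ (chanL_enorm_sub_ne_top hG hH hGf hHf) hx, ← mul_sub,
    ← integral_sub (integrable_duhamel_kernel hk hG hJ hGf hx)
      (integrable_duhamel_kernel hk hH hJ hHf hx)]
  simp only [mul_sub]

/-- The Strichartz-type estimate for the Duhamel integral outside the light cone. -/
theorem exists_chanL_radialDuhamel_le (hk : 1 ≤ k) : ∃ K : ℝ≥0∞, K ≠ ⊤ ∧
    ∀ (G : ℝ → Space (2 * k + 1) → ℝ), Measurable (Function.uncurry G) →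
      ∀ J : Set ℝ, MeasurableSet J → (∀ t ∈ J, Ι 0 t ⊆ J) →
      chanL 1 2 J (fun τ y => ‖G τ y‖ₑ) ≠ ⊤ →
      chanL (waveExp k) (2 * waveExp k) J (fun t x => ‖radialDuhamel k G t x‖ₑ)
        ≤ K * chanL 1 2 J fun τ y => ‖G τ y‖ₑ := by
  obtain ⟨C, hC, hCb⟩ := exists_lintegral_duhamel_le_bump hk
  obtain ⟨K, hK, hKb⟩ := exists_chanL_le_of_bump hk
  set c := ‖waveConst k‖ₑ * C with hc
  have hct : c ≠ ⊤ := ENNReal.mul_ne_top enorm_ne_top hC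
  refine ⟨K * c, ENNReal.mul_ne_top hK hct, fun G hG J hJm hJ hfin => ?_⟩
  rw [mul_assoc, chanL.eq_1 1 2, ← lpn_const_mul two_pos hct]
  refine hKb J _ _ (fun i => ENNReal.mul_ne_top hct (ne_top_of_lpn_count hfin i)) ?_
  filter_upwards [ae_restrict_mem hJm] with t ht
  refine Filter.Eventually.of_forall fun x j hj _ => ?_
  calc ‖radialDuhamel k G t x‖ₑ ≤ ∫⁻ τ in Ι 0 t, ‖radialProp k |t - τ| (G τ) x‖ₑ :=
        enorm_integral_le_lintegral_enorm _
    _ ≤ ∫⁻ τ in Ι 0 t, ‖waveConst k‖ₑ * ∫⁻ y, ‖waveKernel k 0 |t - τ| ‖x‖ ‖y‖ * G τ y‖ₑ :=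
        lintegral_mono fun τ => enorm_radialProp_le _ _ _
    _ = ‖waveConst k‖ₑ * ∫⁻ τ in Ι 0 t, ∫⁻ y, ‖waveKernel k 0 |t - τ| ‖x‖ ‖y‖ * G τ y‖ₑ :=
        lintegral_const_mul' _ _ enorm_ne_top
    _ ≤ ‖waveConst k‖ₑ * (C * ∑' m : ℕ,
          mixedL 1 2 J (channelCut (j + m) fun τ y => ‖G τ y‖ₑ) * bump k (j + m) ‖x‖) :=
        mul_le_mul_right (hCb G hG J t x j (hJ t ht) hj) _
    _ = _ := by
        rw [← mul_assoc, ← ENNReal.tsum_mul_left]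
        simp only [hc, mul_assoc]

/-- The Duhamel integral is the sum of those of the parts of the source in the single channels. -/
theorem hasSum_radialDuhamel (hk : 1 ≤ k) (hG : Measurable (Function.uncurry G))
    (hsupp : ∀ τ y, ¬ |τ| < ‖y‖ → G τ y = 0) (hJ : Ι 0 t ⊆ J)
    (hfin : chanL 1 2 J (fun τ y => ‖G τ y‖ₑ) ≠ ⊤) (hx : |t| < ‖x‖) :
    HasSum (fun i : ℤ => radialDuhamel k (channelCut i G) t x) (radialDuhamel k G t x) := by
  -- the channels partition the exterior of the cone in space-time, and the integrand is integrable there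
  set S : ℤ → Set (ℝ × Space (2 * k + 1)) := fun j =>
    {z | |z.1| + (2 : ℝ) ^ j ≤ ‖z.2‖ ∧ ‖z.2‖ < |z.1| + (2 : ℝ) ^ (j + 1)} with hS
  have hSm : ∀ j, MeasurableSet (S j) := fun j =>
    (measurableSet_le (f := fun z : ℝ × Space (2 * k + 1) => |z.1| + (2 : ℝ) ^ j) (g := fun z => ‖z.2‖)
      (by fun_prop) (by fun_prop)).inter
    (measurableSet_lt (f := fun z : ℝ × Space (2 * k + 1) => ‖z.2‖)
      (g := fun z => |z.1| + (2 : ℝ) ^ (j + 1)) (by fun_prop) (by fun_prop))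
  have hdisj : Pairwise (Function.onFun Disjoint S) := by
    intro i j hij
    rw [Function.onFun, Set.disjoint_left]
    rintro z ⟨h1, h2⟩ ⟨h3, h4⟩
    have h5 := (zpow_lt_zpow_iff_right₀ (one_lt_two (α := ℝ))).mp
      (lt_of_add_lt_add_left (h1.trans_lt h4))
    have h6 := (zpow_lt_zpow_iff_right₀ (one_lt_two (α := ℝ))).mp
      (lt_of_add_lt_add_left (h3.trans_lt h2))
    omega
  have hint := integrable_duhamel_kernel hk hG hJ hfin hx
  have hchan : ∀ i : ℤ, radialDuhamel k (channelCut i G) t x = waveConst k *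
      ∫ z in S i, waveKernel k 0 |t - z.1| ‖x‖ ‖z.2‖ * G z.1 z.2
        ∂((volume.restrict (Ι 0 t)).prod volume) := by
    intro i
    have hle : chanL 1 2 J (fun τ y => ‖channelCut i G τ y‖ₑ) ≠ ⊤ := by
      refine ne_top_of_le_ne_top hfin (chanL_mono one_pos two_pos (Filter.Eventually.of_forall fun τ =>
        Filter.Eventually.of_forall fun y _ => ?_))
      rw [channelCut]
      exact enorm_indicator_le_enorm_self _ _
    rw [radialDuhamel_eq_integral hk (measurable_channelCut hG i) hJ hle hx,
      ← integral_indicator (hSm i)]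
    congr 2
    ext z
    by_cases hz : z ∈ S i
    · rw [indicator_of_mem hz, channelCut_of_mem hz]
    · rw [indicator_of_notMem hz, channelCut_of_notMem hz, mul_zero]
  simp only [hchan]
  rw [radialDuhamel_eq_integral hk hG hJ hfin hx]
  refine HasSum.mul_left _ ?_
  have h0 : ∫ z : ℝ × Space (2 * k + 1), waveKernel k 0 |t - z.1| ‖x‖ ‖z.2‖ * G z.1 z.2
      ∂((volume.restrict (Ι 0 t)).prod volume) = ∫ z in ⋃ i, S i,
        waveKernel k 0 |t - z.1| ‖x‖ ‖z.2‖ * G z.1 z.2 ∂((volume.restrict (Ι 0 t)).prod volume) := by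
    refine (setIntegral_eq_integral_of_forall_compl_eq_zero fun z hz => ?_).symm
    rw [hsupp z.1 z.2, mul_zero]
    intro hlt
    obtain ⟨j, hj⟩ := exists_mem_channel hlt
    exact hz (mem_iUnion.mpr ⟨j, hj⟩)
  rw [h0]
  exact hasSum_integral_iUnion hSm hdisj hint.integrableOn

theorem channelCut_congr {d : ℕ} {G H : ℝ → Space d → ℝ} {τ : ℝ} (h : G τ =ᵐ[volume] H τ) (i : ℤ) :
    channelCut i G τ =ᵐ[volume] channelCut i H τ := by
  filter_upwards [h] with y hy
  simp only [channelCut, indicator_apply, hy]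

theorem duhamel_congr {d : ℕ} {G H : ℝ → Space d → ℝ} {t : ℝ}
    (h : ∀ᵐ τ ∂(volume.restrict (Ι 0 t)), G τ =ᵐ[volume] H τ) : duhamel G t = duhamel H t := by
  refine intervalIntegral.integral_congr_ae_restrict ?_
  filter_upwards [h] with τ hτ
  have : (toL2 fun y => (G τ y : ℂ)) = toL2 fun y => (H τ y : ℂ) := by
    refine toL2_congr ?_
    filter_upwards [hτ] with y hy
    rw [hy]
  rw [this]

/-- The Duhamel integral of a source in `Z`, taken channel by channel. -/
theorem hasSum_duhamel (hk : 1 ≤ k) (hG : Measurable (Function.uncurry G))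
    (hr : ∀ᵐ τ ∂(volume.restrict J), IsRadialOn univ (G τ))
    (hsupp : ∀ τ y, ¬ |τ| < ‖y‖ → G τ y = 0) (hJ : Ι 0 t ⊆ J)
    (hfin : chanL 1 2 J (fun τ y => ‖G τ y‖ₑ) ≠ ⊤) :
    ∀ᵐ x, |t| < ‖x‖ →
      HasSum (fun i : ℤ => duhamel (channelCut i G) t x) (radialDuhamel k G t x : ℂ) := by
  have h1 : ∀ i : ℤ, ∀ᵐ x, |t| < ‖x‖ →
      duhamel (channelCut i G) t x = (radialDuhamel k (channelCut i G) t x : ℂ) := by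
    intro i
    refine duhamel_ae_eq hk (measurable_channelCut hG i) ?_ ?_
    · filter_upwards [ae_restrict_of_ae_restrict_of_subset hJ hr] with τ ⟨h, hh⟩
      refine ⟨fun r => if |τ| + (2 : ℝ) ^ i ≤ r ∧ r < |τ| + (2 : ℝ) ^ (i + 1) then h r else 0, ?_⟩
      filter_upwards [hh] with y hy hy'
      simp only [channelCut, indicator_apply, hy hy', mem_ofPred_eq]
    · have h2 : mixedL 1 2 J (channelCut i fun τ y => ‖G τ y‖ₑ) ≠ ⊤ :=
        ne_top_of_le_ne_top hfin (mixedL_le_chanL _ i)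
      refine lt_of_le_of_lt (le_of_eq_of_le (lintegral_congr fun τ => ?_)
        (lintegral_mono_set hJ)) (lt_top_iff_ne_top.mpr (?_ : ∫⁻ τ in J,
          lpn 2 volume (channelCut i (fun τ y => ‖G τ y‖ₑ) τ) ≠ ⊤))
      · rw [eLpNorm_eq_lintegral_rpow_enorm_toReal (p := 2) two_ne_zero ENNReal.ofNat_ne_top, lpn]
        simp only [ENNReal.toReal_ofNat, enorm_channelCut]
      · simpa [mixedL, lpn] using h2
  filter_upwards [ae_all_iff.mpr h1] with x hx htx
  have h2 := hasSum_radialDuhamel hk hG hsupp hJ hfin htx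
  simp only [fun i => hx i htx]
  exact Complex.hasSum_ofReal.mpr h2

theorem radialDuhamel_of_norm (G : ℝ → Space (2 * k + 1) → ℝ) (t : ℝ) {x y : Space (2 * k + 1)}
    (h : ‖x‖ = ‖y‖) : radialDuhamel k G t x = radialDuhamel k G t y := by
  simp only [radialDuhamel, radialProp_of_norm _ _ h]

end Duhamel

/-! ### The nonlinear estimate -/

/-- Hölder with the exponents `p / (p - 1)` and `p`, applied to `a ^ (p - 1)` and `b`. -/
theorem lpn_rpow_mul_le {α : Type*} [MeasurableSpace α] {μ : Measure α} {r p : ℝ} (hr : 0 < r)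
    (hp : 1 < p) {a b : α → ℝ≥0∞} (ha : AEMeasurable a μ) (hb : AEMeasurable b μ) :
    lpn r μ (fun z => a z ^ (p - 1) * b z) ≤ lpn (r * p) μ a ^ (p - 1) * lpn (r * p) μ b := by
  have hp0 : 0 < p := by linarith
  have hp1 : 0 < p - 1 := by linarith
  have hpq : (p / (p - 1)).HolderConjugate p := (Real.HolderConjugate.conjExponent hp).symm
  have h1 := ENNReal.lintegral_mul_le_Lp_mul_Lq μ hpq ((ha.pow_const ((p - 1) * r)))
    (hb.pow_const r)
  have h2 : ∀ z, (a z ^ (p - 1) * b z) ^ r = a z ^ ((p - 1) * r) * b z ^ r := fun z => by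
    rw [ENNReal.mul_rpow_of_nonneg _ _ hr.le, ← ENNReal.rpow_mul]
  have h3 : ∀ z, (a z ^ ((p - 1) * r)) ^ (p / (p - 1)) = a z ^ (r * p) := fun z => by
    rw [← ENNReal.rpow_mul]
    congr 1
    field_simp
  have h4 : ∀ z, (b z ^ r) ^ p = b z ^ (r * p) := fun z => by
    rw [← ENNReal.rpow_mul]
  simp only [Pi.mul_apply, h3, h4] at h1
  simp only [lpn, h2]
  refine (ENNReal.rpow_le_rpow h1 (by positivity)).trans (le_of_eq ?_)
  rw [ENNReal.mul_rpow_of_nonneg _ _ (by positivity), ← ENNReal.rpow_mul, ← ENNReal.rpow_mul,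
    ← ENNReal.rpow_mul]
  congr 2 <;> field_simp

/-- Hölder in each channel. The factor `a` is estimated by its largest channel, so that the square sum
over the channels falls on `b` alone. -/
theorem chanL_rpow_mul_le {d : ℕ} {p : ℝ} (hp : 1 < p) (J : Set ℝ) {a b : ℝ → Space d → ℝ≥0∞}
    (ha : Measurable (Function.uncurry a)) (hb : Measurable (Function.uncurry b))
    (hfin : chanL p (2 * p) J a ≠ ⊤) :
    chanL 1 2 J (fun t x => a t x ^ (p - 1) * b t x)
      ≤ chanL p (2 * p) J a ^ (p - 1) * chanL p (2 * p) J b := by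
  have hp1 : 0 < p - 1 := by linarith
  rw [chanL.eq_1 p _ _ b, ← lpn_const_mul two_pos (ENNReal.rpow_ne_top_of_nonneg hp1.le hfin)]
  refine lpn_mono two_pos (Filter.Eventually.of_forall fun j => ?_)
  have hcut : channelCut j (fun t x => a t x ^ (p - 1) * b t x)
      = fun t x => channelCut j a t x ^ (p - 1) * channelCut j b t x := by
    ext t x
    simp only [channelCut, indicator_apply]
    split_ifs <;> simp
  rw [hcut]
  have ham := measurable_channelCut ha j
  have hbm := measurable_channelCut hb j
  calc _ ≤ lpn 1 (volume.restrict J) fun t => lpn (2 * p) volume (channelCut j a t) ^ (p - 1) *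
        lpn (2 * p) volume (channelCut j b t) := by
        refine lpn_mono one_pos (Filter.Eventually.of_forall fun t => ?_)
        exact lpn_rpow_mul_le two_pos hp (ham.comp measurable_prodMk_left).aemeasurable
          (hbm.comp measurable_prodMk_left).aemeasurable
    _ ≤ mixedL p (2 * p) J (channelCut j a) ^ (p - 1) * mixedL p (2 * p) J (channelCut j b) := by
        have := lpn_rpow_mul_le (μ := volume.restrict J) one_pos hp
          (measurable_lpn_section (q := 2 * p) ham).aemeasurable
          (measurable_lpn_section (q := 2 * p) hbm).aemeasurable
        rwa [one_mul] at this
    _ ≤ _ := by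
        gcongr
        exact mixedL_le_chanL a j

/-- The norm of `Y(J)` in dimension `2k + 1`. -/
noncomputable def waveNorm (k : ℕ) (J : Set ℝ) (u : ℝ → Space (2 * k + 1) → ℝ) : ℝ≥0∞ :=
  chanL (waveExp k) (2 * waveExp k) J fun t x => ‖u t x‖ₑ

/-- The norm of `Z(J)`. -/
noncomputable def sourceNorm {d : ℕ} (J : Set ℝ) (G : ℝ → Space d → ℝ) : ℝ≥0∞ :=
  chanL 1 2 J fun t x => ‖G t x‖ₑ

/-- The exponents `p`, `q` and `4 / (d - 2) = p - 1` in dimension `d = 2k + 1`. -/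
theorem exponent_eq {k : ℕ} (hk : 1 ≤ k) :
    (((2 * k + 1 : ℕ) : ℝ) + 2) / (((2 * k + 1 : ℕ) : ℝ) - 2) = waveExp k ∧
    2 * (((2 * k + 1 : ℕ) : ℝ) + 2) / (((2 * k + 1 : ℕ) : ℝ) - 2) = 2 * waveExp k ∧
    4 / (((2 * k + 1 : ℕ) : ℝ) - 2) = waveExp k - 1 := by
  have hk' : (1 : ℝ) ≤ k := by exact_mod_cast hk
  have h1 : (2 * k - 1 : ℝ) ≠ 0 := by linarith
  have h2 : (((2 * k + 1 : ℕ) : ℝ) - 2) = 2 * k - 1 := by push_cast; ring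
  have h3 : (((2 * k + 1 : ℕ) : ℝ) + 2) = 2 * k + 3 := by push_cast; ring
  rw [h2, h3, waveExp]
  refine ⟨rfl, by ring, ?_⟩
  field_simp
  ring

theorem YNorm_eq {k : ℕ} (hk : 1 ≤ k) {V : Type*} [NormedAddCommGroup V] (J : Set ℝ)
    (u : ℝ → Space (2 * k + 1) → V) :
    YNorm J u = chanL (waveExp k) (2 * waveExp k) J fun t x => ‖u t x‖ₑ := by
  obtain ⟨h1, h2, -⟩ := exponent_eq hk
  rw [YNorm, h1, h2, chan_eq]

theorem ZNorm_eq {d : ℕ} (J : Set ℝ) (G : ℝ → Space d → ℝ) : ZNorm J G = sourceNorm J G := by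
  rw [ZNorm, chan_eq, sourceNorm]

section source

variable {k : ℕ} {C : ℝ} {F : ℝ → Space (2 * k + 1) → ℝ → ℝ} {R : ℝ}
  {u v : ℝ → Space (2 * k + 1) → ℝ}

theorem IsEnergyCritical.zero (hk : 1 ≤ k) (hF : IsEnergyCritical C F) (t : ℝ)
    (x : Space (2 * k + 1)) : F t x 0 = 0 := by
  have h := hF.growth t x 0
  rw [(exponent_eq hk).1, abs_zero, Real.zero_rpow (by linarith [one_lt_waveExp hk]), mul_zero] at h
  exact abs_nonpos_iff.mp h

theorem source_zero (hk : 1 ≤ k) (hF : IsEnergyCritical C F) (R : ℝ) :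
    source F R (fun _ _ => 0) = fun _ _ => 0 := by
  ext t x
  simp [source, extCut, hF.zero hk]

theorem IsEnergyCritical.enorm_sub_le (hk : 1 ≤ k) (hF : IsEnergyCritical C F) (t : ℝ)
    (x : Space (2 * k + 1)) (a b : ℝ) :
    ‖F t x a - F t x b‖ₑ ≤
      ‖C‖ₑ * (‖a‖ₑ ^ (waveExp k - 1) * ‖a - b‖ₑ + ‖b‖ₑ ^ (waveExp k - 1) * ‖a - b‖ₑ) := by
  have hp : 0 ≤ waveExp k - 1 := by linarith [one_lt_waveExp hk]
  have h := hF.lipschitz t x a b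
  rw [(exponent_eq hk).2.2] at h
  have h2 : |F t x a - F t x b| ≤
      |C| * ((|a| ^ (waveExp k - 1)) * |a - b| + |b| ^ (waveExp k - 1) * |a - b|) := by
    refine h.trans ?_
    rw [← add_mul, mul_assoc]
    gcongr
    exact le_abs_self C
  simp only [Real.enorm_eq_ofReal_abs]
  rw [ENNReal.ofReal_rpow_of_nonneg (abs_nonneg _) hp, ENNReal.ofReal_rpow_of_nonneg (abs_nonneg _) hp,
    ← ENNReal.ofReal_mul (by positivity), ← ENNReal.ofReal_mul (by positivity),
    ← ENNReal.ofReal_add (by positivity) (by positivity), ← ENNReal.ofReal_mul (by positivity)]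
  exact ENNReal.ofReal_le_ofReal h2

theorem IsEnergyCritical.continuous (hk : 1 ≤ k) (hF : IsEnergyCritical C F) (t : ℝ)
    (x : Space (2 * k + 1)) : Continuous (F t x) := by
  have hp : 0 ≤ waveExp k - 1 := by linarith [one_lt_waveExp hk]
  rw [continuous_iff_continuousAt]
  intro b
  rw [ContinuousAt, tendsto_iff_norm_sub_tendsto_zero]
  refine squeeze_zero (fun _ => norm_nonneg _) (fun a => hF.lipschitz t x a b) ?_
  rw [(exponent_eq hk).2.2]
  have hc : Continuous fun a : ℝ => C * (|a| ^ (waveExp k - 1) + |b| ^ (waveExp k - 1)) * |a - b| :=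
    (continuous_const.mul ((continuous_abs.rpow_const fun _ => Or.inr hp).add continuous_const)).mul
      (by fun_prop)
  have := hc.tendsto b
  simpa using this

theorem measurable_source (hk : 1 ≤ k) (hF : IsEnergyCritical C F)
    (hu : Measurable (Function.uncurry u)) (R : ℝ) :
    Measurable (Function.uncurry (source F R u)) := by
  have h1 : Measurable fun p : ℝ × (ℝ × Space (2 * k + 1)) => F p.2.1 p.2.2 p.1 :=
    measurable_uncurry_of_continuous_of_measurable (u := fun a (z : ℝ × Space (2 * k + 1)) =>
      F z.1 z.2 a) (fun z => hF.continuous hk z.1 z.2) hF.measurable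
  have h2 : Measurable fun z : ℝ × Space (2 * k + 1) => F z.1 z.2 (Function.uncurry u z) :=
    h1.comp (hu.prodMk measurable_id)
  exact measurable_extCut (f := fun t x => F t x (u t x)) h2 R

theorem source_of_notMem {t : ℝ} {x : Space (2 * k + 1)} (h : ¬ R + |t| < ‖x‖) :
    source F R u t x = 0 := by
  simp only [source, extCut]
  exact indicator_of_notMem (show x ∉ {x : Space (2 * k + 1) | R + |t| < ‖x‖} from h) _

theorem isRadialOn_source (hF : IsEnergyCritical C F) {t : ℝ} (hu : IsRadialOn univ (u t)) :
    IsRadialOn univ (source F R u t) := by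
  obtain ⟨h, hh⟩ := hu
  refine ⟨fun r => if R + |t| < r then
    F t (EuclideanSpace.single (0 : Fin (2 * k + 1)) r) (h r) else 0, ?_⟩
  filter_upwards [hh] with x hx hx'
  simp only [source, extCut, indicator_apply, mem_ofPred_eq, hx hx']
  split_ifs
  · exact hF.radial _ _ _ _ (by rw [PiLp.norm_single, norm_norm])
  · rfl

/-- The nonlinearity is locally Lipschitz from `Y` to `Z`. -/
theorem sourceNorm_source_sub_le (hk : 1 ≤ k) (hF : IsEnergyCritical C F) (J : Set ℝ)
    (hu : Measurable (Function.uncurry u)) (hv : Measurable (Function.uncurry v))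
    (huf : waveNorm k J u ≠ ⊤) (hvf : waveNorm k J v ≠ ⊤) :
    sourceNorm J (fun t x => source F R u t x - source F R v t x) ≤
      ‖C‖ₑ * (waveNorm k J u ^ (waveExp k - 1) + waveNorm k J v ^ (waveExp k - 1)) *
        waveNorm k J fun t x => u t x - v t x := by
  have hp := one_lt_waveExp hk
  have huv : Measurable (Function.uncurry fun t x => ‖u t x - v t x‖ₑ) := (hu.sub hv).enorm
  have hm : ∀ w : ℝ → Space (2 * k + 1) → ℝ, Measurable (Function.uncurry w) → Measurable
      (Function.uncurry fun t x => ‖w t x‖ₑ ^ (waveExp k - 1) * ‖u t x - v t x‖ₑ) := fun w hw => by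
    have h1 : Measurable fun z : ℝ × Space (2 * k + 1) => ‖Function.uncurry w z‖ₑ ^ (waveExp k - 1) :=
      hw.enorm.pow_const _
    exact h1.mul huv
  calc _ ≤ chanL 1 2 J fun t x => ‖C‖ₑ * (‖u t x‖ₑ ^ (waveExp k - 1) * ‖u t x - v t x‖ₑ +
        ‖v t x‖ₑ ^ (waveExp k - 1) * ‖u t x - v t x‖ₑ) := by
        refine chanL_mono one_pos two_pos (Filter.Eventually.of_forall fun t =>
          Filter.Eventually.of_forall fun x _ => ?_)
        simp only [source, extCut, indicator_apply]
        split_ifs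
        · exact hF.enorm_sub_le hk t x _ _
        · simp
    _ ≤ ‖C‖ₑ * (waveNorm k J u ^ (waveExp k - 1) * (waveNorm k J fun t x => u t x - v t x) +
        waveNorm k J v ^ (waveExp k - 1) * waveNorm k J fun t x => u t x - v t x) := by
        rw [chanL_const_mul one_pos two_pos enorm_ne_top]
        gcongr
        refine (chanL_add_le le_rfl one_le_two (hm u hu) (hm v hv)).trans ?_
        exact add_le_add (chanL_rpow_mul_le hp J hu.enorm huv huf)
          (chanL_rpow_mul_le hp J hv.enorm huv hvf)
    _ = _ := by ring

theorem sourceNorm_source_le (hk : 1 ≤ k) (hF : IsEnergyCritical C F) (J : Set ℝ)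
    (hu : Measurable (Function.uncurry u)) (huf : waveNorm k J u ≠ ⊤) :
    sourceNorm J (source F R u) ≤ ‖C‖ₑ * waveNorm k J u ^ (waveExp k - 1) * waveNorm k J u := by
  have hp := one_lt_waveExp hk
  have h0 : waveNorm k J (fun _ _ => 0) = 0 := by
    have h1 : (fun (t : ℝ) (x : Space (2 * k + 1)) => ‖(0 : ℝ)‖ₑ) = fun _ _ => 0 * (0 : ℝ≥0∞) := by
      simp
    rw [waveNorm, h1, chanL_const_mul (by linarith) (by linarith) ENNReal.zero_ne_top, zero_mul]
  have h := sourceNorm_source_sub_le (R := R) (v := fun _ _ => 0) hk hF J hu measurable_const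
    huf (by rw [h0]; exact ENNReal.zero_ne_top)
  rw [h0, ENNReal.zero_rpow_of_pos (by linarith), source_zero hk hF] at h
  simpa using h

end source

section waveNorm

variable {k : ℕ} {J : Set ℝ} {u v : ℝ → Space (2 * k + 1) → ℝ}

theorem waveNorm_mono (hk : 1 ≤ k)
    (h : ∀ᵐ t ∂(volume.restrict J), ∀ᵐ x, |t| < ‖x‖ → ‖u t x‖ₑ ≤ ‖v t x‖ₑ) :
    waveNorm k J u ≤ waveNorm k J v := by
  have hp := one_lt_waveExp hk
  exact chanL_mono (by linarith) (by linarith) h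

theorem waveNorm_congr (hk : 1 ≤ k)
    (h : ∀ᵐ t ∂(volume.restrict J), ∀ᵐ x, |t| < ‖x‖ → u t x = v t x) :
    waveNorm k J u = waveNorm k J v := by
  have hp := one_lt_waveExp hk
  refine chanL_congr (by linarith) (by linarith) ?_
  filter_upwards [h] with t ht
  filter_upwards [ht] with x hx hx'
  rw [hx hx']

theorem waveNorm_le_add (hk : 1 ≤ k) {w : ℝ → Space (2 * k + 1) → ℝ}
    (hv : Measurable (Function.uncurry v)) (hw : Measurable (Function.uncurry w))
    (h : ∀ᵐ t ∂(volume.restrict J), ∀ᵐ x, |t| < ‖x‖ → ‖u t x‖ₑ ≤ ‖v t x‖ₑ + ‖w t x‖ₑ) :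
    waveNorm k J u ≤ waveNorm k J v + waveNorm k J w := by
  have hp := one_lt_waveExp hk
  exact (chanL_mono (by linarith) (by linarith) h).trans
    (chanL_add_le hp.le (by linarith) hv.enorm hw.enorm)

theorem ae_eq_zero_of_waveNorm (hk : 1 ≤ k) (hu : Measurable (Function.uncurry u))
    (h : waveNorm k J u = 0) : ∀ᵐ t ∂(volume.restrict J), ∀ᵐ x, |t| < ‖x‖ → u t x = 0 := by
  have hp := one_lt_waveExp hk
  filter_upwards [ae_eq_zero_of_chanL (by linarith) (by linarith) hu.enorm h] with t ht
  filter_upwards [ht] with x hx hx'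
  exact enorm_eq_zero.mp (hx hx')

theorem waveNorm_mono_set (hk : 1 ≤ k) {J' : Set ℝ} (hJ : J ⊆ J')
    (u : ℝ → Space (2 * k + 1) → ℝ) : waveNorm k J u ≤ waveNorm k J' u :=
  chanL_mono_set (by linarith [one_lt_waveExp hk]) hJ _

/-- The norm over a sequence of time sets that leave almost every time tends to zero. -/
theorem tendsto_waveNorm_inter (hk : 1 ≤ k) (hu : Measurable (Function.uncurry u))
    (hfin : waveNorm k J u ≠ ⊤) {S : ℕ → Set ℝ} (hS : ∀ n, MeasurableSet (S n)) {N : Set ℝ}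
    (hN : volume N = 0) (hNm : MeasurableSet N)
    (h : ∀ t ∉ N, ∀ᶠ n in Filter.atTop, t ∉ S n) :
    Filter.Tendsto (fun n => waveNorm k (J ∩ S n) u) Filter.atTop (nhds 0) := by
  have hp := one_lt_waveExp hk
  have hp0 : 0 < waveExp k := by linarith
  have hq0 : 0 < 2 * waveExp k := by linarith
  -- the times in the null set are removed
  have h1 : ∀ n, waveNorm k (J ∩ S n) u = chanL (waveExp k) (2 * waveExp k) J
      fun t x => (S n \ N).indicator (fun t => ‖u t x‖ₑ) t := by
    intro n
    rw [chanL_indicator hp0 hq0 ((hS n).diff hNm) fun t x => ‖u t x‖ₑ, waveNorm]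
    have h2 : volume.restrict (J ∩ (S n \ N)) = volume.restrict (J ∩ S n) := by
      refine Measure.restrict_congr_set ?_
      have h3 : ∀ᵐ t, t ∉ N := measure_eq_zero_iff_ae_notMem.mp hN
      filter_upwards [h3] with t ht
      apply propext
      exact ⟨fun h => ⟨h.1, h.2.1⟩, fun h => ⟨h.1, h.2, ht⟩⟩
    simp only [chanL, mixedL, h2]
  simp only [h1]
  refine tendsto_chanL_zero hp0 hq0 (g := fun t x => ‖u t x‖ₑ) (fun n => ?_) hu.enorm
    (fun n t x => indicator_le_self' (fun _ _ => zero_le) t) hfin fun t x _ => ?_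
  · exact hu.enorm.indicator (((hS n).diff hNm).preimage measurable_fst)
  · refine tendsto_const_nhds.congr' ?_
    by_cases ht : t ∈ N
    · exact Filter.Eventually.of_forall fun n => (indicator_of_notMem (fun h' => h'.2 ht) _).symm
    · filter_upwards [h t ht] with n hn
      exact (indicator_of_notMem (fun h' => hn h'.1) _).symm

end waveNorm

/-! ### A priori bounds for the integral equation -/

/-- Measurable sets of times that contain with a time `t` all times between `0` and `t`. -/
structure IsTimeSet (J : Set ℝ) : Prop where
  measurable : MeasurableSet J
  uIoc_subset : ∀ t ∈ J, Ι 0 t ⊆ J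

theorem isTimeSet_of_ordConnected {J : Set ℝ} (hJ : J.OrdConnected) (h0 : (0 : ℝ) ∈ J) :
    IsTimeSet J :=
  ⟨hJ.measurableSet, fun _ ht => uIoc_subset_uIcc.trans (hJ.uIcc_subset h0 ht)⟩

/-- The integral equation for a measurable function that vanishes outside the exterior region, with
the free wave given by `L`. -/
structure IsMildSolution {k : ℕ} (F : ℝ → Space (2 * k + 1) → ℝ → ℝ) (R : ℝ) (I : Set ℝ)
    (L u : ℝ → Space (2 * k + 1) → ℝ) : Prop where
  measurable : Measurable (Function.uncurry u)
  support : ∀ t x, ¬ R + |t| < ‖x‖ → u t x = 0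
  radial : ∀ᵐ t ∂(volume.restrict I), IsRadialOn univ (u t)
  finite : waveNorm k I u ≠ ⊤
  equation : ∀ᵐ t ∂(volume.restrict I), ∀ᵐ x, R + |t| < ‖x‖ →
    u t x = L t x + radialDuhamel k (source F R u) t x

theorem measurable_radialDuhamel_uncurry {k : ℕ} (hk : 1 ≤ k) {G : ℝ → Space (2 * k + 1) → ℝ}
    (hG : Measurable (Function.uncurry G)) :
    Measurable (Function.uncurry (radialDuhamel k G)) :=
  measurable_radialDuhamel hk hG

theorem radialDuhamel_zero (k : ℕ) : radialDuhamel k (fun _ _ => 0) = fun _ _ => 0 := by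
  ext t x
  simp [radialDuhamel, radialProp]

theorem sourceNorm_ne_top {k : ℕ} (hk : 1 ≤ k) {C : ℝ} {F : ℝ → Space (2 * k + 1) → ℝ → ℝ}
    (hF : IsEnergyCritical C F) {R : ℝ} {J : Set ℝ} {u : ℝ → Space (2 * k + 1) → ℝ}
    (hu : Measurable (Function.uncurry u)) (huf : waveNorm k J u ≠ ⊤) :
    sourceNorm J (source F R u) ≠ ⊤ :=
  ne_top_of_le_ne_top (ENNReal.mul_ne_top (ENNReal.mul_ne_top enorm_ne_top
    (ENNReal.rpow_ne_top_of_nonneg (by linarith [one_lt_waveExp hk]) huf)) huf)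
    (sourceNorm_source_le hk hF J hu huf)

/-- `A` is an admissible constant in the Lipschitz bound of the Duhamel integral of the
nonlinearity. -/
def IsDuhamelBound (k : ℕ) (C : ℝ) (A : ℝ≥0∞) : Prop :=
  ∀ (F : ℝ → Space (2 * k + 1) → ℝ → ℝ), IsEnergyCritical C F → ∀ (R : ℝ) (J : Set ℝ), IsTimeSet J →
    ∀ (u v : ℝ → Space (2 * k + 1) → ℝ), Measurable (Function.uncurry u) →
      Measurable (Function.uncurry v) → waveNorm k J u ≠ ⊤ → waveNorm k J v ≠ ⊤ →
      waveNorm k J (fun t x => radialDuhamel k (source F R u) t x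
          - radialDuhamel k (source F R v) t x) ≤
        A * (waveNorm k J u ^ (waveExp k - 1) + waveNorm k J v ^ (waveExp k - 1)) *
          waveNorm k J fun t x => u t x - v t x

/-- The Duhamel integral of the nonlinearity is locally Lipschitz from `Y` to `Y`. -/
theorem exists_duhamel_source_sub_le {k : ℕ} (hk : 1 ≤ k) (C : ℝ) :
    ∃ A : ℝ≥0∞, A ≠ ⊤ ∧ IsDuhamelBound k C A := by
  obtain ⟨K, hK, hKb⟩ := exists_chanL_radialDuhamel_le hk
  refine ⟨K * ‖C‖ₑ, ENNReal.mul_ne_top hK enorm_ne_top, fun F hF R J hJ u v hu hv huf hvf => ?_⟩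
  have hsu := measurable_source hk hF hu R
  have hsv := measurable_source hk hF hv R
  have hzu := sourceNorm_ne_top (R := R) hk hF hu huf
  have hzv := sourceNorm_ne_top (R := R) hk hF hv hvf
  calc _ = waveNorm k J (radialDuhamel k fun τ y => source F R u τ y - source F R v τ y) := by
        refine waveNorm_congr hk ?_
        filter_upwards [ae_restrict_mem hJ.measurable] with t ht
        exact Filter.Eventually.of_forall fun x hx =>
          (radialDuhamel_sub hk hsu hsv (hJ.uIoc_subset t ht) hzu hzv hx).symm
    _ ≤ K * sourceNorm J fun τ y => source F R u τ y - source F R v τ y :=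
        hKb (fun τ y => source F R u τ y - source F R v τ y) (hsu.sub hsv) J hJ.measurable hJ.uIoc_subset (chanL_enorm_sub_ne_top hsu hsv hzu hzv)
    _ ≤ K * (‖C‖ₑ * (waveNorm k J u ^ (waveExp k - 1) + waveNorm k J v ^ (waveExp k - 1)) *
          waveNorm k J fun t x => u t x - v t x) := by
        gcongr
        exact sourceNorm_source_sub_le hk hF J hu hv huf hvf
    _ = _ := by ring

section apriori

variable {k : ℕ} {C : ℝ} {A : ℝ≥0∞} {F : ℝ → Space (2 * k + 1) → ℝ → ℝ} {R : ℝ} {I J : Set ℝ}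
  {L M u v : ℝ → Space (2 * k + 1) → ℝ}

theorem waveNorm_zero (hk : 1 ≤ k) : waveNorm k J (fun _ _ => 0) = 0 := by
  have hp := one_lt_waveExp hk
  have h1 : (fun (t : ℝ) (x : Space (2 * k + 1)) => ‖(0 : ℝ)‖ₑ) = fun _ _ => 0 * (0 : ℝ≥0∞) := by
    simp
  rw [waveNorm, h1, chanL_const_mul (by linarith) (by linarith) ENNReal.zero_ne_top, zero_mul]

theorem IsDuhamelBound.waveNorm_le (hk : 1 ≤ k) (hA : IsDuhamelBound k C A)
    (hF : IsEnergyCritical C F) (R : ℝ) (hJ : IsTimeSet J) (hu : Measurable (Function.uncurry u))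
    (huf : waveNorm k J u ≠ ⊤) :
    waveNorm k J (radialDuhamel k (source F R u)) ≤
      A * waveNorm k J u ^ (waveExp k - 1) * waveNorm k J u := by
  have h := hA F hF R J hJ u (fun _ _ => 0) hu measurable_const huf
    (by rw [waveNorm_zero hk]; exact ENNReal.zero_ne_top)
  rw [waveNorm_zero hk, source_zero hk hF, radialDuhamel_zero,
    ENNReal.zero_rpow_of_pos (by linarith [one_lt_waveExp hk])] at h
  simpa using h

theorem waveNorm_union_le (hk : 1 ≤ k) {S T : Set ℝ} (hS : MeasurableSet S) (hT : MeasurableSet T)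
    (hu : Measurable (Function.uncurry u)) :
    waveNorm k (S ∪ T) u ≤ waveNorm k S u + waveNorm k T u := by
  have hp := one_lt_waveExp hk
  have hp0 : 0 < waveExp k := by linarith
  have hq0 : 0 < 2 * waveExp k := by linarith
  have h : ∀ S : Set ℝ, MeasurableSet S → waveNorm k S u = chanL (waveExp k) (2 * waveExp k) univ
      fun t x => S.indicator (fun t => ‖u t x‖ₑ) t := fun S hS => by
    rw [chanL_indicator hp0 hq0 hS fun t x => ‖u t x‖ₑ, univ_inter, waveNorm]
  have hm : ∀ S : Set ℝ, MeasurableSet S → Measurable (Function.uncurry fun t x =>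
      S.indicator (fun t => ‖u t x‖ₑ) t) := fun S hS =>
    hu.enorm.indicator (hS.preimage measurable_fst)
  rw [h _ (hS.union hT), h _ hS, h _ hT]
  refine (chanL_mono hp0 hq0 (Filter.Eventually.of_forall fun t => Filter.Eventually.of_forall
    fun x _ => ?_)).trans (chanL_add_le hp.le (by linarith) (hm S hS) (hm T hT))
  by_cases h1 : t ∈ S <;> by_cases h2 : t ∈ T <;> simp [h1, h2]

theorem IsMildSolution.waveNorm_ne_top (hk : 1 ≤ k) (hu : IsMildSolution F R I L u) (hJI : J ⊆ I) :
    waveNorm k J u ≠ ⊤ :=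
  ne_top_of_le_ne_top hu.finite (waveNorm_mono_set hk hJI u)

/-- The estimate for the difference of two solutions, before absorption. -/
theorem IsMildSolution.waveNorm_sub_le (hk : 1 ≤ k) (hA : IsDuhamelBound k C A)
    (hF : IsEnergyCritical C F) (hL : Measurable (Function.uncurry L))
    (hM : Measurable (Function.uncurry M)) (hu : IsMildSolution F R I L u)
    (hv : IsMildSolution F R I M v) (hI : IsTimeSet I) :
    waveNorm k I (fun t x => u t x - v t x) ≤
      waveNorm k I (extCut R fun t x => L t x - M t x) +
        A * (waveNorm k I u ^ (waveExp k - 1) + waveNorm k I v ^ (waveExp k - 1)) *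
          waveNorm k I fun t x => u t x - v t x := by
  have hDu := measurable_radialDuhamel_uncurry hk (measurable_source hk hF hu.measurable R)
  have hDv := measurable_radialDuhamel_uncurry hk (measurable_source hk hF hv.measurable R)
  refine (waveNorm_le_add hk (measurable_extCut (f := fun t x => L t x - M t x) (hL.sub hM) R)
    (w := fun t x => radialDuhamel k (source F R u) t x - radialDuhamel k (source F R v) t x)
    (hDu.sub hDv) ?_).trans (add_le_add le_rfl
      (hA F hF R I hI u v hu.measurable hv.measurable hu.finite hv.finite))
  filter_upwards [hu.equation, hv.equation] with t htu htv
  filter_upwards [htu, htv] with x hxu hxv _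
  by_cases hx : R + |t| < ‖x‖
  · have h1 : extCut R (fun t x => L t x - M t x) t x = L t x - M t x :=
      indicator_of_mem (show x ∈ {x : Space (2 * k + 1) | R + |t| < ‖x‖} from hx) _
    rw [h1, hxu hx, hxv hx]
    refine le_trans (le_of_eq (congrArg _ ?_)) (enorm_add_le _ _)
    ring
  · rw [hu.support t x hx, hv.support t x hx]
    simp

theorem IsMildSolution.waveNorm_le (hk : 1 ≤ k) (hA : IsDuhamelBound k C A)
    (hF : IsEnergyCritical C F) (hL : Measurable (Function.uncurry L))
    (hu : IsMildSolution F R I L u) (hJ : IsTimeSet J) (hJI : J ⊆ I) :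
    waveNorm k J u ≤ waveNorm k J (extCut R L) +
      A * waveNorm k J u ^ (waveExp k - 1) * waveNorm k J u := by
  have hDu := measurable_radialDuhamel_uncurry hk (measurable_source hk hF hu.measurable R)
  refine (waveNorm_le_add hk (measurable_extCut hL R) hDu ?_).trans (add_le_add le_rfl
    (hA.waveNorm_le hk hF R hJ hu.measurable (hu.waveNorm_ne_top hk hJI)))
  filter_upwards [ae_restrict_of_ae_restrict_of_subset hJI hu.equation] with t htu
  filter_upwards [htu] with x hxu _
  by_cases hx : R + |t| < ‖x‖
  · have h1 : extCut R L t x = L t x :=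
      indicator_of_mem (show x ∈ {x : Space (2 * k + 1) | R + |t| < ‖x‖} from hx) _
    rw [h1, hxu hx]
    exact enorm_add_le _ _
  · rw [hu.support t x hx]
    simp

theorem measurableSet_abs_le (T : ℝ) : MeasurableSet {t : ℝ | |t| ≤ T} :=
  measurableSet_le (by fun_prop) (by fun_prop)

/-- The norm over `I ∩ [-T, T]` depends continuously on `T`. -/
theorem continuous_waveNorm_inter (hk : 1 ≤ k) (hI : MeasurableSet I)
    (hu : Measurable (Function.uncurry u)) (hfin : waveNorm k I u ≠ ⊤) :
    Continuous fun T : ℝ => waveNorm k (I ∩ {t | |t| ≤ T}) u := by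
  rw [continuous_iff_seqContinuous]
  intro τ T hτ
  -- two such norms differ by at most the norm over the symmetric difference of the sets of times
  set S : ℕ → Set ℝ := fun n => {t | ¬ (|t| ≤ τ n ↔ |t| ≤ T)} with hS
  have hSm : ∀ n, MeasurableSet (S n) := fun n =>
    ((measurableSet_abs_le (τ n)).iff (measurableSet_abs_le T)).compl
  have hlim : Filter.Tendsto (fun n => waveNorm k (I ∩ S n) u) Filter.atTop (nhds 0) := by
    refine tendsto_waveNorm_inter hk hu hfin hSm (N := {T, -T}) (Set.Finite.measure_zero (by simp) _)
      (Set.Finite.measurableSet (by simp)) fun t ht => ?_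
    have hne : |t| ≠ T := by
      intro h
      apply ht
      rcases abs_choice t with h' | h'
      · left; linarith
      · right; simp only [mem_singleton_iff]; linarith
    rcases lt_or_gt_of_ne hne with h | h
    · filter_upwards [hτ.eventually (lt_mem_nhds h)] with n hn
      simp only [hS, mem_ofPred_eq, not_not]
      exact ⟨fun _ => h.le, fun _ => hn.le⟩
    · filter_upwards [hτ.eventually (gt_mem_nhds h)] with n hn
      simp only [hS, mem_ofPred_eq, not_not]
      exact ⟨fun h' => absurd hn h'.not_gt, fun h' => absurd h h'.not_gt⟩
  have hle : ∀ S T U : Set ℝ, MeasurableSet S → MeasurableSet T → U ⊆ S ∪ T →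
      waveNorm k (I ∩ U) u ≤ waveNorm k (I ∩ S) u + waveNorm k (I ∩ T) u := by
    intro S T U hS hT hU
    refine (waveNorm_mono_set hk ?_ u).trans (waveNorm_union_le hk (hI.inter hS) (hI.inter hT) hu)
    rw [← inter_union_distrib_left]
    exact inter_subset_inter_right I hU
  have hT : waveNorm k (I ∩ {t | |t| ≤ T}) u ≠ ⊤ :=
    ne_top_of_le_ne_top hfin (waveNorm_mono_set hk inter_subset_left u)
  have hlow : Filter.Tendsto (fun n => waveNorm k (I ∩ {t | |t| ≤ T}) u - waveNorm k (I ∩ S n) u)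
      Filter.atTop (nhds (waveNorm k (I ∩ {t | |t| ≤ T}) u)) := by
    have := ENNReal.Tendsto.sub (tendsto_const_nhds (x := waveNorm k (I ∩ {t | |t| ≤ T}) u)) hlim
      (Or.inl hT)
    rwa [tsub_zero] at this
  have hup : Filter.Tendsto (fun n => waveNorm k (I ∩ {t | |t| ≤ T}) u + waveNorm k (I ∩ S n) u)
      Filter.atTop (nhds (waveNorm k (I ∩ {t | |t| ≤ T}) u)) := by
    have := (tendsto_const_nhds (x := waveNorm k (I ∩ {t | |t| ≤ T}) u)).add hlim
    rwa [add_zero] at this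
  refine tendsto_of_tendsto_of_tendsto_of_le_of_le hlow hup (fun n => ?_) (fun n => ?_)
  · refine tsub_le_iff_right.mpr (hle _ _ _ (measurableSet_abs_le _) (hSm n) fun t ht => ?_)
    by_cases h : |t| ≤ τ n
    · exact Or.inl h
    · exact Or.inr fun h' => h (h'.mpr ht)
  · refine hle _ _ _ (measurableSet_abs_le _) (hSm n) fun t ht => ?_
    by_cases h : |t| ≤ T
    · exact Or.inl h
    · exact Or.inr fun h' => h (h'.mp ht)

theorem IsTimeSet.inter_abs_le (hI : IsTimeSet I) (T : ℝ) : IsTimeSet (I ∩ {t | |t| ≤ T}) := by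
  refine ⟨hI.measurable.inter (measurableSet_abs_le T), fun t ht s hs =>
    ⟨hI.uIoc_subset t ht.1 hs, ?_⟩⟩
  have h1 := uIoc_subset_uIcc hs
  have h2 : |s - 0| ≤ |t - 0| := abs_sub_left_of_mem_uIcc h1
  rw [sub_zero, sub_zero] at h2
  exact h2.trans ht.2

/-- A solution of finite norm with a small free wave is small: its norm over `I ∩ [-T, T]` depends
continuously on `T` and cannot take the value `2δ`. -/
theorem IsMildSolution.waveNorm_le_two_mul (hk : 1 ≤ k) (hA : IsDuhamelBound k C A)
    (hF : IsEnergyCritical C F) (hL : Measurable (Function.uncurry L))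
    (hu : IsMildSolution F R I L u) (hI : IsTimeSet I) {δ : ℝ≥0∞} (hδ : δ ≠ ⊤)
    (hAδ : A * (2 * δ) ^ (waveExp k - 1) ≤ 1 / 4) (hs : waveNorm k I (extCut R L) < δ) :
    waveNorm k I u ≤ 2 * δ := by
  have hcont := continuous_waveNorm_inter hk hI.measurable hu.measurable hu.finite
  have hne : ∀ T : ℝ, waveNorm k (I ∩ {t | |t| ≤ T}) u ≠ 2 * δ := by
    intro T hT
    -- the value `2δ` would give `2δ < δ + (1/4) 2δ`
    have h1 := hu.waveNorm_le hk hA hF hL (hI.inter_abs_le T) inter_subset_left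
    rw [hT] at h1
    have h2 : 2 * δ ≤ waveNorm k I (extCut R L) + 1 / 4 * (2 * δ) :=
      h1.trans (add_le_add (waveNorm_mono_set hk inter_subset_left _) (mul_le_mul_left hAδ _))
    have h3 : waveNorm k I (extCut R L) + 1 / 4 * (2 * δ) < δ + 1 / 4 * (2 * δ) :=
      ENNReal.add_lt_add_right (ENNReal.mul_ne_top (by norm_num) (ENNReal.mul_ne_top (by norm_num) hδ)) hs
    have h4 := h2.trans_lt h3
    lift δ to NNReal using hδ
    have h5 : ((2 * δ : NNReal) : ℝ≥0∞) < ((δ + 1 / 4 * (2 * δ) : NNReal) : ℝ≥0∞) := by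
      push_cast
      exact h4
    rw [ENNReal.coe_lt_coe, ← NNReal.coe_lt_coe] at h5
    push_cast at h5
    have := δ.coe_nonneg
    linarith
  have hzero : waveNorm k (I ∩ {t | |t| ≤ 0}) u = 0 := by
    rw [← waveNorm_zero hk (J := I ∩ {t | |t| ≤ 0})]
    refine waveNorm_congr hk ?_
    have h0 : volume (I ∩ {t : ℝ | |t| ≤ 0}) = 0 :=
      measure_mono_null (t := {0}) (fun t ht => abs_nonpos_iff.mp ht.2) (by simp)
    rw [Measure.restrict_eq_zero.mpr h0]
    simp
  have hle : ∀ n : ℕ, waveNorm k (I ∩ {t | |t| ≤ (n : ℝ)}) u ≤ 2 * δ := by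
    intro n
    by_contra! hn
    obtain ⟨T, -, hT⟩ := intermediate_value_Icc (Nat.cast_nonneg n) hcont.continuousOn
      (show 2 * δ ∈ Icc _ _ from ⟨hzero.le.trans zero_le, hn.le⟩)
    exact hne T hT
  -- the bound over all of `I` follows as the times beyond `n` contribute less and less
  have htail : Filter.Tendsto (fun n : ℕ => waveNorm k (I ∩ {t | ¬ |t| ≤ (n : ℝ)}) u)
      Filter.atTop (nhds 0) := by
    refine tendsto_waveNorm_inter hk hu.measurable hu.finite (S := fun n : ℕ => {t | ¬ |t| ≤ (n : ℝ)})
      (fun n => (measurableSet_abs_le _).compl) (N := ∅) measure_empty MeasurableSet.empty fun t _ => ?_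
    filter_upwards [Filter.eventually_ge_atTop ⌈|t|⌉₊] with n hn h
    exact h ((Nat.le_ceil _).trans (by exact_mod_cast hn))
  have hlim : Filter.Tendsto (fun n : ℕ => 2 * δ + waveNorm k (I ∩ {t | ¬ |t| ≤ (n : ℝ)}) u)
      Filter.atTop (nhds (2 * δ)) := by
    have := (tendsto_const_nhds (x := 2 * δ)).add htail
    rwa [add_zero] at this
  refine ge_of_tendsto' hlim fun n => ?_
  refine (waveNorm_mono_set hk (J' := (I ∩ {t | |t| ≤ (n : ℝ)}) ∪ (I ∩ {t | ¬ |t| ≤ (n : ℝ)}))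
    (fun t ht => ?_) u).trans ((waveNorm_union_le hk (hI.measurable.inter (measurableSet_abs_le _))
      (hI.measurable.inter (measurableSet_abs_le _).compl) hu.measurable).trans
      (add_le_add (hle n) le_rfl))
  by_cases h : |t| ≤ n
  · exact Or.inl ⟨ht, h⟩
  · exact Or.inr ⟨ht, h⟩

/-- Absorption of a finite term into the left-hand side. -/
theorem le_two_mul_of_le_add_half {a X B : ℝ≥0∞} (hX : X ≠ ⊤) (hB : B ≤ 1 / 2)
    (h : X ≤ a + B * X) : X ≤ 2 * a := by
  have h1 : X ≤ a + X / 2 := by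
    refine h.trans (add_le_add le_rfl ((mul_le_mul_left hB _).trans (le_of_eq ?_)))
    rw [one_div, ENNReal.div_eq_inv_mul]
  have h2 : X / 2 ≤ a := by
    have hX2 : X / 2 ≠ ⊤ := ENNReal.div_ne_top hX (by norm_num)
    exact (ENNReal.add_le_add_iff_right hX2).mp ((ENNReal.add_halves X).le.trans h1)
  calc X = 2 * (X / 2) := (ENNReal.mul_div_cancel two_ne_zero ENNReal.ofNat_ne_top).symm
    _ ≤ 2 * a := by gcongr

/-- Lipschitz dependence of small solutions on the free wave. No smallness of the solutions is assumed:
it follows from that of the free waves by `IsMildSolution.waveNorm_le_two_mul`. -/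
theorem IsMildSolution.waveNorm_sub_le_two_mul (hk : 1 ≤ k) (hA : IsDuhamelBound k C A)
    (hF : IsEnergyCritical C F) (hL : Measurable (Function.uncurry L))
    (hM : Measurable (Function.uncurry M)) (hu : IsMildSolution F R I L u)
    (hv : IsMildSolution F R I M v) (hI : IsTimeSet I) {δ : ℝ≥0∞} (hδ : δ ≠ ⊤)
    (hAδ : A * (2 * δ) ^ (waveExp k - 1) ≤ 1 / 4) (hLs : waveNorm k I (extCut R L) < δ)
    (hMs : waveNorm k I (extCut R M) < δ) :
    waveNorm k I (fun t x => u t x - v t x) ≤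
      2 * waveNorm k I (extCut R fun t x => L t x - M t x) := by
  have hp := one_lt_waveExp hk
  have h1 := hu.waveNorm_le_two_mul hk hA hF hL hI hδ hAδ hLs
  have h2 := hv.waveNorm_le_two_mul hk hA hF hM hI hδ hAδ hMs
  refine le_two_mul_of_le_add_half ?_ ?_ (hu.waveNorm_sub_le hk hA hF hL hM hv hI)
  · refine ne_top_of_le_ne_top (ENNReal.add_ne_top.mpr ⟨hu.finite, hv.finite⟩)
      (waveNorm_le_add hk hu.measurable hv.measurable (Filter.Eventually.of_forall fun t =>
        Filter.Eventually.of_forall fun x _ => enorm_sub_le))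
  · calc A * (waveNorm k I u ^ (waveExp k - 1) + waveNorm k I v ^ (waveExp k - 1))
        ≤ A * ((2 * δ) ^ (waveExp k - 1) + (2 * δ) ^ (waveExp k - 1)) := by
          gcongr
      _ ≤ 1 / 4 + 1 / 4 := by
          rw [mul_add]
          exact add_le_add hAδ hAδ
      _ = 1 / 2 := by
          rw [ENNReal.div_add_div_same, one_add_one_eq_two,
            ENNReal.div_eq_div_iff two_ne_zero ENNReal.ofNat_ne_top four_ne_zero ENNReal.ofNat_ne_top]
          norm_num

end apriori

/-! ### Picard iteration -/

theorem ae_lt_top_of_chanL {d : ℕ} {p q : ℝ} {I : Set ℝ} (hp : 0 < p) (hq : 0 < q)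
    {f : ℝ → Space d → ℝ≥0∞} (hf : Measurable (Function.uncurry f)) (h : chanL p q I f ≠ ⊤) :
    ∀ᵐ t ∂(volume.restrict I), ∀ᵐ x, |t| < ‖x‖ → f t x < ⊤ := by
  have h1 : ∀ j : ℤ, ∀ᵐ t ∂(volume.restrict I), ∀ᵐ x, channelCut j f t x < ⊤ := by
    intro j
    have hm := measurable_channelCut hf j
    filter_upwards [ae_lt_top_of_lpn hp (measurable_lpn_section hm)
      (ne_top_of_le_ne_top h (mixedL_le_chanL f j))] with t ht
    exact ae_lt_top_of_lpn hq (hm.comp measurable_prodMk_left) ht.ne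
  filter_upwards [ae_all_iff.mpr h1] with t ht
  filter_upwards [ae_all_iff.mpr ht] with x hx htx
  obtain ⟨j, hj⟩ := exists_mem_channel htx
  rw [← channelCut_of_mem (f := f) hj]
  exact hx j

/-- The Picard iterates for the integral equation. -/
noncomputable def picard {k : ℕ} (F : ℝ → Space (2 * k + 1) → ℝ → ℝ) (R : ℝ)
    (L : ℝ → Space (2 * k + 1) → ℝ) : ℕ → ℝ → Space (2 * k + 1) → ℝ
  | 0 => fun _ _ => 0
  | n + 1 => extCut R fun t x => L t x + radialDuhamel k (source F R (picard F R L n)) t x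

section picard

variable {k : ℕ} {C : ℝ} {A : ℝ≥0∞} {F : ℝ → Space (2 * k + 1) → ℝ → ℝ} {R : ℝ} {I : Set ℝ}
  {L : ℝ → Space (2 * k + 1) → ℝ}

theorem extCut_of_mem {d : ℕ} {V : Type*} [Zero V] {R : ℝ} {u : ℝ → Space d → V} {t : ℝ} {x : Space d}
    (h : R + |t| < ‖x‖) : extCut R u t x = u t x :=
  indicator_of_mem (show x ∈ {x : Space d | R + |t| < ‖x‖} from h) _

theorem extCut_of_notMem {d : ℕ} {V : Type*} [Zero V] {R : ℝ} {u : ℝ → Space d → V} {t : ℝ}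
    {x : Space d} (h : ¬ R + |t| < ‖x‖) : extCut R u t x = 0 :=
  indicator_of_notMem (show x ∉ {x : Space d | R + |t| < ‖x‖} from h) _

theorem measurable_duhamelStep (hk : 1 ≤ k) (hF : IsEnergyCritical C F)
    (hL : Measurable (Function.uncurry L)) {u : ℝ → Space (2 * k + 1) → ℝ}
    (hu : Measurable (Function.uncurry u)) : Measurable (Function.uncurry
      (extCut R fun t x => L t x + radialDuhamel k (source F R u) t x)) :=
  measurable_extCut (f := fun t x => L t x + radialDuhamel k (source F R u) t x)
    (hL.add (measurable_radialDuhamel_uncurry hk (measurable_source hk hF hu R))) R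

theorem measurable_picard (hk : 1 ≤ k) (hF : IsEnergyCritical C F)
    (hL : Measurable (Function.uncurry L)) (n : ℕ) :
    Measurable (Function.uncurry (picard F R L n)) := by
  induction n with
  | zero => exact measurable_const
  | succ n ih => exact measurable_duhamelStep hk hF hL ih

theorem picard_support (n : ℕ) (t : ℝ) (x : Space (2 * k + 1)) (h : ¬ R + |t| < ‖x‖) :
    picard F R L n t x = 0 := by
  cases n with
  | zero => rfl
  | succ n => exact extCut_of_notMem h

theorem isRadialOn_picard {t : ℝ} (hL : IsRadialOn {x | R + |t| < ‖x‖} (L t)) (n : ℕ) :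
    IsRadialOn univ (picard F R L n t) := by
  cases n with
  | zero => exact ⟨fun _ => 0, Filter.Eventually.of_forall fun x _ => rfl⟩
  | succ n =>
    obtain ⟨h, hh⟩ := hL
    obtain ⟨h', hh'⟩ := isRadialOn_of_norm (by omega) univ
      (Φ := radialDuhamel k (source F R (picard F R L n)) t)
      (fun x y hxy => radialDuhamel_of_norm _ _ hxy)
    refine ⟨fun r => if R + |t| < r then h r + h' r else 0, ?_⟩
    filter_upwards [hh, hh'] with x h1 h2 hx
    by_cases hxR : R + |t| < ‖x‖
    · rw [if_pos hxR, picard, extCut_of_mem hxR, h1 hxR, h2 hx]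
    · rw [if_neg hxR, picard, extCut_of_notMem hxR]

theorem waveNorm_picard_le (hk : 1 ≤ k) (hA : IsDuhamelBound k C A) (hF : IsEnergyCritical C F)
    (hL : Measurable (Function.uncurry L)) (hI : IsTimeSet I) {δ : ℝ≥0∞} (hδ : δ ≠ ⊤)
    (hAδ : A * (2 * δ) ^ (waveExp k - 1) ≤ 1 / 4) (hs : waveNorm k I (extCut R L) < δ) (n : ℕ) :
    waveNorm k I (picard F R L n) ≤ 2 * δ := by
  have hp := one_lt_waveExp hk
  have h2δ : 2 * δ ≠ ⊤ := ENNReal.mul_ne_top (by norm_num) hδ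
  induction n with
  | zero => exact (waveNorm_zero hk).le.trans zero_le
  | succ n ih =>
    have hm := measurable_picard (R := R) hk hF hL n
    have hD := measurable_radialDuhamel_uncurry hk (measurable_source hk hF hm R)
    calc waveNorm k I (picard F R L (n + 1))
        ≤ waveNorm k I (extCut R L) +
          waveNorm k I (radialDuhamel k (source F R (picard F R L n))) := by
          refine waveNorm_le_add hk (measurable_extCut hL R) hD (Filter.Eventually.of_forall fun t =>
            Filter.Eventually.of_forall fun x _ => ?_)
          by_cases hx : R + |t| < ‖x‖
          · rw [picard, extCut_of_mem hx, extCut_of_mem hx]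
            exact enorm_add_le _ _
          · rw [picard, extCut_of_notMem hx]
            simp
      _ ≤ δ + A * (2 * δ) ^ (waveExp k - 1) * (2 * δ) := by
          refine add_le_add hs.le ((hA.waveNorm_le hk hF R hI hm (ne_top_of_le_ne_top h2δ ih)).trans ?_)
          gcongr
      _ ≤ δ + 1 / 4 * (2 * δ) := by gcongr
      _ ≤ 2 * δ := by
          rw [two_mul δ, mul_add]
          gcongr
          rw [← add_mul]
          refine mul_le_of_le_one_left zero_le ?_
          rw [ENNReal.div_add_div_same, one_add_one_eq_two]
          exact ENNReal.div_le_of_le_mul (by norm_num)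

/-- The integral equation is a contraction with factor `1/2` on the ball of radius `2δ`. -/
theorem waveNorm_picard_succ_sub_le (hk : 1 ≤ k) (hA : IsDuhamelBound k C A)
    (hF : IsEnergyCritical C F) (hL : Measurable (Function.uncurry L)) (hI : IsTimeSet I) {δ : ℝ≥0∞}
    (hδ : δ ≠ ⊤) (hAδ : A * (2 * δ) ^ (waveExp k - 1) ≤ 1 / 4)
    (hs : waveNorm k I (extCut R L) < δ) (n : ℕ) :
    waveNorm k I (fun t x => picard F R L (n + 1) t x - picard F R L n t x)
      ≤ 2 * δ * (1 / 2) ^ n := by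
  have hp := one_lt_waveExp hk
  have h2δ : 2 * δ ≠ ⊤ := ENNReal.mul_ne_top (by norm_num) hδ
  have hb := fun n => waveNorm_picard_le hk hA hF hL hI hδ hAδ hs n
  induction n with
  | zero =>
    rw [pow_zero, mul_one]
    refine le_trans (le_of_eq (waveNorm_congr hk ?_)) (hb 1)
    exact Filter.Eventually.of_forall fun t => Filter.Eventually.of_forall fun x _ => by
      simp [picard]
  | succ n ih =>
    have hm := measurable_picard (R := R) hk hF hL n
    have hm' := measurable_picard (R := R) hk hF hL (n + 1)
    calc _ ≤ waveNorm k I (fun t x => radialDuhamel k (source F R (picard F R L (n + 1))) t x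
          - radialDuhamel k (source F R (picard F R L n)) t x) := by
          refine waveNorm_mono hk (Filter.Eventually.of_forall fun t =>
            Filter.Eventually.of_forall fun x _ => ?_)
          by_cases hx : R + |t| < ‖x‖
          · rw [picard, extCut_of_mem hx, picard.eq_2 F R L n, extCut_of_mem hx,
              add_sub_add_left_eq_sub]
          · rw [picard, extCut_of_notMem hx, picard_support _ _ _ hx]
            simp
      _ ≤ A * ((2 * δ) ^ (waveExp k - 1) + (2 * δ) ^ (waveExp k - 1)) *
          (2 * δ * (1 / 2) ^ n) := by
          refine (hA F hF R I hI _ _ hm' hm (ne_top_of_le_ne_top h2δ (hb _))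
            (ne_top_of_le_ne_top h2δ (hb _))).trans ?_
          have h1 := hb n
          have h2 := hb (n + 1)
          gcongr
      _ ≤ (1 / 2) * (2 * δ * (1 / 2) ^ n) := by
          gcongr
          rw [mul_add]
          refine (add_le_add hAδ hAδ).trans (le_of_eq ?_)
          rw [ENNReal.div_add_div_same, one_add_one_eq_two,
            ENNReal.div_eq_div_iff two_ne_zero ENNReal.ofNat_ne_top four_ne_zero ENNReal.ofNat_ne_top]
          norm_num
      _ = _ := by ring

/-- The Picard iterates converge to a solution if the free wave is small. -/
theorem exists_isMildSolution (hk : 1 ≤ k) (hA : IsDuhamelBound k C A) (hAt : A ≠ ⊤)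
    (hF : IsEnergyCritical C F) (hR : 0 ≤ R) (hL : Measurable (Function.uncurry L))
    (hLr : ∀ᵐ t ∂(volume.restrict I), IsRadialOn {x | R + |t| < ‖x‖} (L t)) (hI : IsTimeSet I)
    {δ : ℝ≥0∞} (hδ : δ ≠ ⊤) (hAδ : A * (2 * δ) ^ (waveExp k - 1) ≤ 1 / 4)
    (hs : waveNorm k I (extCut R L) < δ) : ∃ u, IsMildSolution F R I L u := by
  have hp := one_lt_waveExp hk
  have hp0 : 0 < waveExp k := by linarith
  have hq0 : 0 < 2 * waveExp k := by linarith
  have h2δ : 2 * δ ≠ ⊤ := ENNReal.mul_ne_top (by norm_num) hδ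
  set U := picard F R L with hU
  have hUm : ∀ n, Measurable (Function.uncurry (U n)) := measurable_picard hk hF hL
  have hUb : ∀ n, waveNorm k I (U n) ≤ 2 * δ := waveNorm_picard_le hk hA hF hL hI hδ hAδ hs
  set D : ℕ → ℝ → Space (2 * k + 1) → ℝ≥0∞ := fun n t x => ‖U (n + 1) t x - U n t x‖ₑ with hD
  have hDm : ∀ n, Measurable (Function.uncurry (D n)) := fun n => ((hUm (n + 1)).sub (hUm n)).enorm
  set e : ℕ → ℝ≥0∞ := fun n => chanL (waveExp k) (2 * waveExp k) I (D n) with he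
  have heb : ∀ n, e n ≤ 2 * δ * (1 / 2) ^ n :=
    waveNorm_picard_succ_sub_le hk hA hF hL hI hδ hAδ hs
  have hesum : ∑' n, e n ≠ ⊤ := by
    refine ne_top_of_le_ne_top ?_ (ENNReal.tsum_le_tsum heb)
    rw [ENNReal.tsum_mul_left, ENNReal.tsum_geometric]
    refine ENNReal.mul_ne_top h2δ (ENNReal.inv_ne_top.mpr (tsub_pos_of_lt ?_).ne')
    exact ENNReal.div_lt_of_lt_mul (by norm_num)
  -- the differences of the iterates are summable in norm, hence at almost every point of the cone
  -- exterior, and the tails of the sums bound the errors of the iterates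
  set S : ℕ → ℝ → Space (2 * k + 1) → ℝ≥0∞ := fun n t x => ∑' m, D (n + m) t x with hS
  have hSm : ∀ n, Measurable (Function.uncurry (S n)) := fun n => by
    have h1 : Measurable fun z : ℝ × Space (2 * k + 1) => ∑' m, Function.uncurry (D (n + m)) z :=
      Measurable.tsum fun m => hDm (n + m)
    exact h1
  have hSle : ∀ n, chanL (waveExp k) (2 * waveExp k) I (S n) ≤ ∑' m, e (n + m) := fun n =>
    chanL_tsum_le hp.le (by linarith) fun m => hDm (n + m)
  have hStail : Filter.Tendsto (fun n => ∑' m, e (n + m)) Filter.atTop (nhds 0) := by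
    simpa only [add_comm] using ENNReal.tendsto_sum_nat_add e hesum
  have hS0 : chanL (waveExp k) (2 * waveExp k) I (S 0) ≠ ⊤ :=
    ne_top_of_le_ne_top (by simpa using hesum) (hSle 0)
  set u : ℝ → Space (2 * k + 1) → ℝ := fun t x => Filter.limUnder Filter.atTop fun n => U n t x with hu
  have hum : Measurable (Function.uncurry u) :=
    (StronglyMeasurable.limUnder (l := Filter.atTop) (f := fun n => Function.uncurry (U n))
      fun n => (hUm n).stronglyMeasurable).measurable
  have hconv : ∀ᵐ t ∂(volume.restrict I), ∀ᵐ x, |t| < ‖x‖ → ∀ n, ‖u t x - U n t x‖ₑ ≤ S n t x := by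
    filter_upwards [ae_lt_top_of_chanL hp0 hq0 (hSm 0) hS0] with t ht
    filter_upwards [ht] with x hx htx n
    have hfin : ∑' m, D m t x ≠ ⊤ := by simpa [hS] using (hx htx).ne
    have hed : ∀ n, edist (U n t x) (U (n + 1) t x) ≤ D n t x := fun n => by
      rw [edist_comm, edist_eq_enorm_sub]
    have hc := cauchySeq_of_edist_le_of_tsum_ne_top (f := fun n => U n t x) (fun n => D n t x) hed hfin
    have h1 := edist_le_tsum_of_edist_le_of_tendsto (f := fun n => U n t x) (fun n => D n t x) hed
      hc.tendsto_limUnder n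
    rwa [edist_comm, edist_eq_enorm_sub] at h1
  have hdiff : ∀ n, waveNorm k I (fun t x => u t x - U n t x) ≤ ∑' m, e (n + m) := fun n =>
    (chanL_mono hp0 hq0 (by
      filter_upwards [hconv] with t ht
      filter_upwards [ht] with x hx htx using hx htx n)).trans (hSle n)
  have hufin : waveNorm k I u ≠ ⊤ := by
    have h1 := hdiff 0
    have h2 : waveNorm k I (fun t x => u t x - U 0 t x) = waveNorm k I u := waveNorm_congr hk
      (Filter.Eventually.of_forall fun t => Filter.Eventually.of_forall fun x _ => by
        simp [hU, picard])
    rw [h2] at h1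
    exact ne_top_of_le_ne_top (by simpa using hesum) h1
  have hsupp : ∀ t x, ¬ R + |t| < ‖x‖ → u t x = 0 := by
    intro t x h
    have : (fun n => U n t x) = fun _ => 0 := by
      ext n
      exact picard_support n t x h
    simp only [hu, this]
    exact tendsto_const_nhds.limUnder_eq
  refine ⟨u, hum, hsupp, ?_, hufin, ?_⟩
  · filter_upwards [hLr] with t ht
    choose h hh using fun n => isRadialOn_picard (F := F) ht n
    refine ⟨fun r => Filter.limUnder Filter.atTop fun n => h n r, ?_⟩
    filter_upwards [ae_all_iff.mpr hh] with x hx hx'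
    simp only [hu, hU, fun n => hx n hx']
  -- the defect of the integral equation is bounded by the errors of the iterates
  · set Z : ℝ → Space (2 * k + 1) → ℝ := fun t x =>
      u t x - extCut R (fun t x => L t x + radialDuhamel k (source F R u) t x) t x with hZ
    have hZm : Measurable (Function.uncurry Z) := hum.sub (measurable_duhamelStep hk hF hL hum)
    have hDu := measurable_radialDuhamel_uncurry hk (measurable_source hk hF hum R)
    have hZle : ∀ n, waveNorm k I Z ≤ (∑' m, e (n + 1 + m)) +
        A * ((2 * δ) ^ (waveExp k - 1) + waveNorm k I u ^ (waveExp k - 1)) * ∑' m, e (n + m) := by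
      intro n
      have hDn := measurable_radialDuhamel_uncurry hk (measurable_source hk hF (hUm n) R)
      refine (waveNorm_le_add hk (v := fun t x => u t x - U (n + 1) t x)
        (w := fun t x => radialDuhamel k (source F R (U n)) t x - radialDuhamel k (source F R u) t x)
        (hum.sub (hUm (n + 1))) (hDn.sub hDu) (Filter.Eventually.of_forall fun t =>
          Filter.Eventually.of_forall fun x _ => ?_)).trans (add_le_add (hdiff (n + 1)) ?_)
      · by_cases hx : R + |t| < ‖x‖
        · have h1 : U (n + 1) t x = L t x + radialDuhamel k (source F R (U n)) t x :=
            extCut_of_mem hx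
          have h2 : Z t x = (u t x - U (n + 1) t x) +
              (radialDuhamel k (source F R (U n)) t x - radialDuhamel k (source F R u) t x) := by
            rw [h1, hZ]
            beta_reduce
            rw [extCut_of_mem hx]
            ring
          rw [h2]
          exact enorm_add_le _ _
        · have h2 : Z t x = 0 := by
            rw [hZ]
            beta_reduce
            rw [extCut_of_notMem hx, hsupp t x hx, sub_zero]
          rw [h2]
          simp
      · refine (hA F hF R I hI _ _ (hUm n) hum (ne_top_of_le_ne_top h2δ (hUb n)) hufin).trans ?_
        have h1 : waveNorm k I (fun t x => U n t x - u t x) ≤ ∑' m, e (n + m) := by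
          refine le_trans (le_of_eq ?_) (hdiff n)
          simp only [waveNorm, enorm_sub_rev]
        have h2 := hUb n
        gcongr
    have hZ0 : waveNorm k I Z = 0 := by
      refine le_antisymm (ge_of_tendsto' (x := Filter.atTop) ?_ hZle) zero_le
      have h1 : Filter.Tendsto (fun n => ∑' m, e (n + 1 + m)) Filter.atTop (nhds 0) :=
        hStail.comp (Filter.tendsto_add_atTop_nat 1)
      have h2 := ENNReal.Tendsto.const_mul (a := A * ((2 * δ) ^ (waveExp k - 1) +
        waveNorm k I u ^ (waveExp k - 1))) hStail (Or.inr (ENNReal.mul_ne_top hAt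
          (ENNReal.add_ne_top.mpr ⟨ENNReal.rpow_ne_top_of_nonneg (by linarith) h2δ,
            ENNReal.rpow_ne_top_of_nonneg (by linarith) hufin⟩)))
      have h3 := h1.add h2
      rwa [mul_zero, add_zero] at h3
    filter_upwards [ae_eq_zero_of_waveNorm hk hZm hZ0] with t ht
    filter_upwards [ht] with x hx hxR
    have h1 := hx (by linarith)
    rw [hZ] at h1
    beta_reduce at h1
    rw [extCut_of_mem hxR] at h1
    linarith

end picard

/-! ### Exterior solutions and the integral equation -/

section solutions

variable {k : ℕ} {C : ℝ} {F : ℝ → Space (2 * k + 1) → ℝ → ℝ} {R : ℝ} {I : Set ℝ}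
  {u₀ u₁ : Space (2 * k + 1) → ℝ} {L u : ℝ → Space (2 * k + 1) → ℝ}

theorem source_congr {d : ℕ} {F : ℝ → Space d → ℝ → ℝ} {R τ : ℝ} {u v : ℝ → Space d → ℝ}
    (h : ∀ᵐ x, R + |τ| < ‖x‖ → u τ x = v τ x) : source F R u τ =ᵐ[volume] source F R v τ := by
  filter_upwards [h] with x hx
  by_cases hxR : R + |τ| < ‖x‖
  · rw [source, source, extCut_of_mem hxR, extCut_of_mem hxR, hx hxR]
  · rw [source, source, extCut_of_notMem hxR, extCut_of_notMem hxR]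

/-- The sum over the channels in the definition of an exterior solution is the Duhamel integral with the
explicit kernel. -/
theorem hasSum_duhamel_source (hk : 1 ≤ k) (hF : IsEnergyCritical C F) (hR : 0 ≤ R)
    (hI : IsTimeSet I) (hum : Measurable (Function.uncurry u))
    (hur : ∀ᵐ t ∂(volume.restrict I), IsRadialOn univ (u t)) (hfin : waveNorm k I u ≠ ⊤) {t : ℝ}
    (ht : t ∈ I) : ∀ᵐ x, |t| < ‖x‖ →
      HasSum (fun i : ℤ => duhamel (channelCut i (source F R u)) t x)
        (radialDuhamel k (source F R u) t x : ℂ) := by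
  refine hasSum_duhamel hk (measurable_source hk hF hum R) ?_ (fun τ y hy => source_of_notMem
    fun h => hy (by linarith)) (hI.uIoc_subset t ht) (sourceNorm_ne_top hk hF hum hfin)
  filter_upwards [hur] with τ hτ using isRadialOn_source hF hτ

theorem IsMildSolution.isExteriorSolution (hk : 1 ≤ k) (hF : IsEnergyCritical C F) (hR : 0 ≤ R)
    (hI : IsTimeSet I) (hL : ∀ᵐ t, ∀ᵐ x, |t| < ‖x‖ → freeWave u₀ u₁ t x = (L t x : ℂ))
    (hu : IsMildSolution F R I L u) : IsExteriorSolution F u₀ u₁ R I u where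
  measurable := (measurable_extCut hu.measurable R).aestronglyMeasurable
  radial := by
    filter_upwards [hu.radial] with t ⟨h, hh⟩
    refine ⟨h, ?_⟩
    filter_upwards [hh] with x hx _ using hx (mem_univ x)
  source_mem := by
    rw [ZNorm_eq]
    exact (sourceNorm_ne_top hk hF hu.measurable hu.finite).lt_top
  formula := by
    filter_upwards [ae_restrict_mem hI.measurable, ae_restrict_of_ae hL, hu.equation]
      with t htI htL hte
    filter_upwards [htL, hte, hasSum_duhamel_source hk hF hR hI hu.measurable hu.radial hu.finite htI]
      with x hxL hxe hxs hx
    have htx : |t| < ‖x‖ := by linarith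
    have h := hxs htx
    rw [hxL htx, hxe hx]
    convert h using 1
    push_cast
    ring

/-- An exterior solution of finite norm agrees in the exterior region with a measurable solution of the
integral equation with the explicit kernel. -/
theorem exists_isMildSolution_of_isExteriorSolution (hk : 1 ≤ k) (hF : IsEnergyCritical C F)
    (hR : 0 ≤ R) (hI : IsTimeSet I)
    (hL : ∀ᵐ t, ∀ᵐ x, |t| < ‖x‖ → freeWave u₀ u₁ t x = (L t x : ℂ))
    (hu : IsExteriorSolution F u₀ u₁ R I u) (hfin : YNorm I (extCut R u) < ⊤) :
    ∃ v, IsMildSolution F R I L v ∧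
      ∀ᵐ t ∂(volume.restrict I), ∀ᵐ x, R + |t| < ‖x‖ → u t x = v t x := by
  have hae := hu.measurable.ae_eq_mk
  set w := hu.measurable.mk fun z : ℝ × Space (2 * k + 1) => extCut R u z.1 z.2 with hw
  have hwm : Measurable w := hu.measurable.stronglyMeasurable_mk.measurable
  have hprod : (volume : Measure (ℝ × Space (2 * k + 1))).restrict (I ×ˢ univ)
      = (volume.restrict I).prod volume := by
    rw [Measure.volume_eq_prod, ← Measure.prod_restrict, Measure.restrict_univ]
  rw [hprod] at hae
  have hae' := Measure.ae_ae_of_ae_prod hae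
  set v : ℝ → Space (2 * k + 1) → ℝ := extCut R fun t x => w (t, x) with hv
  have hvm : Measurable (Function.uncurry v) :=
    measurable_extCut (f := fun t x => w (t, x)) hwm R
  have huv : ∀ᵐ t ∂(volume.restrict I), ∀ᵐ x, R + |t| < ‖x‖ → u t x = v t x := by
    filter_upwards [hae'] with t ht
    filter_upwards [ht] with x hx hxR
    rw [hv, extCut_of_mem hxR, ← hx, extCut_of_mem hxR]
  have hvsupp : ∀ t x, ¬ R + |t| < ‖x‖ → v t x = 0 := fun t x h => extCut_of_notMem h
  have hvr : ∀ᵐ t ∂(volume.restrict I), IsRadialOn univ (v t) := by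
    filter_upwards [huv, hu.radial] with t ht ⟨h, hh⟩
    refine ⟨fun r => if R + |t| < r then h r else 0, ?_⟩
    filter_upwards [ht, hh] with x h1 h2 _
    by_cases hx : R + |t| < ‖x‖
    · rw [if_pos hx, ← h1 hx, h2 hx]
    · rw [if_neg hx, hvsupp t x hx]
  have hvf : waveNorm k I v ≠ ⊤ := by
    rw [YNorm_eq hk] at hfin
    refine (lt_of_le_of_lt (waveNorm_mono (v := extCut R u) hk ?_) hfin).ne
    filter_upwards [huv] with t ht
    filter_upwards [ht] with x hx _
    by_cases hxR : R + |t| < ‖x‖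
    · rw [extCut_of_mem hxR, hx hxR]
    · rw [hvsupp t x hxR]
      simp
  refine ⟨v, ⟨hvm, hvsupp, hvr, hvf, ?_⟩, huv⟩
  filter_upwards [ae_restrict_mem hI.measurable, ae_restrict_of_ae hL, hu.formula, huv]
    with t htI htL htf htv
  have hsrc : ∀ i : ℤ, duhamel (channelCut i (source F R u)) t
      = duhamel (channelCut i (source F R v)) t := by
    intro i
    refine duhamel_congr ?_
    filter_upwards [ae_restrict_of_ae_restrict_of_subset (hI.uIoc_subset t htI) huv] with τ hτ
    exact channelCut_congr (source_congr hτ) i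
  simp only [hsrc] at htf
  filter_upwards [htL, htf, htv, hasSum_duhamel_source hk hF hR hI hvm hvr hvf htI]
    with x hxL hxf hxv hxs hx
  have htx : |t| < ‖x‖ := by linarith
  have h := (hxf hx).unique (hxs htx)
  rw [hxL htx, ← Complex.ofReal_sub, Complex.ofReal_inj] at h
  rw [← hxv hx]
  linarith

theorem YNorm_extCut_freeWave (hk : 1 ≤ k)
    (hL : ∀ᵐ t, ∀ᵐ x, |t| < ‖x‖ → freeWave u₀ u₁ t x = (L t x : ℂ)) :
    YNorm I (extCut R (freeWave u₀ u₁)) = waveNorm k I (extCut R L) := by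
  have hp := one_lt_waveExp hk
  rw [YNorm_eq hk]
  refine chanL_congr (by linarith) (by linarith) ?_
  filter_upwards [ae_restrict_of_ae hL] with t ht
  filter_upwards [ht] with x hx htx
  by_cases hxR : R + |t| < ‖x‖
  · rw [extCut_of_mem hxR, extCut_of_mem hxR, hx htx]
    rw [← ofReal_norm, ← ofReal_norm, Complex.norm_real]
  · rw [extCut_of_notMem hxR, extCut_of_notMem hxR]
    simp

/-- A bound `δ` for the free wave for which the integral equation is a contraction, with factor `1/2`, on
the ball of radius `2δ`. It involves the dimension and the constant `C` only. -/
def IsSmallDataConstant (k : ℕ) (C δ : ℝ) : Prop :=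
  ∃ A : ℝ≥0∞, A ≠ ⊤ ∧ IsDuhamelBound k C A ∧
    A * (2 * ENNReal.ofReal δ) ^ (waveExp k - 1) ≤ 1 / 4

theorem exists_isSmallDataConstant (hk : 1 ≤ k) (C : ℝ) :
    ∃ δ : ℝ, 0 < δ ∧ IsSmallDataConstant k C δ := by
  obtain ⟨A, hA, hAb⟩ := exists_duhamel_source_sub_le hk C
  have hp : 0 < waveExp k - 1 := by linarith [one_lt_waveExp hk]
  set a := A.toReal with ha
  have ha0 : 0 ≤ a := ENNReal.toReal_nonneg
  -- chosen such that `(2δ)^(p-1) = 1 / (4 (a + 1))`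
  set δ : ℝ := (1 / (4 * (a + 1))) ^ (1 / (waveExp k - 1)) / 2 with hδ
  have hδ0 : 0 < δ := by positivity
  refine ⟨δ, hδ0, A, hA, hAb, ?_⟩
  have h1 : (2 * δ) ^ (waveExp k - 1) = 1 / (4 * (a + 1)) := by
    rw [hδ, mul_div_cancel₀ _ two_ne_zero, ← Real.rpow_mul (by positivity),
      one_div_mul_cancel hp.ne', Real.rpow_one]
  have h2 : (2 : ℝ≥0∞) * ENNReal.ofReal δ = ENNReal.ofReal (2 * δ) := by
    rw [ENNReal.ofReal_mul two_pos.le]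
    simp
  have h3 : (1 / 4 : ℝ≥0∞) = ENNReal.ofReal (1 / 4) := by
    rw [ENNReal.ofReal_div_of_pos (by norm_num)]
    simp
  rw [h2, ENNReal.ofReal_rpow_of_nonneg (by positivity) hp.le, h1, ← ENNReal.ofReal_toReal hA,
    ← ENNReal.ofReal_mul ha0, h3]
  refine ENNReal.ofReal_le_ofReal ?_
  rw [mul_one_div, div_le_div_iff₀ (by positivity) (by norm_num)]
  linarith

/-- The difference of two small exterior solutions. -/
theorem YNorm_sub_le (hk : 1 ≤ k) {δ : ℝ} (hδ : IsSmallDataConstant k C δ)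
    (hF : IsEnergyCritical C F) (hR : 0 ≤ R) (hI : IsTimeSet I) (hud : IsRadialData u₀ u₁)
    (hus : YNorm I (extCut R (freeWave u₀ u₁)) < ENNReal.ofReal δ)
    {v₀ v₁ : Space (2 * k + 1) → ℝ} (hvd : IsRadialData v₀ v₁)
    (hvs : YNorm I (extCut R (freeWave v₀ v₁)) < ENNReal.ofReal δ)
    {v : ℝ → Space (2 * k + 1) → ℝ} (hu : IsExteriorSolution F u₀ u₁ R I u)
    (huf : YNorm I (extCut R u) < ⊤) (hv : IsExteriorSolution F v₀ v₁ R I v)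
    (hvf : YNorm I (extCut R v) < ⊤) :
    YNorm I (extCut R (u - v)) ≤ 2 * YNorm I (extCut R (freeWave (u₀ - v₀) (u₁ - v₁))) := by
  obtain ⟨A, hAt, hA, hAδ⟩ := hδ
  obtain ⟨L, hLm, hL, -, -⟩ := exists_freeWave_rep hk hud
  obtain ⟨M, hMm, hM, -, -⟩ := exists_freeWave_rep hk hvd
  rw [YNorm_extCut_freeWave hk hL] at hus
  rw [YNorm_extCut_freeWave hk hM] at hvs
  have hLM : ∀ᵐ t, ∀ᵐ x, |t| < ‖x‖ →
      freeWave (u₀ - v₀) (u₁ - v₁) t x = ((L t x - M t x : ℝ) : ℂ) := by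
    filter_upwards [hL, hM] with t h1 h2
    filter_upwards [h1, h2, freeWave_sub hud hvd t] with x h3 h4 h5 hx
    rw [h5, h3 hx, h4 hx, Complex.ofReal_sub]
  rw [YNorm_extCut_freeWave (L := fun t x => L t x - M t x) hk hLM]
  obtain ⟨u', hu', huu⟩ := exists_isMildSolution_of_isExteriorSolution hk hF hR hI hL hu huf
  obtain ⟨v', hv', hvv⟩ := exists_isMildSolution_of_isExteriorSolution hk hF hR hI hM hv hvf
  refine le_trans (le_of_eq ?_) (hu'.waveNorm_sub_le_two_mul hk hA hF hLm hMm hv' hI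
    ENNReal.ofReal_ne_top hAδ hus hvs)
  rw [YNorm_eq hk]
  refine waveNorm_congr hk ?_
  filter_upwards [huu, hvv] with t h1 h2
  filter_upwards [h1, h2] with x h3 h4 _
  by_cases hxR : R + |t| < ‖x‖
  · rw [extCut_of_mem hxR, ← h3 hxR, ← h4 hxR]
    rfl
  · rw [extCut_of_notMem hxR, hu'.support t x hxR, hv'.support t x hxR, sub_zero]

theorem freeWave_zero_sub (hud : IsRadialData u₀ u₁) (hk : 1 ≤ k) :
    YNorm I (extCut R (freeWave (u₀ - u₀) (u₁ - u₁))) = 0 := by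
  have h : ∀ᵐ t : ℝ, ∀ᵐ x : Space (2 * k + 1), |t| < ‖x‖ →
      freeWave (u₀ - u₀) (u₁ - u₁) t x = ((0 : ℝ) : ℂ) := by
    refine Filter.Eventually.of_forall fun t => ?_
    filter_upwards [freeWave_sub hud hud t] with x hx _
    rw [hx, sub_self, Complex.ofReal_zero]
  rw [YNorm_extCut_freeWave (L := fun _ _ => 0) hk h, ← waveNorm_zero hk (J := I)]
  congr 1
  ext t x
  simp [extCut]

theorem existsUnique_of_small (hk : 1 ≤ k) {δ : ℝ} (hδ : IsSmallDataConstant k C δ)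
    (hF : IsEnergyCritical C F) (hR : 0 ≤ R) (hI : IsTimeSet I) (hud : IsRadialData u₀ u₁)
    (hus : YNorm I (extCut R (freeWave u₀ u₁)) < ENNReal.ofReal δ) :
    ExistsUniqueExteriorSolution F u₀ u₁ R I := by
  refine ⟨?_, fun u v hu huf hv hvf => ?_⟩
  · obtain ⟨A, hAt, hA, hAδ⟩ := hδ
    obtain ⟨L, hLm, hL, hLr, -⟩ := exists_freeWave_rep hk hud
    rw [YNorm_extCut_freeWave hk hL] at hus
    have hLr' : ∀ᵐ t ∂(volume.restrict I), IsRadialOn {x | R + |t| < ‖x‖} (L t) := by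
      filter_upwards [ae_restrict_of_ae hLr] with t ⟨h, hh⟩
      refine ⟨h, ?_⟩
      filter_upwards [hh] with x hx hxR
      have hxR' : R + |t| < ‖x‖ := hxR
      exact hx (show |t| < ‖x‖ by linarith)
    obtain ⟨u, hu⟩ := exists_isMildSolution hk hA hAt hF hR hLm hLr' hI ENNReal.ofReal_ne_top hAδ hus
    refine ⟨u, hu.isExteriorSolution hk hF hR hI hL, ?_⟩
    rw [YNorm_eq hk]
    refine (lt_of_le_of_lt (waveNorm_mono (u := extCut R u) hk (Filter.Eventually.of_forall fun t =>
      Filter.Eventually.of_forall fun x _ => ?_)) hu.finite.lt_top)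
    exact enorm_indicator_le_enorm_self _ _
  · have h := YNorm_sub_le hk hδ hF hR hI hud hus hud hus hu huf hv hvf
    rw [freeWave_zero_sub hud hk, mul_zero] at h
    obtain ⟨L, hLm, hL, -, -⟩ := exists_freeWave_rep hk hud
    obtain ⟨u', hu', huu⟩ := exists_isMildSolution_of_isExteriorSolution hk hF hR hI hL hu huf
    obtain ⟨v', hv', hvv⟩ := exists_isMildSolution_of_isExteriorSolution hk hF hR hI hL hv hvf
    have h0 : waveNorm k I (fun t x => u' t x - v' t x) = 0 := by
      refine le_antisymm (le_trans (le_of_eq ?_) h) zero_le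
      rw [YNorm_eq hk]
      refine waveNorm_congr (v := extCut R (u - v)) hk ?_
      filter_upwards [huu, hvv] with t h1 h2
      filter_upwards [h1, h2] with x h3 h4 _
      by_cases hxR : R + |t| < ‖x‖
      · rw [extCut_of_mem hxR, ← h3 hxR, ← h4 hxR]
        rfl
      · rw [extCut_of_notMem hxR, hu'.support t x hxR, hv'.support t x hxR, sub_zero]
    filter_upwards [huu, hvv, ae_eq_zero_of_waveNorm (u := fun t x => u' t x - v' t x) hk
      (hu'.measurable.sub hv'.measurable) h0] with t h1 h2 h3
    filter_upwards [h1, h2, h3] with x h4 h5 h6 hx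
    rw [h4 hx, h5 hx]
    exact sub_eq_zero.mp (h6 (by linarith))

theorem exists_existsUnique_Icc (hk : 1 ≤ k) (hF : IsEnergyCritical C F)
    (hud : IsRadialData u₀ u₁) (hR : 0 ≤ R) :
    ∃ T : ℝ, 0 < T ∧ ExistsUniqueExteriorSolution F u₀ u₁ R (Icc (-T) T) := by
  obtain ⟨δ, hδ0, hδ⟩ := exists_isSmallDataConstant hk C
  obtain ⟨L, hLm, hL, -, hLf⟩ := exists_freeWave_rep hk hud
  have hfin : waveNorm k univ (extCut R L) ≠ ⊤ := by
    refine ne_top_of_le_ne_top hLf (waveNorm_mono hk (Filter.Eventually.of_forall fun t =>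
      Filter.Eventually.of_forall fun x _ => ?_))
    exact enorm_indicator_le_enorm_self _ _
  -- the intervals shrink to the time `0`, which has measure zero
  have hlim := tendsto_waveNorm_inter hk (measurable_extCut hLm R) hfin
    (S := fun n : ℕ => Icc (-(1 / ((n : ℝ) + 1))) (1 / ((n : ℝ) + 1))) (fun n => measurableSet_Icc)
    (N := {0}) (by simp) (measurableSet_singleton 0) (fun t ht => by
      have ht' : 0 < |t| := abs_pos.mpr ht
      filter_upwards [(tendsto_one_div_add_atTop_nhds_zero_nat (𝕜 := ℝ)).eventually
        (gt_mem_nhds ht')] with n hn h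
      exact absurd (abs_le.mpr h) hn.not_ge)
  obtain ⟨n, hn⟩ := (hlim.eventually (gt_mem_nhds (ENNReal.ofReal_pos.mpr hδ0))).exists
  have hT : (0 : ℝ) < 1 / ((n : ℝ) + 1) := by positivity
  refine ⟨1 / ((n : ℝ) + 1), hT, existsUnique_of_small hk hδ hF hR
    (isTimeSet_of_ordConnected ordConnected_Icc ⟨by linarith, hT.le⟩) hud ?_⟩
  rw [YNorm_extCut_freeWave hk hL]
  simpa only [univ_inter] using hn

theorem exists_existsUnique_univ (hk : 1 ≤ k) (hF : IsEnergyCritical C F)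
    (hud : IsRadialData u₀ u₁) :
    ∃ R₀ : ℝ, 0 ≤ R₀ ∧ ∀ R : ℝ, R₀ ≤ R → ExistsUniqueExteriorSolution F u₀ u₁ R univ := by
  have hp := one_lt_waveExp hk
  obtain ⟨δ, hδ0, hδ⟩ := exists_isSmallDataConstant hk C
  obtain ⟨L, hLm, hL, -, hLf⟩ := exists_freeWave_rep hk hud
  -- every point leaves the region `|x| > n + |t|` for large `n`, so that dominated convergence applies
  have hlim : Filter.Tendsto (fun n : ℕ => waveNorm k univ (extCut (n : ℝ) L)) Filter.atTop (nhds 0) := by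
    refine tendsto_chanL_zero (f := fun n t x => ‖extCut (n : ℝ) L t x‖ₑ) (g := fun t x => ‖L t x‖ₑ)
      (by linarith) (by linarith) (fun n => (measurable_extCut hLm n).enorm) hLm.enorm (fun n t x => enorm_indicator_le_enorm_self _ _) hLf fun t x _ => ?_
    refine tendsto_const_nhds.congr' ?_
    filter_upwards [Filter.eventually_ge_atTop ⌈‖x‖⌉₊] with n hn
    rw [extCut_of_notMem, enorm_zero]
    have h1 : ‖x‖ ≤ n := (Nat.le_ceil _).trans (by exact_mod_cast hn)
    have := abs_nonneg t
    linarith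
  obtain ⟨n, hn⟩ := (hlim.eventually (gt_mem_nhds (ENNReal.ofReal_pos.mpr hδ0))).exists
  refine ⟨n, Nat.cast_nonneg n, fun R hR => ?_⟩
  have hR0 : 0 ≤ R := (Nat.cast_nonneg n).trans hR
  refine existsUnique_of_small hk hδ hF hR0
    (isTimeSet_of_ordConnected ordConnected_univ (mem_univ 0)) hud ?_
  rw [YNorm_extCut_freeWave hk hL]
  refine lt_of_le_of_lt (waveNorm_mono hk (Filter.Eventually.of_forall fun t =>
    Filter.Eventually.of_forall fun x _ => ?_)) hn
  by_cases hxR : R + |t| < ‖x‖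
  · rw [extCut_of_mem hxR, extCut_of_mem (by linarith)]
  · rw [extCut_of_notMem hxR]
    simp

end solutions

end ExteriorWave

theorem mainTheorem2 (d : ℕ) (hd : 3 ≤ d) (hodd : Odd d) (C : ℝ) :
    (∃ δ : ℝ, 0 < δ ∧
      ∀ F : ℝ → ExteriorWave.Space d → ℝ → ℝ, ExteriorWave.IsEnergyCritical C F →
      ∀ R : ℝ, 0 ≤ R → ∀ I : Set ℝ, I.OrdConnected → (0 : ℝ) ∈ I →
      ∀ u₀ u₁ : ExteriorWave.Space d → ℝ, ExteriorWave.IsRadialData u₀ u₁ →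
      ExteriorWave.YNorm I (ExteriorWave.extCut R (ExteriorWave.freeWave u₀ u₁))
        < ENNReal.ofReal δ →
      ExteriorWave.ExistsUniqueExteriorSolution F u₀ u₁ R I ∧
      ∀ v₀ v₁ : ExteriorWave.Space d → ℝ, ExteriorWave.IsRadialData v₀ v₁ →
      ExteriorWave.YNorm I (ExteriorWave.extCut R (ExteriorWave.freeWave v₀ v₁))
        < ENNReal.ofReal δ →
      ∀ u v : ℝ → ExteriorWave.Space d → ℝ,
      ExteriorWave.IsExteriorSolution F u₀ u₁ R I u →
      ExteriorWave.YNorm I (ExteriorWave.extCut R u) < ⊤ →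
      ExteriorWave.IsExteriorSolution F v₀ v₁ R I v →
      ExteriorWave.YNorm I (ExteriorWave.extCut R v) < ⊤ →
      ExteriorWave.YNorm I (ExteriorWave.extCut R (u - v)) ≤
        2 * ExteriorWave.YNorm I
          (ExteriorWave.extCut R (ExteriorWave.freeWave (u₀ - v₀) (u₁ - v₁)))) ∧
    (∀ F : ℝ → ExteriorWave.Space d → ℝ → ℝ, ExteriorWave.IsEnergyCritical C F →
      ∀ u₀ u₁ : ExteriorWave.Space d → ℝ, ExteriorWave.IsRadialData u₀ u₁ →
      ∀ R : ℝ, 0 ≤ R → ∃ T : ℝ, 0 < T ∧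
        ExteriorWave.ExistsUniqueExteriorSolution F u₀ u₁ R (Set.Icc (-T) T)) ∧
    (∀ F : ℝ → ExteriorWave.Space d → ℝ → ℝ, ExteriorWave.IsEnergyCritical C F →
      ∀ u₀ u₁ : ExteriorWave.Space d → ℝ, ExteriorWave.IsRadialData u₀ u₁ →
      ∃ R₀ : ℝ, 0 ≤ R₀ ∧ ∀ R : ℝ, R₀ ≤ R →
        ExteriorWave.ExistsUniqueExteriorSolution F u₀ u₁ R Set.univ) := by
  obtain ⟨k, rfl⟩ := hodd
  have hk : 1 ≤ k := by omega
  refine ⟨?_, fun F hF u₀ u₁ hu R hR => ExteriorWave.exists_existsUnique_Icc hk hF hu hR,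
    fun F hF u₀ u₁ hu => ExteriorWave.exists_existsUnique_univ hk hF hu⟩
  obtain ⟨δ, hδ0, hδ⟩ := ExteriorWave.exists_isSmallDataConstant hk C
  refine ⟨δ, hδ0, fun F hF R hR I hI h0 u₀ u₁ hu hus => ?_⟩
  have hI' := ExteriorWave.isTimeSet_of_ordConnected hI h0
  exact ⟨ExteriorWave.existsUnique_of_small hk hδ hF hR hI' hu hus,
    fun v₀ v₁ hv hvs u v hsu huf hsv hvf =>
      ExteriorWave.YNorm_sub_le hk hδ hF hR hI' hu hus hv hvs hsu huf hsv hvf⟩
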